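/- Setting. Finitely many asynchronous processes run a concurrent data structure $D$ whose shared memory consists of CAS objects, which can be read, updated by CAS, and created dynamically. $D$ accesses only objects that exist. Its operations are split into a set $Q_D$ of read-only operations (queries), which perform no CAS and create no object, and the set $L_D$ of the remaining operations. Suppose that $D$ is linearizable with solo queries $Q_D$ with respect to some abstract data type: every history of $D$ in which each instance of a query in $Q_D$ runs to completion (or to the end of the history) without an event of another process during its interval is linearizable. For a query $q$ and a state $C$ of the shared memory of $D$, let $T(q,C)$ be the number of steps of $q$ when it runs alone from $C$ ($\infty$ if it does not terminate). Construction. A camera is a counter $timestamp$, initially $0$. A versioned CAS object has a pointer $VHead$ to the newest element of a linked list of versions, each with a value, a pointer to the next older version, and a timestamp, which is initially undecided. - $initTS(n)$: if the timestamp of $n$ is undecided, read $timestamp$ and try to install the value read in $n$ by a CAS. - $takeSnapshot$: read $h=timestamp$, perform $CAS(timestamp,h,h+1)$, and return the handle $h$. - $vRead$: read $VHead$, call $initTS$ on that version, and return its value. - $vCAS(old,new)$: read $VHead$ and call $initTS$ on that version. If its value is not $old$, return false; if $new=old$, return true. Otherwise create a version with value $new$ that points to the version read, and try to make it the head by a CAS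 on $VHead$. On success, call $initTS$ on it and return true; on failure, delete it, read $VHead$ again, call $initTS$ on that version and return false. - $readSnapshot(h)$: read $VHead$, call $initTS$ on that version, and follow the list to the first version with timestamp at most $h$, whose value is returned. $D_\ell$ is obtained from $D$ by replacing every CAS object by a versioned CAS object with the same initial value, all under one camera. Operations of $L_D$ use $vRead$ and $vCAS$ in place of read and CAS. A query of $Q_D$ first performs $takeSnapshot$, which returns a handle $h$, and then uses $readSnapshot(h)$ in place of read. Theorem. $D_\ell$ is a linearizable implementation, for all of its histories, of the same abstract data type with all operations of $L_D$ and $Q_D$, and it never accesses an object or version that does not exist. Moreover, there is an absolute constant $c$ such that the following hold. 1. Operations of $L_D$ keep their progress properties: for every set $F\subseteq L_D$, if the operations of $F$ are wait-free (respectively lock-free, obstruction-free) in the executions of $D$ in which the queries run solo, then they are so in all executions of $D_\ell$. Their running times grow by at most the factor $c$: every finite execution $E$ of $D_\ell$ has a corresponding execution $H$ of $D$ (with the queries run solo) that has the same history of invocations and responses of operations of $L_D$, and in which every instance of an operation of $L_D$ takes at most as many steps as in $E$, and at least $1/c$ times as many (counting the call and the return as steps). 2. Every instance of a query $q\in Q_D$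 in $E$ that has completed its $takeSnapshot$ has performed, up to any moment until it returns, at most $c\,(T(q,C_\ell)+W\cdot A)$ steps. Here $C_\ell$ is the state of the objects (in $H$) at the moment when that $takeSnapshot$ takes effect, that is, when the camera goes from $h$ to $h+1$; $W$ is the number of $vCAS$ operations concurrent with $q$ on objects accessed by $q$; and $A$ is the maximum number of accesses by $q$ to the same object. -/

import Mathlib

/-! ## Asynchronous shared-memory implementations, their runs and histories -/

/-- The events of a run: process `p` invokes `op`, process `p` executes one instruction,
process `p` returns `r`. -/
inductive Label (P Op Ret : Type*)
  | inv (p : P) (op : Op)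
  | step (p : P)
  | res (p : P) (r : Ret)

/-- The process that an event belongs to. -/
def Label.proc {P Op Ret : Type*} : Label P Op Ret → P
  | .inv p _ => p
  | .step p => p
  | .res p _ => p

/-- A concurrent implementation of the operations `Op` with responses in `Ret`, for processes `P`,
with shared states `S` and local states `L`.  `step l s l' s'` says that a process in local state
`l` can execute its next instruction when the shared state is `s`, and this leads to `l'` and `s'`.
`result l = some r` says that the next instruction is to return `r`. -/
structure Impl (P Op Ret S L : Type*) where
  init : S
  start : P → Op → L
  step : L → S → L → S → Prop
  result : L → Option Ret

/-- A configuration: the shared state and, for every process, either `none` (no pending operation)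
or the pending operation together with the local state. -/
structure Config (P Op S L : Type*) where
  shared : S
  procs : P → Option (Op × L)

namespace Impl

variable {P Op Ret S L : Type*}

open Classical in
/-- The transitions between configurations. -/
inductive Step (M : Impl P Op Ret S L) :
    Config P Op S L → Label P Op Ret → Config P Op S L → Prop
  | inv (c : Config P Op S L) (p : P) (op : Op) (h : c.procs p = none) :
      Step M c (.inv p op) ⟨c.shared, Function.update c.procs p (some (op, M.start p op))⟩
  | step (c : Config P Op S L) (p : P) (op : Op) (l l' : L) (s' : S)
      (h : c.procs p = some (op, l)) (hs : M.step l c.shared l' s') :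
      Step M c (.step p) ⟨s', Function.update c.procs p (some (op, l'))⟩
  | res (c : Config P Op S L) (p : P) (op : Op) (l : L) (r : Ret)
      (h : c.procs p = some (op, l)) (hr : M.result l = some r) :
      Step M c (.res p r) ⟨c.shared, Function.update c.procs p none⟩

/-- `cfg`, `lab` form a run with `n` events (`n = ⊤`: an infinite run) from the initial
configuration: event `i` leads from configuration `i` to configuration `i + 1`.  The values of `cfg`
and `lab` beyond the length of the run are irrelevant. -/
def IsRun (M : Impl P Op Ret S L) (n : ℕ∞) (cfg : ℕ → Config P Op S L)
    (lab : ℕ → Label P Op Ret) : Prop :=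
  cfg 0 = ⟨M.init, fun _ => none⟩ ∧ ∀ i : ℕ, (i : ℕ∞) < n → M.Step (cfg i) (lab i) (cfg (i + 1))

/-- A run in which every instance of an operation of `Q` runs solo: while such an instance is
pending, all events belong to its process.  For `Q = ∅` these are all runs. -/
def IsSoloRun (M : Impl P Op Ret S L) (Q : Set Op) (n : ℕ∞) (cfg : ℕ → Config P Op S L)
    (lab : ℕ → Label P Op Ret) : Prop :=
  M.IsRun n cfg lab ∧
    ∀ i : ℕ, (i : ℕ∞) < n → ∀ p op l, (cfg i).procs p = some (op, l) → op ∈ Q → (lab i).proc = p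

/-- In the runs in which the operations of `Q` run solo, every pending operation can always return
or execute its next instruction.  (The only instructions that cannot be executed are accesses to
objects that do not exist.) -/
def NeverStuck (M : Impl P Op Ret S L) (Q : Set Op) : Prop :=
  ∀ (n : ℕ) (cfg : ℕ → Config P Op S L) (lab : ℕ → Label P Op Ret), M.IsSoloRun Q n cfg lab →
    ∀ p op l, (cfg n).procs p = some (op, l) →
      (∃ r, M.result l = some r) ∨ ∃ l' s', M.step l (cfg n).shared l' s'

end Impl

/-! ## Linearizability -/

/-- An abstract data type, possibly non-deterministic: `step s op r s'` says that `op` applied in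
state `s` may return `r` and lead to `s'`. -/
structure ADT (Op Ret S : Type*) where
  init : S
  step : S → Op → Ret → S → Prop

/-- The sequence of operations with responses is legal from state `s`. -/
def ADT.LegalFrom {Op Ret S : Type*} (A : ADT Op Ret S) : S → List (Op × Ret) → Prop
  | _, [] => True
  | s, x :: xs => ∃ s', A.step s x.1 x.2 s' ∧ A.LegalFrom s' xs

/-- The operation instance invoked by event `i` returns `r` by event `k`, among the first `n`
events: event `k` is the first response to its process after event `i`. -/
def RespondsAt {P Op Ret : Type*} (lab : ℕ → Label P Op Ret) (n i k : ℕ) (r : Ret) : Prop :=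
  i < k ∧ k < n ∧ ∃ p op, lab i = .inv p op ∧ lab k = .res p r ∧
    ∀ j, i < j → j < k → ∀ r', lab j ≠ .res p r'

/-- `xs` is a linearization of the history formed by the invocations and responses among the first
`n` events.  Its entries are triples (position of the invocation, operation, response).  It contains
all completed instances, with their responses, and possibly some pending ones; it respects the order
of instances that do not overlap, and it is legal for the abstract data type. -/
structure IsLinearization {P Op Ret S : Type*} (A : ADT Op Ret S) (lab : ℕ → Label P Op Ret) (n : ℕ)
    (xs : List (ℕ × Op × Ret)) : Prop where
  nodup : (xs.map Prod.fst).Nodup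
  isInv : ∀ x ∈ xs, x.1 < n ∧ ∃ p, lab x.1 = .inv p x.2.1
  complete : ∀ i k r, RespondsAt lab n i k r → ∃ op, (i, op, r) ∈ xs
  order : xs.Pairwise fun x y => ¬ ∃ k r, RespondsAt lab n y.1 k r ∧ k < x.1
  legal : A.LegalFrom A.init (xs.map Prod.snd)

namespace Impl

variable {P Op Ret S L : Type*}

/-- `M` is a linearizable implementation of `A` with solo queries `Q`: every history in which all
instances of operations of `Q` run solo is linearizable. -/
def LinearizableWithSolo {S' : Type*} (M : Impl P Op Ret S L) (Q : Set Op) (A : ADT Op Ret S') :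
    Prop :=
  ∀ (n : ℕ) (cfg : ℕ → Config P Op S L) (lab : ℕ → Label P Op Ret), M.IsSoloRun Q n cfg lab →
    ∃ xs, IsLinearization A lab n xs

/-- `M` is a linearizable implementation of `A`: every history is linearizable. -/
def Linearizable {S' : Type*} (M : Impl P Op Ret S L) (A : ADT Op Ret S') : Prop :=
  M.LinearizableWithSolo ∅ A

/-! ## Progress properties of a set `F` of operations, in the runs with `Q` run solo -/

/-- Event `i` belongs to an instance of an operation of `F`. -/
def EventOf (F : Set Op) (cfg : ℕ → Config P Op S L) (lab : ℕ → Label P Op Ret) (i : ℕ) : Prop :=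
  match lab i with
  | .inv _ op => op ∈ F
  | .step p => ∃ op l, (cfg i).procs p = some (op, l) ∧ op ∈ F
  | .res p _ => ∃ op l, (cfg i).procs p = some (op, l) ∧ op ∈ F

/-- Wait-freedom: every instance that takes infinitely many steps returns. -/
def WaitFree (M : Impl P Op Ret S L) (Q F : Set Op) : Prop :=
  ∀ cfg lab, M.IsSoloRun Q ⊤ cfg lab → ∀ i p op, lab i = .inv p op → op ∈ F →
    {j | lab j = .step p}.Infinite → ∃ k r, i < k ∧ lab k = .res p r

/-- Lock-freedom: if infinitely many steps are taken by instances of operations of `F`, then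
infinitely many instances of operations of `F` return. -/
def LockFree (M : Impl P Op Ret S L) (Q F : Set Op) : Prop :=
  ∀ cfg lab, M.IsSoloRun Q ⊤ cfg lab →
    {j | EventOf F cfg lab j ∧ ∃ p, lab j = .step p}.Infinite →
    {j | EventOf F cfg lab j ∧ ∃ p r, lab j = .res p r}.Infinite

/-- Obstruction-freedom: every instance whose process eventually runs alone returns. -/
def ObstructionFree (M : Impl P Op Ret S L) (Q F : Set Op) : Prop :=
  ∀ cfg lab, M.IsSoloRun Q ⊤ cfg lab → ∀ i p op, lab i = .inv p op → op ∈ F →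
    (∃ N, ∀ j, N ≤ j → (lab j).proc = p) → ∃ k r, i < k ∧ lab k = .res p r

/-! ## Running times -/

/-- A process that runs alone from local state `l` and shared state `s` returns after exactly `t`
instructions, the return included. -/
inductive SoloTime (M : Impl P Op Ret S L) : L → S → ℕ → Prop
  | ret (l : L) (s : S) (r : Ret) (h : M.result l = some r) : SoloTime M l s 1
  | step (l l' : L) (s s' : S) (t : ℕ) (h : M.step l s l' s') (ht : SoloTime M l' s' t) :
      SoloTime M l s (t + 1)

/-- `T(q, C)`: the running time of the operation `q` run solo by process `p` in shared state `C`
(`⊤` if it does not terminate). -/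
noncomputable def soloTime (M : Impl P Op Ret S L) (p : P) (q : Op) (C : S) : ℕ∞ :=
  ⨅ t ∈ {t : ℕ | M.SoloTime (M.start p q) C t}, (t : ℕ∞)

end Impl

/-- Events `a, …, b - 1` contain the invocation of `op` by `p` at `a`, and no later event of another
instance by `p`: the instance is still pending before event `b`, or has returned just by event
`b - 1`. -/
def IsInstance {P Op Ret : Type*} (lab : ℕ → Label P Op Ret) (p : P) (op : Op) (a b : ℕ) : Prop :=
  a < b ∧ lab a = .inv p op ∧ ∀ j r, a < j → j + 1 < b → lab j ≠ .res p r

/-- The number of events of process `p` among `a, …, b - 1`: for an instance, its running time so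
far (the call, the instructions and the return). -/
noncomputable def procTime {P Op Ret : Type*} (lab : ℕ → Label P Op Ret) (p : P) (a b : ℕ) : ℕ∞ :=
  {j | a ≤ j ∧ j < b ∧ (lab j).proc = p}.encard

/-! ## Data structures implemented from CAS objects -/

/-- The instructions of such a data structure, with local states `St`; CAS objects hold values in
`V` and are named by natural numbers. `new v` creates a CAS object with value `v`, `loc` is a local
step. -/
inductive Instr (Ret V St : Type*)
  | read (x : ℕ) (k : V → St)
  | cas (x : ℕ) (old new : V) (k : Bool → St)
  | new (v : V) (k : ℕ → St)
  | loc (s : St)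
  | ret (r : Ret)

/-- A concurrent data structure implemented from CAS objects: the code of the operations and the
CAS objects that exist initially, with their values.  Names for new objects never run out. -/
structure CASStructure (P Op Ret V St : Type*) where
  start : P → Op → St
  code : St → Instr Ret V St
  init : ℕ → Option V
  fresh : {x | init x = none}.Infinite

namespace CASStructure

variable {P Op Ret V St : Type*}

open Classical in
/-- The implementation given by a CAS-based data structure. The shared state maps the existing
objects to their values; objects can only be accessed if they exist, and a new object gets an
arbitrary unused name. -/
def impl (D : CASStructure P Op Ret V St) : Impl P Op Ret (ℕ → Option V) St where
  init := D.init
  start := D.start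
  step l m l' m' :=
    match D.code l with
    | .read x k => ∃ v, m x = some v ∧ l' = k v ∧ m' = m
    | .cas x old new k => ∃ v, m x = some v ∧
        if v = old then l' = k true ∧ m' = Function.update m x (some new)
        else l' = k false ∧ m' = m
    | .new v k => ∃ x, m x = none ∧ l' = k x ∧ m' = Function.update m x (some v)
    | .loc s => l' = s ∧ m' = m
    | .ret _ => False
  result l :=
    match D.code l with
    | .ret r => some r
    | _ => none

/-- The operations of `Q` are read-only: in the runs in which they run solo, they never perform a
CAS and never create an object. -/
def ReadOnly (D : CASStructure P Op Ret V St) (Q : Set Op) : Prop :=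
  ∀ (n : ℕ) (cfg : ℕ → Config P Op (ℕ → Option V) St) (lab : ℕ → Label P Op Ret),
    D.impl.IsSoloRun Q n cfg lab → ∀ p q l, (cfg n).procs p = some (q, l) → q ∈ Q →
      match D.code l with
      | .cas _ _ _ _ => False
      | .new _ _ => False
      | _ => True

end CASStructure

/-! ## Versioned CAS objects and the camera -/

/-- A version node. `ts = none` is the timestamp "to be decided". -/
structure VNode (V : Type*) where
  val : V
  nextv : Option ℕ
  ts : Option ℕ

/-- The memory: the counter of the camera, the head pointers of the versioned CAS objects, and the
version nodes (nodes are named by natural numbers as well). -/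
structure VMem (V : Type*) where
  timestamp : ℕ
  vhead : ℕ → Option ℕ
  node : ℕ → Option (VNode V)

/-- The instructions on this memory. `casTs n t` is `CAS(&n->ts, TBD, t)`; `newObj n` creates
a versioned CAS object with head pointer `n`; `crash` can never be executed. -/
inductive VInstr (Ret V L : Type*)
  | readClock (k : ℕ → L)
  | casClock (old new : ℕ) (k : Bool → L)
  | readHead (x : ℕ) (k : ℕ → L)
  | casHead (x old new : ℕ) (k : Bool → L)
  | readTs (n : ℕ) (k : Option ℕ → L)
  | casTs (n t : ℕ) (k : Bool → L)
  | readVal (n : ℕ) (k : V → L)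
  | readNext (n : ℕ) (k : Option ℕ → L)
  | newNode (v : V) (next : Option ℕ) (k : ℕ → L)
  | delNode (n : ℕ) (l : L)
  | newObj (n : ℕ) (k : ℕ → L)
  | loc (l : L)
  | ret (r : Ret)
  | crash

open Classical in
/-- Execution of one instruction. -/
def VInstr.Exec {Ret V L : Type*} (m : VMem V) (l' : L) (m' : VMem V) : VInstr Ret V L → Prop
  | .readClock k => l' = k m.timestamp ∧ m' = m
  | .casClock old new k =>
      if m.timestamp = old then l' = k true ∧ m' = { m with timestamp := new }
      else l' = k false ∧ m' = m
  | .readHead x k => ∃ n, m.vhead x = some n ∧ l' = k n ∧ m' = m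
  | .casHead x old new k => ∃ n, m.vhead x = some n ∧
      if n = old then
        l' = k true ∧ m' = { m with vhead := Function.update m.vhead x (some new) }
      else l' = k false ∧ m' = m
  | .readTs n k => ∃ nd, m.node n = some nd ∧ l' = k nd.ts ∧ m' = m
  | .casTs n t k => ∃ nd, m.node n = some nd ∧
      if nd.ts = none then
        l' = k true ∧
          m' = { m with node := Function.update m.node n (some { nd with ts := some t }) }
      else l' = k false ∧ m' = m
  | .readVal n k => ∃ nd, m.node n = some nd ∧ l' = k nd.val ∧ m' = m
  | .readNext n k => ∃ nd, m.node n = some nd ∧ l' = k nd.nextv ∧ m' = m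
  | .newNode v next k => ∃ n, m.node n = none ∧ l' = k n ∧
      m' = { m with node := Function.update m.node n (some ⟨v, next, none⟩) }
  | .delNode n l => l' = l ∧ m' = { m with node := Function.update m.node n none }
  | .newObj n k => ∃ x, m.vhead x = none ∧ l' = k x ∧
      m' = { m with vhead := Function.update m.vhead x (some n) }
  | .loc l => l' = l ∧ m' = m
  | .ret _ => False
  | .crash => False

/-- The local states of the transformed data structure, where `St` are the local states of the
original one. -/
inductive VState (V St : Type*)
  /-- a non-query operation, about to perform the next instruction of its original code -/
  | upd (s : St)
  /-- `initTS(n)`: about to test `n->ts == TBD`; then continue with `next` -/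
  | initTest (n : ℕ) (next : VState V St)
  /-- `initTS(n)`: about to read the timestamp of the camera -/
  | initRead (n : ℕ) (next : VState V St)
  /-- `initTS(n)`: about to perform `CAS(&n->ts, TBD, t)` -/
  | initCas (n t : ℕ) (next : VState V St)
  /-- `vRead`: about to return `n->val` -/
  | readRet (n : ℕ) (k : V → St)
  /-- `vCAS` on `x`: about to compare `n->val` (and `new`) with `old` -/
  | casTest (x : ℕ) (old new : V) (k : Bool → St) (n : ℕ)
  /-- `vCAS` on `x`: about to create the version node -/
  | casNew (x : ℕ) (new : V) (k : Bool → St) (n : ℕ)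
  /-- `vCAS` on `x`: about to perform `CAS(&VHead, n, m)` -/
  | casAppend (x : ℕ) (k : Bool → St) (n m : ℕ)
  /-- `vCAS` on `x`: about to delete the node `m` -/
  | casDelete (x : ℕ) (k : Bool → St) (m : ℕ)
  /-- `vCAS` on `x`: about to read `VHead` for the final `initTS(VHead)` -/
  | casHelp (x : ℕ) (k : Bool → St)
  /-- `vCAS` on `x`: about to return `b` -/
  | casRet (x : ℕ) (k : Bool → St) (b : Bool)
  /-- constructor of a versioned CAS object: about to create the object with head `n` -/
  | newHead (n : ℕ) (k : ℕ → St)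
  /-- `takeSnapshot` of a query: about to read the timestamp of the camera -/
  | snapRead (s : St)
  /-- `takeSnapshot` of a query: about to perform `CAS(&timestamp, h, h + 1)` and return `h` -/
  | snapInc (s : St) (h : ℕ)
  /-- a query with handle `h`, about to perform the next instruction of its original code -/
  | query (h : ℕ) (s : St)
  /-- `readSnapshot(h)`: about to test `n->ts > h` -/
  | ssTest (h : ℕ) (k : V → St) (n : ℕ)
  /-- `readSnapshot(h)`: about to follow `n->nextv` -/
  | ssNext (h : ℕ) (k : V → St) (n : ℕ)
  /-- `readSnapshot(h)`: about to return `n->val` -/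
  | ssRet (h : ℕ) (k : V → St) (n : ℕ)
  /-- after a null pointer has been followed -/
  | crash

/-- The object on which a `vCAS` is in progress (begun and not yet returned). -/
def VState.vcasOn {V St : Type*} : VState V St → Option ℕ
  | .casTest x _ _ _ _ => some x
  | .casNew x _ _ _ => some x
  | .casAppend x _ _ _ => some x
  | .casDelete x _ _ => some x
  | .casHelp x _ => some x
  | .casRet x _ _ => some x
  | .initTest _ next => next.vcasOn
  | .initRead _ next => next.vcasOn
  | .initCas _ _ next => next.vcasOn
  | _ => none

namespace CASStructure

variable {P Op Ret V St : Type*}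

open Classical in
/-- The code of the transformed data structure. -/
noncomputable def vcode (D : CASStructure P Op Ret V St) :
    VState V St → VInstr Ret V (VState V St)
  | .upd s =>
      match D.code s with
      | .read x k => .readHead x fun n => .initTest n (.readRet n k)
      | .cas x old new k => .readHead x fun n => .initTest n (.casTest x old new k n)
      | .new v k => .newNode v none fun n => .newHead n k
      | .loc s' => .loc (.upd s')
      | .ret r => .ret r
  | .initTest n next => .readTs n fun t => if t = none then .initRead n next else next
  | .initRead n next => .readClock fun t => .initCas n t next
  | .initCas n t next => .casTs n t fun _ => next
  | .readRet n k => .readVal n fun v => .upd (k v)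
  | .casTest x old new k n => .readVal n fun v =>
      if v ≠ old then .casRet x k false
      else if new = old then .casRet x k true
      else .casNew x new k n
  | .casNew x new k n => .newNode new (some n) fun m => .casAppend x k n m
  | .casAppend x k n m => .casHead x n m fun b =>
      if b = true then .initTest m (.casRet x k true) else .casDelete x k m
  | .casDelete x k m => .delNode m (.casHelp x k)
  | .casHelp x k => .readHead x fun n => .initTest n (.casRet x k false)
  | .casRet _ k b => .loc (.upd (k b))
  | .newHead n k => .newObj n fun x => .initTest n (.upd (k x))
  | .snapRead s => .readClock fun h => .snapInc s h
  | .snapInc s h => .casClock h (h + 1) fun _ => .query h s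
  | .query h s =>
      match D.code s with
      | .read x k => .readHead x fun n => .initTest n (.ssTest h k n)
      | .cas _ _ _ _ => .crash
      | .new _ _ => .crash
      | .loc s' => .loc (.query h s')
      | .ret r => .ret r
  | .ssTest h k n => .readTs n fun t => if ∃ t', t = some t' ∧ h < t' then .ssNext h k n
      else .ssRet h k n
  | .ssNext h k n => .readNext n fun m =>
      match m with
      | some n' => .ssTest h k n'
      | none => .crash
  | .ssRet h k n => .readVal n fun v => .query h (k v)
  | .crash => .crash

open Classical in
/-- The transformed data structure. Every CAS object is replaced by a versioned CAS object,
initialized with the same value (one version, with timestamp `0`); there is one camera.  Operations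
of `Q` first take a snapshot and then use `readSnapshot`, the others use `vRead` and `vCAS`. -/
noncomputable def versioned (D : CASStructure P Op Ret V St) (Q : Set Op) :
    Impl P Op Ret (VMem V) (VState V St) where
  init :=
    { timestamp := 0
      vhead := fun x => (D.init x).map fun _ => x
      node := fun x => (D.init x).map fun v => ⟨v, none, some 0⟩ }
  start p op := if op ∈ Q then .snapRead (D.start p op) else .upd (D.start p op)
  step l m l' m' := (D.vcode l).Exec m l' m'
  result l :=
    match D.vcode l with
    | .ret r => some r
    | _ => none

/-! ## The quantities in the time bounds -/

/-- Event `i` is the first step of a `vCAS` on `x`. -/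
def BeginsVCAS (D : CASStructure P Op Ret V St) (cfg : ℕ → Config P Op (VMem V) (VState V St))
    (lab : ℕ → Label P Op Ret) (i x : ℕ) : Prop :=
  ∃ p op s old new k, lab i = .step p ∧ (cfg i).procs p = some (op, .upd s) ∧
    D.code s = .cas x old new k

/-- Event `i` is the first step of a `readSnapshot` on `x` by process `p`. -/
def BeginsReadSnapshot (D : CASStructure P Op Ret V St)
    (cfg : ℕ → Config P Op (VMem V) (VState V St)) (lab : ℕ → Label P Op Ret) (p : P) (i x : ℕ) :
    Prop :=
  ∃ q h s k, lab i = .step p ∧ (cfg i).procs p = some (q, .query h s) ∧ D.code s = .read x k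

/-- The number of accesses to the object `x` by the query that `p` runs during the events
`a, …, b - 1`. -/
noncomputable def accesses (D : CASStructure P Op Ret V St)
    (cfg : ℕ → Config P Op (VMem V) (VState V St)) (lab : ℕ → Label P Op Ret) (p : P) (a b x : ℕ) :
    ℕ∞ :=
  {i | a ≤ i ∧ i < b ∧ D.BeginsReadSnapshot cfg lab p i x}.encard

/-- `A`: the maximum number of accesses to the same object by this query. -/
noncomputable def maxAccesses (D : CASStructure P Op Ret V St)
    (cfg : ℕ → Config P Op (VMem V) (VState V St)) (lab : ℕ → Label P Op Ret) (p : P) (a b : ℕ) :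
    ℕ∞ :=
  ⨆ x, D.accesses cfg lab p a b x

/-- `W`: the number of `vCAS` operations concurrent with this query on objects accessed by it: those
in progress at the invocation of the query (at most one for each process) and those that begin
later. -/
noncomputable def concurrentVCAS (D : CASStructure P Op Ret V St)
    (cfg : ℕ → Config P Op (VMem V) (VState V St)) (lab : ℕ → Label P Op Ret) (p : P) (a b : ℕ) :
    ℕ∞ :=
  {p' | ∃ op l x, (cfg a).procs p' = some (op, l) ∧ l.vcasOn = some x ∧
      D.accesses cfg lab p a b x ≠ 0}.encard +
    {i | a ≤ i ∧ i < b ∧ ∃ x, D.BeginsVCAS cfg lab i x ∧ D.accesses cfg lab p a b x ≠ 0}.encard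

end CASStructure

/-- Event `s` is the first and event `t` the last step of a `takeSnapshot` by process `p`, within
the events `a, …, b - 1`, and `h` is the handle. -/
def TakesSnapshot {P Op Ret V St : Type*} (cfg : ℕ → Config P Op (VMem V) (VState V St))
    (lab : ℕ → Label P Op Ret) (p : P) (a b s t h : ℕ) : Prop :=
  a < s ∧ s < t ∧ t < b ∧ lab s = .step p ∧ lab t = .step p ∧
    (∃ q l, (cfg s).procs p = some (q, .snapRead l)) ∧
    ∃ q l, (cfg t).procs p = some (q, .snapInc l h)

/-- `v` is the value of the first version with timestamp at most `h` in the version list from the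
node `n`. -/
inductive VMem.VersionVal {V : Type*} (m : VMem V) (h : ℕ) : ℕ → V → Prop
  | here (n t : ℕ) (nd : VNode V) (hn : m.node n = some nd) (ht : nd.ts = some t) (hle : t ≤ h) :
      VersionVal m h n nd.val
  | next (n n' : ℕ) (nd : VNode V) (v : V) (hn : m.node n = some nd)
      (ht : ¬ ∃ t, nd.ts = some t ∧ t ≤ h) (hn' : nd.nextv = some n') (hv : VersionVal m h n' v) :
      VersionVal m h n v

/-- `C` holds the objects that existed, with the values they had, when the camera went from
timestamp `h` to `h + 1`, which is when the `takeSnapshot` operations with handle `h` take effect.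
(A `vCAS` or a constructor takes effect when the timestamp of its version is read from the camera;
so exactly the versions with timestamps at most `h` were installed before that moment.) -/
def VMem.IsSnapshot {V : Type*} (m : VMem V) (h : ℕ) (C : ℕ → Option V) : Prop :=
  ∀ x v, C x = some v ↔ ∃ n, m.vhead x = some n ∧ m.VersionVal h n v

/-- Event `i` is an invocation or response of an operation of `F`. -/
def HighLevelEventOf {P Op Ret S L : Type*} (F : Set Op) (cfg : ℕ → Config P Op S L)
    (lab : ℕ → Label P Op Ret) (i : ℕ) : Prop :=
  Impl.EventOf F cfg lab i ∧ ∀ p, lab i ≠ .step p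

/-- Two runs with `n` and `n'` events have the same history of invocations and responses of the
operations of `F`; `f` maps their positions in the first run to those in the second. -/
structure SameHistory {P Op Ret S L S' L' : Type*} (F : Set Op)
    (n : ℕ) (cfg : ℕ → Config P Op S L) (lab : ℕ → Label P Op Ret)
    (n' : ℕ) (cfg' : ℕ → Config P Op S' L') (lab' : ℕ → Label P Op Ret) (f : ℕ → ℕ) : Prop where
  map : ∀ i, i < n → HighLevelEventOf F cfg lab i →
    f i < n' ∧ lab' (f i) = lab i ∧ HighLevelEventOf F cfg' lab' (f i)
  mono : ∀ i j, i < j → j < n → HighLevelEventOf F cfg lab i → HighLevelEventOf F cfg lab j →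
    f i < f j
  surj : ∀ j, j < n' → HighLevelEventOf F cfg' lab' j →
    ∃ i, i < n ∧ HighLevelEventOf F cfg lab i ∧ f i = j

/-! A run of the transformed structure is simulated by a run of `D`: each update executes its
original instructions at suitable linearization points, and each completed query is executed as one
solo block. The crux is when a version enters the memory of `D`. Its timestamp is read from the
camera before the CAS of `initTS` installs it, so the installed value may be stale. The
linearization point is therefore chosen with foresight (`Linearized`): a version is linearized when
its timestamp is decided, or already when the camera moves beyond the value that the timestamp will
finally get, whichever comes first. The foresight is harmless: by `ts_of_final`, when the camera is
beyond the final timestamp of an undecided version, some process already holds that value, so the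
version has already been installed as a head. It follows that the versions linearized right after
the camera goes from `h` to `h + 1` are exactly those with final timestamp at most `h`
(`linearized_iff`). So the memory of `D` at that moment is what `readSnapshot(h)` computes
(`Sim.isSnapshot`), and this stays true later because newer heads get larger timestamps
(`versionVal_head`).

The other instructions are placed relative to these points. A version is appended only after
`initTS` on its predecessor, so only the head of an object can be unlinearized. A read, and a `vCAS`
that finds a wrong value or has `new = old`, is executed when the head that it has read is
linearized. A successful `vCAS` or a constructor is executed together with its own version. A `vCAS`
that loses is executed just after a newer version than the one it has read is linearized. Adjacent
versions have different values, as nothing is appended when `new = old`, so the CAS of `D` fails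
there. The calls of `initTS` ensure that these points have passed when the operation goes on.
`Outcome`, `InitRel` and `LocRel` record what a pending instruction waits for and whether it has
been executed. `Sim.linearize` treats one new version, first its creator and then all who wait for
it; `Sim.event` treats the remaining effect of an event; `Sim.segment` combines them. After a step
of the camera, the versions it linearizes come first and then the queries whose snapshot it takes.

A query with handle `h` runs its original code on the snapshot `C` (`Running`, `queryState`). Since
`C` is the memory of a reachable configuration of `D` in which the process is idle, the hypotheses
on `D` apply to this solo run: no missing object is accessed, and the response is that of the block
in the simulating run. A block leaves the configuration unchanged, so blocks can be inserted freely
and pending queries omitted. A completed instance occurs in the simulating run inside its original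
interval, so a linearization can be carried back (`exists_linearization`).

An original instruction costs at most 13 steps, the length of the longest `vCAS`. The account kept
in `ProcRel` shows that an update has at most as many events in the simulating run and at least one
thirteenth as many. This gives the running times, and for infinite runs the progress properties: an
instance that runs forever does so in the simulating run, and a process that stops there stops as
well. A query needs at most 6 steps for each original instruction, and 2 for each pointer that it
follows. A followed pointer leaves a version with timestamp larger than `h`, which has been appended
by a `vCAS` that was in progress at the invocation or began later. A `vCAS` appends at most one
version, and one `readSnapshot` leaves a version at most once. Double counting bounds the followed
pointers by `W * A` (`nextCount_le`). -/

/-! ### Case analysis of single steps. -/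

open Classical in
/-- The transitions of a process of the transformed data structure, listed case by case. -/
inductive VStep {P Op Ret V St : Type*} (D : CASStructure P Op Ret V St) :
    VState V St → VMem V → VState V St → VMem V → Prop
  | updRead (s x k n m) (hc : D.code s = .read x k) (hx : m.vhead x = some n) :
      VStep D (.upd s) m (.initTest n (.readRet n k)) m
  | updCas (s x old new k n m) (hc : D.code s = .cas x old new k) (hx : m.vhead x = some n) :
      VStep D (.upd s) m (.initTest n (.casTest x old new k n)) m
  | updNew (s v k n m) (hc : D.code s = .new v k) (hn : m.node n = none) :
      VStep D (.upd s) m (.newHead n k)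
        { m with node := Function.update m.node n (some ⟨v, none, none⟩) }
  | updLoc (s s' m) (hc : D.code s = .loc s') : VStep D (.upd s) m (.upd s') m
  | initTestNone (n next m nd) (hn : m.node n = some nd) (ht : nd.ts = none) :
      VStep D (.initTest n next) m (.initRead n next) m
  | initTestSome (n next m nd t) (hn : m.node n = some nd) (ht : nd.ts = some t) :
      VStep D (.initTest n next) m next m
  | initRead (n next m) : VStep D (.initRead n next) m (.initCas n m.timestamp next) m
  | initCasSucc (n t next m nd) (hn : m.node n = some nd) (ht : nd.ts = none) :
      VStep D (.initCas n t next) m next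
        { m with node := Function.update m.node n (some { nd with ts := some t }) }
  | initCasFail (n t next m nd t') (hn : m.node n = some nd) (ht : nd.ts = some t') :
      VStep D (.initCas n t next) m next m
  | readRet (n k m nd) (hn : m.node n = some nd) : VStep D (.readRet n k) m (.upd (k nd.val)) m
  | casTestNe (x old new k n m nd) (hn : m.node n = some nd) (hv : nd.val ≠ old) :
      VStep D (.casTest x old new k n) m (.casRet x k false) m
  | casTestEq (x old new k n m nd) (hn : m.node n = some nd) (hv : nd.val = old)
      (ho : new = old) : VStep D (.casTest x old new k n) m (.casRet x k true) m
  | casTestNew (x old new k n m nd) (hn : m.node n = some nd) (hv : nd.val = old)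
      (ho : new ≠ old) : VStep D (.casTest x old new k n) m (.casNew x new k n) m
  | casNew (x new k n m n') (hn : m.node n' = none) :
      VStep D (.casNew x new k n) m (.casAppend x k n n')
        { m with node := Function.update m.node n' (some ⟨new, some n, none⟩) }
  | casAppendSucc (x k n n' m) (hx : m.vhead x = some n) :
      VStep D (.casAppend x k n n') m (.initTest n' (.casRet x k true))
        { m with vhead := Function.update m.vhead x (some n') }
  | casAppendFail (x k n n' m n'') (hx : m.vhead x = some n'') (hne : n'' ≠ n) :
      VStep D (.casAppend x k n n') m (.casDelete x k n') m
  | casDelete (x k n m) : VStep D (.casDelete x k n) m (.casHelp x k)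
        { m with node := Function.update m.node n none }
  | casHelp (x k n m) (hx : m.vhead x = some n) :
      VStep D (.casHelp x k) m (.initTest n (.casRet x k false)) m
  | casRet (x k b m) : VStep D (.casRet x k b) m (.upd (k b)) m
  | newHead (n k x m) (hx : m.vhead x = none) :
      VStep D (.newHead n k) m (.initTest n (.upd (k x)))
        { m with vhead := Function.update m.vhead x (some n) }
  | snapRead (s m) : VStep D (.snapRead s) m (.snapInc s m.timestamp) m
  | snapIncSucc (s h m) (ht : m.timestamp = h) :
      VStep D (.snapInc s h) m (.query h s) { m with timestamp := h + 1 }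
  | snapIncFail (s h m) (ht : m.timestamp ≠ h) : VStep D (.snapInc s h) m (.query h s) m
  | queryRead (h s x k n m) (hc : D.code s = .read x k) (hx : m.vhead x = some n) :
      VStep D (.query h s) m (.initTest n (.ssTest h k n)) m
  | queryLoc (h s s' m) (hc : D.code s = .loc s') : VStep D (.query h s) m (.query h s') m
  | ssTestGt (h k n m nd t) (hn : m.node n = some nd) (ht : nd.ts = some t) (hlt : h < t) :
      VStep D (.ssTest h k n) m (.ssNext h k n) m
  | ssTestLe (h k n m nd) (hn : m.node n = some nd) (ht : ∀ t, nd.ts = some t → t ≤ h) :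
      VStep D (.ssTest h k n) m (.ssRet h k n) m
  | ssNextSome (h k n m nd n') (hn : m.node n = some nd) (hn' : nd.nextv = some n') :
      VStep D (.ssNext h k n) m (.ssTest h k n') m
  | ssNextNone (h k n m nd) (hn : m.node n = some nd) (hn' : nd.nextv = none) :
      VStep D (.ssNext h k n) m .crash m
  | ssRet (h k n m nd) (hn : m.node n = some nd) : VStep D (.ssRet h k n) m (.query h (k nd.val)) m

section

variable {P Op Ret V St : Type*} {D : CASStructure P Op Ret V St} {Q : Set Op}

/-- Only this direction is needed: steps of a given run are analysed through `VStep`, while the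
existence of steps is shown directly from the code in `VState.Inv.exists_step`. -/
theorem vstep_of_step {l l' : VState V St} {m m' : VMem V}
    (hs : (D.versioned Q).step l m l' m') : VStep D l m l' m' := by
  change (D.vcode l).Exec m l' m' at hs
  cases l with
  | upd s =>
    simp only [CASStructure.vcode] at hs
    cases hc : D.code s <;> simp only [hc, VInstr.Exec] at hs
    · obtain ⟨n, hx, rfl, rfl⟩ := hs
      exact .updRead _ _ _ _ _ hc hx
    · obtain ⟨n, hx, rfl, rfl⟩ := hs
      exact .updCas _ _ _ _ _ _ _ hc hx
    · obtain ⟨n, hx, rfl, rfl⟩ := hs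
      exact .updNew _ _ _ _ _ hc hx
    · obtain ⟨rfl, rfl⟩ := hs
      exact .updLoc _ _ _ hc
  | initTest n next =>
    obtain ⟨nd, hn, rfl, rfl⟩ := hs
    cases ht : nd.ts with
    | none => simpa using .initTestNone _ _ _ _ hn ht
    | some t => simpa using .initTestSome _ _ _ _ _ hn ht
  | initRead n next =>
    obtain ⟨rfl, rfl⟩ := hs
    exact .initRead _ _ _
  | initCas n t next =>
    obtain ⟨nd, hn, hs⟩ := hs
    cases ht : nd.ts with
    | none =>
      rw [if_pos ht] at hs
      obtain ⟨rfl, rfl⟩ := hs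
      exact .initCasSucc _ _ _ _ _ hn ht
    | some t' =>
      rw [if_neg (by simp [ht])] at hs
      obtain ⟨rfl, rfl⟩ := hs
      exact .initCasFail _ _ _ _ _ _ hn ht
  | readRet n k =>
    obtain ⟨nd, hn, rfl, rfl⟩ := hs
    exact .readRet _ _ _ _ hn
  | casTest x old new k n =>
    obtain ⟨nd, hn, rfl, rfl⟩ := hs
    by_cases hv : nd.val = old
    · by_cases ho : new = old
      · subst ho
        simpa [hv] using .casTestEq _ _ _ _ _ _ _ hn hv rfl
      · simpa [hv, ho] using .casTestNew _ _ _ _ _ _ _ hn hv ho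
    · simpa [hv] using .casTestNe _ _ _ _ _ _ _ hn hv
  | casNew x new k n =>
    obtain ⟨n', hn, rfl, rfl⟩ := hs
    exact .casNew _ _ _ _ _ _ hn
  | casAppend x k n n' =>
    obtain ⟨n'', hx, hs⟩ := hs
    by_cases he : n'' = n
    · rw [if_pos he] at hs
      obtain ⟨rfl, rfl⟩ := hs
      subst he
      simpa using .casAppendSucc _ _ _ _ _ hx
    · rw [if_neg he] at hs
      obtain ⟨rfl, rfl⟩ := hs
      simpa using .casAppendFail _ _ _ _ _ _ hx he
  | casDelete x k n =>
    obtain ⟨rfl, rfl⟩ := hs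
    exact .casDelete _ _ _ _
  | casHelp x k =>
    obtain ⟨n, hx, rfl, rfl⟩ := hs
    exact .casHelp _ _ _ _ hx
  | casRet x k b =>
    obtain ⟨rfl, rfl⟩ := hs
    exact .casRet _ _ _ _
  | newHead n k =>
    obtain ⟨x, hx, rfl, rfl⟩ := hs
    exact .newHead _ _ _ _ hx
  | snapRead s =>
    obtain ⟨rfl, rfl⟩ := hs
    exact .snapRead _ _
  | snapInc s h =>
    simp only [CASStructure.vcode, VInstr.Exec] at hs
    split_ifs at hs with he
    · obtain ⟨rfl, rfl⟩ := hs
      exact .snapIncSucc _ _ _ he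
    · obtain ⟨rfl, rfl⟩ := hs
      exact .snapIncFail _ _ _ he
  | query h s =>
    simp only [CASStructure.vcode] at hs
    cases hc : D.code s <;> simp only [hc, VInstr.Exec] at hs
    · obtain ⟨n, hx, rfl, rfl⟩ := hs
      exact .queryRead _ _ _ _ _ _ hc hx
    · obtain ⟨rfl, rfl⟩ := hs
      exact .queryLoc _ _ _ _ hc
  | ssTest h k n =>
    obtain ⟨nd, hn, rfl, rfl⟩ := hs
    by_cases ht : ∃ t', nd.ts = some t' ∧ h < t'
    · beta_reduce
      rw [if_pos ht]
      obtain ⟨t, ht, hlt⟩ := ht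
      exact .ssTestGt _ _ _ _ _ _ hn ht hlt
    · beta_reduce
      rw [if_neg ht]
      exact .ssTestLe _ _ _ _ _ hn fun t h1 => not_lt.1 fun h2 => ht ⟨t, h1, h2⟩
  | ssNext h k n =>
    obtain ⟨nd, hn, rfl, rfl⟩ := hs
    cases hn' : nd.nextv with
    | none => exact .ssNextNone _ _ _ _ _ hn hn'
    | some n' => exact .ssNextSome _ _ _ _ _ _ hn hn'
  | ssRet h k n =>
    obtain ⟨nd, hn, rfl, rfl⟩ := hs
    exact .ssRet _ _ _ _ _ hn
  | crash => exact hs.elim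

/-- The instruction `return r` occurs only in the code of the original operations. -/
theorem versioned_result {l : VState V St} {r : Ret} :
    (D.versioned Q).result l = some r ↔
      (∃ s, l = .upd s ∧ D.code s = .ret r) ∨ ∃ h s, l = .query h s ∧ D.code s = .ret r := by
  change (match D.vcode l with | .ret r => some r | _ => none) = some r ↔ _
  cases l <;> simp only [CASStructure.vcode] <;>
    first
    | (rename_i s; cases hc : D.code s <;> simp [hc])
    | simp

theorem impl_result {s : St} {r : Ret} : D.impl.result s = some r ↔ D.code s = .ret r := by
  change (match D.code s with | .ret r => some r | _ => none) = some r ↔ _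
  cases hc : D.code s <;> simp

end

/-! ## Invariants of the transformed data structure -/

namespace VMem

variable {V : Type*}

/-- The value of a version node, if it exists. -/
def valOf (m : VMem V) (n : ℕ) : Option V := (m.node n).map VNode.val

/-- The successor pointer of a version node, if the node exists. -/
def nextOf (m : VMem V) (n : ℕ) : Option (Option ℕ) := (m.node n).map VNode.nextv

/-- The timestamp of a version node, if the node exists. -/
def tsOf (m : VMem V) (n : ℕ) : Option (Option ℕ) := (m.node n).map VNode.ts

/-- The timestamp of the node has been decided. -/
def Decided (m : VMem V) (n : ℕ) : Prop := ∃ t, m.tsOf n = some (some t)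

/-- The invariants of the memory, where `J x n` says that `n` has been the head of `x`. -/
structure Inv (J : ℕ → ℕ → Prop) (m : VMem V) : Prop where
  exists_of_J : ∀ {x n}, J x n → m.node n ≠ none
  J_of_head : ∀ {x n}, m.vhead x = some n → J x n
  head_of_J : ∀ {x n}, J x n → ∃ n', m.vhead x = some n'
  J_of_ts : ∀ {n t}, m.tsOf n = some (some t) → (∃ x, J x n) ∧ t ≤ m.timestamp
  -- A version becomes the head only after its predecessor has been decided, so undecided versions
  -- are confined to the current heads.
  head_of_undecided : ∀ {x n}, J x n → m.tsOf n = some none → m.vhead x = some n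
  obj_unique : ∀ {x y n}, J x n → J y n → x = y
  -- The values differ because a `vCAS` with `new = old` appends nothing. This makes the CAS of a
  -- competitor fail once a newer version is linearized.
  next : ∀ {x n n'}, J x n → m.nextOf n = some (some n') →
    J x n' ∧ m.Decided n' ∧ m.valOf n' ≠ m.valOf n
  next_inj : ∀ {x n₁ n₂}, J x n₁ → J x n₂ → m.nextOf n₁ = m.nextOf n₂ → n₁ = n₂
  exists_pred : ∀ {x n}, J x n → m.vhead x ≠ some n → ∃ n', J x n' ∧ m.nextOf n' = some (some n)
  head_no_pred : ∀ {x n n'}, m.vhead x = some n → J x n' → m.nextOf n' ≠ some (some n)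
  -- The freshness clauses serve only to show that nodes and objects can always be created.
  fresh_node : {n | m.node n = none}.Infinite
  fresh_obj : {x | m.vhead x = none}.Infinite

/-- The memory `m'` arises from `m` by steps that respect the nodes that have been heads. -/
structure Ext (J : ℕ → ℕ → Prop) (m : VMem V) (J' : ℕ → ℕ → Prop) (m' : VMem V) : Prop where
  J_mono : ∀ {x n}, J x n → J' x n
  time_le : m.timestamp ≤ m'.timestamp
  val_eq : ∀ {x n}, J x n → m'.valOf n = m.valOf n
  next_eq : ∀ {x n}, J x n → m'.nextOf n = m.nextOf n
  ts_eq : ∀ {x n t}, J x n → m.tsOf n = some (some t) → m'.tsOf n = some (some t)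

theorem Ext.refl (J : ℕ → ℕ → Prop) (m : VMem V) : Ext J m J m :=
  ⟨id, le_rfl, fun _ => rfl, fun _ => rfl, fun _ h => h⟩

theorem Ext.trans {J J' J'' : ℕ → ℕ → Prop} {m m' m'' : VMem V} (h : Ext J m J' m')
    (h' : Ext J' m' J'' m'') : Ext J m J'' m'' :=
  ⟨fun hj => h'.J_mono (h.J_mono hj), h.time_le.trans h'.time_le,
    fun hj => (h'.val_eq (h.J_mono hj)).trans (h.val_eq hj),
    fun hj => (h'.next_eq (h.J_mono hj)).trans (h.next_eq hj),
    fun hj ht => h'.ts_eq (h.J_mono hj) (h.ts_eq hj ht)⟩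

theorem Ext.decided {J J' : ℕ → ℕ → Prop} {m m' : VMem V} (h : Ext J m J' m') {x n : ℕ}
    (hj : J x n) (hd : m.Decided n) : m'.Decided n :=
  hd.imp fun _ ht => h.ts_eq hj ht

variable {J : ℕ → ℕ → Prop} {m : VMem V}

theorem Inv.undecided_or_decided (hm : m.Inv J) {x n : ℕ} (h : J x n) :
    m.tsOf n = some none ∨ m.Decided n := by
  have := hm.exists_of_J h
  unfold Decided tsOf
  cases hn : m.node n with
  | none => exact (this hn).elim
  | some nd => cases ht : nd.ts <;> simp [ht]

theorem Inv.decided_of_not_head (hm : m.Inv J) {x n : ℕ} (h : J x n) (hx : m.vhead x ≠ some n) :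
    m.Decided n :=
  (hm.undecided_or_decided h).resolve_left fun hu => hx (hm.head_of_undecided h hu)

theorem Inv.setTime (hm : m.Inv J) {t : ℕ} (ht : m.timestamp ≤ t) :
    Inv J { m with timestamp := t } :=
  { hm with J_of_ts := fun h => ⟨(hm.J_of_ts h).1, (hm.J_of_ts h).2.trans ht⟩ }

-- Values and pointers are untouched and the new timestamp does not exceed the camera, so every
-- clause survives. The last component is for the private nodes of other processes.
open Classical in
theorem Inv.setTs (hm : m.Inv J) {x n t : ℕ} {nd : VNode V} (hj : J x n) (hn : m.node n = some nd)
    (ht : nd.ts = none) (hle : t ≤ m.timestamp) :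
    Inv J { m with node := Function.update m.node n (some { nd with ts := some t }) } ∧
    Ext J m J { m with node := Function.update m.node n (some { nd with ts := some t }) } ∧
    ∀ n', n' ≠ n → Function.update m.node n (some { nd with ts := some t }) n' = m.node n' := by
  set m' : VMem V := { m with node := Function.update m.node n (some { nd with ts := some t }) }
  have hne : ∀ n', n' ≠ n → m'.node n' = m.node n' := fun n' h => Function.update_of_ne h _ _
  have hself : m'.node n = some { nd with ts := some t } := Function.update_self _ _ _
  have hval : ∀ n', m'.valOf n' = m.valOf n' := fun n' => by
    by_cases h : n' = n
    · subst h; simp [valOf, hself, hn]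
    · simp [valOf, hne _ h]
  have hnext : ∀ n', m'.nextOf n' = m.nextOf n' := fun n' => by
    by_cases h : n' = n
    · subst h; simp [nextOf, hself, hn]
    · simp [nextOf, hne _ h]
  have hts : ∀ n', n' ≠ n → m'.tsOf n' = m.tsOf n' := fun n' h => by simp [tsOf, hne _ h]
  have htn : m'.tsOf n = some (some t) := by simp [tsOf, hself]
  have htn' : m.tsOf n = some none := by simp [tsOf, hn, ht]
  have hdec : ∀ n', m.Decided n' → m'.Decided n' := fun n' h => by
    by_cases h' : n' = n
    · exact h' ▸ ⟨t, htn⟩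
    · simpa only [Decided, hts _ h'] using h
  have hex : ∀ n', m'.node n' = none ↔ m.node n' = none := fun n' => by
    by_cases h : n' = n
    · subst h; simp [hself, hn]
    · rw [hne _ h]
  refine ⟨⟨fun h => (hex _).not.2 (hm.exists_of_J h), hm.J_of_head, hm.head_of_J, ?_, ?_,
    hm.obj_unique, ?_, ?_, ?_, ?_, ?_, hm.fresh_obj⟩,
    ⟨id, le_rfl, fun _ => hval _, fun _ => hnext _, ?_⟩, hne⟩
  · intro n' t' h
    by_cases h' : n' = n
    · subst h'
      rw [htn] at h
      cases h
      exact ⟨⟨x, hj⟩, hle⟩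
    · exact hm.J_of_ts (hts _ h' ▸ h)
  · intro y n' hj' h
    by_cases h' : n' = n
    · subst h'
      rw [htn] at h
      cases h
    · exact hm.head_of_undecided hj' (hts _ h' ▸ h)
  · intro y n₁ n₂ h1 h2
    rw [hnext] at h2
    obtain ⟨h3, h4, h5⟩ := hm.next h1 h2
    exact ⟨h3, hdec _ h4, by rwa [hval, hval]⟩
  · intro y n₁ n₂ h1 h2 h3
    rw [hnext, hnext] at h3
    exact hm.next_inj h1 h2 h3
  · intro y n' h1 h2
    simpa only [hnext] using hm.exists_pred h1 h2
  · intro y n₁ n₂ h1 h2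
    rw [hnext]
    exact hm.head_no_pred h1 h2
  · simpa only [hex] using hm.fresh_node
  · intro y n' t' hj' h
    by_cases h' : n' = n
    · subst h'
      rw [htn'] at h
      cases h
    · rwa [hts _ h']

-- The clauses speak only of nodes that have been heads and of decided timestamps, so rewriting
-- another node to something undecided or absent does not affect them. Creation and deletion of
-- nodes are both instances.
open Classical in
theorem Inv.setNode (hm : m.Inv J) {n : ℕ} (hj : ∀ x, ¬ J x n) {o : Option (VNode V)}
    (ho : ∀ nd, o = some nd → nd.ts = none) :
    Inv J { m with node := Function.update m.node n o } ∧
    Ext J m J { m with node := Function.update m.node n o } := by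
  set m' : VMem V := { m with node := Function.update m.node n o }
  have hne : ∀ n', n' ≠ n → m'.node n' = m.node n' := fun n' h => Function.update_of_ne h _ _
  have hself : m'.node n = o := Function.update_self _ _ _
  have hJ : ∀ {x n'}, J x n' → m'.node n' = m.node n' := fun {x n'} h =>
    hne _ fun h' => hj x (h' ▸ h)
  have hval : ∀ {x n'}, J x n' → m'.valOf n' = m.valOf n' := fun h => by simp [valOf, hJ h]
  have hnext : ∀ {x n'}, J x n' → m'.nextOf n' = m.nextOf n' := fun h => by simp [nextOf, hJ h]
  have hts : ∀ {x n'}, J x n' → m'.tsOf n' = m.tsOf n' := fun h => by simp [tsOf, hJ h]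
  refine ⟨⟨fun h => (hJ h).symm ▸ hm.exists_of_J h, hm.J_of_head, hm.head_of_J, ?_, ?_,
    hm.obj_unique, ?_, ?_, ?_, ?_, ?_, hm.fresh_obj⟩,
    ⟨id, le_rfl, hval, hnext, fun h h' => (hts h).trans h'⟩⟩
  · intro n' t h
    by_cases h' : n' = n
    · subst h'
      simp only [tsOf, hself, Option.map_eq_some_iff] at h
      obtain ⟨nd, h1, h2⟩ := h
      rw [ho nd h1] at h2
      cases h2
    · have : m.tsOf n' = some (some t) := by simpa only [tsOf, hne _ h'] using h
      exact hm.J_of_ts this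
  · intro y n' hj' h
    exact hm.head_of_undecided hj' (hts hj' ▸ h)
  · intro y n₁ n₂ h1 h2
    rw [hnext h1] at h2
    obtain ⟨h3, h4, h5⟩ := hm.next h1 h2
    exact ⟨h3, by simpa only [Decided, hts h3] using h4, by rwa [hval h1, hval h3]⟩
  · intro y n₁ n₂ h1 h2 h3
    rw [hnext h1, hnext h2] at h3
    exact hm.next_inj h1 h2 h3
  · intro y n' h1 h2
    obtain ⟨n'', h3, h4⟩ := hm.exists_pred h1 h2
    exact ⟨n'', h3, (hnext h3).trans h4⟩
  · intro y n₁ n₂ h1 h2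
    rw [hnext h2]
    exact hm.head_no_pred h1 h2
  · refine (hm.fresh_node.sdiff (Set.finite_singleton n)).mono fun n' h => ?_
    exact (hne n' h.2).trans h.1

open Classical in
/-- A node becomes the head of an object: it points to the previous head, or it is the first
version of a new object. -/
theorem Inv.setHead (hm : m.Inv J) {x n : ℕ} (hj : ∀ y, ¬ J y n) (hu : m.tsOf n = some none)
    (hn : m.nextOf n = some (m.vhead x))
    (hd : ∀ n', m.vhead x = some n' → m.Decided n' ∧ m.valOf n' ≠ m.valOf n) :
    Inv (fun y n' => J y n' ∨ y = x ∧ n' = n)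
      { m with vhead := Function.update m.vhead x (some n) } ∧
    Ext J m (fun y n' => J y n' ∨ y = x ∧ n' = n)
      { m with vhead := Function.update m.vhead x (some n) } := by
  set m' : VMem V := { m with vhead := Function.update m.vhead x (some n) }
  have hself : m'.vhead x = some n := Function.update_self _ _ _
  have hne : ∀ y, y ≠ x → m'.vhead y = m.vhead y := fun y h => Function.update_of_ne h _ _
  refine ⟨⟨?_, ?_, ?_, ?_, ?_, ?_, ?_, ?_, ?_, ?_, hm.fresh_node, ?_⟩,
    ⟨Or.inl, le_rfl, fun _ => rfl, fun _ => rfl, fun _ h => h⟩⟩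
  · rintro y n' (h | ⟨rfl, rfl⟩)
    · exact hm.exists_of_J h
    · intro h
      change m.node n' = none at h
      simp [tsOf, h] at hu
  · intro y n' h
    by_cases hy : y = x
    · subst hy
      rw [hself] at h
      exact .inr ⟨rfl, (Option.some.inj h).symm⟩
    · exact .inl (hm.J_of_head (hne y hy ▸ h))
  · intro y n' h
    by_cases hy : y = x
    · exact ⟨n, hy ▸ hself⟩
    · rw [hne y hy]
      exact hm.head_of_J (h.resolve_right fun h => hy h.1)
  · intro n' t h
    obtain ⟨⟨y, h1⟩, h2⟩ := hm.J_of_ts h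
    exact ⟨⟨y, .inl h1⟩, h2⟩
  · rintro y n' (h | ⟨rfl, rfl⟩) hu'
    · have h1 := hm.head_of_undecided h hu'
      by_cases hy : y = x
      · subst hy
        obtain ⟨t, ht⟩ := (hd _ h1).1
        exact absurd (hu'.symm.trans ht) (by simp)
      · rw [hne y hy, h1]
    · exact hself
  · rintro y z n' (h | ⟨h1, h2⟩) (h' | ⟨h1', h2'⟩)
    · exact hm.obj_unique h h'
    · exact (hj _ (h2' ▸ h)).elim
    · exact (hj _ (h2 ▸ h')).elim
    · exact h1.trans h1'.symm
  · rintro y n₁ n₂ (h | ⟨rfl, rfl⟩) h'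
    · obtain ⟨h1, h2⟩ := hm.next h h'
      exact ⟨.inl h1, h2⟩
    · have h1 : m.vhead y = some n₂ := Option.some.inj (hn.symm.trans h')
      exact ⟨.inl (hm.J_of_head h1), hd _ h1⟩
  -- No older version of `x` has the same successor as `n`: it would point to the current head, or
  -- be a first version although `x` has no head yet.
  · have key : ∀ n', J x n' → m.nextOf n' ≠ m.nextOf n := by
      intro n' h h'
      rw [hn] at h'
      cases hx : m.vhead x with
      | none =>
        obtain ⟨z, hz⟩ := hm.head_of_J h
        exact absurd (hx.symm.trans hz) (by simp)
      | some z => exact hm.head_no_pred hx h (h'.trans (congrArg some hx))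
    rintro y n₁ n₂ (h | ⟨rfl, rfl⟩) (h' | ⟨h1, rfl⟩) he
    · exact hm.next_inj h h' he
    · subst h1
      exact (key _ h he).elim
    · exact (key _ h' he.symm).elim
    · rfl
  · rintro y n' h hx
    by_cases hy : y = x
    · subst hy
      have hJ : J y n' := h.resolve_right fun h => hx (h.2 ▸ hself)
      by_cases h2 : m.vhead y = some n'
      · exact ⟨n, .inr ⟨rfl, rfl⟩, hn.trans (congrArg some h2)⟩
      · obtain ⟨n'', h3, h4⟩ := hm.exists_pred hJ h2
        exact ⟨n'', .inl h3, h4⟩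
    · have hJ : J y n' := h.resolve_right fun h => hy h.1
      obtain ⟨n'', h3, h4⟩ := hm.exists_pred hJ (hne y hy ▸ hx)
      exact ⟨n'', .inl h3, h4⟩
  · rintro y n₁ n₂ hx (h | ⟨rfl, rfl⟩) h'
    · by_cases hy : y = x
      · subst hy
        rw [hself] at hx
        cases hx
        exact hj _ (hm.next h h').1
      · exact hm.head_no_pred (hne y hy ▸ hx) h h'
    · rw [hself] at hx
      cases hx
      have h1 : m.vhead y = some n₁ := Option.some.inj (hn.symm.trans h')
      exact hj _ (hm.J_of_head h1)
  · refine (hm.fresh_obj.sdiff (Set.finite_singleton x)).mono fun y h => ?_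
    exact (hne y h.2).trans h.1

end VMem

namespace VState

variable {V St : Type*}

/-- The version node that the process has created and not yet made a head. -/
def privNode : VState V St → Option ℕ
  | .casAppend _ _ _ n => some n
  | .casDelete _ _ n => some n
  | .newHead n _ => some n
  | _ => none

/-- After `initTS(n)`, an update or a constructor that has installed `n` is complete. -/
def AfterInstall : VState V St → Prop
  | .casRet _ _ b => b = true
  | .upd _ => True
  | _ => False

open Classical in
/-- The version node that the process has created and, if it is a head, whose timestamp it still
has to initialize. -/
noncomputable def ownNode : VState V St → Option ℕ
  | .casAppend _ _ _ n => some n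
  | .casDelete _ _ n => some n
  | .newHead n _ => some n
  | .initTest n next => if next.AfterInstall then some n else none
  | .initRead n next => if next.AfterInstall then some n else none
  | .initCas n _ next => if next.AfterInstall then some n else none
  | _ => none

/-- The local states of queries. -/
def IsQuery : VState V St → Prop
  | .snapRead _ => True
  | .snapInc _ _ => True
  | .query _ _ => True
  | .ssTest _ _ _ => True
  | .ssNext _ _ _ => True
  | .ssRet _ _ _ => True
  | .crash => True
  | .initTest _ next => next.IsQuery
  | .initRead _ next => next.IsQuery
  | .initCas _ _ next => next.IsQuery
  | _ => False

/-- `initTS(n)` may be followed by `next`. -/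
def InitOK (J : ℕ → ℕ → Prop) (m : VMem V) (n : ℕ) (next : VState V St) : Prop :=
  (∃ x, J x n) ∧
    match next with
    | .readRet n' _ => n' = n
    | .casTest x _ _ _ n' => n' = n ∧ J x n
    | .casRet x _ b => J x n ∧ (b = true → ∃ n', m.nextOf n = some (some n'))
    | .upd _ => m.nextOf n = some none
    | .ssTest h _ n' => n' = n ∧ h < m.timestamp
    | _ => False

/-- The invariants of a local state. -/
def Inv (J : ℕ → ℕ → Prop) (m : VMem V) : VState V St → Prop
  | .initTest n next => InitOK J m n next
  | .initRead n next => InitOK J m n next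
  | .initCas n t next => InitOK J m n next ∧ t ≤ m.timestamp
  | .readRet n _ => (∃ x, J x n) ∧ m.Decided n
  | .casTest x _ _ _ n => J x n ∧ m.Decided n
  | .casNew x new _ n => J x n ∧ m.Decided n ∧ m.valOf n ≠ some new
  | .casAppend x _ n n' => J x n ∧ m.Decided n ∧ m.nextOf n' = some (some n) ∧
      m.tsOf n' = some none ∧ m.valOf n ≠ m.valOf n'
  | .casDelete x _ n => (∃ n', J x n') ∧ m.node n ≠ none
  | .casHelp x _ => ∃ n', J x n'
  | .newHead n _ => m.nextOf n = some none ∧ m.tsOf n = some none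
  | .snapInc _ h => h ≤ m.timestamp
  | .query h _ => h < m.timestamp
  | .ssTest h _ n => h < m.timestamp ∧ (∃ x, J x n) ∧ m.Decided n
  | .ssNext h _ n => h < m.timestamp ∧ (∃ x, J x n) ∧ ∃ t, h < t ∧ m.tsOf n = some (some t)
  | .ssRet h _ n => h < m.timestamp ∧ (∃ x, J x n) ∧ ∃ t, t ≤ h ∧ m.tsOf n = some (some t)
  | _ => True

theorem ownNode_of_privNode {l : VState V St} {n : ℕ} (h : l.privNode = some n) :
    l.ownNode = some n := by
  cases l <;> simp_all [privNode, ownNode]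

variable {J J' : ℕ → ℕ → Prop} {m m' : VMem V}

theorem InitOK.ext {n : ℕ} {next : VState V St} (h : InitOK J m n next)
    (he : VMem.Ext J m J' m') : InitOK J' m' n next := by
  obtain ⟨⟨x, hx⟩, h⟩ := h
  refine ⟨⟨x, he.J_mono hx⟩, ?_⟩
  cases next <;> simp only at h ⊢
  · rwa [he.next_eq hx]
  · exact h
  · exact ⟨h.1, he.J_mono h.2⟩
  · exact ⟨he.J_mono h.1, by rw [he.next_eq h.1]; exact h.2⟩
  · exact ⟨h.1, h.2.trans_le he.time_le⟩

/-- Apart from the private node, all clauses concern the camera, which only grows, and nodes that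
have been heads, whose value, successor and decided timestamp are permanent. So local invariants are
stable under the steps of other processes. -/
theorem Inv.ext {l : VState V St} (h : l.Inv J m) (he : VMem.Ext J m J' m')
    (hp : ∀ n, l.privNode = some n → m'.node n = m.node n) : l.Inv J' m' := by
  cases l <;> simp only [Inv] at h ⊢
  · exact h.ext he
  · exact h.ext he
  · exact ⟨h.1.ext he, h.2.trans he.time_le⟩
  · obtain ⟨⟨x, hx⟩, hd⟩ := h
    exact ⟨⟨x, he.J_mono hx⟩, he.decided hx hd⟩
  · exact ⟨he.J_mono h.1, he.decided h.1 h.2⟩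
  · exact ⟨he.J_mono h.1, he.decided h.1 h.2.1, by rw [he.val_eq h.1]; exact h.2.2⟩
  · have := hp _ rfl
    simp only [VMem.nextOf, VMem.tsOf, this]
    refine ⟨he.J_mono h.1, he.decided h.1 h.2.1, h.2.2.1, h.2.2.2.1, ?_⟩
    rw [he.val_eq h.1]
    simpa only [VMem.valOf, this] using h.2.2.2.2
  · rw [hp _ rfl]
    exact ⟨h.1.imp fun _ => he.J_mono, h.2⟩
  · exact h.imp fun _ => he.J_mono
  · have := hp _ rfl
    simpa only [VMem.nextOf, VMem.tsOf, this] using h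
  · exact h.trans he.time_le
  · exact h.trans_le he.time_le
  · obtain ⟨h0, ⟨x, hx⟩, hd⟩ := h
    exact ⟨h0.trans_le he.time_le, ⟨x, he.J_mono hx⟩, he.decided hx hd⟩
  all_goals
    obtain ⟨h0, ⟨x, hx⟩, t, ht, hd⟩ := h
    exact ⟨h0.trans_le he.time_le, ⟨x, he.J_mono hx⟩, t, ht, he.ts_eq hx hd⟩

/-- Used to see that a newly allocated name is not owned by any process, even though the names of
deleted nodes are reused. -/
theorem Inv.own_exists {l : VState V St} (h : l.Inv J m) (hm : m.Inv J) {n : ℕ}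
    (ho : l.ownNode = some n) : m.node n ≠ none := by
  cases l <;> simp only [Inv, ownNode] at h ho <;>
    first
    | (cases ho; done)
    | (split_ifs at ho; cases ho; obtain ⟨⟨x, hx⟩, -⟩ := h; exact hm.exists_of_J hx)
    | (split_ifs at ho; cases ho; obtain ⟨⟨⟨x, hx⟩, -⟩, -⟩ := h; exact hm.exists_of_J hx)
    | (cases ho; exact h.2)
    | (cases ho; intro hn; simp [VMem.nextOf, hn] at h)

end VState

namespace CASStructure

variable {P Op Ret V St : Type*}

/-- The invariants of the configurations of the transformed data structure, where `J x n` says that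
`n` has been the head of `x`. -/
structure ConfigInv (D : CASStructure P Op Ret V St) (Q : Set Op) (J : ℕ → ℕ → Prop)
    (c : Config P Op (VMem V) (VState V St)) : Prop where
  mem : c.shared.Inv J
  loc : ∀ {p op l}, c.procs p = some (op, l) → l.Inv J c.shared
  priv : ∀ {p op l n}, c.procs p = some (op, l) → l.privNode = some n → ∀ x, ¬ J x n
  own_inj : ∀ {p q op op' l l' n}, c.procs p = some (op, l) → c.procs q = some (op', l') →
    l.ownNode = some n → l'.ownNode = some n → p = q
  own_of_undecided : ∀ {x n}, J x n → c.shared.tsOf n = some none →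
    ∃ p op l, c.procs p = some (op, l) ∧ l.ownNode = some n
  query_iff : ∀ {p op l}, c.procs p = some (op, l) → (op ∈ Q ↔ l.IsQuery)

variable {D : CASStructure P Op Ret V St} {Q : Set Op} {J J' : ℕ → ℕ → Prop}
  {c : Config P Op (VMem V) (VState V St)}

-- The frame argument for a step of one process. Ownership is exclusive, so it is enough that this
-- process acquires only fresh nodes (`hown`), that new heads come from its own nodes (`hnew`), and
-- that every undecided head keeps an owner (`hund`).
open Classical in
theorem ConfigInv.update (hc : D.ConfigInv Q J c) {p : P} {op : Op} {l l' : VState V St}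
    (hp : c.procs p = some (op, l)) {m' : VMem V} (hm' : m'.Inv J')
    (he : VMem.Ext J c.shared J' m') (hl' : l'.Inv J' m')
    (hnode : ∀ q op' l₁ n, q ≠ p → c.procs q = some (op', l₁) → l₁.privNode = some n →
      m'.node n = c.shared.node n)
    (hnew : ∀ x n, J' x n → J x n ∨ l.ownNode = some n)
    (hpriv : ∀ n, l'.privNode = some n → ∀ x, ¬ J' x n)
    (hown : ∀ n, l'.ownNode = some n → l.ownNode = some n ∨ c.shared.node n = none)
    (hund : ∀ x n, J' x n → m'.tsOf n = some none →
      l'.ownNode = some n ∨ J x n ∧ c.shared.tsOf n = some none ∧ l.ownNode ≠ some n)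
    (hquery : l'.IsQuery ↔ l.IsQuery) :
    D.ConfigInv Q J' ⟨m', Function.update c.procs p (some (op, l'))⟩ := by
  have hcase : ∀ {q op' l₁}, Function.update c.procs p (some (op, l')) q = some (op', l₁) →
      q = p ∧ op' = op ∧ l₁ = l' ∨ q ≠ p ∧ c.procs q = some (op', l₁) := by
    intro q op' l₁ h
    by_cases hq : q = p
    · subst hq
      rw [Function.update_self] at h
      cases h
      exact .inl ⟨rfl, rfl, rfl⟩
    · rw [Function.update_of_ne hq] at h
      exact .inr ⟨hq, h⟩
  have hother : ∀ {q op' l₁ n}, q ≠ p → c.procs q = some (op', l₁) → l₁.ownNode = some n →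
      l'.ownNode ≠ some n := by
    intro q op' l₁ n hq h1 h2 h3
    rcases hown n h3 with h | h
    · exact hq (hc.own_inj h1 hp h2 h)
    · exact (hc.loc h1).own_exists hc.mem h2 h
  refine ⟨hm', ?_, ?_, ?_, ?_, ?_⟩
  · intro q op' l₁ h
    rcases hcase h with ⟨rfl, rfl, rfl⟩ | ⟨hq, h⟩
    · exact hl'
    · exact (hc.loc h).ext he fun n hn => hnode q op' l₁ n hq h hn
  · intro q op' l₁ n h hn x hx
    rcases hcase h with ⟨rfl, rfl, rfl⟩ | ⟨hq, h⟩
    · exact hpriv n hn x hx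
    · rcases hnew x n hx with h' | h'
      · exact hc.priv h hn x h'
      · exact hq (hc.own_inj h hp (VState.ownNode_of_privNode hn) h')
  · intro q q' op₁ op₂ l₁ l₂ n h h' hn hn'
    rcases hcase h with ⟨rfl, rfl, rfl⟩ | ⟨hq, h⟩ <;>
      rcases hcase h' with ⟨rfl, rfl, rfl⟩ | ⟨hq', h'⟩
    · rfl
    · exact (hother hq' ‹_› hn' hn).elim
    · exact (hother hq ‹_› hn hn').elim
    · exact hc.own_inj h h' hn hn'
  · intro x n hx hu
    rcases hund x n hx hu with h | ⟨h1, h2, h3⟩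
    · refine ⟨p, op, l', ?_, h⟩
      change Function.update c.procs p (some (op, l')) p = _
      rw [Function.update_self]
    · obtain ⟨q, op', l₁, h4, h5⟩ := hc.own_of_undecided h1 h2
      have hq : q ≠ p := by
        rintro rfl
        rw [hp] at h4
        cases h4
        exact h3 h5
      refine ⟨q, op', l₁, ?_, h5⟩
      change Function.update c.procs p (some (op, l')) q = _
      rwa [Function.update_of_ne hq]
  · intro q op' l₁ h
    rcases hcase h with ⟨rfl, rfl, rfl⟩ | ⟨hq, h⟩
    · rw [hquery]
      exact hc.query_iff hp
    · exact hc.query_iff h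

open Classical in
/-- A step that does not change the memory. -/
theorem ConfigInv.update_local (hc : D.ConfigInv Q J c) {p : P} {op : Op} {l l' : VState V St}
    (hp : c.procs p = some (op, l)) (hl' : l'.Inv J c.shared)
    (hpriv : ∀ n, l'.privNode = some n → l.privNode = some n)
    (hown : ∀ n, l'.ownNode = some n → l.ownNode = some n)
    (hund : ∀ n, l.ownNode = some n → l'.ownNode = some n ∨ c.shared.tsOf n ≠ some none ∨
      ∀ x, ¬ J x n)
    (hquery : l'.IsQuery ↔ l.IsQuery) :
    D.ConfigInv Q J ⟨c.shared, Function.update c.procs p (some (op, l'))⟩ := by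
  refine hc.update hp hc.mem (VMem.Ext.refl _ _) hl' (fun _ _ _ _ _ _ _ => rfl)
    (fun x n h => .inl h) (fun n h => hc.priv hp (hpriv n h)) (fun n h => .inl (hown n h)) ?_ hquery
  intro x n hx hu
  by_cases h : l.ownNode = some n
  · rcases hund n h with h' | h' | h'
    · exact .inl h'
    · exact (h' hu).elim
    · exact (h' x hx).elim
  · exact .inr ⟨hx, hu, h⟩

end CASStructure

/-- Once the timestamp is decided, the continuation has all that it needs, and nothing remains to be
initialized, so ownership ends here. -/
theorem VState.InitOK.done {V St : Type*} {J : ℕ → ℕ → Prop} {m : VMem V} {n : ℕ}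
    {next : VState V St} (h : InitOK J m n next) (hd : m.Decided n) :
    next.Inv J m ∧ next.ownNode = none ∧ next.privNode = none := by
  obtain ⟨⟨x, hx⟩, h⟩ := h
  cases next <;> simp only at h <;> refine ⟨?_, rfl, rfl⟩
  · trivial
  · exact h ▸ ⟨⟨x, hx⟩, hd⟩
  · exact ⟨h.1 ▸ h.2, h.1 ▸ hd⟩
  · trivial
  · exact ⟨h.2, h.1 ▸ ⟨⟨x, hx⟩, hd⟩⟩

namespace CASStructure

variable {P Op Ret V St : Type*} {D : CASStructure P Op Ret V St} {Q : Set Op}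
  {J : ℕ → ℕ → Prop} {c c' : Config P Op (VMem V) (VState V St)}

/-- A step that moves no head does not enlarge the history of heads; this puts most cases below into
the form with a fixed `J`. -/
theorem ConfigInv.J_eq (hc : D.ConfigInv Q J c) {m' : VMem V} (h : m'.vhead = c.shared.vhead) :
    (fun x n => J x n ∨ m'.vhead x = some n) = J := by
  funext x n
  rw [h]
  exact propext ⟨fun h' => h'.elim id fun h' => hc.mem.J_of_head h', .inl⟩

open Classical in
theorem ConfigInv.vstep (hc : D.ConfigInv Q J c) {p : P} {op : Op} {l l' : VState V St}
    (hp : c.procs p = some (op, l)) {m' : VMem V} (hs : VStep D l c.shared l' m') :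
    D.ConfigInv Q (fun x n => J x n ∨ m'.vhead x = some n)
      ⟨m', Function.update c.procs p (some (op, l'))⟩ ∧
    VMem.Ext J c.shared (fun x n => J x n ∨ m'.vhead x = some n) m' := by
  have hl := hc.loc hp
  have hm := hc.mem
  have hsame : ∀ l₁ : VState V St, l₁.Inv J c.shared →
      (∀ n, l₁.privNode = some n → l.privNode = some n) →
      (∀ n, l₁.ownNode = some n → l.ownNode = some n) →
      (∀ n, l.ownNode = some n → l₁.ownNode = some n ∨ c.shared.tsOf n ≠ some none ∨
        ∀ x, ¬ J x n) → (l₁.IsQuery ↔ l.IsQuery) →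
      D.ConfigInv Q (fun x n => J x n ∨ c.shared.vhead x = some n)
        ⟨c.shared, Function.update c.procs p (some (op, l₁))⟩ ∧
      VMem.Ext J c.shared (fun x n => J x n ∨ c.shared.vhead x = some n) c.shared := by
    intro l₁ h1 h2 h3 h4 h5
    rw [hc.J_eq rfl]
    exact ⟨hc.update_local hp h1 h2 h3 h4 h5, VMem.Ext.refl _ _⟩
  have hdone : ∀ {n next}, l.ownNode = some n ∨ l.ownNode = none →
      VState.InitOK J c.shared n next → c.shared.Decided n →
      (next.IsQuery ↔ l.IsQuery) →
      D.ConfigInv Q (fun x n => J x n ∨ c.shared.vhead x = some n)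
        ⟨c.shared, Function.update c.procs p (some (op, next))⟩ ∧
      VMem.Ext J c.shared (fun x n => J x n ∨ c.shared.vhead x = some n) c.shared := by
    intro n next h0 h1 h2 h3
    obtain ⟨h4, h5, h6⟩ := h1.done h2
    refine hsame _ h4 (by simp [h6]) (by simp [h5]) ?_ h3
    intro n' h7
    rcases h0 with h0 | h0 <;> rw [h0] at h7 <;> cases h7
    obtain ⟨t, ht⟩ := h2
    exact .inr (.inl (by simp [ht]))
  have hinit : ∀ (n : ℕ) (next : VState V St), (VState.initTest n next).ownNode = some n ∨
      (VState.initTest n next).ownNode = none := by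
    intro n next
    by_cases h : next.AfterInstall <;> simp [VState.ownNode, h]
  have hinit' : ∀ (n t : ℕ) (next : VState V St), (VState.initCas n t next).ownNode = some n ∨
      (VState.initCas n t next).ownNode = none := by
    intro n t next
    by_cases h : next.AfterInstall <;> simp [VState.ownNode, h]
  have hnode : ∀ {n : ℕ} {o : Option (VNode V)}, l.ownNode = some n ∨ c.shared.node n = none →
      ∀ q op' (l₁ : VState V St) n', q ≠ p → c.procs q = some (op', l₁) →
        l₁.privNode = some n' →
        (Function.update c.shared.node n o) n' = c.shared.node n' := by
    intro n o hn q op' l₁ n' hq h1 h2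
    have h3 := VState.ownNode_of_privNode h2
    refine Function.update_of_ne ?_ _ _
    rintro rfl
    rcases hn with hn | hn
    · exact hq (hc.own_inj h1 hp h3 hn)
    · exact (hc.loc h1).own_exists hm h3 hn
  have hfresh : ∀ {n}, c.shared.node n = none → ∀ x, ¬ J x n :=
    fun hn x hx => hm.exists_of_J hx hn
  cases hs with
  | updRead s x k n m hcode hx =>
    exact hsame _ ⟨⟨x, hm.J_of_head hx⟩, rfl⟩ (by simp [VState.privNode])
      (by simp [VState.ownNode, VState.AfterInstall]) (by simp [VState.ownNode])
      (by simp [VState.IsQuery])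
  | updCas s x old new k n m hcode hx =>
    exact hsame _ ⟨⟨x, hm.J_of_head hx⟩, rfl, hm.J_of_head hx⟩ (by simp [VState.privNode])
      (by simp [VState.ownNode, VState.AfterInstall]) (by simp [VState.ownNode])
      (by simp [VState.IsQuery])
  | updNew s v k n m hcode hn =>
    obtain ⟨h1, h2⟩ := hm.setNode (hfresh hn) (o := some ⟨v, none, none⟩)
      (by rintro nd h; cases h; rfl)
    rw [hc.J_eq rfl]
    refine ⟨hc.update hp h1 h2 ?_ ?_ (fun x n h => .inl h) ?_ ?_ ?_ (by simp [VState.IsQuery]), h2⟩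
    · simp [VState.Inv, VMem.nextOf, VMem.tsOf]
    · exact hnode (.inr hn)
    · rintro n' h
      cases h
      exact hfresh hn
    · rintro n' h
      cases h
      exact .inr hn
    · intro x n' hx hu
      refine .inr ⟨hx, ?_, by simp [VState.ownNode]⟩
      have hne : n' ≠ n := by rintro rfl; exact hfresh hn x hx
      simpa [VMem.tsOf, Function.update_of_ne hne] using hu
  | updLoc s s' m hcode =>
    exact hsame _ trivial (by simp [VState.privNode]) (by simp [VState.ownNode])
      (by simp [VState.ownNode]) (by simp [VState.IsQuery])
  | initTestNone n next m nd hn ht =>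
    exact hsame _ hl (by simp [VState.privNode]) (by simp [VState.ownNode])
      (by simp only [VState.ownNode]; tauto) (by simp [VState.IsQuery])
  | initTestSome n next m nd t hn ht =>
    exact hdone (hinit _ _) hl ⟨t, by simp [VMem.tsOf, hn, ht]⟩ (by simp [VState.IsQuery])
  | initRead n next m =>
    exact hsame _ ⟨hl, le_rfl⟩ (by simp [VState.privNode]) (by simp [VState.ownNode])
      (by simp only [VState.ownNode]; tauto) (by simp [VState.IsQuery])
  | initCasSucc n t next m nd hn ht =>
    obtain ⟨⟨⟨x, hx⟩, hok⟩, hle⟩ := id hl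
    obtain ⟨h1, h2, h3⟩ := hm.setTs hx hn ht hle
    have hd : VMem.Decided { c.shared with
        node := Function.update c.shared.node n (some { nd with ts := some t }) } n :=
      ⟨t, by simp [VMem.tsOf]⟩
    obtain ⟨h4, h5, h6⟩ := (hl.1.ext h2).done hd
    rw [hc.J_eq rfl]
    refine ⟨hc.update hp h1 h2 h4 ?_ (fun x n h => .inl h) (by simp [h6]) (by simp [h5]) ?_
      (by simp [VState.IsQuery]), h2⟩
    · intro q op' l₁ n' hq h7 h8
      refine h3 n' ?_
      rintro rfl
      exact hc.priv h7 h8 x hx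
    · intro y n' hy hu
      have hne : n' ≠ n := by
        rintro rfl
        simp [VMem.tsOf] at hu
      refine .inr ⟨hy, by simpa [VMem.tsOf, Function.update_of_ne hne] using hu, ?_⟩
      intro h
      rcases hinit' n t l' with h' | h' <;> rw [h'] at h <;> cases h
      exact hne rfl
  | initCasFail n t next m nd t' hn ht =>
    exact hdone (hinit' _ _ _) hl.1 ⟨t', by simp [VMem.tsOf, hn, ht]⟩ (by simp [VState.IsQuery])
  | readRet n k m nd hn =>
    exact hsame _ trivial (by simp [VState.privNode]) (by simp [VState.ownNode])
      (by simp [VState.ownNode]) (by simp [VState.IsQuery])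
  | casTestNe x old new k n m nd hn hv =>
    exact hsame _ trivial (by simp [VState.privNode]) (by simp [VState.ownNode])
      (by simp [VState.ownNode]) (by simp [VState.IsQuery])
  | casTestEq x old new k n m nd hn hv ho =>
    exact hsame _ trivial (by simp [VState.privNode]) (by simp [VState.ownNode])
      (by simp [VState.ownNode]) (by simp [VState.IsQuery])
  | casTestNew x old new k n m nd hn hv ho =>
    refine hsame _ ⟨hl.1, hl.2, ?_⟩ (by simp [VState.privNode]) (by simp [VState.ownNode])
      (by simp [VState.ownNode]) (by simp [VState.IsQuery])
    -- The test `new ≠ old` is the origin of the inequality of adjacent values.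
    simpa [VMem.valOf, hn, hv] using Ne.symm ho
  | casNew x new k n m n' hn =>
    obtain ⟨h1, h2⟩ := hm.setNode (hfresh hn) (o := some ⟨new, some n, none⟩)
      (by rintro nd h; cases h; rfl)
    rw [hc.J_eq rfl]
    refine ⟨hc.update hp h1 h2 ?_ ?_ (fun x n h => .inl h) ?_ ?_ ?_ (by simp [VState.IsQuery]), h2⟩
    · refine ⟨hl.1, h2.decided hl.1 hl.2.1, by simp [VMem.nextOf], by simp [VMem.tsOf], ?_⟩
      rw [h2.val_eq hl.1]
      simpa [VMem.valOf] using hl.2.2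
    · exact hnode (.inr hn)
    · rintro n' h
      cases h
      exact hfresh hn
    · rintro n' h
      cases h
      exact .inr hn
    · intro x n'' hx hu
      refine .inr ⟨hx, ?_, by simp [VState.ownNode]⟩
      have hne : n'' ≠ n' := by rintro rfl; exact hfresh hn x hx
      simpa [VMem.tsOf, Function.update_of_ne hne] using hu
  | casAppendSucc x k n n' m hx =>
    obtain ⟨hj, hd, hnx, hu, hv⟩ := hl
    -- Comparing names is sound: a node that has been a head is never deleted, so its name still
    -- denotes the version that was read, despite the reuse of names.
    obtain ⟨h1, h2⟩ := hm.setHead (x := x) (hc.priv hp (n := n') rfl) hu (by rw [hnx, hx])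
      (by intro n'' h; rw [hx] at h; cases h; exact ⟨hd, hv⟩)
    have hJ : (fun y z => J y z ∨ VMem.vhead { c.shared with
        vhead := Function.update c.shared.vhead x (some n') } y = some z) =
        fun y z => J y z ∨ y = x ∧ z = n' := by
      funext y z
      by_cases hy : y = x
      · subst hy
        simp [eq_comm]
      · simp only [Function.update_of_ne hy, hy, false_and, or_false]
        exact propext ⟨fun h' => h'.elim id fun h' => hm.J_of_head h', .inl⟩
    rw [hJ]
    refine ⟨hc.update hp h1 h2 ?_ (fun _ _ _ _ _ _ _ => rfl) ?_ (by simp [VState.privNode]) ?_ ?_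
      (by simp [VState.IsQuery]), h2⟩
    · exact ⟨⟨x, .inr ⟨rfl, rfl⟩⟩, .inr ⟨rfl, rfl⟩, fun _ => ⟨n, hnx⟩⟩
    · rintro y z (h | ⟨-, rfl⟩)
      · exact .inl h
      · exact .inr rfl
    · intro z h
      exact .inl (by simpa [VState.ownNode, VState.AfterInstall] using h)
    · intro y z h hu'
      by_cases hz : z = n'
      · exact .inl (by simp [VState.ownNode, VState.AfterInstall, hz])
      · exact .inr ⟨h.resolve_right fun h => hz h.2, hu', by simpa [VState.ownNode] using Ne.symm hz⟩
  | casAppendFail x k n n' m n'' hx hne =>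
    refine hsame _ ⟨⟨n, hl.1⟩, ?_⟩ (by simp [VState.privNode]) (by simp [VState.ownNode])
      (by simp only [VState.ownNode]; tauto) (by simp [VState.IsQuery])
    intro h
    have h1 := hl.2.2.1
    simp [VMem.nextOf, h] at h1
  | casDelete x k n m =>
    have hn := hc.priv hp (n := n) rfl
    obtain ⟨h1, h2⟩ := hm.setNode hn (o := none) (by simp)
    rw [hc.J_eq rfl]
    refine ⟨hc.update hp h1 h2 hl.1 ?_ (fun x n h => .inl h) (by simp [VState.privNode])
      (by simp [VState.ownNode]) ?_ (by simp [VState.IsQuery]), h2⟩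
    · exact hnode (.inl rfl)
    · intro x n' hx hu
      have hne : n' ≠ n := by rintro rfl; exact hn x hx
      refine .inr ⟨hx, ?_, by simpa [VState.ownNode] using hne.symm⟩
      simpa [VMem.tsOf, Function.update_of_ne hne] using hu
  | casHelp x k n m hx =>
    exact hsame _ ⟨⟨x, hm.J_of_head hx⟩, hm.J_of_head hx, by simp⟩ (by simp [VState.privNode])
      (by simp [VState.ownNode, VState.AfterInstall]) (by simp [VState.ownNode])
      (by simp [VState.IsQuery])
  | casRet x k b m =>
    exact hsame _ trivial (by simp [VState.privNode]) (by simp [VState.ownNode])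
      (by simp [VState.ownNode]) (by simp [VState.IsQuery])
  | newHead n k x m hx =>
    obtain ⟨hnx, hu⟩ := hl
    obtain ⟨h1, h2⟩ := hm.setHead (x := x) (hc.priv hp (n := n) rfl) hu (by rw [hnx, hx])
      (by intro n'' h; rw [hx] at h; cases h)
    have hJ : (fun y z => J y z ∨ VMem.vhead { c.shared with
        vhead := Function.update c.shared.vhead x (some n) } y = some z) =
        fun y z => J y z ∨ y = x ∧ z = n := by
      funext y z
      by_cases hy : y = x
      · subst hy
        simp [eq_comm]
      · simp only [Function.update_of_ne hy, hy, false_and, or_false]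
        exact propext ⟨fun h' => h'.elim id fun h' => hm.J_of_head h', .inl⟩
    rw [hJ]
    refine ⟨hc.update hp h1 h2 ?_ (fun _ _ _ _ _ _ _ => rfl) ?_ (by simp [VState.privNode]) ?_ ?_
      (by simp [VState.IsQuery]), h2⟩
    · exact ⟨⟨x, .inr ⟨rfl, rfl⟩⟩, hnx⟩
    · rintro y z (h | ⟨-, rfl⟩)
      · exact .inl h
      · exact .inr rfl
    · intro z h
      exact .inl (by simpa [VState.ownNode, VState.AfterInstall] using h)
    · intro y z h hu'
      by_cases hz : z = n
      · exact .inl (by simp [VState.ownNode, VState.AfterInstall, hz])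
      · exact .inr ⟨h.resolve_right fun h => hz h.2, hu', by simpa [VState.ownNode] using Ne.symm hz⟩
  | snapRead s m =>
    exact hsame _ le_rfl (by simp [VState.privNode]) (by simp [VState.ownNode])
      (by simp [VState.ownNode]) (by simp [VState.IsQuery])
  | snapIncSucc s h m ht =>
    have hle : c.shared.timestamp ≤ h + 1 := by omega
    have h2 : VMem.Ext J c.shared J { c.shared with timestamp := h + 1 } :=
      ⟨id, hle, fun _ => rfl, fun _ => rfl, fun _ h => h⟩
    rw [hc.J_eq rfl]
    exact ⟨hc.update hp (hm.setTime hle) h2 (Nat.lt_succ_self h) (fun _ _ _ _ _ _ _ => rfl)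
      (fun x n h => .inl h) (by simp [VState.privNode]) (by simp [VState.ownNode])
      (fun x n hx hu => .inr ⟨hx, hu, by simp [VState.ownNode]⟩) (by simp [VState.IsQuery]), h2⟩
  | snapIncFail s h m ht =>
    -- The CAS fails only because the camera has moved, and then it is already beyond `h`.
    exact hsame _ (lt_of_le_of_ne hl (Ne.symm ht)) (by simp [VState.privNode])
      (by simp [VState.ownNode]) (by simp [VState.ownNode]) (by simp [VState.IsQuery])
  | queryRead h s x k n m hcode hx =>
    exact hsame _ ⟨⟨x, hm.J_of_head hx⟩, rfl, hl⟩ (by simp [VState.privNode])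
      (by simp [VState.ownNode, VState.AfterInstall]) (by simp [VState.ownNode])
      (by simp [VState.IsQuery])
  | queryLoc h s s' m hcode =>
    exact hsame _ hl (by simp [VState.privNode]) (by simp [VState.ownNode])
      (by simp [VState.ownNode]) (by simp [VState.IsQuery])
  | ssTestGt h k n m nd t hn ht hlt =>
    exact hsame _ ⟨hl.1, hl.2.1, t, hlt, by simp [VMem.tsOf, hn, ht]⟩ (by simp [VState.privNode])
      (by simp [VState.ownNode]) (by simp [VState.ownNode]) (by simp [VState.IsQuery])
  | ssTestLe h k n m nd hn ht =>
    obtain ⟨h1, h2, t, h3⟩ := hl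
    refine hsame _ ⟨h1, h2, t, ht t ?_, h3⟩ (by simp [VState.privNode])
      (by simp [VState.ownNode]) (by simp [VState.ownNode]) (by simp [VState.IsQuery])
    simpa [VMem.tsOf, hn] using h3
  | ssNextSome h k n m nd n' hn hn' =>
    obtain ⟨h1, ⟨x, hx⟩, -⟩ := hl
    -- All versions below a head are decided, so the traversal needs no further `initTS`.
    obtain ⟨h2, h3, -⟩ := hm.next hx (n' := n') (by simp [VMem.nextOf, hn, hn'])
    exact hsame _ ⟨h1, ⟨x, h2⟩, h3⟩ (by simp [VState.privNode])
      (by simp [VState.ownNode]) (by simp [VState.ownNode]) (by simp [VState.IsQuery])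
  | ssNextNone h k n m nd hn hn' =>
    exact hsame _ trivial (by simp [VState.privNode])
      (by simp [VState.ownNode]) (by simp [VState.ownNode]) (by simp [VState.IsQuery])
  | ssRet h k n m nd hn =>
    exact hsame _ hl.1 (by simp [VState.privNode])
      (by simp [VState.ownNode]) (by simp [VState.ownNode]) (by simp [VState.IsQuery])

end CASStructure

/-! ### The history of heads, and the invariants along a run. -/

/-- `n` has been the head of `x` in one of the configurations `0, …, i`. -/
def HeadBy {P Op V L : Type*} (cfg : ℕ → Config P Op (VMem V) L) (i x n : ℕ) : Prop :=
  ∃ j ≤ i, (cfg j).shared.vhead x = some n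

theorem headBy_succ {P Op V L : Type*} (cfg : ℕ → Config P Op (VMem V) L) (i : ℕ) :
    HeadBy cfg (i + 1) = fun x n => HeadBy cfg i x n ∨ (cfg (i + 1)).shared.vhead x = some n := by
  funext x n
  refine propext ⟨?_, ?_⟩
  · rintro ⟨j, hj, h⟩
    rcases Nat.le_succ_iff.1 hj with hj | rfl
    · exact .inl ⟨j, hj, h⟩
    · exact .inr h
  · rintro (⟨j, hj, h⟩ | h)
    · exact ⟨j, hj.trans (Nat.le_succ i), h⟩
    · exact ⟨i + 1, le_rfl, h⟩

theorem HeadBy.mono {P Op V L : Type*} {cfg : ℕ → Config P Op (VMem V) L} {i j x n : ℕ}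
    (h : HeadBy cfg i x n) (hij : i ≤ j) : HeadBy cfg j x n := by
  obtain ⟨k, hk, h⟩ := h
  exact ⟨k, hk.trans hij, h⟩

namespace Impl

variable {P Op Ret S L : Type*} {M : Impl P Op Ret S L} {c c' : Config P Op S L}
  {ℓ : Label P Op Ret}

theorem Step.procs_of_ne (h : M.Step c ℓ c') {p : P} (hp : ℓ.proc ≠ p) :
    c'.procs p = c.procs p := by
  classical
  cases h <;> simp only <;> exact Function.update_of_ne (Ne.symm hp) _ _

theorem Step.inv_iff {p : P} {op : Op} (h : M.Step c (.inv p op) c') :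
    c.procs p = none ∧ c'.procs p = some (op, M.start p op) ∧ c'.shared = c.shared := by
  cases h with
  | inv _ _ h => exact ⟨h, by simp, rfl⟩

theorem Step.step_iff {p : P} (h : M.Step c (.step p) c') :
    ∃ op l l', c.procs p = some (op, l) ∧ M.step l c.shared l' c'.shared ∧
      c'.procs p = some (op, l') := by
  cases h with
  | step _ op l l' s' h hs => exact ⟨op, l, l', h, hs, by simp⟩

theorem Step.res_iff {p : P} {r : Ret} (h : M.Step c (.res p r) c') :
    ∃ op l, c.procs p = some (op, l) ∧ M.result l = some r ∧ c'.procs p = none ∧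
      c'.shared = c.shared := by
  cases h with
  | res _ op l _ h hr => exact ⟨op, l, h, hr, by simp, rfl⟩

/-- A pending operation stays pending until it returns. -/
theorem IsRun.pending {n : ℕ∞} {cfg : ℕ → Config P Op S L} {lab : ℕ → Label P Op Ret}
    (hrun : M.IsRun n cfg lab) {p : P} {op : Op} {i j : ℕ} (hij : i ≤ j) (hj : (j : ℕ∞) ≤ n)
    {l : L} (hi : (cfg i).procs p = some (op, l))
    (hres : ∀ k r, i ≤ k → k < j → lab k ≠ .res p r) :
    ∃ l', (cfg j).procs p = some (op, l') := by
  induction j, hij using Nat.le_induction with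
  | base => exact ⟨l, hi⟩
  | succ j hij ih =>
    have hjn : (j : ℕ∞) < n := lt_of_lt_of_le (by exact_mod_cast Nat.lt_succ_self j) hj
    obtain ⟨l', hl'⟩ := ih hjn.le fun k r h1 h2 => hres k r h1 (h2.trans (Nat.lt_succ_self j))
    have hstep := hrun.2 j hjn
    by_cases hp : (lab j).proc = p
    · cases hlab : lab j with
      | inv q op' =>
        rw [hlab] at hstep hp
        obtain rfl : q = p := hp
        have := hstep.inv_iff.1
        simp [hl'] at this
      | step q =>
        rw [hlab] at hstep hp
        obtain rfl : q = p := hp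
        obtain ⟨op₁, l₁, l₂, h1, -, h2⟩ := hstep.step_iff
        rw [hl'] at h1
        cases h1
        exact ⟨l₂, h2⟩
      | res q r =>
        rw [hlab] at hp
        obtain rfl : q = p := hp
        exact (hres j r hij (Nat.lt_succ_self j) hlab).elim
    · exact ⟨l', by rw [hstep.procs_of_ne hp, hl']⟩

/-- The operation of a pending instance has been invoked before. -/
theorem IsRun.exists_inv {n : ℕ∞} {cfg : ℕ → Config P Op S L} {lab : ℕ → Label P Op Ret}
    (hrun : M.IsRun n cfg lab) {p : P} {op : Op} {j : ℕ} (hj : (j : ℕ∞) ≤ n)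
    {l : L} (hp : (cfg j).procs p = some (op, l)) :
    ∃ i < j, lab i = .inv p op ∧ ∀ k, i < k → k < j → (∀ r, lab k ≠ .res p r) ∧
      ∀ op', lab k ≠ .inv p op' := by
  induction j generalizing l with
  | zero => simp [hrun.1] at hp
  | succ j ih =>
    have hjn : (j : ℕ∞) < n := lt_of_lt_of_le (by exact_mod_cast Nat.lt_succ_self j) hj
    have hstep := hrun.2 j hjn
    have hext : ∀ l', (cfg j).procs p = some (op, l') → (∀ r, lab j ≠ .res p r) →
        (∀ op', lab j ≠ .inv p op') → ∃ i < j + 1, lab i = .inv p op ∧ ∀ k, i < k → k < j + 1 →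
          (∀ r, lab k ≠ .res p r) ∧ ∀ op', lab k ≠ .inv p op' := by
      intro l' hl' h1 h2
      obtain ⟨i, hi, h3, h4⟩ := ih hjn.le hl'
      refine ⟨i, hi.trans (Nat.lt_succ_self j), h3, fun k hk hk' => ?_⟩
      rcases Nat.lt_succ_iff_lt_or_eq.1 hk' with hk' | rfl
      · exact h4 k hk hk'
      · exact ⟨h1, h2⟩
    by_cases hq : (lab j).proc = p
    · cases hlab : lab j with
      | inv q op' =>
        rw [hlab] at hstep hq
        obtain rfl : q = p := hq
        have := hstep.inv_iff.2.1
        rw [hp] at this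
        cases this
        exact ⟨j, Nat.lt_succ_self j, hlab, fun k h1 h2 => by omega⟩
      | step q =>
        rw [hlab] at hstep hq
        obtain rfl : q = p := hq
        obtain ⟨op₁, l₁, l₂, h1, -, h2⟩ := hstep.step_iff
        rw [hp] at h2
        cases h2
        exact hext l₁ h1 (by simp [hlab]) (by simp [hlab])
      | res q r =>
        rw [hlab] at hstep hq
        obtain rfl : q = p := hq
        obtain ⟨-, -, -, -, h1, -⟩ := hstep.res_iff
        simp [hp] at h1
    · exact hext l (by rw [← hstep.procs_of_ne hq, hp]) (by rintro r h; simp [h, Label.proc] at hq)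
        (by rintro r h; simp [h, Label.proc] at hq)

end Impl

namespace CASStructure

variable {P Op Ret V St : Type*} {D : CASStructure P Op Ret V St} {Q : Set Op}
  {J : ℕ → ℕ → Prop} {c c' : Config P Op (VMem V) (VState V St)} {ℓ : Label P Op Ret}

open Classical in
theorem ConfigInv.step (hc : D.ConfigInv Q J c) (hs : (D.versioned Q).Step c ℓ c') :
    D.ConfigInv Q (fun x n => J x n ∨ c'.shared.vhead x = some n) c' ∧
    VMem.Ext J c.shared (fun x n => J x n ∨ c'.shared.vhead x = some n) c'.shared := by
  cases hs with
  | inv p op h =>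
    rw [hc.J_eq rfl]
    refine ⟨?_, VMem.Ext.refl _ _⟩
    have hstart : (D.versioned Q).start p op =
      if op ∈ Q then .snapRead (D.start p op) else .upd (D.start p op) := rfl
    have hown : ((D.versioned Q).start p op).ownNode = none := by
      rw [hstart]
      split_ifs <;> rfl
    have hcase : ∀ {q op' l₁}, Function.update c.procs p
        (some (op, (D.versioned Q).start p op)) q = some (op', l₁) →
        op' = op ∧ l₁ = (D.versioned Q).start p op ∨ c.procs q = some (op', l₁) := by
      intro q op' l₁ h
      by_cases hq : q = p
      · subst hq
        rw [Function.update_self] at h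
        cases h
        exact .inl ⟨rfl, rfl⟩
      · rw [Function.update_of_ne hq] at h
        exact .inr h
    refine ⟨hc.mem, ?_, ?_, ?_, ?_, ?_⟩
    · intro q op' l₁ h
      rcases hcase h with ⟨-, rfl⟩ | h
      · rw [hstart]
        split_ifs <;> trivial
      · exact hc.loc h
    · intro q op' l₁ n h hn
      rcases hcase h with ⟨-, rfl⟩ | h
      · rw [VState.ownNode_of_privNode hn] at hown
        cases hown
      · exact hc.priv h hn
    · intro q q' op₁ op₂ l₁ l₂ n h h' hn hn'
      rcases hcase h with ⟨-, rfl⟩ | h <;> rcases hcase h' with ⟨-, rfl⟩ | h'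
      · simp [hown] at hn
      · simp [hown] at hn
      · simp [hown] at hn'
      · exact hc.own_inj h h' hn hn'
    · intro x n hx hu
      obtain ⟨q, op', l₁, h1, h2⟩ := hc.own_of_undecided hx hu
      refine ⟨q, op', l₁, ?_, h2⟩
      have hq : q ≠ p := by
        rintro rfl
        simp [h] at h1
      change Function.update c.procs p _ q = _
      rwa [Function.update_of_ne hq]
    · intro q op' l₁ h
      rcases hcase h with ⟨rfl, rfl⟩ | h
      · rw [hstart]
        split_ifs with h <;> simp [h, VState.IsQuery]
      · exact hc.query_iff h
  | step p op l l' s' h hs => exact hc.vstep h (vstep_of_step hs)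
  | res p op l r h hr =>
    rw [hc.J_eq rfl]
    refine ⟨?_, VMem.Ext.refl _ _⟩
    have hown : l.ownNode = none := by
      rcases versioned_result.1 hr with ⟨s, rfl, -⟩ | ⟨h, s, rfl, -⟩ <;> rfl
    have hcase : ∀ {q op' l₁}, Function.update c.procs p none q = some (op', l₁) →
        c.procs q = some (op', l₁) := by
      intro q op' l₁ h
      by_cases hq : q = p
      · subst hq
        rw [Function.update_self] at h
        cases h
      · rwa [Function.update_of_ne hq] at h
    refine ⟨hc.mem, fun h => hc.loc (hcase h), fun h => hc.priv (hcase h),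
      fun h h' => hc.own_inj (hcase h) (hcase h'), ?_, fun h => hc.query_iff (hcase h)⟩
    intro x n hx hu
    obtain ⟨q, op', l₁, h1, h2⟩ := hc.own_of_undecided hx hu
    refine ⟨q, op', l₁, ?_, h2⟩
    have hq : q ≠ p := by
      rintro rfl
      rw [h] at h1
      cases h1
      simp [hown] at h2
    change Function.update c.procs p _ q = _
    rwa [Function.update_of_ne hq]

variable {N : ℕ∞} {cfg : ℕ → Config P Op (VMem V) (VState V St)} {lab : ℕ → Label P Op Ret}

theorem configInv_init (hrun : (D.versioned Q).IsRun N cfg lab) :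
    D.ConfigInv Q (HeadBy cfg 0) (cfg 0) := by
  have hJ : ∀ x n, HeadBy cfg 0 x n ↔ D.init x ≠ none ∧ n = x := by
    intro x n
    simp only [HeadBy, Nat.le_zero, exists_eq_left, hrun.1, versioned]
    cases D.init x <;> simp [eq_comm]
  have hp : ∀ {p op l}, (cfg 0).procs p = some (op, l) → False := by
    intro p op l h
    simp [hrun.1] at h
  have hh : (cfg 0).shared.vhead = fun x => (D.init x).map fun _ => x := by rw [hrun.1]; rfl
  have hn : (cfg 0).shared.node = fun x => (D.init x).map fun v => ⟨v, none, some 0⟩ := by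
    rw [hrun.1]; rfl
  have hnx : ∀ n n', (cfg 0).shared.nextOf n ≠ some (some n') := by
    intro n n'
    simp only [VMem.nextOf, hn]
    cases D.init n <;> simp
  have hts : ∀ n o, (cfg 0).shared.tsOf n = some o → D.init n ≠ none ∧ o = some 0 := by
    intro n o
    simp only [VMem.tsOf, hn]
    cases D.init n <;> simp [eq_comm]
  refine ⟨⟨?_, ?_, ?_, ?_, ?_, ?_, ?_, ?_, ?_, ?_, ?_, ?_⟩, fun h => (hp h).elim,
    fun h => (hp h).elim, fun h => (hp h).elim, ?_, fun h => (hp h).elim⟩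
  · intro x n h
    obtain ⟨h, rfl⟩ := (hJ x n).1 h
    simpa [hn] using h
  · exact fun h => ⟨0, le_rfl, h⟩
  · rintro x n ⟨j, hj, h⟩
    exact ⟨n, by rwa [Nat.le_zero.1 hj] at h⟩
  · intro n t h
    obtain ⟨h1, h2⟩ := hts _ _ h
    cases h2
    exact ⟨⟨n, (hJ n n).2 ⟨h1, rfl⟩⟩, Nat.zero_le _⟩
  · intro x n _ h
    cases (hts _ _ h).2
  · intro x y n h h'
    rw [← ((hJ _ _).1 h).2, ← ((hJ _ _).1 h').2]
  · intro x n n' _ h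
    exact (hnx _ _ h).elim
  · intro x n n' h h' _
    rw [((hJ _ _).1 h).2, ((hJ _ _).1 h').2]
  · intro x n h h'
    obtain ⟨h, rfl⟩ := (hJ x n).1 h
    refine (h' ?_).elim
    rw [hh]
    cases h1 : D.init n <;> simp_all
  · intro x n n' _ _
    exact hnx _ _
  · refine D.fresh.mono fun x hx => ?_
    have hx : D.init x = none := hx
    simp [hn, hx]
  · refine D.fresh.mono fun x hx => ?_
    have hx : D.init x = none := hx
    simp [hh, hx]
  · intro x n _ h
    cases (hts _ _ h).2

theorem configInv_run (hrun : (D.versioned Q).IsRun N cfg lab) {i : ℕ} (hi : (i : ℕ∞) ≤ N) :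
    D.ConfigInv Q (HeadBy cfg i) (cfg i) := by
  induction i with
  | zero => exact configInv_init hrun
  | succ i ih =>
    have hiN : (i : ℕ∞) < N := lt_of_lt_of_le (by exact_mod_cast Nat.lt_succ_self i) hi
    rw [headBy_succ]
    exact ((ih hiN.le).step (hrun.2 i hiN)).1

/-- This is what allows facts about a version at an early moment to be read off the memory at the
end of the run, where snapshots are evaluated. -/
theorem ext_run (hrun : (D.versioned Q).IsRun N cfg lab) {i j : ℕ} (hij : i ≤ j)
    (hj : (j : ℕ∞) ≤ N) :
    VMem.Ext (HeadBy cfg i) (cfg i).shared (HeadBy cfg j) (cfg j).shared := by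
  induction j, hij using Nat.le_induction with
  | base => exact VMem.Ext.refl _ _
  | succ j hij ih =>
    have hjN : (j : ℕ∞) < N := lt_of_lt_of_le (by exact_mod_cast Nat.lt_succ_self j) hj
    refine (ih hjN.le).trans ?_
    rw [headBy_succ]
    exact ((configInv_run hrun hjN.le).step (hrun.2 j hjN)).2

end CASStructure

/-! ## The correspondence between local states -/

/-- A pending instruction has been executed, with the new state `r`, if and only if `T` holds;
`s` is the old state. -/
def Outcome {St : Type*} (T : Prop) (s r hl : St) (d : Bool) : Prop :=
  T ∧ d = true ∧ hl = r ∨ ¬ T ∧ d = false ∧ hl = s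

/-- When the awaited condition can only become true, either the record remains valid as it is, or
this is the moment at which the pending instruction has to be executed. -/
theorem Outcome.of_imp {St : Type*} {T T' : Prop} {s r hl : St} {d : Bool}
    (h : Outcome T s r hl d) (hT : T → T') :
    Outcome T' s r hl d ∨ ¬ T ∧ T' ∧ d = false ∧ hl = s ∧ Outcome T' s r r true := by
  rcases h with ⟨h, h'⟩ | ⟨h, h'⟩
  · exact .inl (.inl ⟨hT h, h'⟩)
  · by_cases hT' : T'
    · exact .inr ⟨h, hT', h'.1, h'.2, .inl ⟨hT', rfl, rfl⟩⟩
    · exact .inl (.inr ⟨hT', h'⟩)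

theorem Outcome.of_true {St : Type*} {T : Prop} {s r hl : St} {d : Bool}
    (h : Outcome T s r hl d) (hT : T) : d = true ∧ hl = r := by
  rcases h with ⟨-, h⟩ | ⟨h, -⟩
  · exact h
  · exact (h hT).elim

theorem Outcome.of_false {St : Type*} {T : Prop} {s r hl : St} {d : Bool}
    (h : Outcome T s r hl d) (hT : ¬ T) : d = false ∧ hl = s := by
  rcases h with ⟨h, -⟩ | ⟨-, h⟩
  · exact (hT h).elim
  · exact h

/-- A newer version than `n` of the same object has been linearized. -/
def VMem.Superseded {V : Type*} (m : VMem V) (Lin : ℕ → Prop) (n : ℕ) : Prop :=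
  ∃ n', Lin n' ∧ m.nextOf n' = some (some n)

section

variable {P Op Ret V St : Type*} (D : CASStructure P Op Ret V St) (J : ℕ → ℕ → Prop) (m : VMem V)
  (Lin : ℕ → Prop)

/-- The original local state `hl` that corresponds to a call of `initTS(n)` followed by the
given local state, where `Lin` is the set of the linearized versions; the flag says whether the
current original instruction has been linearized. -/
inductive InitRel : VState V St → ℕ → St → Bool → Prop
  | read (n x k s v hl d) (hc : D.code s = .read x k) (hx : J x n) (hv : m.valOf n = some v)
      (ho : Outcome (Lin n) s (k v) hl d) : InitRel (.readRet n k) n hl d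
  | casNe (n x old new k s v hl d) (hc : D.code s = .cas x old new k) (hx : J x n)
      (hv : m.valOf n = some v) (hne : v ≠ old) (ho : Outcome (Lin n) s (k false) hl d) :
      InitRel (.casTest x old new k n) n hl d
  | casEq (n x old k s hl d) (hc : D.code s = .cas x old old k) (hx : J x n)
      (hv : m.valOf n = some old) (ho : Outcome (Lin n) s (k true) hl d) :
      InitRel (.casTest x old old k n) n hl d
  -- A `vCAS` that has seen the expected value may still succeed or fail. Only failure is provided
  -- for here, to be executed when a newer version is linearized; success is handed over to `own`
  -- when the append succeeds.
  | casLater (n x old new k s hl d) (hc : D.code s = .cas x old new k) (hx : J x n)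
      (hv : m.valOf n = some old) (hne : new ≠ old)
      (ho : Outcome (m.Superseded Lin n) s (k false) hl d) :
      InitRel (.casTest x old new k n) n hl d
  -- The creator waits for its own version `n'`, and its CAS succeeds when that version is
  -- linearized, even if another process decides the timestamp.
  | own (n' n x old new k s hl d) (hc : D.code s = .cas x old new k) (hx : J x n')
      (hv : m.valOf n = some old) (hv' : m.valOf n' = some new) (hn : m.nextOf n' = some (some n))
      (ho : Outcome (Lin n') s (k true) hl d) : InitRel (.casRet x k true) n' hl d
  -- The version `n'` read for the final `initTS` either is directly above `n`, so that deciding it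
  -- supersedes `n`, or `n` has been superseded before. In both cases the failure has been executed
  -- when `initTS` ends.
  | help (n' n x old new k s hl d) (hc : D.code s = .cas x old new k) (hx : J x n)
      (hx' : J x n') (hv : m.valOf n = some old) (hne : new ≠ old)
      (hn : m.nextOf n' = some (some n) ∨ m.Superseded Lin n)
      (ho : Outcome (m.Superseded Lin n) s (k false) hl d) : InitRel (.casRet x k false) n' hl d
  | root (n x v k s hl d) (hc : D.code s = .new v k) (hx : J x n) (hv : m.valOf n = some v)
      (hn : m.nextOf n = some none) (ho : Outcome (Lin n) s (k x) hl d) :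
      InitRel (.upd (k x)) n hl d

/-- The original local state that corresponds to a local state of an operation that is not a
query. -/
inductive LocRel : VState V St → St → Bool → Prop
  | upd (s) : LocRel (.upd s) s false
  | initTest (n next hl d) (h : InitRel D J m Lin next n hl d) : LocRel (.initTest n next) hl d
  | initRead (n next hl d) (h : InitRel D J m Lin next n hl d) : LocRel (.initRead n next) hl d
  | initCas (n t next hl d) (h : InitRel D J m Lin next n hl d) : LocRel (.initCas n t next) hl d
  | readRet (n k hl d) (h : InitRel D J m Lin (.readRet n k) n hl d) : LocRel (.readRet n k) hl d
  | casTest (x old new k n hl d) (h : InitRel D J m Lin (.casTest x old new k n) n hl d) :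
      LocRel (.casTest x old new k n) hl d
  | casNew (x old new k n s hl d) (hc : D.code s = .cas x old new k) (hx : J x n)
      (hv : m.valOf n = some old) (hne : new ≠ old)
      (ho : Outcome (m.Superseded Lin n) s (k false) hl d) : LocRel (.casNew x new k n) hl d
  | casAppend (x old new k n n' s hl d) (hc : D.code s = .cas x old new k) (hx : J x n)
      (hv : m.valOf n = some old) (hne : new ≠ old) (hv' : m.valOf n' = some new)
      (hn : m.nextOf n' = some (some n))
      (ho : Outcome (m.Superseded Lin n) s (k false) hl d) : LocRel (.casAppend x k n n') hl d
  | casDelete (x old new k n n' n'' s hl d) (hc : D.code s = .cas x old new k) (hx : J x n)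
      (hv : m.valOf n = some old) (hne : new ≠ old) (hx' : J x n'')
      (hn : m.nextOf n'' = some (some n))
      (ho : Outcome (m.Superseded Lin n) s (k false) hl d) : LocRel (.casDelete x k n') hl d
  | casHelp (x old new k n n'' s hl d) (hc : D.code s = .cas x old new k) (hx : J x n)
      (hv : m.valOf n = some old) (hne : new ≠ old) (hx' : J x n'')
      (hn : m.nextOf n'' = some (some n))
      (ho : Outcome (m.Superseded Lin n) s (k false) hl d) : LocRel (.casHelp x k) hl d
  | casRet (x k b) : LocRel (.casRet x k b) (k b) true
  | newHead (n k s v) (hc : D.code s = .new v k) (hv : m.valOf n = some v)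
      (hn : m.nextOf n = some none) : LocRel (.newHead n k) s false

end

namespace VState

variable {V St : Type*}

/-- `0` between two original instructions, `1` during one. -/
def mid : VState V St → ℕ
  | .upd _ => 0
  | _ => 1

/-- A bound for the number of steps taken before a call of `initTS` that is followed by the given
state. -/
def initProgress : VState V St → ℕ
  | .readRet _ _ => 1
  | .casTest _ _ _ _ _ => 1
  -- The longest prefix is that of a failing `vCAS`: reading `VHead`, three steps of `initTS`, then
  -- test, creation, failed append, deletion, and reading `VHead` again. A successful `vCAS` has 7
  -- steps here and a constructor 2.
  | _ => 9

/-- A bound for the number of steps taken for the current original instruction. -/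
def progress : VState V St → ℕ
  | .upd _ => 0
  | .initTest _ next => next.initProgress
  | .initRead _ next => next.initProgress + 1
  | .initCas _ _ next => next.initProgress + 2
  | .readRet _ _ => 4
  | .casTest _ _ _ _ _ => 4
  | .casNew _ _ _ _ => 5
  | .casAppend _ _ _ _ => 6
  | .casDelete _ _ _ => 7
  | .casHelp _ _ => 8
  -- These are the 9 steps above and the three steps of the second `initTS`; the return of the
  -- `vCAS` makes it 13.
  | .casRet _ _ _ => 12
  | .newHead _ _ => 1
  | _ => 0

end VState

section

variable {P Op Ret V St : Type*} {D : CASStructure P Op Ret V St} {J J' : ℕ → ℕ → Prop}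
  {m m' : VMem V} {Lin : ℕ → Prop} {hl : St} {d : Bool}

/-- Linearized versions have been heads, so their successor pointers are permanent. -/
theorem superseded_ext (he : VMem.Ext J m J' m') (hL : ∀ n, Lin n → ∃ x, J x n) :
    m'.Superseded Lin = m.Superseded Lin := by
  funext n
  refine propext (exists_congr fun n' => and_congr_right fun h => ?_)
  obtain ⟨x, hx⟩ := hL _ h
  rw [he.next_eq hx]

theorem InitRel.ext {n : ℕ} {next : VState V St} (h : InitRel D J m Lin next n hl d)
    (he : VMem.Ext J m J' m') (hm : m.Inv J) (hL : ∀ n, Lin n → ∃ x, J x n) :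
    InitRel D J' m' Lin next n hl d := by
  have hs := superseded_ext he hL
  cases h with
  | read n x k s v hl d hc hx hv ho =>
    exact .read _ _ _ _ _ _ _ hc (he.J_mono hx) ((he.val_eq hx).trans hv) ho
  | casNe n x old new k s v hl d hc hx hv hne ho =>
    exact .casNe _ _ _ _ _ _ _ _ _ hc (he.J_mono hx) ((he.val_eq hx).trans hv) hne ho
  | casEq n x old k s hl d hc hx hv ho =>
    exact .casEq _ _ _ _ _ _ _ hc (he.J_mono hx) ((he.val_eq hx).trans hv) ho
  | casLater n x old new k s hl d hc hx hv hne ho =>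
    exact .casLater _ _ _ _ _ _ _ _ hc (he.J_mono hx) ((he.val_eq hx).trans hv) hne (hs ▸ ho)
  | own n' n x old new k s hl d hc hx hv hv' hn ho =>
    exact .own _ _ _ _ _ _ _ _ _ hc (he.J_mono hx) ((he.val_eq (hm.next hx hn).1).trans hv)
      ((he.val_eq hx).trans hv') ((he.next_eq hx).trans hn) ho
  | help n' n x old new k s hl d hc hx hx' hv hne hn ho =>
    exact .help _ _ _ _ _ _ _ _ _ hc (he.J_mono hx) (he.J_mono hx') ((he.val_eq hx).trans hv) hne
      (by rw [hs, he.next_eq hx']; exact hn) (hs ▸ ho)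
  | root n x v k s hl d hc hx hv hn ho =>
    exact .root _ _ _ _ _ _ _ hc (he.J_mono hx) ((he.val_eq hx).trans hv)
      ((he.next_eq hx).trans hn) ho

theorem LocRel.ext {l : VState V St} (h : LocRel D J m Lin l hl d)
    (he : VMem.Ext J m J' m') (hm : m.Inv J) (hL : ∀ n, Lin n → ∃ x, J x n)
    (hp : ∀ n, l.privNode = some n → m'.node n = m.node n) :
    LocRel D J' m' Lin l hl d := by
  have hs := superseded_ext he hL
  cases h with
  | upd s => exact .upd _
  | initTest n next hl d h => exact .initTest _ _ _ _ (h.ext he hm hL)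
  | initRead n next hl d h => exact .initRead _ _ _ _ (h.ext he hm hL)
  | initCas n t next hl d h => exact .initCas _ _ _ _ _ (h.ext he hm hL)
  | readRet n k hl d h => exact .readRet _ _ _ _ (h.ext he hm hL)
  | casTest x old new k n hl d h => exact .casTest _ _ _ _ _ _ _ (h.ext he hm hL)
  | casNew x old new k n s hl d hc hx hv hne ho =>
    exact .casNew _ _ _ _ _ _ _ _ hc (he.J_mono hx) ((he.val_eq hx).trans hv) hne (hs ▸ ho)
  | casAppend x old new k n n' s hl d hc hx hv hne hv' hn ho =>
    have h1 := hp _ rfl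
    exact .casAppend _ _ _ _ _ _ _ _ _ hc (he.J_mono hx) ((he.val_eq hx).trans hv) hne
      (by simpa only [VMem.valOf, h1] using hv') (by simpa only [VMem.nextOf, h1] using hn)
      (hs ▸ ho)
  | casDelete x old new k n n' n'' s hl d hc hx hv hne hx' hn ho =>
    exact .casDelete _ _ _ _ _ _ _ _ _ _ hc (he.J_mono hx) ((he.val_eq hx).trans hv) hne
      (he.J_mono hx') ((he.next_eq hx').trans hn) (hs ▸ ho)
  | casHelp x old new k n n'' s hl d hc hx hv hne hx' hn ho =>
    exact .casHelp _ _ _ _ _ _ _ _ _ hc (he.J_mono hx) ((he.val_eq hx).trans hv) hne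
      (he.J_mono hx') ((he.next_eq hx').trans hn) (hs ▸ ho)
  | casRet x k b => exact .casRet _ _ _
  | newHead n k s v hc hv hn =>
    have h1 := hp _ rfl
    exact .newHead _ _ _ _ hc (by simpa only [VMem.valOf, h1] using hv)
      (by simpa only [VMem.nextOf, h1] using hn)

/-! ### Steps of the original data structure -/

variable {s : St} {C : ℕ → Option V}

theorem impl_read {x : ℕ} {k : V → St} {v : V} (hc : D.code s = .read x k) (hx : C x = some v) :
    D.impl.step s C (k v) C := by
  unfold CASStructure.impl
  dsimp only
  rw [hc]
  exact ⟨v, hx, rfl, rfl⟩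

open Classical in
theorem impl_cas_true {x : ℕ} {old new : V} {k : Bool → St} (hc : D.code s = .cas x old new k)
    (hx : C x = some old) : D.impl.step s C (k true) (Function.update C x (some new)) := by
  unfold CASStructure.impl
  dsimp only
  rw [hc]
  refine ⟨old, hx, ?_⟩
  rw [if_pos rfl]
  exact ⟨rfl, rfl⟩

theorem impl_cas_false {x : ℕ} {old new v : V} {k : Bool → St} (hc : D.code s = .cas x old new k)
    (hx : C x = some v) (hv : v ≠ old) : D.impl.step s C (k false) C := by
  unfold CASStructure.impl
  dsimp only
  rw [hc]
  refine ⟨v, hx, ?_⟩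
  rw [if_neg hv]
  exact ⟨rfl, rfl⟩

/-- A CAS that writes the value already present leaves the memory unchanged, so a `vCAS` with `new =
old` can be executed at the same points as a read. -/
theorem impl_cas_eq {x : ℕ} {old : V} {k : Bool → St} (hc : D.code s = .cas x old old k)
    (hx : C x = some old) : D.impl.step s C (k true) C := by
  classical
  have := impl_cas_true hc hx
  rwa [← hx, Function.update_eq_self] at this

open Classical in
theorem impl_new {x : ℕ} {v : V} {k : ℕ → St} (hc : D.code s = .new v k)
    (hx : C x = none) : D.impl.step s C (k x) (Function.update C x (some v)) := by
  unfold CASStructure.impl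
  dsimp only
  rw [hc]
  exact ⟨x, hx, rfl, rfl⟩

theorem impl_loc {s' : St} (hc : D.code s = .loc s') : D.impl.step s C s' C := by
  unfold CASStructure.impl
  dsimp only
  rw [hc]
  exact ⟨rfl, rfl⟩

/-- The contents of the original objects: the values of the newest linearized versions. -/
def SharedRel (J : ℕ → ℕ → Prop) (m : VMem V) (Lin : ℕ → Prop) (C : ℕ → Option V) : Prop :=
  ∀ x v, C x = some v ↔ ∃ n, J x n ∧ Lin n ∧ ¬ m.Superseded Lin n ∧ m.valOf n = some v

/-! ### Linearizing one more version -/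

/-- The effect of linearizing the version `n₀` on a process that has not created it. -/
theorem InitRel.linearize {n n₀ x₀ : ℕ} {next : VState V St} (h : InitRel D J m Lin next n hl d)
    (hm : m.Inv J) (hx₀ : J x₀ n₀) (hC : C x₀ = m.valOf n₀) (hown : next.AfterInstall → n ≠ n₀) :
    InitRel D J m (fun n => Lin n ∨ n = n₀) next n hl d ∨ d = false ∧
      ∃ hl', D.impl.step hl C hl' C ∧ InitRel D J m (fun n => Lin n ∨ n = n₀) next n hl' true := by
  have hsup : ∀ n, m.Superseded Lin n → m.Superseded (fun n => Lin n ∨ n = n₀) n :=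
    fun n ⟨n', h, h'⟩ => ⟨n', .inl h, h'⟩
  -- If `n` is superseded only now, then `n₀` is the version directly above it. So the object
  -- already holds the value of `n₀`, which differs from that of `n`, and the original CAS fails.
  have hsup' : ∀ {x n}, J x n → ¬ m.Superseded Lin n →
      m.Superseded (fun n => Lin n ∨ n = n₀) n → ∀ {old}, m.valOf n = some old →
      ∃ v, C x = some v ∧ v ≠ old := by
    rintro x n hx h1 ⟨n', h2 | rfl, h3⟩ old hv
    · exact (h1 ⟨n', h2, h3⟩).elim
    · obtain ⟨h4, -, h5⟩ := hm.next hx₀ h3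
      obtain rfl := hm.obj_unique hx h4
      obtain ⟨nd, hnd⟩ := Option.ne_none_iff_exists'.1 (hm.exists_of_J hx₀)
      refine ⟨nd.val, by rw [hC, VMem.valOf, hnd]; rfl, ?_⟩
      rintro rfl
      exact h5 (hv.trans (by rw [VMem.valOf, hnd]; rfl))
  have hCx : ∀ {x n v}, J x n → n = n₀ → m.valOf n = some v → C x = some v := by
    rintro x n v hx rfl hv
    rw [hm.obj_unique hx hx₀, hC, hv]
  have hinl : ∀ {n}, Lin n → Lin n ∨ n = n₀ := .inl
  cases h with
  | read n x k s v hl d hc hx hv ho =>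
    rcases ho.of_imp hinl with h | ⟨h1, h2, rfl, rfl, h3⟩
    · exact .inl (.read _ _ _ _ _ _ _ hc hx hv h)
    · exact .inr ⟨rfl, _, impl_read hc (hCx hx (h2.resolve_left h1) hv),
        .read _ _ _ _ _ _ _ hc hx hv h3⟩
  | casNe n x old new k s v hl d hc hx hv hne ho =>
    rcases ho.of_imp hinl with h | ⟨h1, h2, rfl, rfl, h3⟩
    · exact .inl (.casNe _ _ _ _ _ _ _ _ _ hc hx hv hne h)
    · exact .inr ⟨rfl, _, impl_cas_false hc (hCx hx (h2.resolve_left h1) hv) hne,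
        .casNe _ _ _ _ _ _ _ _ _ hc hx hv hne h3⟩
  | casEq n x old k s hl d hc hx hv ho =>
    rcases ho.of_imp hinl with h | ⟨h1, h2, rfl, rfl, h3⟩
    · exact .inl (.casEq _ _ _ _ _ _ _ hc hx hv h)
    · exact .inr ⟨rfl, _, impl_cas_eq hc (hCx hx (h2.resolve_left h1) hv),
        .casEq _ _ _ _ _ _ _ hc hx hv h3⟩
  | casLater n x old new k s hl d hc hx hv hne ho =>
    rcases ho.of_imp (hsup n) with h | ⟨h1, h2, rfl, rfl, h3⟩
    · exact .inl (.casLater _ _ _ _ _ _ _ _ hc hx hv hne h)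
    · obtain ⟨v, h4, h5⟩ := hsup' hx h1 h2 hv
      exact .inr ⟨rfl, _, impl_cas_false hc h4 h5, .casLater _ _ _ _ _ _ _ _ hc hx hv hne h3⟩
  | own n' n x old new k s hl d hc hx hv hv' hn ho =>
    rcases ho.of_imp hinl with h | ⟨h1, h2, rfl, rfl, h3⟩
    · exact .inl (.own _ _ _ _ _ _ _ _ _ hc hx hv hv' hn h)
    -- The creator of `n₀` is excluded here; its instruction changes the memory and is treated in
    -- `LocRel.own`.
    · exact (hown rfl (h2.resolve_left h1)).elim
  | help n' n x old new k s hl d hc hx hx' hv hne hn ho =>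
    rcases ho.of_imp (hsup n) with h | ⟨h1, h2, rfl, rfl, h3⟩
    · exact .inl (.help _ _ _ _ _ _ _ _ _ hc hx hx' hv hne (hn.imp_right (hsup n)) h)
    · obtain ⟨v, h4, h5⟩ := hsup' hx h1 h2 hv
      exact .inr ⟨rfl, _, impl_cas_false hc h4 h5,
        .help _ _ _ _ _ _ _ _ _ hc hx hx' hv hne (hn.imp_right (hsup n)) h3⟩
  | root n x v k s hl d hc hx hv hn ho =>
    rcases ho.of_imp hinl with h | ⟨h1, h2, rfl, rfl, h3⟩
    · exact .inl (.root _ _ _ _ _ _ _ hc hx hv hn h)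
    · exact (hown trivial (h2.resolve_left h1)).elim

/-- The same argument for all local states. That `l.mid = 1` in the second case shows that the
instruction executed belongs to an operation on an object in progress, which the account of steps
needs. -/
theorem LocRel.linearize {n₀ x₀ : ℕ} {l : VState V St} (h : LocRel D J m Lin l hl d)
    (hm : m.Inv J) (hx₀ : J x₀ n₀) (hC : C x₀ = m.valOf n₀) (hown : l.ownNode ≠ some n₀) :
    LocRel D J m (fun n => Lin n ∨ n = n₀) l hl d ∨ d = false ∧ l.mid = 1 ∧
      ∃ hl', D.impl.step hl C hl' C ∧ LocRel D J m (fun n => Lin n ∨ n = n₀) l hl' true := by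
  have hsup : ∀ n, m.Superseded Lin n → m.Superseded (fun n => Lin n ∨ n = n₀) n :=
    fun n ⟨n', h, h'⟩ => ⟨n', .inl h, h'⟩
  have hsup' : ∀ {x n}, J x n → ¬ m.Superseded Lin n →
      m.Superseded (fun n => Lin n ∨ n = n₀) n → ∀ {old}, m.valOf n = some old →
      ∃ v, C x = some v ∧ v ≠ old := by
    rintro x n hx h1 ⟨n', h2 | rfl, h3⟩ old hv
    · exact (h1 ⟨n', h2, h3⟩).elim
    · obtain ⟨h4, -, h5⟩ := hm.next hx₀ h3
      obtain rfl := hm.obj_unique hx h4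
      obtain ⟨nd, hnd⟩ := Option.ne_none_iff_exists'.1 (hm.exists_of_J hx₀)
      refine ⟨nd.val, by rw [hC, VMem.valOf, hnd]; rfl, ?_⟩
      rintro rfl
      exact h5 (hv.trans (by rw [VMem.valOf, hnd]; rfl))
  cases h with
  | upd s => exact .inl (.upd _)
  | initTest n next hl d h =>
    rcases h.linearize hm hx₀ hC (by simpa [VState.ownNode] using hown) with h | ⟨h, hl', h1, h2⟩
    · exact .inl (.initTest _ _ _ _ h)
    · exact .inr ⟨h, rfl, hl', h1, .initTest _ _ _ _ h2⟩
  | initRead n next hl d h =>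
    rcases h.linearize hm hx₀ hC (by simpa [VState.ownNode] using hown) with h | ⟨h, hl', h1, h2⟩
    · exact .inl (.initRead _ _ _ _ h)
    · exact .inr ⟨h, rfl, hl', h1, .initRead _ _ _ _ h2⟩
  | initCas n t next hl d h =>
    rcases h.linearize hm hx₀ hC (by simpa [VState.ownNode] using hown) with h | ⟨h, hl', h1, h2⟩
    · exact .inl (.initCas _ _ _ _ _ h)
    · exact .inr ⟨h, rfl, hl', h1, .initCas _ _ _ _ _ h2⟩
  | readRet n k hl d h =>
    rcases h.linearize hm hx₀ hC (by simp [VState.AfterInstall]) with h | ⟨h, hl', h1, h2⟩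
    · exact .inl (.readRet _ _ _ _ h)
    · exact .inr ⟨h, rfl, hl', h1, .readRet _ _ _ _ h2⟩
  | casTest x old new k n hl d h =>
    rcases h.linearize hm hx₀ hC (by simp [VState.AfterInstall]) with h | ⟨h, hl', h1, h2⟩
    · exact .inl (.casTest _ _ _ _ _ _ _ h)
    · exact .inr ⟨h, rfl, hl', h1, .casTest _ _ _ _ _ _ _ h2⟩
  | casNew x old new k n s hl d hc hx hv hne ho =>
    rcases ho.of_imp (hsup n) with h | ⟨h1, h2, rfl, rfl, h3⟩
    · exact .inl (.casNew _ _ _ _ _ _ _ _ hc hx hv hne h)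
    · obtain ⟨v, h4, h5⟩ := hsup' hx h1 h2 hv
      exact .inr ⟨rfl, rfl, _, impl_cas_false hc h4 h5, .casNew _ _ _ _ _ _ _ _ hc hx hv hne h3⟩
  | casAppend x old new k n n' s hl d hc hx hv hne hv' hn ho =>
    rcases ho.of_imp (hsup n) with h | ⟨h1, h2, rfl, rfl, h3⟩
    · exact .inl (.casAppend _ _ _ _ _ _ _ _ _ hc hx hv hne hv' hn h)
    · obtain ⟨v, h4, h5⟩ := hsup' hx h1 h2 hv
      exact .inr ⟨rfl, rfl, _, impl_cas_false hc h4 h5,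
        .casAppend _ _ _ _ _ _ _ _ _ hc hx hv hne hv' hn h3⟩
  | casDelete x old new k n n' n'' s hl d hc hx hv hne hx' hn ho =>
    rcases ho.of_imp (hsup n) with h | ⟨h1, h2, rfl, rfl, h3⟩
    · exact .inl (.casDelete _ _ _ _ _ _ _ _ _ _ hc hx hv hne hx' hn h)
    · obtain ⟨v, h4, h5⟩ := hsup' hx h1 h2 hv
      exact .inr ⟨rfl, rfl, _, impl_cas_false hc h4 h5,
        .casDelete _ _ _ _ _ _ _ _ _ _ hc hx hv hne hx' hn h3⟩
  | casHelp x old new k n n'' s hl d hc hx hv hne hx' hn ho =>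
    rcases ho.of_imp (hsup n) with h | ⟨h1, h2, rfl, rfl, h3⟩
    · exact .inl (.casHelp _ _ _ _ _ _ _ _ _ hc hx hv hne hx' hn h)
    · obtain ⟨v, h4, h5⟩ := hsup' hx h1 h2 hv
      exact .inr ⟨rfl, rfl, _, impl_cas_false hc h4 h5,
        .casHelp _ _ _ _ _ _ _ _ _ hc hx hv hne hx' hn h3⟩
  | casRet x k b => exact .inl (.casRet _ _ _)
  | newHead n k s v hc hv hn => exact .inl (.newHead _ _ _ _ hc hv hn)

end

/-! ## Paths in which the operations of `Q` run solo -/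

/-- A path from one configuration to another in which the pending operations of `Q` run solo,
with the list of its labels and of the configurations before them. -/
inductive SoloPath {P Op Ret S L : Type*} (M : Impl P Op Ret S L) (Q : Set Op) :
    Config P Op S L → List (Config P Op S L × Label P Op Ret) → Config P Op S L → Prop
  | nil (c) : SoloPath M Q c [] c
  | cons (c ℓ c' es c'') (h : M.Step c ℓ c')
      (hq : ∀ p op l, c.procs p = some (op, l) → op ∈ Q → ℓ.proc = p)
      (hs : SoloPath M Q c' es c'') : SoloPath M Q c ((c, ℓ) :: es) c''

/-- The number of events of the process `p`. -/
noncomputable def procCount {P Op Ret C : Type*} (p : P) (es : List (C × Label P Op Ret)) : ℕ :=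
  open Classical in es.countP fun e => e.2.proc = p

section

variable {P Op Ret S L C : Type*} {M : Impl P Op Ret S L} {Q : Set Op} {c c' c'' : Config P Op S L}
  {es es' : List (Config P Op S L × Label P Op Ret)}

theorem SoloPath.append (h : SoloPath M Q c es c') (h' : SoloPath M Q c' es' c'') :
    SoloPath M Q c (es ++ es') c'' := by
  induction h with
  | nil c => exact h'
  | cons c ℓ c' es c'' h hq hs ih => exact .cons _ _ _ _ _ h hq (ih h')

theorem SoloPath.single {ℓ : Label P Op Ret} (h : M.Step c ℓ c')
    (hq : ∀ p op l, c.procs p = some (op, l) → op ∈ Q → ℓ.proc = p) :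
    SoloPath M Q c [(c, ℓ)] c' :=
  .cons _ _ _ _ _ h hq (.nil _)

@[simp]
theorem procCount_nil (p : P) : procCount p ([] : List (C × Label P Op Ret)) = 0 := rfl

theorem procCount_append (p : P) (es es' : List (C × Label P Op Ret)) :
    procCount p (es ++ es') = procCount p es + procCount p es' := by
  simp [procCount]

open Classical in
theorem procCount_singleton (p : P) (e : C × Label P Op Ret) :
    procCount p [e] = if e.2.proc = p then 1 else 0 := by
  by_cases h : e.2.proc = p <;> simp [procCount, h]

theorem procCount_eq_zero {p : P} {es : List (C × Label P Op Ret)} (h : ∀ e ∈ es, e.2.proc ≠ p) :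
    procCount p es = 0 := by
  simpa [procCount, List.countP_eq_zero] using fun a b hab => h (a, b) hab

/-- A set of processes can execute instructions that do not change the shared state, one after
another. -/
theorem exists_soloPath_steps [Finite P] (hq : ∀ p op l, c.procs p = some (op, l) → op ∉ Q)
    (T : Set P) (tgt : P → Option (Op × L))
    (hT : ∀ p ∈ T, ∃ op l l', c.procs p = some (op, l) ∧ M.step l c.shared l' c.shared ∧
      tgt p = some (op, l')) :
    ∃ es c', SoloPath M Q c es c' ∧ c'.shared = c.shared ∧
      (∀ p ∈ T, c'.procs p = tgt p ∧ procCount p es = 1) ∧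
      (∀ p ∉ T, c'.procs p = c.procs p ∧ procCount p es = 0) ∧
      ∀ e ∈ es, ∃ p ∈ T, e.2 = .step p := by
  classical
  induction T, T.toFinite using Set.Finite.induction_on with
  | empty => exact ⟨[], c, .nil c, rfl, by simp, by simp, by simp⟩
  | @insert a T ha _ ih =>
    obtain ⟨es, c', h1, h2, h3, h4, h5⟩ := ih fun p hp => hT p (.inr hp)
    obtain ⟨op, l, l', h6, h7, h8⟩ := hT a (.inl rfl)
    have hstep := Impl.Step.step (M := M) c' a op l l' c.shared ((h4 a ha).1.trans h6)
      (by rwa [h2])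
    have hcount : ∀ p, procCount p (es ++ [(c', Label.step a)]) =
        procCount p es + if a = p then 1 else 0 := by
      intro p
      rw [procCount_append, procCount_singleton]
      rfl
    refine ⟨es ++ [(c', .step a)], ⟨c.shared, Function.update c'.procs a (some (op, l'))⟩,
      h1.append (.single hstep ?_), rfl, ?_, ?_, ?_⟩
    · intro p op' l₁ hp hop
      exfalso
      by_cases hpT : p ∈ T
      · obtain ⟨op₂, l₂, l₂', h9, -, h10⟩ := hT p (.inr hpT)
        rw [(h3 p hpT).1, h10] at hp
        cases hp
        exact hq _ _ _ h9 hop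
      · rw [(h4 p hpT).1] at hp
        exact hq _ _ _ hp hop
    · intro p hp
      rw [hcount]
      by_cases hpa : p = a
      · subst hpa
        exact ⟨by simp [h8], by simp [(h4 p ha).2]⟩
      · have hpT : p ∈ T := hp.resolve_left hpa
        refine ⟨?_, by simp [(h3 p hpT).2, Ne.symm hpa]⟩
        simp only [Function.update_of_ne hpa, (h3 p hpT).1]
    · intro p hp
      rw [hcount]
      have hpa : p ≠ a := fun h => hp (.inl h)
      have hpT : p ∉ T := fun h => hp (.inr h)
      refine ⟨?_, by simp [(h4 p hpT).2, Ne.symm hpa]⟩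
      simp only [Function.update_of_ne hpa, (h4 p hpT).1]
    · intro e he
      rcases List.mem_append.1 he with he | he
      · obtain ⟨p, hp, h⟩ := h5 e he
        exact ⟨p, .inr hp, h⟩
      · rw [List.mem_singleton.1 he]
        exact ⟨a, .inl rfl, rfl⟩

end

/-! ## The simulation relation -/

section

variable {P Op Ret V St : Type*}

/-- `hl` corresponds to the local state `l`, and the numbers `e` and `h` of events of the
current operation in the two runs fit together. -/
def ProcRel (D : CASStructure P Op Ret V St) (J : ℕ → ℕ → Prop) (m : VMem V) (Lin : ℕ → Prop)
    (l : VState V St) (hl : St) (e h : ℕ) : Prop :=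
  ∃ d : Bool, LocRel D J m Lin l hl d ∧ h + l.mid ≤ e + d.toNat ∧
    e + 13 * (1 + d.toNat) ≤ 1 + 13 * h + l.progress

/-- The configuration `hc` of the original data structure corresponds to the configuration `c` of
the transformed one, where `Lin` is the set of the linearized versions. -/
structure Sim (D : CASStructure P Op Ret V St) (Q : Set Op) (J : ℕ → ℕ → Prop) (Lin : ℕ → Prop)
    (c : Config P Op (VMem V) (VState V St)) (hc : Config P Op (ℕ → Option V) St)
    (e h : P → ℕ) : Prop where
  inv : D.ConfigInv Q J c
  lin_J : ∀ n, Lin n → ∃ x, J x n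
  lin_of_decided : ∀ n, c.shared.Decided n → Lin n
  shared : SharedRel J c.shared Lin hc.shared
  idle : ∀ p, c.procs p = none → hc.procs p = none
  query : ∀ p op l, c.procs p = some (op, l) → op ∈ Q → hc.procs p = none
  upd : ∀ p op l, c.procs p = some (op, l) → op ∉ Q → ∃ hl, hc.procs p = some (op, hl) ∧
    ProcRel D J c.shared Lin l hl (e p) (h p)

variable {D : CASStructure P Op Ret V St} {Q : Set Op} {J J' : ℕ → ℕ → Prop} {Lin : ℕ → Prop}
  {c c' : Config P Op (VMem V) (VState V St)} {hc : Config P Op (ℕ → Option V) St} {e h : P → ℕ}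

/-- Between events the simulating run has no pending queries, since each of them is executed as one
complete block. This makes the solo condition hold for all instructions of updates. -/
theorem Sim.not_query (hs : Sim D Q J Lin c hc e h) {p : P} {op : Op} {hl : St}
    (hp : hc.procs p = some (op, hl)) :
    op ∉ Q ∧ ∃ l, c.procs p = some (op, l) ∧ ProcRel D J c.shared Lin l hl (e p) (h p) := by
  cases hc' : c.procs p with
  | none => simp [hs.idle p hc'] at hp
  | some a =>
    obtain ⟨op', l⟩ := a
    by_cases hop : op' ∈ Q
    · simp [hs.query p op' l hc' hop] at hp
    · obtain ⟨hl', h1, h2⟩ := hs.upd p op' l hc' hop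
      rw [hp] at h1
      cases h1
      exact ⟨hop, l, rfl, h2⟩

/-- A version that is not linearized is the undecided head of its object. -/
theorem Sim.head_of_not_lin (hs : Sim D Q J Lin c hc e h) {x n : ℕ} (hx : J x n) (hn : ¬ Lin n) :
    c.shared.vhead x = some n :=
  hs.inv.mem.head_of_undecided hx
    ((hs.inv.mem.undecided_or_decided hx).resolve_right fun hd => hn (hs.lin_of_decided n hd))

/-- A linearized head contains the value of its object. -/
theorem Sim.shared_head (hs : Sim D Q J Lin c hc e h) {x n : ℕ} (hx : c.shared.vhead x = some n)
    (hn : Lin n) : ¬ c.shared.Superseded Lin n ∧ hc.shared x = c.shared.valOf n := by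
  have hm := hs.inv.mem
  have hJ := hm.J_of_head hx
  have hsup : ¬ c.shared.Superseded Lin n := by
    rintro ⟨n', h1, h2⟩
    obtain ⟨y, hy⟩ := hs.lin_J n' h1
    obtain ⟨h3, -⟩ := hm.next hy h2
    rw [hm.obj_unique h3 hJ] at hy
    exact hm.head_no_pred hx hy h2
  refine ⟨hsup, ?_⟩
  obtain ⟨nd, hnd⟩ := Option.ne_none_iff_exists'.1 (hm.exists_of_J hJ)
  have hv : c.shared.valOf n = some nd.val := by rw [VMem.valOf, hnd]; rfl
  rw [hv]
  exact (hs.shared x _).2 ⟨n, hJ, hn, hsup, hv⟩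

/-- The value of an object whose head is not linearized is that of the version below. -/
theorem Sim.shared_next (hs : Sim D Q J Lin c hc e h) {x n n' : ℕ} (hx : J x n)
    (hn : ¬ Lin n) (hn' : c.shared.nextOf n = some (some n')) :
    hc.shared x = c.shared.valOf n' := by
  have hm := hs.inv.mem
  obtain ⟨h1, h2, -⟩ := hm.next hx hn'
  obtain ⟨nd, hnd⟩ := Option.ne_none_iff_exists'.1 (hm.exists_of_J h1)
  have hv : c.shared.valOf n' = some nd.val := by rw [VMem.valOf, hnd]; rfl
  rw [hv]
  refine (hs.shared x _).2 ⟨n', h1, hs.lin_of_decided _ h2, ?_, hv⟩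
  rintro ⟨n'', h3, h4⟩
  obtain ⟨y, hy⟩ := hs.lin_J n'' h3
  obtain ⟨h5, -⟩ := hm.next hy h4
  rw [hm.obj_unique h5 h1] at hy
  rw [hm.next_inj hy hx (h4.trans hn'.symm)] at h3
  exact hn h3

/-- An object without a linearized version does not exist in the original data structure. -/
theorem Sim.shared_none (hs : Sim D Q J Lin c hc e h) {x n : ℕ} (hx : J x n)
    (hn : ¬ Lin n) (hn' : c.shared.nextOf n = some none) : hc.shared x = none := by
  have hm := hs.inv.mem
  refine Option.eq_none_iff_forall_ne_some.2 fun v hv => ?_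
  obtain ⟨n₁, h1, h2, h3, -⟩ := (hs.shared x v).1 hv
  have hhead := hs.head_of_not_lin hx hn
  by_cases he : c.shared.vhead x = some n₁
  · rw [he] at hhead
    cases hhead
    exact hn h2
  · obtain ⟨n₂, h4, h5⟩ := hm.exists_pred h1 he
    refine h3 ⟨n₂, ?_, h5⟩
    by_contra h6
    have := hs.head_of_not_lin h4 h6
    rw [hhead] at this
    cases this
    rw [hn'] at h5
    cases h5

/-- The creator of a version can be linearized together with it. -/
theorem LocRel.own {l : VState V St} {hl : St} {d : Bool} {m : VMem V}
    (h : LocRel D J m Lin l hl d) {n₀ : ℕ} (hown : l.ownNode = some n₀)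
    (hpriv : l.privNode = none) (hlin : ¬ Lin n₀) :
    d = false ∧ l.mid = 1 ∧ ∃ x hl', J x n₀ ∧
      ((∃ n old new k, D.code hl = .cas x old new k ∧ hl' = k true ∧ m.valOf n = some old ∧
          m.valOf n₀ = some new ∧ m.nextOf n₀ = some (some n)) ∨
        ∃ v k, D.code hl = .new v k ∧ hl' = k x ∧ m.valOf n₀ = some v ∧
          m.nextOf n₀ = some none) ∧
      ∀ Lin' : ℕ → Prop, Lin' n₀ → LocRel D J m Lin' l hl' true := by
  have key : ∀ {next : VState V St} {n}, next.AfterInstall → n = n₀ →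
      InitRel D J m Lin next n hl d → d = false ∧ ∃ x hl', J x n₀ ∧
      ((∃ n old new k, D.code hl = .cas x old new k ∧ hl' = k true ∧ m.valOf n = some old ∧
          m.valOf n₀ = some new ∧ m.nextOf n₀ = some (some n)) ∨
        ∃ v k, D.code hl = .new v k ∧ hl' = k x ∧ m.valOf n₀ = some v ∧
          m.nextOf n₀ = some none) ∧
      ∀ Lin' : ℕ → Prop, Lin' n₀ → InitRel D J m Lin' next n hl' true := by
    rintro next n hnext rfl h
    cases h with
    | own n' n x old new k s hl d hc hx hv hv' hn ho =>
      obtain ⟨rfl, rfl⟩ := ho.of_false hlin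
      exact ⟨rfl, x, _, hx, .inl ⟨n, old, new, k, hc, rfl, hv, hv', hn⟩,
        fun Lin' h => .own _ _ _ _ _ _ _ _ _ hc hx hv hv' hn (.inl ⟨h, rfl, rfl⟩)⟩
    | root n x v k s hl d hc hx hv hn ho =>
      obtain ⟨rfl, rfl⟩ := ho.of_false hlin
      exact ⟨rfl, x, _, hx, .inr ⟨v, k, hc, rfl, hv, hn⟩,
        fun Lin' h => .root _ _ _ _ _ _ _ hc hx hv hn (.inl ⟨h, rfl, rfl⟩)⟩
    | help => simp [VState.AfterInstall] at hnext
    | read => exact hnext.elim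
    | casNe => exact hnext.elim
    | casEq => exact hnext.elim
    | casLater => exact hnext.elim
  cases h with
  | initTest n next hl d h =>
    simp only [VState.ownNode, Option.ite_none_right_eq_some] at hown
    obtain ⟨h1, x, hl', h2, h3, h4⟩ := key hown.1 (Option.some.inj hown.2) h
    exact ⟨h1, rfl, x, hl', h2, h3, fun Lin' h => .initTest _ _ _ _ (h4 Lin' h)⟩
  | initRead n next hl d h =>
    simp only [VState.ownNode, Option.ite_none_right_eq_some] at hown
    obtain ⟨h1, x, hl', h2, h3, h4⟩ := key hown.1 (Option.some.inj hown.2) h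
    exact ⟨h1, rfl, x, hl', h2, h3, fun Lin' h => .initRead _ _ _ _ (h4 Lin' h)⟩
  | initCas n t next hl d h =>
    simp only [VState.ownNode, Option.ite_none_right_eq_some] at hown
    obtain ⟨h1, x, hl', h2, h3, h4⟩ := key hown.1 (Option.some.inj hown.2) h
    exact ⟨h1, rfl, x, hl', h2, h3, fun Lin' h => .initCas _ _ _ _ _ (h4 Lin' h)⟩
  | casAppend => cases hpriv
  | casDelete => cases hpriv
  | newHead => cases hpriv
  | _ => cases hown

/-- Queries may help to decide timestamps but create no versions, so the creator of an undecided
version is also pending in the simulating run. -/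
theorem VState.Inv.not_isQuery_of_own {m : VMem V} {l : VState V St} (h : l.Inv J m) {n : ℕ}
    (hown : l.ownNode = some n) : ¬ l.IsQuery := by
  cases l with
  | initTest n next => cases next <;> simp_all [VState.ownNode, VState.AfterInstall, VState.IsQuery]
  | initRead n next => cases next <;> simp_all [VState.ownNode, VState.AfterInstall, VState.IsQuery]
  | initCas n t next =>
    cases next <;> simp_all [VState.ownNode, VState.AfterInstall, VState.IsQuery]
  | _ => simp_all [VState.ownNode, VState.IsQuery]

/-- Executing the pending instruction ahead raises both `h` and the flag by one, which adds the same
amount to both sides of each inequality. -/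
theorem ProcRel.of_step {m : VMem V} {l : VState V St} {hl : St} {e h : ℕ}
    (hd : h + l.mid ≤ e + (false : Bool).toNat)
    (hd' : e + 13 * (1 + (false : Bool).toNat) ≤ 1 + 13 * h + l.progress)
    (hr : LocRel D J m Lin l hl true) (hmid : l.mid = 1) : ProcRel D J m Lin l hl e (h + 1) := by
  refine ⟨true, hr, ?_, ?_⟩
  · simp only [hmid, Bool.toNat_false, Bool.toNat_true] at hd ⊢
    omega
  · simp only [Bool.toNat_false, Bool.toNat_true] at hd' ⊢
    omega

open Classical in
/-- One more version is linearized: first its creator, then all processes that wait for this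
version execute their pending instructions. -/
theorem Sim.linearize [Finite P] (hs : Sim D Q J Lin c hc e h) {x₀ n₀ : ℕ} (hx₀ : J x₀ n₀)
    (hlin : ¬ Lin n₀) :
    ∃ es hc', SoloPath D.impl Q hc es hc' ∧
      (∀ a ∈ es, ∃ p op l, a.2 = .step p ∧ c.procs p = some (op, l) ∧ op ∉ Q) ∧
      Sim D Q J (fun n => Lin n ∨ n = n₀) c hc' e (fun p => h p + procCount p es) := by
  have hm := hs.inv.mem
  have hhead := hs.head_of_not_lin hx₀ hlin
  have hund : c.shared.tsOf n₀ = some none :=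
    (hm.undecided_or_decided hx₀).resolve_right fun hd => hlin (hs.lin_of_decided _ hd)
  -- An undecided head still has its creator inside `initTS`, so the instruction that installs its
  -- value is pending.
  obtain ⟨p₀, op₀, l₀, hp₀, hown₀⟩ := hs.inv.own_of_undecided hx₀ hund
  have hop₀ : op₀ ∉ Q := fun hop =>
    (hs.inv.loc hp₀).not_isQuery_of_own hown₀ ((hs.inv.query_iff hp₀).1 hop)
  obtain ⟨hl₀, hhp₀, d₀, hr₀, hd₀, hd₀'⟩ := hs.upd p₀ op₀ l₀ hp₀ hop₀
  have hpriv₀ : l₀.privNode = none := by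
    cases hpr : l₀.privNode with
    | none => rfl
    | some n =>
      have := VState.ownNode_of_privNode hpr
      rw [hown₀] at this
      cases this
      exact (hs.inv.priv hp₀ hpr _ hx₀).elim
  obtain ⟨rfl, hmid₀, x, hl₀', hx, hcode, hr₀'⟩ := hr₀.own hown₀ hpriv₀ hlin
  obtain rfl := hm.obj_unique hx hx₀
  -- the creator executes its instruction
  set C' : ℕ → Option V := Function.update hc.shared x (c.shared.valOf n₀) with hC'
  have hstep₀ : D.impl.step hl₀ hc.shared hl₀' C' := by
    -- As `n₀` is not linearized, the object has the value of the version below it, which is the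
    -- expected one, or does not exist yet if there is none.
    rcases hcode with ⟨n, old, new, k, h1, rfl, h2, h3, h4⟩ | ⟨v, k, h1, rfl, h2, h3⟩
    · rw [hC', h3]
      exact impl_cas_true h1 ((hs.shared_next hx hlin h4).trans h2)
    · rw [hC', h2]
      exact impl_new h1 (hs.shared_none hx hlin h3)
  have hnoq : ∀ p op l, hc.procs p = some (op, l) → op ∉ Q := fun p op l hp => (hs.not_query hp).1
  set hc₁ : Config P Op (ℕ → Option V) St :=
    ⟨C', Function.update hc.procs p₀ (some (op₀, hl₀'))⟩ with hhc₁
  have hfirst : D.impl.Step hc (.step p₀) hc₁ := .step _ _ _ _ _ _ hhp₀ hstep₀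
  have hnoq₁ : ∀ p op l, hc₁.procs p = some (op, l) → op ∉ Q := by
    intro p op l hp
    by_cases hpp : p = p₀
    · subst hpp
      simp only [hhc₁, Function.update_self] at hp
      cases hp
      exact hop₀
    · simp only [hhc₁, Function.update_of_ne hpp] at hp
      exact hnoq p op l hp
  -- the other processes
  have hC'x : C' x = c.shared.valOf n₀ := Function.update_self _ _ _
  have hother : ∀ p op l hl, p ≠ p₀ → c.procs p = some (op, l) → ∀ d, LocRel D J c.shared Lin l hl d →
      LocRel D J c.shared (fun n => Lin n ∨ n = n₀) l hl d ∨ d = false ∧ l.mid = 1 ∧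
        ∃ hl', D.impl.step hl C' hl' C' ∧
          LocRel D J c.shared (fun n => Lin n ∨ n = n₀) l hl' true := by
    intro p op l hl hp hcp d hr
    exact hr.linearize hm hx hC'x fun ho => hp (hs.inv.own_inj hcp hp₀ ho hown₀)
  -- The processes whose awaited condition has become true by the linearization of `n₀`. Their
  -- instructions do not change the memory, so they can be executed in any order.
  let T : Set P := {p | p ≠ p₀ ∧ ∃ op l hl hl', c.procs p = some (op, l) ∧ op ∉ Q ∧
    hc.procs p = some (op, hl) ∧ D.impl.step hl C' hl' C' ∧ l.mid = 1 ∧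
    LocRel D J c.shared (fun n => Lin n ∨ n = n₀) l hl' true ∧
    h p + l.mid ≤ e p + (false : Bool).toNat ∧
    e p + 13 * (1 + (false : Bool).toNat) ≤ 1 + 13 * h p + l.progress}
  have htgt : ∀ p, ∃ o : Option (Op × St), p ∈ T → ∃ op l hl hl', c.procs p = some (op, l) ∧
      hc.procs p = some (op, hl) ∧ D.impl.step hl C' hl' C' ∧ o = some (op, hl') ∧
      ProcRel D J c.shared (fun n => Lin n ∨ n = n₀) l hl' (e p) (h p + 1) := by
    intro p
    by_cases hp : p ∈ T
    · obtain ⟨-, op, l, hl, hl', h1, -, h3, h4, h5, h6, h7, h8⟩ := hp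
      exact ⟨some (op, hl'), fun _ => ⟨op, l, hl, hl', h1, h3, h4, rfl, .of_step h7 h8 h6 h5⟩⟩
    · exact ⟨none, fun h => (hp h).elim⟩
  choose tgt htgt using htgt
  have hT₁ : ∀ p ∈ T, hc₁.procs p = hc.procs p := fun p hp => Function.update_of_ne hp.1 _ _
  obtain ⟨es, hc₂, hpath, hsh, hinT, hnotT, hes⟩ := exists_soloPath_steps (M := D.impl) hnoq₁ T tgt (by
    intro p hp
    obtain ⟨op, l, hl, hl', h1, h2, h3, h4, -⟩ := htgt p hp
    exact ⟨op, hl, hl', (hT₁ p hp).trans h2, h3, h4⟩)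
  refine ⟨(hc, .step p₀) :: es, _, .cons _ _ _ _ _ hfirst
    (fun p op l hp hop => (hnoq p op l hp hop).elim) hpath, ?_, ?_⟩
  · intro a ha
    rcases List.mem_cons.1 ha with rfl | ha
    · exact ⟨p₀, op₀, l₀, rfl, hp₀, hop₀⟩
    · obtain ⟨p, ⟨-, op, l, hl, hl', h1, h2, -⟩, h3⟩ := hes a ha
      exact ⟨p, op, l, h3, h1, h2⟩
  · have hcnt : ∀ p, procCount p ((hc, Label.step p₀) :: es) =
        (if p₀ = p then 1 else 0) + procCount p es := by
      intro p
      rw [← List.singleton_append, procCount_append, procCount_singleton]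
      rfl
    have hidle : ∀ p, hc.procs p = none → hc₂.procs p = none := by
      intro p hp
      have h1 : p ∉ T := by
        rintro ⟨-, op, l, hl, hl', -, -, h1, -⟩
        simp [hp] at h1
      have h2 : p ≠ p₀ := by
        rintro rfl
        simp [hhp₀] at hp
      rw [(hnotT p h1).1]
      exact (Function.update_of_ne h2 _ _).trans hp
    refine ⟨hs.inv, ?_, fun n hd => .inl (hs.lin_of_decided n hd), ?_,
      fun p hp => hidle p (hs.idle p hp), fun p op l hp hop => hidle p (hs.query p op l hp hop), ?_⟩
    · rintro n (hn | rfl)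
      · exact hs.lin_J n hn
      · exact ⟨x, hx⟩
    · intro y v
      rw [hsh]
      change C' y = some v ↔ _
      by_cases hy : y = x
      · subst hy
        rw [hC'x]
        constructor
        · intro hv
          refine ⟨n₀, hx, .inr rfl, ?_, hv⟩
          rintro ⟨n', h1, h2⟩
          obtain ⟨z, hz⟩ : ∃ z, J z n' := by
            rcases h1 with h1 | rfl
            · exact hs.lin_J _ h1
            · exact ⟨_, hx⟩
          obtain ⟨h3, -⟩ := hm.next hz h2
          rw [hm.obj_unique h3 hx] at hz
          exact hm.head_no_pred hhead hz h2
        -- Any other version of the object is superseded: the version above it is linearized, or it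
        -- is the only unlinearized one, `n₀`.
        · rintro ⟨n, h1, -, h3, h4⟩
          by_cases hn : c.shared.vhead y = some n
          · rw [hhead] at hn
            cases hn
            exact h4
          · obtain ⟨n', h5, h6⟩ := hm.exists_pred h1 hn
            refine (h3 ⟨n', ?_, h6⟩).elim
            by_contra h7
            push Not at h7
            have := hs.head_of_not_lin h5 h7.1
            rw [hhead] at this
            cases this
            exact h7.2 rfl
      · rw [hC', Function.update_of_ne hy, hs.shared y v]
        refine exists_congr fun n => and_congr_right fun hJ => ?_
        have h1 : n ≠ n₀ := by
          rintro rfl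
          exact hy (hm.obj_unique hJ hx)
        have h2 : c.shared.Superseded (fun n => Lin n ∨ n = n₀) n ↔ c.shared.Superseded Lin n := by
          constructor
          · rintro ⟨n', h3 | rfl, h4⟩
            · exact ⟨n', h3, h4⟩
            · exact (hy (hm.obj_unique hJ (hm.next hx h4).1)).elim
          · rintro ⟨n', h3, h4⟩
            exact ⟨n', .inl h3, h4⟩
        rw [h2]
        simp [h1]
    · intro p op l hp hop
      rw [hcnt]
      by_cases hpT : p ∈ T
      · obtain ⟨op', l', hl, hl', h1, -, -, h2, h3⟩ := htgt p hpT
        rw [hp] at h1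
        cases h1
        refine ⟨hl', by rw [(hinT p hpT).1, h2], ?_⟩
        simpa [(hinT p hpT).2, Ne.symm hpT.1] using h3
      · rw [(hnotT p hpT).1, (hnotT p hpT).2]
        by_cases hpp : p = p₀
        · subst hpp
          rw [hp] at hp₀
          cases hp₀
          refine ⟨hl₀', by simp [hhc₁], ?_⟩
          simpa using ProcRel.of_step hd₀ hd₀' (hr₀' (fun n => Lin n ∨ n = n₀) (.inr rfl)) hmid₀
        · obtain ⟨hl, h1, d, h2, h3, h4⟩ := hs.upd p op l hp hop
          refine ⟨hl, (Function.update_of_ne hpp _ _).trans h1, ?_⟩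
          simp only [Ne.symm hpp, if_false, Nat.add_zero]
          rcases hother p op l hl hpp hp d h2 with h5 | ⟨rfl, h5, hl', h6, h7⟩
          · exact ⟨d, h5, h3, h4⟩
          · exact (hpT ⟨hpp, op, l, hl, hl', hp, hop, h1, h6, h5, h7, h3, h4⟩).elim

end

/-! ### Simulation of one event. -/

section

variable {P Op Ret V St : Type*} {D : CASStructure P Op Ret V St} {Q : Set Op} {J : ℕ → ℕ → Prop}
  {Lin : ℕ → Prop} {c c' : Config P Op (VMem V) (VState V St)}
  {hc : Config P Op (ℕ → Option V) St} {e h : P → ℕ}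

theorem VState.mid_le {l : VState V St} : l.mid ≤ 1 := by
  cases l <;> simp [VState.mid]

/-- The awaited conditions of `own`, `help` and `root` follow from the linearization of `n`, so
there the instruction has been executed. The 3 stands for the steps of `initTS`. A constructor ends
with this call, so its flag is reset and 13 is released in the account. -/
theorem InitRel.done {m : VMem V} {next : VState V St} {n : ℕ} {hl : St} {d : Bool}
    (hr : InitRel D J m Lin next n hl d) (hn : Lin n) :
    ∃ d' : Bool, LocRel D J m Lin next hl d' ∧
      3 + 13 * d'.toNat + next.initProgress ≤ next.progress + 13 * d.toNat := by
  cases hr with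
  | read n x k s v hl d hc hx hv ho =>
    exact ⟨d, .readRet _ _ _ _ (.read _ _ _ _ _ _ _ hc hx hv ho),
      by simp only [VState.initProgress, VState.progress]; omega⟩
  | casNe n x old new k s v hl d hc hx hv hne ho =>
    exact ⟨d, .casTest _ _ _ _ _ _ _ (.casNe _ _ _ _ _ _ _ _ _ hc hx hv hne ho),
      by simp only [VState.initProgress, VState.progress]; omega⟩
  | casEq n x old k s hl d hc hx hv ho =>
    exact ⟨d, .casTest _ _ _ _ _ _ _ (.casEq _ _ _ _ _ _ _ hc hx hv ho),
      by simp only [VState.initProgress, VState.progress]; omega⟩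
  | casLater n x old new k s hl d hc hx hv hne ho =>
    exact ⟨d, .casTest _ _ _ _ _ _ _ (.casLater _ _ _ _ _ _ _ _ hc hx hv hne ho),
      by simp only [VState.initProgress, VState.progress]; omega⟩
  | own n' n x old new k s hl d hc hx hv hv' hn' ho =>
    obtain ⟨rfl, rfl⟩ := ho.of_true hn
    exact ⟨true, .casRet _ _ _, by simp [VState.initProgress, VState.progress]⟩
  | help n' n x old new k s hl d hc hx hx' hv hne hn' ho =>
    obtain ⟨rfl, rfl⟩ := ho.of_true (hn'.elim (fun h => ⟨_, hn, h⟩) id)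
    exact ⟨true, .casRet _ _ _, by simp [VState.initProgress, VState.progress]⟩
  | root n x v k s hl d hc hx hv hn' ho =>
    obtain ⟨rfl, rfl⟩ := ho.of_true hn
    exact ⟨false, .upd _, by simp [VState.initProgress, VState.progress]⟩

/-- One step of an operation that is not a query corresponds to at most one step of the original
operation. -/
theorem Sim.vstep_locRel (hs : Sim D Q J Lin c hc e h) {p : P} {op : Op} {l l' : VState V St}
    (hp : c.procs p = some (op, l)) (hop : op ∉ Q) {m' : VMem V} (hst : VStep D l c.shared l' m')
    (hdec : ∀ n, m'.Decided n → Lin n) {hl : St} {d : Bool}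
    (hr : LocRel D J c.shared Lin l hl d) :
    ∃ (hl' : St) (d' : Bool) (δ : ℕ),
      LocRel D (fun x n => J x n ∨ m'.vhead x = some n) m' Lin l' hl' d' ∧
      (δ = 0 ∧ hl' = hl ∨ δ = 1 ∧ D.impl.step hl hc.shared hl' hc.shared) ∧
      l'.mid + δ + d.toNat ≤ l.mid + 1 + d'.toNat ∧
      1 + 13 * d'.toNat + l.progress ≤ 13 * δ + l'.progress + 13 * d.toNat := by
  have hm := hs.inv.mem
  have hloc := hs.inv.loc hp
  have hnq : ¬ l.IsQuery := fun hq => hop ((hs.inv.query_iff hp).2 hq)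
  obtain ⟨-, hext⟩ := hs.inv.vstep hp hst
  have hJ : ∀ m₁ : VMem V, m₁.vhead = c.shared.vhead →
      (fun x n => J x n ∨ m₁.vhead x = some n) = J := fun m₁ h => hs.inv.J_eq h
  have hlin : ∀ n, Lin n → ∃ x, J x n := hs.lin_J
  have hdec' := hs.lin_of_decided
  have hval : ∀ {n nd}, c.shared.node n = some nd → c.shared.valOf n = some nd.val := by
    intro n nd h
    rw [VMem.valOf, h]; rfl
  have hJval : ∀ {x n}, J x n → ∃ v, c.shared.valOf n = some v := by
    intro x n h
    obtain ⟨nd, hnd⟩ := Option.ne_none_iff_exists'.1 (hm.exists_of_J h)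
    exact ⟨_, hval hnd⟩
  have hout : ∀ {T : Prop} (s r : St) (d : Bool), T → d = true → Outcome T s r r d :=
    fun s r d h hd => .inl ⟨h, hd, rfl⟩
  cases hst with
  | updRead s x k n m hc hx =>
    rw [hJ _ rfl]
    cases hr
    obtain ⟨v, hv⟩ := hJval (hm.J_of_head hx)
    -- If the head is already linearized, it holds the current value and the read is executed now;
    -- otherwise it waits.
    by_cases hn : Lin n
    · obtain ⟨-, h1⟩ := hs.shared_head hx hn
      exact ⟨k v, true, 1, .initTest _ _ _ _ (.read _ _ _ _ _ _ _ hc (hm.J_of_head hx) hv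
        (hout _ _ _ hn rfl)), .inr ⟨rfl, impl_read hc (h1.trans hv)⟩,
        by simp [VState.mid], by simp [VState.progress, VState.initProgress]⟩
    · exact ⟨_, false, 0, .initTest _ _ _ _ (.read _ _ _ _ _ _ _ hc (hm.J_of_head hx) hv
        (.inr ⟨hn, rfl, rfl⟩)), .inl ⟨rfl, rfl⟩,
        by simp [VState.mid], by simp [VState.progress, VState.initProgress]⟩
  | updCas s x old new k n m hc hx =>
    rw [hJ _ rfl]
    cases hr
    have hJx := hm.J_of_head hx
    obtain ⟨v, hv⟩ := hJval hJx
    by_cases hne : v = old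
    · subst hne
      by_cases ho : new = v
      · subst ho
        by_cases hn : Lin n
        · obtain ⟨-, h1⟩ := hs.shared_head hx hn
          exact ⟨k true, true, 1, .initTest _ _ _ _ (.casEq _ _ _ _ _ _ _ hc hJx hv
            (hout _ _ _ hn rfl)), .inr ⟨rfl, impl_cas_eq hc (h1.trans hv)⟩,
            by simp [VState.mid], by simp [VState.progress, VState.initProgress]⟩
        · exact ⟨_, false, 0, .initTest _ _ _ _ (.casEq _ _ _ _ _ _ _ hc hJx hv
            (.inr ⟨hn, rfl, rfl⟩)), .inl ⟨rfl, rfl⟩,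
            by simp [VState.mid], by simp [VState.progress, VState.initProgress]⟩
      -- Nothing points to a head, so it is not superseded and the failure is still open.
      · refine ⟨_, false, 0, .initTest _ _ _ _ (.casLater _ _ _ _ _ _ _ _ hc hJx hv ho
          (.inr ⟨?_, rfl, rfl⟩)), .inl ⟨rfl, rfl⟩,
          by simp [VState.mid], by simp [VState.progress, VState.initProgress]⟩
        rintro ⟨n', h1, h2⟩
        obtain ⟨y, hy⟩ := hlin n' h1
        obtain ⟨h3, -⟩ := hm.next hy h2
        rw [hm.obj_unique h3 hJx] at hy
        exact hm.head_no_pred hx hy h2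
    · by_cases hn : Lin n
      · obtain ⟨-, h1⟩ := hs.shared_head hx hn
        exact ⟨k false, true, 1, .initTest _ _ _ _ (.casNe _ _ _ _ _ _ _ _ _ hc hJx hv hne
          (hout _ _ _ hn rfl)), .inr ⟨rfl, impl_cas_false hc (h1.trans hv) hne⟩,
          by simp [VState.mid], by simp [VState.progress, VState.initProgress]⟩
      · exact ⟨_, false, 0, .initTest _ _ _ _ (.casNe _ _ _ _ _ _ _ _ _ hc hJx hv hne
          (.inr ⟨hn, rfl, rfl⟩)), .inl ⟨rfl, rfl⟩,
          by simp [VState.mid], by simp [VState.progress, VState.initProgress]⟩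
  | updNew s v k n m hc hn =>
    cases hr
    exact ⟨_, false, 0, .newHead _ _ _ v hc (by simp [VMem.valOf]) (by simp [VMem.nextOf]),
      .inl ⟨rfl, rfl⟩, by simp [VState.mid], by simp [VState.progress]⟩
  | updLoc s s' m hc =>
    cases hr
    exact ⟨s', false, 1, .upd _, .inr ⟨rfl, impl_loc hc⟩, by simp [VState.mid],
      by simp [VState.progress]⟩
  | initTestNone n next m nd hn ht =>
    rw [hJ _ rfl]
    cases hr with
    | initTest _ _ _ _ hr =>
      exact ⟨_, d, 0, .initRead _ _ _ _ hr, .inl ⟨rfl, rfl⟩, by simp [VState.mid],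
        by simp only [VState.progress]; omega⟩
  | initTestSome n next m nd t hn ht =>
    rw [hJ _ rfl]
    cases hr with
    | initTest _ _ _ _ hr =>
      obtain ⟨d', h1, h2⟩ := hr.done (hdec' n ⟨t, by simp [VMem.tsOf, hn, ht]⟩)
      refine ⟨_, d', 0, h1, .inl ⟨rfl, rfl⟩, ?_, ?_⟩
      · have := (VState.mid_le : l'.mid ≤ 1)
        have := d.toNat_le
        change l'.mid + 0 + d.toNat ≤ 1 + 1 + d'.toNat
        omega
      · change 1 + 13 * d'.toNat + (l'.initProgress) ≤ _
        omega
  | initRead n next m =>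
    rw [hJ _ rfl]
    cases hr with
    | initRead _ _ _ _ hr =>
      exact ⟨_, d, 0, .initCas _ _ _ _ _ hr, .inl ⟨rfl, rfl⟩, by simp [VState.mid],
        by simp only [VState.progress]; omega⟩
  | initCasSucc n t next m nd hn ht =>
    cases hr with
    | initCas _ _ _ _ _ hr =>
      obtain ⟨d', h1, h2⟩ := (hr.ext hext hm hlin).done (hdec n ⟨t, by simp [VMem.tsOf]⟩)
      refine ⟨_, d', 0, h1, .inl ⟨rfl, rfl⟩, ?_, ?_⟩
      · have := (VState.mid_le : l'.mid ≤ 1)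
        have := d.toNat_le
        change l'.mid + 0 + d.toNat ≤ 1 + 1 + d'.toNat
        omega
      · change 1 + 13 * d'.toNat + (l'.initProgress + 2) ≤ _
        omega
  | initCasFail n t next m nd t' hn ht =>
    rw [hJ _ rfl]
    cases hr with
    | initCas _ _ _ _ _ hr =>
      obtain ⟨d', h1, h2⟩ := hr.done (hdec' n ⟨t', by simp [VMem.tsOf, hn, ht]⟩)
      refine ⟨_, d', 0, h1, .inl ⟨rfl, rfl⟩, ?_, ?_⟩
      · have := (VState.mid_le : l'.mid ≤ 1)
        have := d.toNat_le
        change l'.mid + 0 + d.toNat ≤ 1 + 1 + d'.toNat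
        omega
      · change 1 + 13 * d'.toNat + (l'.initProgress + 2) ≤ _
        omega
  | readRet n k m nd hn =>
    cases hr with
    | readRet _ _ _ _ hr =>
      cases hr with
      | read _ x _ s v _ _ hc hx hv ho =>
        obtain ⟨rfl, rfl⟩ := ho.of_true (hdec' n hloc.2)
        rw [hval hn] at hv
        cases hv
        exact ⟨_, false, 0, .upd _, .inl ⟨rfl, rfl⟩, by simp [VState.mid],
          by simp [VState.progress]⟩
  | casTestNe x old new k n m nd hn hv' =>
    cases hr with
    | casTest _ _ _ _ _ _ _ hr =>
      cases hr with
      | casNe _ _ _ _ _ s v _ _ hc hx hv hne ho =>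
        obtain ⟨rfl, rfl⟩ := ho.of_true (hdec' n hloc.2)
        exact ⟨_, true, 0, .casRet _ _ _, .inl ⟨rfl, rfl⟩, by simp [VState.mid],
          by simp [VState.progress]⟩
      | casEq _ _ _ _ s _ _ hc hx hv ho =>
        rw [hval hn] at hv
        exact (hv' (Option.some.inj hv)).elim
      | casLater _ _ _ _ _ s _ _ hc hx hv hne ho =>
        rw [hval hn] at hv
        exact (hv' (Option.some.inj hv)).elim
  | casTestEq x old new k n m nd hn hv' ho' =>
    cases hr with
    | casTest _ _ _ _ _ _ _ hr =>
      cases hr with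
      | casNe _ _ _ _ _ s v _ _ hc hx hv hne ho =>
        rw [hval hn] at hv
        exact (hne ((Option.some.inj hv).symm.trans hv')).elim
      | casEq _ _ _ _ s _ _ hc hx hv ho =>
        obtain ⟨rfl, rfl⟩ := ho.of_true (hdec' n hloc.2)
        exact ⟨_, true, 0, .casRet _ _ _, .inl ⟨rfl, rfl⟩, by simp [VState.mid],
          by simp [VState.progress]⟩
      | casLater _ _ _ _ _ s _ _ hc hx hv hne ho => exact (hne ho').elim
  | casTestNew x old new k n m nd hn hv' ho' =>
    rw [hJ _ rfl]
    cases hr with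
    | casTest _ _ _ _ _ _ _ hr =>
      cases hr with
      | casNe _ _ _ _ _ s v _ _ hc hx hv hne ho =>
        rw [hval hn] at hv
        exact (hne ((Option.some.inj hv).symm.trans hv')).elim
      | casEq _ _ _ _ s _ _ hc hx hv ho => exact (ho' rfl).elim
      | casLater _ _ _ _ _ s _ _ hc hx hv hne ho =>
        exact ⟨_, d, 0, .casNew _ _ _ _ _ _ _ _ hc hx hv hne ho, .inl ⟨rfl, rfl⟩,
          by simp [VState.mid], by simp only [VState.progress]; omega⟩
  | casNew x new k n m n' hn =>
    cases hr with
    | casNew _ old _ _ _ s _ _ hc hx hv hne ho =>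
      refine ⟨_, d, 0, .casAppend _ _ _ _ _ _ _ _ _ hc (.inl hx) ((hext.val_eq hx).trans hv) hne
        (by simp [VMem.valOf]) (by simp [VMem.nextOf])
        (by rw [superseded_ext hext hlin]; exact ho), .inl ⟨rfl, rfl⟩,
        by simp [VState.mid], by simp only [VState.progress]; omega⟩
  | casAppendSucc x k n n' m hx =>
    cases hr with
    | casAppend _ old new _ _ _ s _ _ hc hJn hv hne hv' hn ho =>
      -- The append succeeds only while `n` is the head, and then nothing supersedes it. So the
      -- failure has not been executed, and the process may change to waiting for its own version.
      have hsup : ¬ c.shared.Superseded Lin n := by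
        rintro ⟨n₁, h1, h2⟩
        obtain ⟨y, hy⟩ := hlin n₁ h1
        obtain ⟨h3, -⟩ := hm.next hy h2
        rw [hm.obj_unique h3 hJn] at hy
        exact hm.head_no_pred hx hy h2
      obtain ⟨rfl, rfl⟩ := ho.of_false hsup
      have hn' : ¬ Lin n' := fun h1 => by
        obtain ⟨y, hy⟩ := hlin n' h1
        exact hs.inv.priv hp (n := n') rfl y hy
      exact ⟨_, false, 0, .initTest _ _ _ _ (.own _ _ _ _ _ _ _ _ _ hc (.inr (by simp)) hv hv' hn
        (.inr ⟨hn', rfl, rfl⟩)), .inl ⟨rfl, rfl⟩, by simp [VState.mid],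
        by simp [VState.progress, VState.initProgress]⟩
  | casAppendFail x k n n' m n'' hx hne' =>
    rw [hJ _ rfl]
    cases hr with
    | casAppend _ old new _ _ _ s _ _ hc hJn hv hne hv' hn ho =>
      obtain ⟨n₁, h1, h2⟩ := hm.exists_pred hJn (by
        rw [hx]
        exact fun h => hne' (Option.some.inj h))
      exact ⟨_, d, 0, .casDelete _ _ _ _ _ _ _ _ _ _ hc hJn hv hne h1 h2 ho, .inl ⟨rfl, rfl⟩,
        by simp [VState.mid], by simp only [VState.progress]; omega⟩
  | casDelete x k n m =>
    cases hr with
    | casDelete _ old new _ n₁ _ n₂ s _ _ hc hx hv hne hx' hn ho =>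
      exact ⟨_, d, 0, .casHelp _ _ _ _ _ _ _ _ _ hc (.inl hx) ((hext.val_eq hx).trans hv) hne
        (.inl hx') ((hext.next_eq hx').trans hn) (by rw [superseded_ext hext hlin]; exact ho),
        .inl ⟨rfl, rfl⟩, by simp [VState.mid], by simp only [VState.progress]; omega⟩
  | casHelp x k n m hx =>
    rw [hJ _ rfl]
    cases hr with
    | casHelp _ old new _ n₁ n₂ s _ _ hc hJn hv hne hx' hn ho =>
      -- Either `n₂`, the version above `n₁`, is still the head that is read, or it is not the head
      -- any more; then it is decided and hence linearized.
      have : c.shared.nextOf n = some (some n₁) ∨ c.shared.Superseded Lin n₁ := by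
        by_cases h2 : c.shared.vhead x = some n₂
        · rw [hx] at h2
          cases h2
          exact .inl hn
        · exact .inr ⟨n₂, hdec' _ (hm.decided_of_not_head hx' h2), hn⟩
      exact ⟨_, d, 0, .initTest _ _ _ _ (.help _ _ _ _ _ _ _ _ _ hc hJn (hm.J_of_head hx) hv hne
        this ho), .inl ⟨rfl, rfl⟩, by simp [VState.mid],
        by simp only [VState.progress, VState.initProgress]; omega⟩
  | casRet x k b m =>
    cases hr
    exact ⟨_, false, 0, .upd _, .inl ⟨rfl, rfl⟩, by simp [VState.mid], by simp [VState.progress]⟩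
  | newHead n k x m hx =>
    cases hr with
    | newHead _ _ _ v hc hv hn =>
      have hn' : ¬ Lin n := fun h1 => by
        obtain ⟨y, hy⟩ := hlin n h1
        exact hs.inv.priv hp (n := n) rfl y hy
      exact ⟨_, false, 0, .initTest _ _ _ _ (.root _ _ _ _ _ _ _ hc (.inr (by simp)) hv hn
        (.inr ⟨hn', rfl, rfl⟩)), .inl ⟨rfl, rfl⟩, by simp [VState.mid],
        by simp [VState.progress, VState.initProgress]⟩
  | _ => simp [VState.IsQuery] at hnq

open Classical in
/-- The number of events of its current operation that each process has taken, after an event. -/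
noncomputable def countEvent (ℓ : Label P Op Ret) (e : P → ℕ) : P → ℕ :=
  fun p => if ℓ.proc = p then (match ℓ with | .inv _ _ => 1 | _ => e p + 1) else e p

open Classical in
/-- The number of events before the current operation of each process is reset by an invocation. -/
noncomputable def resetCount (ℓ : Label P Op Ret) (h : P → ℕ) : P → ℕ :=
  fun p => if ℓ.proc = p then (match ℓ with | .inv _ _ => 0 | _ => h p) else h p

/-- An event by which no version becomes linearized: it corresponds to at most one event of the
original data structure. -/
theorem Sim.event (hs : Sim D Q J Lin c hc e h) {ℓ : Label P Op Ret}
    (hst : (D.versioned Q).Step c ℓ c') (hdec : ∀ n, c'.shared.Decided n → Lin n) :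
    ∃ es hc', SoloPath D.impl Q hc es hc' ∧
      (es = [] ∧ (∀ p op, ℓ = .inv p op → op ∈ Q) ∧
          (∀ p r op l, ℓ = .res p r → c.procs p = some (op, l) → op ∈ Q) ∨ es = [(hc, ℓ)] ∧
        ((∃ p op, ℓ = .inv p op ∧ op ∉ Q) ∨
          ∃ op l, c.procs ℓ.proc = some (op, l) ∧ op ∉ Q)) ∧
      Sim D Q (fun x n => J x n ∨ c'.shared.vhead x = some n) Lin c' hc' (countEvent ℓ e)
        (fun p => resetCount ℓ h p + procCount p es) := by
  classical
  obtain ⟨hinv, hext⟩ := hs.inv.step hst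
  have hm := hs.inv.mem
  have hnoq : ∀ p op l, hc.procs p = some (op, l) → op ∈ Q → ℓ.proc = p :=
    fun p op l hp hop => ((hs.not_query hp).1 hop).elim
  have hlinJ : ∀ n, Lin n → ∃ x, J x n ∨ c'.shared.vhead x = some n :=
    fun n hn => (hs.lin_J n hn).imp fun _ => .inl
  have hshared : SharedRel (fun x n => J x n ∨ c'.shared.vhead x = some n) c'.shared Lin
      hc.shared := by
    intro x v
    rw [hs.shared x v, superseded_ext hext hs.lin_J]
    refine exists_congr fun n => ⟨?_, ?_⟩
    · rintro ⟨h1, h2, h3, h4⟩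
      exact ⟨.inl h1, h2, h3, (hext.val_eq h1).trans h4⟩
    · rintro ⟨h1, h2, h3, h4⟩
      obtain ⟨y, hy⟩ := hs.lin_J n h2
      have hyx : y = x := hinv.mem.obj_unique (.inl hy) h1
      subst hyx
      exact ⟨hy, h2, h3, (hext.val_eq hy).symm.trans h4⟩
  have hstay : ∀ p, ℓ.proc ≠ p → c'.procs p = c.procs p := fun p hp => hst.procs_of_ne hp
  have hrel : ∀ p op l hl e h, ℓ.proc ≠ p → c.procs p = some (op, l) →
      ProcRel D J c.shared Lin l hl e h →
      ProcRel D (fun x n => J x n ∨ c'.shared.vhead x = some n) c'.shared Lin l hl e h := by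
    rintro p op l hl e h hp hcp ⟨d, h1, h2, h3⟩
    refine ⟨d, h1.ext hext hm hs.lin_J ?_, h2, h3⟩
    intro n hn
    have hown := VState.ownNode_of_privNode hn
    cases hst with
    | inv => rfl
    | res => rfl
    | step q op' l₁ l₂ s' hq hst =>
      replace hp : q ≠ p := hp
      -- A node that is written is owned by the moving process, fresh, or a former head, so it is
      -- not the private node of another process.
      have key : ∀ (n' : ℕ) (o : Option (VNode V)),
          l₁.ownNode = some n' ∨ c.shared.node n' = none ∨ (∃ x, J x n') →
          Function.update c.shared.node n' o n = c.shared.node n := by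
        intro n' o h
        refine Function.update_of_ne ?_ _ _
        rintro rfl
        rcases h with h | h | ⟨x, hx⟩
        · exact hp (hs.inv.own_inj hq hcp h hown)
        · exact (hs.inv.loc hcp).own_exists hm hown h
        · exact hs.inv.priv hcp hn x hx
      have hloc := hs.inv.loc hq
      cases vstep_of_step hst with
      | updNew s v k n m hc hn => exact key _ _ (.inr (.inl hn))
      | casNew x new k n m n' hn => exact key _ _ (.inr (.inl hn))
      | casDelete x k n m => exact key _ _ (.inl rfl)
      | initCasSucc n t next m nd hn ht => exact key _ _ (.inr (.inr hloc.1.1))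
      | _ => rfl
  cases hst with
  | inv p op hp =>
    have hidle := hs.idle p hp
    by_cases hop : op ∈ Q
    · refine ⟨[], hc, .nil _, .inl ⟨rfl, by rintro p' op' h; cases h; exact hop, by simp⟩, hinv,
        hlinJ, hdec, hshared, ?_, ?_, ?_⟩
      · intro q hq
        by_cases hqp : p = q
        · exact hqp ▸ hidle
        · exact hs.idle q ((hstay q hqp).symm.trans hq)
      · intro q op' l hq hop'
        by_cases hqp : p = q
        · exact hqp ▸ hidle
        · exact hs.query q op' l ((hstay q hqp).symm.trans hq) hop'
      · intro q op' l hq hop'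
        by_cases hqp : p = q
        · subst hqp
          simp only [Function.update_self] at hq
          cases hq
          exact (hop' hop).elim
        · have hq' := (hstay q hqp).symm.trans hq
          obtain ⟨hl, h1, h2⟩ := hs.upd q op' l hq' hop'
          refine ⟨hl, h1, hrel q op' l hl _ _ hqp hq' ?_⟩
          simpa [countEvent, resetCount, Label.proc, hqp] using h2
    · have hstep := Impl.Step.inv (M := D.impl) hc p op hidle
      refine ⟨[(hc, .inv p op)], _, .single hstep hnoq, .inr ⟨rfl, .inl ⟨p, op, rfl, hop⟩⟩, hinv,
        hlinJ, hdec, hshared, ?_, ?_, ?_⟩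
      · intro q hq
        by_cases hqp : p = q
        · subst hqp
          simp at hq
        · have := hs.idle q ((hstay q hqp).symm.trans hq)
          simpa [Function.update_of_ne (Ne.symm hqp)] using this
      · intro q op' l hq hop'
        by_cases hqp : p = q
        · subst hqp
          simp only [Function.update_self] at hq
          cases hq
          exact (hop hop').elim
        · have := hs.query q op' l ((hstay q hqp).symm.trans hq) hop'
          simpa [Function.update_of_ne (Ne.symm hqp)] using this
      · intro q op' l hq hop'
        by_cases hqp : p = q
        · subst hqp
          simp only [Function.update_self] at hq
          cases hq
          refine ⟨D.start p op, by simp [CASStructure.impl], false, ?_, ?_, ?_⟩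
          · have : (D.versioned Q).start p op = .upd (D.start p op) := if_neg hop
            rw [this]
            exact .upd _
          all_goals
            have : (D.versioned Q).start p op = .upd (D.start p op) := if_neg hop
            simp [this, countEvent, resetCount, Label.proc, procCount_singleton, VState.mid,
              VState.progress]
        · have hq' := (hstay q hqp).symm.trans hq
          obtain ⟨hl, h1, h2⟩ := hs.upd q op' l hq' hop'
          refine ⟨hl, by simpa [Function.update_of_ne (Ne.symm hqp)] using h1,
            hrel q op' l hl _ _ hqp hq' ?_⟩
          simpa [countEvent, resetCount, Label.proc, hqp, procCount_singleton] using h2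
  | step p op l l' s' hp hst =>
    by_cases hop : op ∈ Q
    · have hidle := hs.query p op l hp hop
      refine ⟨[], hc, .nil _, .inl ⟨rfl, by simp, by simp⟩, hinv,
        hlinJ, hdec, hshared, ?_, ?_, ?_⟩
      · intro q hq
        by_cases hqp : p = q
        · exact hqp ▸ hidle
        · exact hs.idle q ((hstay q hqp).symm.trans hq)
      · intro q op' l hq hop'
        by_cases hqp : p = q
        · exact hqp ▸ hidle
        · exact hs.query q op' l ((hstay q hqp).symm.trans hq) hop'
      · intro q op' l hq hop'
        by_cases hqp : p = q
        · subst hqp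
          simp only [Function.update_self] at hq
          cases hq
          exact (hop' hop).elim
        · have hq' := (hstay q hqp).symm.trans hq
          obtain ⟨hl, h1, h2⟩ := hs.upd q op' l hq' hop'
          refine ⟨hl, h1, hrel q op' l hl _ _ hqp hq' ?_⟩
          simpa [countEvent, resetCount, Label.proc, hqp] using h2
    · obtain ⟨hl, h1, d, h2, h3, h4⟩ := hs.upd p op l hp hop
      obtain ⟨hl', d', δ, h5, h6, h7, h8⟩ := hs.vstep_locRel hp hop (vstep_of_step hst) hdec h2
      rcases h6 with ⟨rfl, rfl⟩ | ⟨rfl, h6⟩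
      · refine ⟨[], hc, .nil _, .inl ⟨rfl, by simp, by simp⟩, hinv,
          hlinJ, hdec, hshared, ?_, ?_, ?_⟩
        · intro q hq
          by_cases hqp : p = q
          · subst hqp
            simp at hq
          · exact hs.idle q ((hstay q hqp).symm.trans hq)
        · intro q op' l hq hop'
          by_cases hqp : p = q
          · subst hqp
            simp only [Function.update_self] at hq
            cases hq
            exact (hop hop').elim
          · exact hs.query q op' l ((hstay q hqp).symm.trans hq) hop'
        · intro q op' l₁ hq hop'
          by_cases hqp : p = q
          · subst hqp
            simp only [Function.update_self] at hq
            cases hq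
            refine ⟨hl', h1, d', h5, ?_, ?_⟩ <;>
              simp only [countEvent, resetCount, Label.proc, if_true, procCount_nil] <;> omega
          · have hq' := (hstay q hqp).symm.trans hq
            obtain ⟨hl, h1, h2⟩ := hs.upd q op' l₁ hq' hop'
            refine ⟨hl, h1, hrel q op' l₁ hl _ _ hqp hq' ?_⟩
            simpa [countEvent, resetCount, Label.proc, hqp] using h2
      · have hstep := Impl.Step.step (M := D.impl) hc p op hl hl' hc.shared h1 h6
        refine ⟨[(hc, .step p)], _, .single hstep hnoq, .inr ⟨rfl, .inr ⟨op, l, hp, hop⟩⟩, hinv,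
          hlinJ, hdec, hshared, ?_, ?_, ?_⟩
        · intro q hq
          by_cases hqp : p = q
          · subst hqp
            simp at hq
          · have := hs.idle q ((hstay q hqp).symm.trans hq)
            simpa [Function.update_of_ne (Ne.symm hqp)] using this
        · intro q op' l hq hop'
          by_cases hqp : p = q
          · subst hqp
            simp only [Function.update_self] at hq
            cases hq
            exact (hop hop').elim
          · have := hs.query q op' l ((hstay q hqp).symm.trans hq) hop'
            simpa [Function.update_of_ne (Ne.symm hqp)] using this
        · intro q op' l₁ hq hop'
          by_cases hqp : p = q
          · subst hqp
            simp only [Function.update_self] at hq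
            cases hq
            refine ⟨hl', by simp, d', h5, ?_, ?_⟩ <;>
              simp only [countEvent, resetCount, Label.proc, if_true, procCount_singleton] <;> omega
          · have hq' := (hstay q hqp).symm.trans hq
            obtain ⟨hl, h1, h2⟩ := hs.upd q op' l₁ hq' hop'
            refine ⟨hl, by simpa [Function.update_of_ne (Ne.symm hqp)] using h1,
              hrel q op' l₁ hl _ _ hqp hq' ?_⟩
            simpa [countEvent, resetCount, Label.proc, hqp, procCount_singleton] using h2
  | res p op l r hp hr =>
    by_cases hop : op ∈ Q
    · have hidle := hs.query p op l hp hop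
      refine ⟨[], hc, .nil _, .inl ⟨rfl, by simp, ?_⟩, hinv,
        hlinJ, hdec, hshared, ?_, ?_, ?_⟩
      · rintro p' r' op' l' h h'
        cases h
        rw [hp] at h'
        cases h'
        exact hop
      · intro q hq
        by_cases hqp : p = q
        · exact hqp ▸ hidle
        · exact hs.idle q ((hstay q hqp).symm.trans hq)
      · intro q op' l hq hop'
        by_cases hqp : p = q
        · exact hqp ▸ hidle
        · exact hs.query q op' l ((hstay q hqp).symm.trans hq) hop'
      · intro q op' l hq hop'
        by_cases hqp : p = q
        · subst hqp
          simp at hq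
        · have hq' := (hstay q hqp).symm.trans hq
          obtain ⟨hl, h1, h2⟩ := hs.upd q op' l hq' hop'
          refine ⟨hl, h1, hrel q op' l hl _ _ hqp hq' ?_⟩
          simpa [countEvent, resetCount, Label.proc, hqp] using h2
    · obtain ⟨hl, h1, d, h2, h3, h4⟩ := hs.upd p op l hp hop
      -- An update returns only in a state `upd`, where the two local states coincide.
      have hres : D.impl.result hl = some r := by
        rcases versioned_result.1 hr with ⟨s, rfl, hs⟩ | ⟨h', s, rfl, -⟩
        · cases h2
          exact impl_result.2 hs
        · exact (hop ((hs.inv.query_iff hp).2 trivial)).elim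
      have hstep := Impl.Step.res (M := D.impl) hc p op hl r h1 hres
      refine ⟨[(hc, .res p r)], _, .single hstep hnoq, .inr ⟨rfl, .inr ⟨op, l, hp, hop⟩⟩, hinv,
        hlinJ, hdec, hshared, ?_, ?_, ?_⟩
      · intro q hq
        by_cases hqp : p = q
        · subst hqp
          simp
        · have := hs.idle q ((hstay q hqp).symm.trans hq)
          simpa [Function.update_of_ne (Ne.symm hqp)] using this
      · intro q op' l hq hop'
        by_cases hqp : p = q
        · subst hqp
          simp at hq
        · have := hs.query q op' l ((hstay q hqp).symm.trans hq) hop'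
          simpa [Function.update_of_ne (Ne.symm hqp)] using this
      · intro q op' l₁ hq hop'
        by_cases hqp : p = q
        · subst hqp
          simp at hq
        · have hq' := (hstay q hqp).symm.trans hq
          obtain ⟨hl, h1, h2⟩ := hs.upd q op' l₁ hq' hop'
          refine ⟨hl, by simpa [Function.update_of_ne (Ne.symm hqp)] using h1,
            hrel q op' l₁ hl _ _ hqp hq' ?_⟩
          simpa [countEvent, resetCount, Label.proc, hqp, procCount_singleton] using h2

end

/-! ## Which versions are linearized -/

section

variable {P Op Ret V St : Type*}

/-- Within the run of length `N`, the timestamp of the node `n` becomes `t`. -/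
def FinalTs (N : ℕ∞) (cfg : ℕ → Config P Op (VMem V) (VState V St)) (n t : ℕ) : Prop :=
  ∃ j : ℕ, (j : ℕ∞) ≤ N ∧ (cfg j).shared.tsOf n = some (some t)

/-- The versions that are linearized before event `i`: those whose timestamps have been decided,
and those whose timestamps will become smaller than the current timestamp of the camera. -/
def Linearized (N : ℕ∞) (cfg : ℕ → Config P Op (VMem V) (VState V St)) (i n : ℕ) : Prop :=
  (∃ x, HeadBy cfg i x n) ∧
    ((cfg i).shared.Decided n ∨ ∃ t < (cfg i).shared.timestamp, FinalTs N cfg n t)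

variable {D : CASStructure P Op Ret V St} {Q : Set Op} {N : ℕ∞}
  {cfg : ℕ → Config P Op (VMem V) (VState V St)} {lab : ℕ → Label P Op Ret}

theorem VState.InitOK.ne_initCas {J : ℕ → ℕ → Prop} {m : VMem V} {n n' t : ℕ}
    {next next' : VState V St} (h : InitOK J m n next) : next ≠ .initCas n' t next' := by
  rintro rfl
  exact h.2

/-- How timestamps are decided. -/
theorem VStep.tsOf_eq {l l' : VState V St} {m m' : VMem V} (h : VStep D l m l' m') {n t : ℕ}
    (ht : m'.tsOf n = some (some t)) :
    m.tsOf n = some (some t) ∨ m.tsOf n = some none ∧ (∃ next, l = .initCas n t next) ∧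
      m'.timestamp = m.timestamp := by
  have key : ∀ (m : VMem V) (n' : ℕ) (nd : VNode V), nd.ts = none →
      VMem.tsOf { m with node := Function.update m.node n' (some nd) } n = some (some t) →
      m.tsOf n = some (some t) := by
    intro m n' nd hnd ht
    by_cases hn : n = n'
    · subst hn
      simp [VMem.tsOf, hnd] at ht
    · simpa [VMem.tsOf, Function.update_of_ne hn] using ht
  cases h with
  | updNew s v k n' m hc hn => exact .inl (by classical convert key m n' ⟨v, none, none⟩ rfl _; simpa using ht)
  | casNew x new k n₁ m n' hn =>
    exact .inl (by classical convert key m n' ⟨new, some n₁, none⟩ rfl _; simpa using ht)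
  | casDelete x k n' m =>
    left
    by_cases hn : n = n'
    · subst hn
      simp [VMem.tsOf] at ht
    · simpa [VMem.tsOf, Function.update_of_ne hn] using ht
  | initCasSucc n' t' next m nd hn hts =>
    by_cases hn' : n = n'
    · subst hn'
      simp only [VMem.tsOf, Function.update_self, Option.map_some, Option.some.injEq] at ht
      subst ht
      exact .inr ⟨by simp [VMem.tsOf, hn, hts], ⟨_, rfl⟩, rfl⟩
    · exact .inl (by simpa [VMem.tsOf, Function.update_of_ne hn'] using ht)
  | _ => exact .inl ht

/-- How the camera changes. -/
theorem VStep.timestamp_eq {l l' : VState V St} {m m' : VMem V} (h : VStep D l m l' m') :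
    m'.timestamp = m.timestamp ∨ (∃ s, l = .snapInc s m.timestamp) ∧
      m' = { m with timestamp := m.timestamp + 1 } := by
  cases h with
  | snapIncSucc s h m ht => exact .inr ⟨⟨s, ht ▸ rfl⟩, ht ▸ rfl⟩
  | _ => exact .inl rfl

/-- Only a process that has read the camera is about to set a timestamp. -/
theorem VStep.initCas_eq {J : ℕ → ℕ → Prop} {l : VState V St} {m m' : VMem V} {n t : ℕ}
    {next : VState V St} (h : VStep D l m (.initCas n t next) m') (hl : l.Inv J m) :
    m.timestamp = t ∧ m'.timestamp = m.timestamp := by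
  generalize hl' : VState.initCas n t next = l' at h
  cases h with
  | initRead n' next' m => cases hl'; exact ⟨rfl, rfl⟩
  | initTestSome n' next' m nd t' hn ht => exact (VState.InitOK.ne_initCas hl hl'.symm).elim
  | initCasSucc n' t' next' m nd hn ht => exact (VState.InitOK.ne_initCas hl.1 hl'.symm).elim
  | initCasFail n' t' next' m nd t'' hn ht => exact (VState.InitOK.ne_initCas hl.1 hl'.symm).elim
  | _ => cases hl'

theorem timestamp_mono (hrun : (D.versioned Q).IsRun N cfg lab) {i j : ℕ} (hij : i ≤ j)
    (hj : (j : ℕ∞) ≤ N) : (cfg i).shared.timestamp ≤ (cfg j).shared.timestamp :=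
  (D.ext_run hrun hij hj).time_le

/-- A timestamp smaller than that of the camera is decided, or a process is about to set it. -/
theorem ts_of_final (hrun : (D.versioned Q).IsRun N cfg lab) {i j n t : ℕ} (hij : i ≤ j)
    (hj : (j : ℕ∞) ≤ N) (ht : (cfg j).shared.tsOf n = some (some t))
    (hlt : t < (cfg i).shared.timestamp) :
    (cfg i).shared.tsOf n = some (some t) ∨
      ∃ p op next, (cfg i).procs p = some (op, .initCas n t next) := by
  by_contra hcon
  push Not at hcon
  obtain ⟨hcon₁, hcon₂⟩ := hcon
  -- If the timestamp is not `t` and no process is about to write `t`, this remains so: a process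
  -- that reads the camera from now on gets a value larger than `t`.
  suffices h : ∀ j, i ≤ j → (j : ℕ∞) ≤ N → (cfg j).shared.tsOf n ≠ some (some t) ∧
      ∀ p op next, (cfg j).procs p ≠ some (op, .initCas n t next) from (h j hij hj).1 ht
  clear hij hj ht j
  intro j hij
  induction j, hij using Nat.le_induction with
  | base => exact fun _ => ⟨hcon₁, hcon₂⟩
  | succ j hij ih =>
    intro hj
    have hjN : (j : ℕ∞) < N := lt_of_lt_of_le (by exact_mod_cast Nat.lt_succ_self j) hj
    obtain ⟨ih₁, ih₂⟩ := ih hjN.le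
    have hst := hrun.2 j hjN
    have hinv := D.configInv_run hrun hjN.le
    have hle := timestamp_mono hrun hij hjN.le
    constructor
    · intro ht
      generalize cfg (j + 1) = c' at hst ht
      generalize lab j = ℓ at hst
      cases hst with
      | inv p op h => exact ih₁ ht
      | res p op l r h hr => exact ih₁ ht
      | step p op l l' s' h hs =>
        rcases (vstep_of_step hs).tsOf_eq ht with h1 | ⟨-, ⟨next, rfl⟩, -⟩
        · exact ih₁ h1
        · exact ih₂ p op next h
    · intro p op next hp
      by_cases hlp : (lab j).proc = p
      · cases hlab : lab j with
        | inv q op' =>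
          rw [hlab] at hst hlp
          obtain rfl : q = p := hlp
          have := hst.inv_iff.2.1
          rw [hp] at this
          have hstart : (D.versioned Q).start q op' = open Classical in
            if op' ∈ Q then .snapRead (D.start q op') else .upd (D.start q op') := rfl
          rw [hstart] at this
          split_ifs at this <;> cases this
        | step q =>
          rw [hlab] at hst hlp
          obtain rfl : q = p := hlp
          obtain ⟨op', l, l', h1, h2, h3⟩ := hst.step_iff
          rw [hp] at h3
          cases h3
          have := (vstep_of_step h2).initCas_eq (hinv.loc h1)
          omega
        | res q r =>
          rw [hlab] at hst hlp
          obtain rfl : q = p := hlp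
          obtain ⟨-, -, -, -, h1, -⟩ := hst.res_iff
          simp [hp] at h1
      · rw [hst.procs_of_ne hlp] at hp
        exact ih₂ p op next hp

theorem Linearized.mono (hrun : (D.versioned Q).IsRun N cfg lab) {i j n : ℕ} (hij : i ≤ j)
    (hj : (j : ℕ∞) ≤ N) (h : Linearized N cfg i n) : Linearized N cfg j n := by
  obtain ⟨⟨x, hx⟩, h⟩ := h
  have hext := D.ext_run hrun hij hj
  refine ⟨⟨x, hx.mono hij⟩, ?_⟩
  rcases h with h | ⟨t, ht, h⟩
  · exact .inl (hext.decided hx h)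
  · exact .inr ⟨t, ht.trans_le hext.time_le, h⟩

/-- The events that linearize a version. -/
theorem Linearized.of_succ (hrun : (D.versioned Q).IsRun N cfg lab) {i n : ℕ} (hi : (i : ℕ∞) < N)
    (h : Linearized N cfg (i + 1) n) :
    Linearized N cfg i n ∨ (∃ x, HeadBy cfg i x n) ∧
      ((∃ p op t next, lab i = .step p ∧ (cfg i).procs p = some (op, .initCas n t next) ∧
          (cfg (i + 1)).shared.timestamp = (cfg i).shared.timestamp) ∨
        (∃ p, lab i = .step p) ∧
          (cfg (i + 1)).shared =
            { (cfg i).shared with timestamp := (cfg i).shared.timestamp + 1 }) := by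
  have hi' : ((i + 1 : ℕ) : ℕ∞) ≤ N := by exact_mod_cast Order.add_one_le_of_lt hi
  have hst := hrun.2 i hi
  have hinv := D.configInv_run hrun hi.le
  obtain ⟨⟨x, hx⟩, h⟩ := h
  -- a version whose final timestamp is smaller than that of the camera
  have hold : ∀ t, t < (cfg i).shared.timestamp → FinalTs N cfg n t → Linearized N cfg i n := by
    rintro t ht ⟨j, hj, h1⟩
    rcases le_total i j with hij | hij
    · rcases ts_of_final hrun hij hj h1 ht with h2 | ⟨p, op, next, h2⟩
      · exact ⟨(hinv.mem.J_of_ts h2).1, .inl ⟨t, h2⟩⟩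
      · exact ⟨(hinv.loc h2).1.1, .inr ⟨t, ht, j, hj, h1⟩⟩
    · obtain ⟨y, hy⟩ := ((D.configInv_run hrun hj).mem.J_of_ts h1).1
      exact ⟨⟨y, hy.mono hij⟩, .inl ⟨t, (D.ext_run hrun hij hi.le).ts_eq hy h1⟩⟩
  have hdec : ∀ t, (cfg i).shared.tsOf n = some (some t) → Linearized N cfg i n := fun t ht =>
    ⟨(hinv.mem.J_of_ts ht).1, .inl ⟨t, ht⟩⟩
  cases hlab : lab i with
  | inv p op =>
    rw [hlab] at hst
    have hsh := hst.inv_iff.2.2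
    rcases h with ⟨t, ht⟩ | ⟨t, ht, h⟩
    · exact .inl (hdec t (hsh ▸ ht))
    · exact .inl (hold t (hsh ▸ ht) h)
  | res p r =>
    rw [hlab] at hst
    obtain ⟨-, -, -, -, -, hsh⟩ := hst.res_iff
    rcases h with ⟨t, ht⟩ | ⟨t, ht, h⟩
    · exact .inl (hdec t (hsh ▸ ht))
    · exact .inl (hold t (hsh ▸ ht) h)
  | step p =>
    rw [hlab] at hst
    obtain ⟨op, l, l', h1, h2, h3⟩ := hst.step_iff
    have hv := vstep_of_step h2
    rcases h with ⟨t, ht⟩ | ⟨t, ht, h⟩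
    · rcases hv.tsOf_eq ht with h4 | ⟨-, ⟨next, rfl⟩, h5⟩
      · exact .inl (hdec t h4)
      · exact .inr ⟨(hinv.loc h1).1.1, .inl ⟨p, op, t, next, rfl, h1, h5⟩⟩
    · rcases hv.timestamp_eq with h4 | ⟨-, h4⟩
      · exact .inl (hold t (h4 ▸ ht) h)
      · rcases hx with ⟨j, hj, hx⟩
        refine .inr ⟨⟨x, ?_⟩, .inr ⟨⟨p, rfl⟩, h4⟩⟩
        rcases Nat.le_succ_iff.1 hj with hj | rfl
        · exact ⟨j, hj, hx⟩
        · exact ⟨i, le_rfl, by rw [h4] at hx; exact hx⟩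

end

/-! ### Linearizing finitely many versions at once. -/

section

variable {P Op Ret V St : Type*} {D : CASStructure P Op Ret V St} {Q : Set Op} {J : ℕ → ℕ → Prop}
  {Lin : ℕ → Prop} {c c' : Config P Op (VMem V) (VState V St)}
  {hc : Config P Op (ℕ → Option V) St} {e h : P → ℕ}

/-- A finite set of versions is linearized. -/
theorem Sim.linearize_set [Finite P] (hs : Sim D Q J Lin c hc e h) {T : Set ℕ} (hfin : T.Finite)
    (hT : ∀ n ∈ T, ∃ x, J x n) :
    ∃ es hc', SoloPath D.impl Q hc es hc' ∧
      (∀ a ∈ es, ∃ p op l, a.2 = .step p ∧ c.procs p = some (op, l) ∧ op ∉ Q) ∧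
      Sim D Q J (fun n => Lin n ∨ n ∈ T) c hc' e (fun p => h p + procCount p es) := by
  induction T, hfin using Set.Finite.induction_on with
  | empty => exact ⟨[], hc, .nil _, by simp, by simpa using hs⟩
  | @insert n T hn _ ih =>
    obtain ⟨es, hc', h1, h2, h3⟩ := ih fun n hn => hT n (.inr hn)
    by_cases hlin : Lin n
    · refine ⟨es, hc', h1, h2, ?_⟩
      convert h3 using 2 with n'
      simp only [Set.mem_insert_iff]
      constructor
      · rintro (h | rfl | h)
        exacts [.inl h, .inl hlin, .inr h]
      · rintro (h | h)
        exacts [.inl h, .inr (.inr h)]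
    · obtain ⟨x, hx⟩ := hT n (.inl rfl)
      obtain ⟨es', hc'', h4, h5, h6⟩ := h3.linearize hx (n₀ := n) (by tauto)
      refine ⟨es ++ es', hc'', h1.append h4, ?_, ?_⟩
      · intro a ha
        rcases List.mem_append.1 ha with ha | ha
        exacts [h2 a ha, h5 a ha]
      · convert h6 using 2 with n' p
        · simp only [Set.mem_insert_iff]
          tauto
        · rw [procCount_append, add_assoc]

/-- Versions that are not linearized belong to pending operations. -/
theorem Sim.finite_not_lin [Finite P] (hs : Sim D Q J Lin c hc e h) :
    {n | (∃ x, J x n) ∧ ¬ Lin n}.Finite := by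
  refine (Set.finite_range fun p => (c.procs p).bind fun a => a.2.ownNode).preimage
    (f := fun n : ℕ => some n) (fun _ _ _ _ h => Option.some.inj h) |>.subset ?_
  rintro n ⟨⟨x, hx⟩, hn⟩
  obtain ⟨p, op, l, h1, h2⟩ := hs.inv.own_of_undecided hx
    ((hs.inv.mem.undecided_or_decided hx).resolve_right fun hd => hn (hs.lin_of_decided n hd))
  exact ⟨p, by simp [h1, h2]⟩

end

/-! ## Solo executions of queries -/

section

variable {P Op Ret V St : Type*}

/-- An operation that runs alone with the shared memory `C` gets from one local state to another by
`k` instructions, which are reads and local steps. -/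
inductive CASStructure.ReadRun (D : CASStructure P Op Ret V St) (C : ℕ → Option V) (s₀ : St) :
    ℕ → St → Prop
  | refl : ReadRun D C s₀ 0 s₀
  | read (k s x κ v) (h : ReadRun D C s₀ k s) (hc : D.code s = .read x κ) (hx : C x = some v) :
      ReadRun D C s₀ (k + 1) (κ v)
  | loc (k s s') (h : ReadRun D C s₀ k s) (hc : D.code s = .loc s') : ReadRun D C s₀ (k + 1) s'

/-- A complete solo execution of the operation `q` by the process `p`, with the response `r`. -/
def IsBlock {C : Type*} (p : P) (q : Op) (r : Ret) (es : List (C × Label P Op Ret)) : Prop :=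
  ∃ c₁ mid c₂, es = (c₁, .inv p q) :: (mid ++ [(c₂, .res p r)]) ∧ ∀ e ∈ mid, e.2 = .step p

/-- The events of the process `p` form a complete solo execution of `q` with the response `r`. -/
def HasBlock {C : Type*} (p : P) (q : Op) (r : Ret) (es : List (C × Label P Op Ret)) : Prop :=
  ∃ pre blk post, es = pre ++ (blk ++ post) ∧ IsBlock p q r blk ∧ (∀ e ∈ pre, e.2.proc ≠ p) ∧
    ∀ e ∈ post, e.2.proc ≠ p

/-- An event of an instance of `q` by the process `p`. -/
def IsEventOf {S L : Type*} (p : P) (q : Op) (e : Config P Op S L × Label P Op Ret) : Prop :=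
  e.2 = .inv p q ∨ e.2.proc = p ∧ ∃ l, e.1.procs p = some (q, l)

theorem IsEventOf.proc {S L : Type*} {p : P} {q : Op} {e : Config P Op S L × Label P Op Ret}
    (h : IsEventOf p q e) : e.2.proc = p := by
  rcases h with h | h
  · rw [h]; rfl
  · exact h.1

theorem HasBlock.append_left {C : Type*} {p : P} {q : Op} {r : Ret}
    {es es' : List (C × Label P Op Ret)} (h : HasBlock p q r es) (h' : ∀ e ∈ es', e.2.proc ≠ p) :
    HasBlock p q r (es' ++ es) := by
  obtain ⟨pre, blk, post, rfl, h1, h2, h3⟩ := h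
  refine ⟨es' ++ pre, blk, post, by simp, h1, fun e he => ?_, h3⟩
  rcases List.mem_append.1 he with he | he
  exacts [h' e he, h2 e he]

theorem HasBlock.append_right {C : Type*} {p : P} {q : Op} {r : Ret}
    {es es' : List (C × Label P Op Ret)} (h : HasBlock p q r es) (h' : ∀ e ∈ es', e.2.proc ≠ p) :
    HasBlock p q r (es ++ es') := by
  obtain ⟨pre, blk, post, rfl, h1, h2, h3⟩ := h
  refine ⟨pre, blk, post ++ es', by simp, h1, h2, fun e he => ?_⟩
  rcases List.mem_append.1 he with he | he
  exacts [h3 e he, h' e he]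

variable {D : CASStructure P Op Ret V St} {Q : Set Op} {c : Config P Op (ℕ → Option V) St}

open Classical in
theorem SoloPath.readRun {p : P} {q : Op} (hp : c.procs p = none)
    (hnoq : ∀ p op l, c.procs p = some (op, l) → op ∉ Q) {k : ℕ} {s : St}
    (h : D.ReadRun c.shared (D.start p q) k s) :
    ∃ mid, SoloPath D.impl Q c ((c, .inv p q) :: mid)
        ⟨c.shared, Function.update c.procs p (some (q, s))⟩ ∧
      (∀ e ∈ mid, e.2 = .step p ∧ IsEventOf p q e) ∧ mid.length = k := by
  have hsolo : ∀ s p' op l, Function.update c.procs p (some (q, s)) p' = some (op, l) → op ∈ Q →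
      p = p' := by
    intro s p' op l h hop
    by_contra hne
    rw [Function.update_of_ne (Ne.symm hne)] at h
    exact hnoq _ _ _ h hop
  have hext : ∀ {k s s'}, (∃ mid, SoloPath D.impl Q c ((c, .inv p q) :: mid)
        ⟨c.shared, Function.update c.procs p (some (q, s))⟩ ∧
      (∀ e ∈ mid, e.2 = .step p ∧ IsEventOf p q e) ∧ mid.length = k) →
      D.impl.step s c.shared s' c.shared →
      ∃ mid, SoloPath D.impl Q c ((c, .inv p q) :: mid)
        ⟨c.shared, Function.update c.procs p (some (q, s'))⟩ ∧
      (∀ e ∈ mid, e.2 = .step p ∧ IsEventOf p q e) ∧ mid.length = k + 1 := by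
    rintro k s s' ⟨mid, h1, h2, rfl⟩ hst
    have hstep := Impl.Step.step (M := D.impl)
      ⟨c.shared, Function.update c.procs p (some (q, s))⟩ p q s s' c.shared (by simp) hst
    simp only [Function.update_idem] at hstep
    refine ⟨mid ++ [(⟨c.shared, Function.update c.procs p (some (q, s))⟩, .step p)],
      by simpa using h1.append (.single hstep (hsolo s)), fun e he => ?_, by simp⟩
    rcases List.mem_append.1 he with he | he
    · exact h2 e he
    · rw [List.mem_singleton.1 he]
      exact ⟨rfl, .inr ⟨rfl, s, by simp⟩⟩
  induction h with
  | refl =>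
    refine ⟨[], .single (.inv c p q hp) ?_, by simp, rfl⟩
    exact fun p' op l h hop => (hnoq _ _ _ h hop).elim
  | read k s x κ v h hc hx ih => exact hext ih (impl_read hc hx)
  | loc k s s' h hc ih => exact hext ih (impl_loc hc)

/-- A query only reads, and after its return the process is idle again, so the block ends in the
configuration where it began. Hence blocks can be inserted without disturbing the simulation. -/
theorem exists_queryBlock {p : P} {q : Op} (hp : c.procs p = none)
    (hnoq : ∀ p op l, c.procs p = some (op, l) → op ∉ Q) {k : ℕ} {s : St} {r : Ret}
    (h : D.ReadRun c.shared (D.start p q) k s) (hr : D.code s = .ret r) :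
    ∃ es, SoloPath D.impl Q c es c ∧ IsBlock p q r es ∧ ∀ e ∈ es, IsEventOf p q e := by
  classical
  obtain ⟨mid, h1, h2, -⟩ := SoloPath.readRun hp hnoq h
  have hstep := Impl.Step.res (M := D.impl)
    ⟨c.shared, Function.update c.procs p (some (q, s))⟩ p q s r (by simp) (impl_result.2 hr)
  have hc : Function.update c.procs p none = c.procs := by
    rw [← hp, Function.update_eq_self]
  simp only [Function.update_idem, hc] at hstep
  refine ⟨_, h1.append (.single hstep ?_), ⟨c, mid, _, by simp; rfl, fun e he => (h2 e he).1⟩, ?_⟩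
  · intro p' op l h hop
    by_contra hne
    replace hne : p ≠ p' := hne
    simp only [Function.update_of_ne (Ne.symm hne)] at h
    exact hnoq _ _ _ h hop
  · intro e he
    rcases List.mem_append.1 he with he | he
    · rcases List.mem_cons.1 he with rfl | he
      · exact .inl rfl
      · exact (h2 e he).2
    · rw [List.mem_singleton.1 he]
      exact .inr ⟨rfl, s, by simp⟩

/-- Several processes run queries, one after another. -/
theorem exists_queryBlocks [Finite P] (hnoq : ∀ p op l, c.procs p = some (op, l) → op ∉ Q)
    (Z : P → Option (Op × Ret)) (hZ : ∀ p q r, Z p = some (q, r) → c.procs p = none ∧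
      ∃ k s, D.ReadRun c.shared (D.start p q) k s ∧ D.code s = .ret r) :
    ∃ es, SoloPath D.impl Q c es c ∧ (∀ p q r, Z p = some (q, r) → HasBlock p q r es) ∧
      ∀ e ∈ es, ∃ p q r, Z p = some (q, r) ∧ IsEventOf p q e := by
  suffices h : ∀ T : Set P, ∃ es, SoloPath D.impl Q c es c ∧
      (∀ p ∈ T, ∀ q r, Z p = some (q, r) → HasBlock p q r es) ∧
      ∀ e ∈ es, ∃ p ∈ T, ∃ q r, Z p = some (q, r) ∧ IsEventOf p q e by
    obtain ⟨es, h1, h2, h3⟩ := h Set.univ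
    refine ⟨es, h1, fun p => h2 p trivial, fun e he => ?_⟩
    obtain ⟨p, -, h⟩ := h3 e he
    exact ⟨p, h⟩
  intro T
  induction T, T.toFinite using Set.Finite.induction_on with
  | empty => exact ⟨[], .nil c, by simp, by simp⟩
  | @insert a T ha _ ih =>
    obtain ⟨es, h1, h2, h3⟩ := ih
    cases hza : Z a with
    | none =>
      refine ⟨es, h1, ?_, fun e he => ?_⟩
      · rintro p (rfl | hp) q r hz
        · simp [hza] at hz
        · exact h2 p hp q r hz
      · obtain ⟨p, hp, h⟩ := h3 e he
        exact ⟨p, .inr hp, h⟩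
    | some z =>
      obtain ⟨q, r⟩ := z
      obtain ⟨h4, k, s, h5, h6⟩ := hZ a q r hza
      obtain ⟨blk, h7, h8, h9⟩ := exists_queryBlock h4 hnoq h5 h6
      refine ⟨es ++ blk, h1.append h7, ?_, fun e he => ?_⟩
      · rintro p (rfl | hp) q' r' hz
        · rw [hza] at hz
          cases hz
          refine HasBlock.append_left ⟨[], blk, [], by simp, h8, by simp, by simp⟩ fun e he h => ?_
          obtain ⟨p', hp', q', r', -, h10⟩ := h3 e he
          rw [h10.proc] at h
          exact ha (h ▸ hp')
        · refine (h2 p hp q' r' hz).append_right fun e he h => ?_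
          rw [(h9 e he).proc] at h
          exact ha (h ▸ hp)
      · rcases List.mem_append.1 he with he | he
        · obtain ⟨p, hp, h⟩ := h3 e he
          exact ⟨p, .inr hp, h⟩
        · exact ⟨a, .inl rfl, q, r, hza, h9 e he⟩

end

/-! ## The events of the original data structure that correspond to one event -/

/-- The event `ℓ` is an invocation or response of an operation that does not belong to `Q`. -/
def IsUpdateEvent {P Op Ret S L : Type*} (Q : Set Op) (c : Config P Op S L)
    (ℓ : Label P Op Ret) : Prop :=
  (∃ p op, ℓ = .inv p op ∧ op ∉ Q) ∨
    ∃ p r op l, ℓ = .res p r ∧ c.procs p = some (op, l) ∧ op ∉ Q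

/-- The event `ℓ` in the configuration `c` of the transformed data structure corresponds to the
path `es` of the original one; `Z` are the queries that are executed. -/
structure IsSegment {P Op Ret V St : Type*} (D : CASStructure P Op Ret V St) (Q : Set Op)
    (Z : P → Option (Op × Ret)) (c : Config P Op (VMem V) (VState V St)) (ℓ : Label P Op Ret)
    (hc : Config P Op (ℕ → Option V) St)
    (es : List (Config P Op (ℕ → Option V) St × Label P Op Ret))
    (hc' : Config P Op (ℕ → Option V) St) : Prop where
  path : SoloPath D.impl Q hc es hc'
  entry : ∀ e ∈ es, e = (hc, ℓ) ∧ es = [(hc, ℓ)] ∧ IsUpdateEvent Q c ℓ ∨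
    (∃ p op l, e.2 = .step p ∧ c.procs p = some (op, l) ∧ op ∉ Q) ∨
    ∃ p q r, Z p = some (q, r) ∧ IsEventOf p q e
  event : IsUpdateEvent Q c ℓ → es = [(hc, ℓ)]
  block : ∀ p q r, Z p = some (q, r) → HasBlock p q r es

section

variable {P Op Ret V St : Type*} {D : CASStructure P Op Ret V St} {Q : Set Op}

/-- The counters matter only for pending updates; what the query blocks add to the counters of their
processes is irrelevant. -/
theorem Sim.congr_counts {J : ℕ → ℕ → Prop} {Lin : ℕ → Prop}
    {c : Config P Op (VMem V) (VState V St)} {hc : Config P Op (ℕ → Option V) St}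
    {e h e' h' : P → ℕ} (hs : Sim D Q J Lin c hc e h)
    (hcnt : ∀ p op l, c.procs p = some (op, l) → op ∉ Q → e' p = e p ∧ h' p = h p) :
    Sim D Q J Lin c hc e' h' :=
  { hs with
    upd := fun p op l hp hop => by
      rw [(hcnt p op l hp hop).1, (hcnt p op l hp hop).2]
      exact hs.upd p op l hp hop }

variable {N : ℕ∞} {cfg : ℕ → Config P Op (VMem V) (VState V St)} {lab : ℕ → Label P Op Ret}
  {hc : Config P Op (ℕ → Option V) St} {e h : P → ℕ} {i : ℕ}

theorem resetCount_step (p : P) (h : P → ℕ) :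
    resetCount (.step p : Label P Op Ret) h = h := by
  funext q
  simp [resetCount]

/-- An event of the camera may linearize many versions, the CAS in `initTS` at most one, and other
events none. Queries are executed only with an event of the camera, after its versions, so that they
see exactly the versions that belong to their snapshot. -/
theorem Sim.segment [Finite P] (hrun : (D.versioned Q).IsRun N cfg lab) (hi : (i : ℕ∞) < N)
    (hs : Sim D Q (HeadBy cfg i) (Linearized N cfg i) (cfg i) hc e h) (Z : P → Option (Op × Ret))
    (hZ : ∀ p q r, Z p = some (q, r) → q ∈ Q ∧ (∃ l, (cfg i).procs p = some (q, l)) ∧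
      (cfg i).shared.timestamp < (cfg (i + 1)).shared.timestamp ∧
      ∀ hc e h, Sim D Q (HeadBy cfg (i + 1)) (Linearized N cfg (i + 1)) (cfg (i + 1)) hc e h →
        ∃ k s, D.ReadRun hc.shared (D.start p q) k s ∧ D.code s = .ret r) :
    ∃ es hc', IsSegment D Q Z (cfg i) (lab i) hc es hc' ∧
      Sim D Q (HeadBy cfg (i + 1)) (Linearized N cfg (i + 1)) (cfg (i + 1)) hc'
        (countEvent (lab i) e) (fun p => resetCount (lab i) h p + procCount p es) := by
  have hst := hrun.2 i hi
  have hi' : ((i + 1 : ℕ) : ℕ∞) ≤ N := by exact_mod_cast Order.add_one_le_of_lt hi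
  have hdec : ∀ n, (cfg (i + 1)).shared.Decided n → Linearized N cfg (i + 1) n :=
    fun n hn => ⟨((D.configInv_run hrun hi').mem.J_of_ts hn.choose_spec).1, .inl hn⟩
  have hmono : ∀ n, Linearized N cfg i n → Linearized N cfg (i + 1) n :=
    fun n hn => hn.mono hrun (Nat.le_succ i) hi'
  have hupd : ∀ {ℓ : Label P Op Ret}, (∃ p, ℓ = .step p) → ¬ IsUpdateEvent Q (cfg i) ℓ := by
    rintro ℓ ⟨p, rfl⟩ (⟨_, _, h, -⟩ | ⟨_, _, _, _, h, -⟩) <;> cases h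
  have hevent : ∀ {hc : Config P Op (ℕ → Option V) St} {es} {Z : P → Option (Op × Ret)},
      (es = [] ∧ (∀ p op, lab i = .inv p op → op ∈ Q) ∧
          (∀ p r op l, lab i = .res p r → (cfg i).procs p = some (op, l) → op ∈ Q) ∨
        es = [(hc, lab i)] ∧ ((∃ p op, lab i = .inv p op ∧ op ∉ Q) ∨
          ∃ op l, (cfg i).procs (lab i).proc = some (op, l) ∧ op ∉ Q)) →
      (∀ a ∈ es, a = (hc, lab i) ∧ es = [(hc, lab i)] ∧ IsUpdateEvent Q (cfg i) (lab i) ∨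
        (∃ p op l, a.2 = .step p ∧ (cfg i).procs p = some (op, l) ∧ op ∉ Q) ∨
        ∃ p q r, Z p = some (q, r) ∧ IsEventOf p q a) ∧
      (IsUpdateEvent Q (cfg i) (lab i) → es = [(hc, lab i)]) := by
    intro hc es Z h
    rcases h with ⟨rfl, h1, h2⟩ | ⟨rfl, h1⟩
    · refine ⟨by simp, ?_⟩
      rintro (⟨p, op, h3, h4⟩ | ⟨p, r, op, l, h3, h4, h5⟩)
      · exact (h4 (h1 _ _ h3)).elim
      · exact (h5 (h2 _ _ _ _ h3 h4)).elim
    · refine ⟨fun a ha => ?_, fun _ => rfl⟩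
      rw [List.mem_singleton.1 ha]
      cases hl : lab i with
      | inv p op =>
        rcases h1 with h1 | ⟨op', l, h1, h2⟩
        · exact .inl ⟨rfl, rfl, .inl (hl ▸ h1)⟩
        · rw [hl] at hst h1
          have := hst.inv_iff.1
          rw [show (Label.inv p op : Label P Op Ret).proc = p from rfl, this] at h1
          cases h1
      | step p =>
        rw [hl] at h1
        rcases h1 with ⟨_, _, h, -⟩ | ⟨op, l, h1, h2⟩
        · cases h
        · exact .inr (.inl ⟨p, op, l, rfl, h1, h2⟩)
      | res p r =>
        rw [hl] at h1
        rcases h1 with ⟨_, _, h, -⟩ | ⟨op, l, h1, h2⟩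
        · cases h
        · exact .inl ⟨rfl, rfl, .inr ⟨p, r, op, l, rfl, h1, h2⟩⟩
  by_cases hclock : (∃ p, lab i = .step p) ∧ (cfg (i + 1)).shared =
      { (cfg i).shared with timestamp := (cfg i).shared.timestamp + 1 }
  · -- the camera advances
    obtain ⟨⟨p₀, hp₀⟩, hclock⟩ := hclock
    have hdec' : ∀ n, (cfg (i + 1)).shared.Decided n → Linearized N cfg i n := by
      intro n hn
      have hn' : (cfg i).shared.Decided n := by
        rw [hclock] at hn
        exact hn
      exact hs.lin_of_decided n hn'
    obtain ⟨es₁, hc₁, h1, h2, h3⟩ := hs.event hst hdec'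
    rw [← headBy_succ] at h3
    have hfin : {n | Linearized N cfg (i + 1) n ∧ ¬ Linearized N cfg i n}.Finite :=
      h3.finite_not_lin.subset fun n hn => ⟨hn.1.1, hn.2⟩
    -- These versions will get a timestamp equal to the old value of the camera. They must be
    -- linearized before the queries, but need not be decided yet; their owners are pending, so
    -- there are finitely many.
    obtain ⟨es₂, hc₂, h4, h5, h6⟩ := h3.linearize_set hfin fun n hn => hn.1.1
    have hLin : (fun n => Linearized N cfg i n ∨
        n ∈ {n | Linearized N cfg (i + 1) n ∧ ¬ Linearized N cfg i n}) =
        Linearized N cfg (i + 1) := by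
      funext n
      have := hmono n
      simp only [Set.mem_ofPred_eq]
      exact propext (by tauto)
    rw [hLin] at h6
    have hpend : ∀ p op l, (cfg (i + 1)).procs p = some (op, l) →
        ∃ l', (cfg i).procs p = some (op, l') := by
      intro p op l hp
      by_cases hpp : (lab i).proc = p
      · rw [hp₀] at hpp hst
        obtain rfl : p₀ = p := hpp
        obtain ⟨op', l₁, l₂, h7, -, h8⟩ := hst.step_iff
        rw [hp] at h8
        cases h8
        exact ⟨_, h7⟩
      · exact ⟨l, by rw [← hst.procs_of_ne hpp, hp]⟩
    have hpend' : ∀ p op l, (cfg i).procs p = some (op, l) →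
        ∃ l', (cfg (i + 1)).procs p = some (op, l') := fun p op l hp =>
      hrun.pending (Nat.le_succ i) hi' hp fun k r h7 h8 h9 => by
        obtain rfl : k = i := by omega
        rw [hp₀] at h9
        cases h9
    have hidle : ∀ p q r, Z p = some (q, r) → hc₂.procs p = none := by
      intro p q r hz
      obtain ⟨hq, ⟨l, hl⟩, -⟩ := hZ p q r hz
      obtain ⟨l', hl'⟩ := hpend' p q l hl
      exact h6.query p q l' hl' hq
    obtain ⟨es₃, h7, h8, h9⟩ := exists_queryBlocks (D := D)
      (fun p op l hp => (h6.not_query hp).1) Z fun p q r hz =>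
        ⟨hidle p q r hz, (hZ p q r hz).2.2.2 _ _ _ h6⟩
    have hnot : ∀ p q r, Z p = some (q, r) → ∀ a ∈ es₁ ++ es₂, a.2.proc ≠ p := by
      intro p q r hz a ha hap
      obtain ⟨hq, ⟨l, hl⟩, -⟩ := hZ p q r hz
      rcases List.mem_append.1 ha with ha | ha
      · rcases (hevent (Z := Z) h2).1 a ha with ⟨-, -, h⟩ | ⟨p', op, l', h10, h11, h12⟩ |
          ⟨p', q', r', h10, h11⟩
        · exact hupd ⟨p₀, hp₀⟩ h
        · rw [h10] at hap
          obtain rfl : p' = p := hap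
          rw [hl] at h11
          cases h11
          exact h12 hq
        · rcases h2 with ⟨rfl, -⟩ | ⟨rfl, h12⟩
          · simp at ha
          · rw [List.mem_singleton.1 ha] at hap
            simp only at hap
            rcases h12 with ⟨_, _, h, -⟩ | ⟨op, l', h13, h14⟩
            · rw [hp₀] at h
              cases h
            · rw [hap, hl] at h13
              cases h13
              exact h14 hq
      · obtain ⟨p', op, l', h10, h11, h12⟩ := h5 a ha
        rw [h10] at hap
        obtain rfl : p' = p := hap
        obtain ⟨l'', h13⟩ := hpend _ _ _ h11
        rw [hl] at h13
        cases h13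
        exact h12 hq
    refine ⟨(es₁ ++ es₂) ++ es₃, hc₂, ⟨(h1.append h4).append h7, ?_, ?_, ?_⟩, ?_⟩
    · intro a ha
      rcases List.mem_append.1 ha with ha | ha
      · rcases List.mem_append.1 ha with ha | ha
        · rcases (hevent (Z := Z) h2).1 a ha with ⟨-, -, h⟩ | h
          · exact (hupd ⟨p₀, hp₀⟩ h).elim
          · exact .inr h
        · obtain ⟨p, op, l, h10, h11, h12⟩ := h5 a ha
          obtain ⟨l', h13⟩ := hpend _ _ _ h11
          exact .inr (.inl ⟨p, op, l', h10, h13, h12⟩)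
      · exact .inr (.inr (h9 a ha))
    · exact fun h => (hupd ⟨p₀, hp₀⟩ h).elim
    · exact fun p q r hz => (h8 p q r hz).append_left (hnot p q r hz)
    · refine h6.congr_counts fun p op l hp hop => ⟨rfl, ?_⟩
      -- A process that runs a query block has a query pending, so the counts of the pending updates
      -- are not affected.
      have : procCount p es₃ = 0 := procCount_eq_zero fun a ha hap => by
        obtain ⟨p', q, r, hz, h10⟩ := h9 a ha
        rw [h10.proc] at hap
        subst hap
        obtain ⟨hq, ⟨l', hl'⟩, -⟩ := hZ _ q r hz
        obtain ⟨l'', hl''⟩ := hpend _ _ _ hp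
        rw [hl'] at hl''
        cases hl''
        exact hop hq
      rw [procCount_append, procCount_append, this]
      omega
  -- Queries are scheduled only for events that advance the camera.
  · have hZ' : ∀ p, Z p = none := by
      intro p
      by_contra hz
      obtain ⟨⟨q, r⟩, hz⟩ := Option.ne_none_iff_exists'.1 hz
      obtain ⟨-, -, hlt, -⟩ := hZ p q r hz
      refine hclock ?_
      cases hl : lab i with
      | inv p' op =>
        rw [hl] at hst
        rw [hst.inv_iff.2.2] at hlt
        exact (lt_irrefl _ hlt).elim
      | res p' r' =>
        rw [hl] at hst
        obtain ⟨-, -, -, -, -, h⟩ := hst.res_iff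
        rw [h] at hlt
        exact (lt_irrefl _ hlt).elim
      | step p' =>
        rw [hl] at hst
        obtain ⟨op, l, l', -, h1, -⟩ := hst.step_iff
        rcases (vstep_of_step h1).timestamp_eq with h2 | ⟨-, h2⟩
        · rw [h2] at hlt
          exact (lt_irrefl _ hlt).elim
        · exact ⟨⟨p', rfl⟩, h2⟩
    by_cases hnew : ∃ n, Linearized N cfg (i + 1) n ∧ ¬ Linearized N cfg i n
    · -- a timestamp is decided
      obtain ⟨n, hn, hn'⟩ := hnew
      have hcas : ∀ n', Linearized N cfg (i + 1) n' → ¬ Linearized N cfg i n' →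
          (∃ x, HeadBy cfg i x n') ∧ ∃ p op t next, lab i = .step p ∧
            (cfg i).procs p = some (op, .initCas n' t next) := by
        intro n' h1 h2
        rcases h1.of_succ hrun hi with h3 | ⟨h3, ⟨p, op, t, next, h4, h5, -⟩ | h4⟩
        · exact (h2 h3).elim
        · exact ⟨h3, p, op, t, next, h4, h5⟩
        · exact (hclock h4).elim
      obtain ⟨⟨x, hx⟩, p, op, t, next, hp, hl⟩ := hcas n hn hn'
      have hLin : (fun n' => Linearized N cfg i n' ∨ n' = n) = Linearized N cfg (i + 1) := by
        funext n'
        refine propext ⟨?_, fun h1 => ?_⟩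
        · rintro (h1 | rfl)
          exacts [hmono _ h1, hn]
        · by_contra h2
          push Not at h2
          obtain ⟨-, p', op', t', next', h3, h4⟩ := hcas n' h1 h2.1
          rw [hp] at h3
          cases h3
          rw [hl] at h4
          cases h4
          exact h2.2 rfl
      -- The linearization precedes the event itself, because after the event the version is decided
      -- and the relation requires decided versions to be linearized.
      obtain ⟨es₁, hc₁, h1, h2, h3⟩ := hs.linearize hx hn'
      rw [hLin] at h3
      obtain ⟨es₂, hc₂, h4, h5, h6⟩ := h3.event hst hdec
      rw [← headBy_succ] at h6
      refine ⟨es₁ ++ es₂, hc₂, ⟨h1.append h4, ?_, fun h => (hupd ⟨p, hp⟩ h).elim, by simp [hZ']⟩, ?_⟩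
      · intro a ha
        rcases List.mem_append.1 ha with ha | ha
        · exact .inr (.inl (h2 a ha))
        · rcases (hevent (Z := Z) h5).1 a ha with ⟨-, -, h⟩ | h
          · exact (hupd ⟨p, hp⟩ h).elim
          · exact .inr h
      · convert h6 using 2 with p'
        rw [hp, resetCount_step, resetCount_step, procCount_append, add_assoc]
    · have hLin : Linearized N cfg (i + 1) = Linearized N cfg i := by
        funext n
        refine propext ⟨fun h1 => ?_, hmono n⟩
        by_contra h2
        exact hnew ⟨n, h1, h2⟩
      rw [hLin] at hdec ⊢
      obtain ⟨es, hc', h1, h2, h3⟩ := hs.event hst hdec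
      rw [← headBy_succ] at h3
      have := hevent (Z := Z) h2
      exact ⟨es, hc', ⟨h1, this.1, this.2, by simp [hZ']⟩, h3⟩

end

/-! ## Joining paths to runs -/

section

variable {P Op Ret S L : Type*} {M : Impl P Op Ret S L} {Q : Set Op} {c c' c₁ c₂ : Config P Op S L}
  {es es₁ es₂ : List (Config P Op S L × Label P Op Ret)}

/-- The configurations of a path with the final configuration `c'`. -/
def pathConfig (es : List (Config P Op S L × Label P Op Ret)) (c' : Config P Op S L) (k : ℕ) :
    Config P Op S L :=
  (es[k]?.map Prod.fst).getD c'

theorem SoloPath.pathConfig_zero (h : SoloPath M Q c es c') : pathConfig es c' 0 = c := by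
  cases h <;> rfl

theorem SoloPath.pathConfig_append (h : SoloPath M Q c₁ es₂ c₂) {k : ℕ} (hk : k ≤ es₁.length) :
    pathConfig (es₁ ++ es₂) c₂ k = pathConfig es₁ c₁ k := by
  rcases hk.lt_or_eq with hk | rfl
  · simp [pathConfig, List.getElem?_append_left hk, List.getElem?_eq_getElem hk]
  · have := h.pathConfig_zero
    simpa [pathConfig, List.getElem?_append_right] using this

theorem SoloPath.step_at (h : SoloPath M Q c es c') {k : ℕ} (hk : k < es.length) :
    M.Step (pathConfig es c' k) (es[k].2) (pathConfig es c' (k + 1)) ∧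
      ∀ p op l, (pathConfig es c' k).procs p = some (op, l) → op ∈ Q → es[k].2.proc = p := by
  induction h generalizing k with
  | nil => simp at hk
  | cons c ℓ c' es c'' h hq hs ih =>
    cases k with
    | zero =>
      have h1 : pathConfig ((c, ℓ) :: es) c'' (0 + 1) = c' := by
        simpa [pathConfig] using hs.pathConfig_zero
      exact ⟨by rw [h1]; exact h, hq⟩
    | succ k => exact ih (by simpa using hk)

/-- The beginning of the list that consists of the given lists. -/
def joined {α : Type*} (seg : ℕ → List α) : ℕ → List α
  | 0 => []
  | i + 1 => joined seg i ++ seg i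

theorem joined_prefix {α : Type*} (seg : ℕ → List α) {i j : ℕ} (hij : i ≤ j) :
    joined seg i <+: joined seg j := by
  induction j, hij using Nat.le_induction with
  | base => exact List.prefix_rfl
  | succ j _ ih => exact ih.trans (List.prefix_append _ _)

/-- The position at which the list with number `i` begins. -/
def joinedPos {α : Type*} (seg : ℕ → List α) (i : ℕ) : ℕ := (joined seg i).length

theorem joinedPos_succ {α : Type*} (seg : ℕ → List α) (i : ℕ) :
    joinedPos seg (i + 1) = joinedPos seg i + (seg i).length := by
  simp [joinedPos, joined]

theorem joinedPos_mono {α : Type*} (seg : ℕ → List α) : Monotone (joinedPos seg) :=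
  fun _ _ hij => (joined_prefix seg hij).length_le

/-- Consecutive paths form a run. -/
theorem exists_run_of_paths {hc : ℕ → Config P Op S L}
    {seg : ℕ → List (Config P Op S L × Label P Op Ret)}
    (hpath : ∀ i, SoloPath M Q (hc i) (seg i) (hc (i + 1))) (ℓ₀ : Label P Op Ret) :
    ∃ (cfg : ℕ → Config P Op S L) (lab : ℕ → Label P Op Ret), (∀ i, cfg (joinedPos seg i) = hc i) ∧
      (∀ i j, j < (seg i).length →
        (seg i)[j]? = some (cfg (joinedPos seg i + j), lab (joinedPos seg i + j))) ∧
      ∀ k i, k < joinedPos seg i → M.Step (cfg k) (lab k) (cfg (k + 1)) ∧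
        ∀ p op l, (cfg k).procs p = some (op, l) → op ∈ Q → (lab k).proc = p := by
  classical
  have hp : ∀ i, SoloPath M Q (hc 0) (joined seg i) (hc i) := by
    intro i
    induction i with
    | zero => exact .nil _
    | succ i ih => exact ih.append (hpath i)
  have hpq : ∀ i j, i ≤ j → ∃ es, joined seg j = joined seg i ++ es ∧
      SoloPath M Q (hc i) es (hc j) := by
    intro i j hij
    induction j, hij using Nat.le_induction with
    | base => exact ⟨[], by simp, .nil _⟩
    | succ j hij ih =>
      obtain ⟨es, h1, h2⟩ := ih
      exact ⟨es ++ seg j, by simp [joined, h1], h2.append (hpath j)⟩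
  have hcfg : ∀ i j k, k ≤ joinedPos seg i → k ≤ joinedPos seg j →
      pathConfig (joined seg i) (hc i) k = pathConfig (joined seg j) (hc j) k := by
    intro i j k hi hj
    rcases le_total i j with h | h
    · obtain ⟨es, h1, h2⟩ := hpq i j h
      rw [h1]
      exact (h2.pathConfig_append hi).symm
    · obtain ⟨es, h1, h2⟩ := hpq j i h
      rw [h1]
      exact h2.pathConfig_append hj
  -- An index is looked up in any sufficiently long prefix; by `hcfg` the choice does not matter. If
  -- the joined run is finite, the values beyond its end are dummies.
  set cfg : ℕ → Config P Op S L := fun k =>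
    if h : ∃ i, k ≤ joinedPos seg i then pathConfig (joined seg h.choose) (hc h.choose) k
    else hc 0 with hcfg_def
  set lab : ℕ → Label P Op Ret := fun k =>
    if h : ∃ i, k < joinedPos seg i then ((joined seg h.choose)[k]'h.choose_spec).2 else ℓ₀
    with hlab_def
  have hcfg' : ∀ i k, k ≤ joinedPos seg i → cfg k = pathConfig (joined seg i) (hc i) k := by
    intro i k hk
    have h : ∃ i, k ≤ joinedPos seg i := ⟨i, hk⟩
    simp only [hcfg_def, dif_pos h]
    exact hcfg _ _ _ h.choose_spec hk
  have hlab' : ∀ i k (hk : k < joinedPos seg i), lab k = ((joined seg i)[k]'hk).2 := by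
    intro i k hk
    have h : ∃ i, k < joinedPos seg i := ⟨i, hk⟩
    simp only [hlab_def, dif_pos h]
    rcases le_total h.choose i with h1 | h1
    · exact congrArg Prod.snd ((joined_prefix seg h1).getElem h.choose_spec)
    · exact congrArg Prod.snd ((joined_prefix seg h1).getElem hk).symm
  have hlast : ∀ i, pathConfig (joined seg i) (hc i) (joinedPos seg i) = hc i := by
    intro i
    simp [pathConfig, joinedPos]
  refine ⟨cfg, lab, fun i => (hcfg' i _ le_rfl).trans (hlast i), ?_, ?_⟩
  · intro i j hj
    have hlt : joinedPos seg i + j < joinedPos seg (i + 1) := by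
      rw [joinedPos_succ]
      omega
    have hget : (joined seg (i + 1))[joinedPos seg i + j]? = (seg i)[j]? := by
      rw [joined, joinedPos, List.getElem?_append_right (by omega), Nat.add_sub_cancel_left]
    rw [hcfg' (i + 1) _ hlt.le, hlab' (i + 1) _ hlt, pathConfig, hget]
    have hget' : (joined seg (i + 1))[joinedPos seg i + j]'hlt = (seg i)[j] := by
      have := List.getElem?_eq_getElem hlt
      rw [hget, List.getElem?_eq_getElem hj] at this
      exact (Option.some.inj this).symm
    rw [hget', List.getElem?_eq_getElem hj]
    rfl
  · intro k i hk
    have := (hp i).step_at hk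
    rw [hcfg' i k hk.le, hcfg' i (k + 1) hk, hlab' i k hk]
    exact this

end

/-! ## Counting events -/

section

variable {P Op Ret : Type*}

open Classical in
/-- The number of events of the process `p` among `a, …, b - 1`. -/
noncomputable def eventCount (lab : ℕ → Label P Op Ret) (p : P) (a b : ℕ) : ℕ :=
  ((Finset.Ico a b).filter fun j => (lab j).proc = p).card

theorem procTime_eq (lab : ℕ → Label P Op Ret) (p : P) (a b : ℕ) :
    procTime lab p a b = eventCount lab p a b := by
  classical
  rw [procTime, eventCount, ← Set.encard_coe_eq_coe_finsetCard]
  congr 1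
  ext j
  simp [and_assoc]

open Classical in
theorem eventCount_succ (lab : ℕ → Label P Op Ret) (p : P) {a b : ℕ} (hab : a ≤ b) :
    eventCount lab p a (b + 1) = eventCount lab p a b + if (lab b).proc = p then 1 else 0 := by
  rw [eventCount, eventCount, ← Finset.insert_Ico_right_eq_Ico_add_one hab, Finset.filter_insert]
  split_ifs
  · rw [Finset.card_insert_of_notMem (by simp)]
  · rfl

@[simp]
theorem eventCount_self (lab : ℕ → Label P Op Ret) (p : P) (a : ℕ) : eventCount lab p a a = 0 := by
  simp [eventCount]

theorem eventCount_add (lab : ℕ → Label P Op Ret) (p : P) {a b c : ℕ} (hab : a ≤ b) (hbc : b ≤ c) :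
    eventCount lab p a c = eventCount lab p a b + eventCount lab p b c := by
  classical
  induction c, hbc using Nat.le_induction with
  | base => simp
  | succ c hbc ih => rw [eventCount_succ _ _ hbc, eventCount_succ _ _ (hab.trans hbc), ih, add_assoc]

theorem eventCount_eq_procCount {C : Type*} (lab : ℕ → Label P Op Ret) (p : P) (s : ℕ)
    (es : List (C × Label P Op Ret)) (h : ∀ j < es.length, es[j]?.map Prod.snd = some (lab (s + j))) :
    eventCount lab p s (s + es.length) = procCount p es := by
  classical
  induction es using List.reverseRecOn with
  | nil => simp
  | append_singleton es e ih =>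
    have h1 := h es.length (by simp)
    simp only [List.getElem?_append_right le_rfl, Nat.sub_self, List.getElem?_cons_zero,
      Option.map_some, Option.some.injEq] at h1
    rw [List.length_append, List.length_singleton, ← add_assoc, eventCount_succ _ _ (by omega), ih,
      procCount_append, procCount_singleton, h1]
    intro j hj
    rw [← h j (by simp; omega), List.getElem?_append_left hj]

end

/-! ## Simulations -/

/-- A simulation of a run of the transformed data structure by the original one: for every event
the configuration `hc` before it, the numbers `e` and `h` of events of the current operations, and the
corresponding path `seg`, where `Z` are the queries that are executed. -/
structure Simulation {P Op Ret V St : Type*} (D : CASStructure P Op Ret V St) (Q : Set Op) (N : ℕ∞)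
    (cfg : ℕ → Config P Op (VMem V) (VState V St)) (lab : ℕ → Label P Op Ret)
    (Z : ℕ → P → Option (Op × Ret)) (hc : ℕ → Config P Op (ℕ → Option V) St) (e h : ℕ → P → ℕ)
    (seg : ℕ → List (Config P Op (ℕ → Option V) St × Label P Op Ret)) : Prop where
  init : hc 0 = ⟨D.init, fun _ => none⟩
  sim : ∀ i : ℕ, (i : ℕ∞) ≤ N →
    Sim D Q (HeadBy cfg i) (Linearized N cfg i) (cfg i) (hc i) (e i) (h i)
  segment : ∀ i : ℕ, (i : ℕ∞) < N → IsSegment D Q (Z i) (cfg i) (lab i) (hc i) (seg i) (hc (i + 1))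
  idle : ∀ i : ℕ, ¬ (i : ℕ∞) < N → seg i = [] ∧ hc (i + 1) = hc i
  count : ∀ i : ℕ, (i : ℕ∞) < N → e (i + 1) = countEvent (lab i) (e i) ∧
    h (i + 1) = fun p => resetCount (lab i) (h i) p + procCount p (seg i)

section

variable {P Op Ret V St : Type*} {D : CASStructure P Op Ret V St} {Q : Set Op} {N : ℕ∞}
  {cfg : ℕ → Config P Op (VMem V) (VState V St)} {lab : ℕ → Label P Op Ret}

/-- The initial versions have timestamp `0`, so all of them count as linearized and the memory of
`D` is its initial one. -/
theorem sim_init (hrun : (D.versioned Q).IsRun N cfg lab) :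
    Sim D Q (HeadBy cfg 0) (Linearized N cfg 0) (cfg 0) ⟨D.init, fun _ => none⟩
      (fun _ => 0) (fun _ => 0) := by
  have hinv := D.configInv_run hrun (i := 0) (by simp)
  have hshared : (cfg 0).shared = (D.versioned Q).init := by rw [hrun.1]
  have hdec : ∀ n, (cfg 0).shared.Decided n → Linearized N cfg 0 n :=
    fun n hn => ⟨(hinv.mem.J_of_ts hn.choose_spec).1, .inl hn⟩
  have hhead : ∀ x n, HeadBy cfg 0 x n ↔ x = n ∧ ∃ v, D.init x = some v := by
    intro x n
    constructor
    · rintro ⟨j, hj, h⟩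
      obtain rfl : j = 0 := by omega
      rw [hshared] at h
      obtain ⟨v, hv, rfl⟩ := Option.map_eq_some_iff.1 h
      exact ⟨rfl, v, hv⟩
    · rintro ⟨rfl, v, hv⟩
      refine ⟨0, le_rfl, ?_⟩
      rw [hshared]
      exact Option.map_eq_some_iff.2 ⟨v, hv, rfl⟩
  have hnode : ∀ n, (cfg 0).shared.node n = (D.init n).map fun v => ⟨v, none, some 0⟩ := fun n => by
    rw [hshared]
    rfl
  refine ⟨hinv, fun n hn => hn.1, hdec, ?_, ?_, ?_, ?_⟩
  · intro x v
    constructor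
    · intro hv
      replace hv : D.init x = some v := hv
      have hts : (cfg 0).shared.tsOf x = some (some 0) := by simp [VMem.tsOf, hnode, hv]
      refine ⟨x, (hhead x x).2 ⟨rfl, v, hv⟩, hdec x ⟨0, hts⟩, ?_, by simp [VMem.valOf, hnode, hv]⟩
      rintro ⟨n, -, hn⟩
      rw [VMem.nextOf, hnode] at hn
      cases h : D.init n <;> simp [h] at hn
    · rintro ⟨n, h1, -, -, h2⟩
      obtain ⟨rfl, v', hv'⟩ := (hhead x n).1 h1
      change D.init x = some v
      simp only [VMem.valOf, hnode, hv', Option.map_some, Option.some.injEq] at h2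
      rw [hv', h2]
  · exact fun p _ => rfl
  · exact fun p op l hp _ => rfl
  · intro p op l hp
    simp [hrun.1] at hp

/-- Dependent choice with an invariant `G`; it constructs the simulation for finite and infinite
runs by one recursion. -/
theorem exists_seq {α β : Type*} {G : ℕ → α → Prop} {R : ℕ → α → β → α → Prop} {a₀ : α}
    (h₀ : G 0 a₀) (h : ∀ i a, G i a → ∃ b a', G (i + 1) a' ∧ R i a b a') :
    ∃ (a : ℕ → α) (b : ℕ → β), a 0 = a₀ ∧ ∀ i, G i (a i) ∧ R i (a i) (b i) (a (i + 1)) := by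
  choose b a' h1 h2 using h
  let s : ∀ i, {a // G i a} := fun i =>
    Nat.rec ⟨a₀, h₀⟩ (fun i x => ⟨a' i x.1 x.2, h1 i x.1 x.2⟩) i
  exact ⟨fun i => (s i).1, fun i => b i (s i).1 (s i).2, rfl, fun i => ⟨(s i).2, h2 i _ _⟩⟩

theorem exists_simulation [Finite P] (hrun : (D.versioned Q).IsRun N cfg lab)
    (Z : ℕ → P → Option (Op × Ret))
    (hZ : ∀ i : ℕ, (i : ℕ∞) < N → ∀ p q r, Z i p = some (q, r) →
      q ∈ Q ∧ (∃ l, (cfg i).procs p = some (q, l)) ∧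
      (cfg i).shared.timestamp < (cfg (i + 1)).shared.timestamp ∧
      ∀ hc e h, Sim D Q (HeadBy cfg (i + 1)) (Linearized N cfg (i + 1)) (cfg (i + 1)) hc e h →
        ∃ k s, D.ReadRun hc.shared (D.start p q) k s ∧ D.code s = .ret r) :
    ∃ hc e h seg, Simulation D Q N cfg lab Z hc e h seg := by
  obtain ⟨a, b, h1, h2⟩ := exists_seq
    (α := Config P Op (ℕ → Option V) St × (P → ℕ) × (P → ℕ))
    (β := List (Config P Op (ℕ → Option V) St × Label P Op Ret))
    -- The guards let the sequence continue with empty segments after the last event of a finite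
    -- run.
    (G := fun i a => (i : ℕ∞) ≤ N →
      Sim D Q (HeadBy cfg i) (Linearized N cfg i) (cfg i) a.1 a.2.1 a.2.2)
    (R := fun i a b a' => ((i : ℕ∞) < N → IsSegment D Q (Z i) (cfg i) (lab i) a.1 b a'.1 ∧
        a'.2.1 = countEvent (lab i) a.2.1 ∧
        a'.2.2 = fun p => resetCount (lab i) a.2.2 p + procCount p b) ∧
      (¬ (i : ℕ∞) < N → b = [] ∧ a'.1 = a.1))
    (a₀ := (⟨D.init, fun _ => none⟩, fun _ => 0, fun _ => 0))
    (fun _ => sim_init hrun) (by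
      intro i a ha
      by_cases hi : (i : ℕ∞) < N
      · obtain ⟨es, hc', h1, h2⟩ := (ha hi.le).segment hrun hi (Z i) (hZ i hi)
        exact ⟨es, (hc', _, _), fun _ => h2, fun _ => ⟨h1, rfl, rfl⟩, fun h => (h hi).elim⟩
      · refine ⟨[], a, fun h => ?_, fun h => (hi h).elim, fun _ => ⟨rfl, rfl⟩⟩
        exact (hi (lt_of_lt_of_le (by exact_mod_cast Nat.lt_succ_self i) h)).elim)
  exact ⟨fun i => (a i).1, fun i => (a i).2.1, fun i => (a i).2.2, b, by simp only [h1],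
    fun i hi => (h2 i).1 hi, fun i hi => ((h2 i).2.1 hi).1, fun i hi => (h2 i).2.2 hi,
    fun i hi => ((h2 i).2.1 hi).2⟩

end

/-- The run `cfg'`, `lab'` of the original data structure simulates the run `cfg`, `lab` of the
transformed one: the events `g i, …, g (i + 1) - 1` correspond to the event `i`, where `Z i` are the
queries that are executed. -/
structure SimulatedRun {P Op Ret V St : Type*} (D : CASStructure P Op Ret V St) (Q : Set Op) (N : ℕ∞)
    (cfg : ℕ → Config P Op (VMem V) (VState V St)) (lab : ℕ → Label P Op Ret)
    (Z : ℕ → P → Option (Op × Ret)) (cfg' : ℕ → Config P Op (ℕ → Option V) St)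
    (lab' : ℕ → Label P Op Ret) (g : ℕ → ℕ) : Prop where
  zero : g 0 = 0
  init : cfg' 0 = ⟨D.init, fun _ => none⟩
  mono : Monotone g
  idle : ∀ i : ℕ, ¬ (i : ℕ∞) < N → g (i + 1) = g i
  step : ∀ k i, k < g i → D.impl.Step (cfg' k) (lab' k) (cfg' (k + 1)) ∧
    ∀ p op l, (cfg' k).procs p = some (op, l) → op ∈ Q → (lab' k).proc = p
  sim : ∀ i : ℕ, (i : ℕ∞) ≤ N → ∃ e h,
    Sim D Q (HeadBy cfg i) (Linearized N cfg i) (cfg i) (cfg' (g i)) e h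
  entry : ∀ i : ℕ, (i : ℕ∞) < N → ∀ k, g i ≤ k → k < g (i + 1) →
    k = g i ∧ lab' k = lab i ∧ IsUpdateEvent Q (cfg i) (lab i) ∨
    (∃ p op l, lab' k = .step p ∧ (cfg i).procs p = some (op, l) ∧ op ∉ Q) ∨
    ∃ p q r, Z i p = some (q, r) ∧ IsEventOf p q (cfg' k, lab' k)
  event : ∀ i : ℕ, (i : ℕ∞) < N → IsUpdateEvent Q (cfg i) (lab i) →
    g (i + 1) = g i + 1 ∧ lab' (g i) = lab i
  query : ∀ i : ℕ, (i : ℕ∞) < N → ∀ p q r, Z i p = some (q, r) →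
    q ∈ Q ∧ ∃ l, (cfg i).procs p = some (q, l)
  block : ∀ i : ℕ, (i : ℕ∞) < N → ∀ p q r, Z i p = some (q, r) →
    ∃ k k', g i ≤ k ∧ k < k' ∧ k' < g (i + 1) ∧ lab' k = .inv p q ∧ lab' k' = .res p r ∧
      (∀ j, k < j → j < k' → lab' j = .step p) ∧
      ∀ j, g i ≤ j → j < g (i + 1) → ∀ q', lab' j = .inv p q' → j = k
  time : ∀ p op a i, op ∉ Q → lab a = .inv p op → a < i → ((i : ℕ) : ℕ∞) ≤ N →
    (∀ k r, a < k → k < i → lab k ≠ .res p r) →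
    eventCount lab' p (g a) (g i) ≤ eventCount lab p a i ∧
      eventCount lab p a i ≤ 13 * eventCount lab' p (g a) (g i)

section

variable {P Op Ret V St : Type*} {D : CASStructure P Op Ret V St} {Q : Set Op} {N : ℕ∞}
  {cfg : ℕ → Config P Op (VMem V) (VState V St)} {lab : ℕ → Label P Op Ret}
  {Z : ℕ → P → Option (Op × Ret)}

/-- An instruction can be executed ahead only while an operation on an object is in progress, so the
flag is at most `l.mid`; and fewer than 13 steps have been taken for the current instruction. With
these bounds the account collapses to the factor 13. -/
theorem ProcRel.le {J : ℕ → ℕ → Prop} {m : VMem V} {Lin : ℕ → Prop} {l : VState V St} {hl : St}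
    {e h : ℕ} (hr : ProcRel D J m Lin l hl e h) : h ≤ e ∧ e ≤ 13 * h := by
  obtain ⟨d, h1, h2, h3⟩ := hr
  have hprog : l.progress ≤ 12 := by
    cases l <;> simp only [VState.progress] <;> try omega
    all_goals
      rename_i next
      cases next <;> simp [VState.initProgress]
  have hmid : d.toNat ≤ l.mid := by
    have := d.toNat_le
    cases h1 <;> simp_all [VState.mid]
  omega

theorem HasBlock.positions {C : Type*} {p : P} {q : Op} {r : Ret}
    {es : List (C × Label P Op Ret)} (h : HasBlock p q r es) {s : ℕ} {lab' : ℕ → Label P Op Ret}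
    (hlab : ∀ j < es.length, es[j]?.map Prod.snd = some (lab' (s + j))) :
    ∃ k k', s ≤ k ∧ k < k' ∧ k' < s + es.length ∧ lab' k = .inv p q ∧ lab' k' = .res p r ∧
      (∀ j, k < j → j < k' → lab' j = .step p) ∧
      ∀ j, s ≤ j → j < s + es.length → ∀ q', lab' j = .inv p q' → j = k := by
  obtain ⟨pre, blk, post, rfl, ⟨c₁, mid, c₂, rfl, h1⟩, h2, h3⟩ := h
  have hget : ∀ j a, (pre ++ ((c₁, Label.inv p q) :: (mid ++ [(c₂, Label.res p r)]) ++ post))[j]? = some a →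
      lab' (s + j) = a.2 := by
    intro j a ha
    have hj : j < (pre ++ ((c₁, Label.inv p q) :: (mid ++ [(c₂, Label.res p r)]) ++ post)).length := by
      by_contra hcon
      rw [List.getElem?_eq_none (by omega)] at ha
      cases ha
    have := hlab j hj
    rw [ha] at this
    exact (Option.some.inj this).symm
  have hmid : ∀ j < mid.length, lab' (s + (pre.length + 1 + j)) = .step p := by
    intro j hj
    have := hget (pre.length + 1 + j) mid[j] (by
      rw [List.getElem?_append_right (by omega), List.getElem?_append_left (by simp; omega),
        show pre.length + 1 + j - pre.length = j + 1 by omega, List.getElem?_cons_succ,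
        List.getElem?_append_left hj, List.getElem?_eq_getElem hj])
    rw [this]
    exact h1 _ (List.getElem_mem hj)
  have hres : lab' (s + (pre.length + 1 + mid.length)) = .res p r := by
    refine hget (pre.length + 1 + mid.length) (c₂, .res p r) ?_
    rw [List.getElem?_append_right (by omega), List.getElem?_append_left (by simp; omega),
      show pre.length + 1 + mid.length - pre.length = mid.length + 1 by omega,
      List.getElem?_cons_succ, List.getElem?_append_right le_rfl]
    simp
  refine ⟨s + pre.length, s + (pre.length + 1 + mid.length), by omega, by omega, ?_, ?_, hres, ?_,
    ?_⟩
  · simp only [List.length_append, List.length_cons, List.length_nil]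
    omega
  · refine hget pre.length (c₁, .inv p q) ?_
    rw [List.getElem?_append_right le_rfl]
    simp
  · intro j hj hj'
    have := hmid (j - (s + pre.length + 1)) (by omega)
    rwa [show s + (pre.length + 1 + (j - (s + pre.length + 1))) = j by omega] at this
  · intro j hj hj' q' hq'
    by_contra hne
    obtain ⟨j, rfl⟩ := Nat.exists_eq_add_of_le hj
    rcases lt_or_ge j pre.length with h4 | h4
    · have := hget j pre[j] (by
        rw [List.getElem?_append_left h4, List.getElem?_eq_getElem h4])
      rw [hq'] at this
      exact h2 _ (List.getElem_mem h4) (by rw [← this]; rfl)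
    rcases lt_or_ge j (pre.length + 1 + mid.length) with h5 | h5
    · have := hmid (j - (pre.length + 1)) (by omega)
      rw [show pre.length + 1 + (j - (pre.length + 1)) = j by omega, hq'] at this
      cases this
    rcases h5.eq_or_lt with h5 | h5
    · rw [← h5, hres] at hq'
      cases hq'
    · have hlen : j - (pre.length + 1 + mid.length + 1) < post.length := by
        simp only [List.length_append, List.length_cons, List.length_nil] at hj'
        omega
      have := hget j post[j - (pre.length + 1 + mid.length + 1)] (by
        rw [List.getElem?_append_right (by omega), List.getElem?_append_right (by simp; omega),
          ← List.getElem?_eq_getElem hlen]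
        congr 1
        simp
        omega)
      rw [hq'] at this
      exact h3 _ (List.getElem_mem hlen) (by rw [← this]; rfl)

theorem exists_simulatedRun [Finite P] (hrun : (D.versioned Q).IsRun N cfg lab)
    (hZ : ∀ i : ℕ, (i : ℕ∞) < N → ∀ p q r, Z i p = some (q, r) →
      q ∈ Q ∧ (∃ l, (cfg i).procs p = some (q, l)) ∧
      (cfg i).shared.timestamp < (cfg (i + 1)).shared.timestamp ∧
      ∀ hc e h, Sim D Q (HeadBy cfg (i + 1)) (Linearized N cfg (i + 1)) (cfg (i + 1)) hc e h →
        ∃ k s, D.ReadRun hc.shared (D.start p q) k s ∧ D.code s = .ret r) :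
    ∃ cfg' lab' g, SimulatedRun D Q N cfg lab Z cfg' lab' g := by
  obtain ⟨hc, e, h, seg, hS⟩ := exists_simulation hrun Z hZ
  have hpath : ∀ i, SoloPath D.impl Q (hc i) (seg i) (hc (i + 1)) := by
    intro i
    by_cases hi : (i : ℕ∞) < N
    · exact (hS.segment i hi).path
    · rw [(hS.idle i hi).1, (hS.idle i hi).2]
      exact .nil _
  obtain ⟨cfg', lab', h1, h2, h3⟩ := exists_run_of_paths hpath (lab 0)
  have hlab : ∀ i j, j < (seg i).length →
      (seg i)[j]?.map Prod.snd = some (lab' (joinedPos seg i + j)) := fun i j hj => by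
    rw [h2 i j hj]
    rfl
  have hcnt : ∀ i p, eventCount lab' p (joinedPos seg i) (joinedPos seg (i + 1)) =
      procCount p (seg i) := fun i p => by
    rw [joinedPos_succ]
    exact eventCount_eq_procCount _ _ _ _ (hlab i)
  have hmem : ∀ i k, joinedPos seg i ≤ k → k < joinedPos seg (i + 1) →
      (cfg' k, lab' k) ∈ seg i := by
    intro i k hk hk'
    rw [joinedPos_succ] at hk'
    have := h2 i (k - joinedPos seg i) (by omega)
    rw [show joinedPos seg i + (k - joinedPos seg i) = k by omega] at this
    exact List.mem_of_getElem? this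
  have hev : ∀ i : ℕ, (i : ℕ∞) < N → seg i = [(hc i, lab i)] →
      joinedPos seg (i + 1) = joinedPos seg i + 1 ∧ lab' (joinedPos seg i) = lab i := by
    intro i hi hs
    refine ⟨by rw [joinedPos_succ, hs]; rfl, ?_⟩
    have := hlab i 0 (by simp [hs])
    simpa [hs] using this.symm
  refine ⟨cfg', lab', joinedPos seg, rfl, ?_, joinedPos_mono seg, ?_, h3, ?_, ?_, ?_, ?_, ?_, ?_⟩
  · rw [← hS.init]
    exact h1 0
  · intro i hi
    rw [joinedPos_succ, (hS.idle i hi).1]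
    rfl
  · intro i hi
    rw [h1]
    exact ⟨_, _, hS.sim i hi⟩
  · intro i hi k hk hk'
    rcases (hS.segment i hi).entry _ (hmem i k hk hk') with ⟨h4, h5, h6⟩ | h4 | h4
    · refine .inl ⟨?_, congrArg Prod.snd h4, h6⟩
      have := (hev i hi h5).1
      omega
    · exact .inr (.inl h4)
    · exact .inr (.inr h4)
  · intro i hi hu
    exact hev i hi ((hS.segment i hi).event hu)
  · exact fun i hi p q r hz => ⟨(hZ i hi p q r hz).1, (hZ i hi p q r hz).2.1⟩
  · intro i hi p q r hz
    rw [joinedPos_succ]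
    exact ((hS.segment i hi).block p q r hz).positions (hlab i)
  · intro p op a i hop ha hai hi hres
    have hlt : ∀ j, j < i → (j : ℕ∞) < N := fun j hj =>
      lt_of_lt_of_le (by exact_mod_cast hj) hi
    have hst := hrun.2 a (hlt a hai)
    rw [ha] at hst
    have hpend : ∀ j, a + 1 ≤ j → j ≤ i → ∃ l, (cfg j).procs p = some (op, l) := fun j hj hj' =>
      hrun.pending hj ((Nat.cast_le.2 hj').trans hi) hst.inv_iff.2.1 fun k r hk hk' =>
        hres k r (by omega) (by omega)
    -- The invocation resets both counters and is itself an event in both runs, so from then on they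
    -- count the events of this instance.
    have key : ∀ j, a + 1 ≤ j → j ≤ i → e j p = eventCount lab p a j ∧
        h j p = eventCount lab' p (joinedPos seg a) (joinedPos seg j) := by
      intro j hj
      induction j, hj using Nat.le_induction with
      | base =>
        intro _
        rw [(hS.count a (hlt a hai)).1, (hS.count a (hlt a hai)).2]
        simp only
        rw [eventCount_succ _ _ le_rfl, hcnt, ha]
        simp [countEvent, resetCount, Label.proc]
      | succ j hj ih =>
        intro hj'
        obtain ⟨ih1, ih2⟩ := ih (by omega)
        obtain ⟨l, hl⟩ := hpend j hj (by omega)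
        rw [(hS.count j (hlt j hj')).1, (hS.count j (hlt j hj')).2]
        simp only
        rw [eventCount_succ _ _ (by omega), eventCount_add _ _ (joinedPos_mono seg (by omega : a ≤ j))
          (joinedPos_mono seg (Nat.le_succ j)), hcnt, ← ih1, ← ih2]
        by_cases hp : (lab j).proc = p
        · have hstj := hrun.2 j (hlt j hj')
          cases hlab : lab j with
          | inv p' op' =>
            rw [hlab] at hp hstj
            obtain rfl : p' = p := hp
            rw [hstj.inv_iff.1] at hl
            cases hl
          | step p' =>
            rw [hlab] at hp
            simp [countEvent, resetCount, hp]
          | res p' r =>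
            rw [hlab] at hp
            simp [countEvent, resetCount, hp]
        · simp [countEvent, resetCount, hp]
    obtain ⟨l, hl⟩ := hpend i hai le_rfl
    obtain ⟨hl', -, h4⟩ := (hS.sim i hi).upd p op l hl hop
    have := h4.le
    rw [(key i hai le_rfl).1, (key i hai le_rfl).2] at this
    exact this

end

section

variable {P Op Ret : Type*} {lab : ℕ → Label P Op Ret} {p : P} {s : ℕ}

theorem eventCount_unbounded (h : {j | s ≤ j ∧ (lab j).proc = p}.Infinite) (n : ℕ) :
    ∃ b, s ≤ b ∧ n ≤ eventCount lab p s b := by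
  classical
  obtain ⟨T, hT, rfl⟩ := h.exists_subset_card_eq n
  refine ⟨s + T.sup id + 1, by omega, Finset.card_le_card fun j hj => ?_⟩
  have h1 := hT hj
  have h2 : j ≤ T.sup id := Finset.le_sup (f := id) hj
  simp only [Finset.mem_filter, Finset.mem_Ico]
  exact ⟨⟨h1.1, by omega⟩, h1.2⟩

theorem eventCount_le_ncard (h : {j | s ≤ j ∧ (lab j).proc = p}.Finite) (b : ℕ) :
    eventCount lab p s b ≤ {j | s ≤ j ∧ (lab j).proc = p}.ncard := by
  classical
  rw [eventCount, ← Set.ncard_coe_finset]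
  refine Set.ncard_le_ncard (fun j hj => ?_) h
  simp only [Finset.coe_filter, Finset.mem_Ico] at hj
  exact ⟨hj.1.1, hj.2⟩

theorem eventCount_mono {b b' : ℕ} (h : b ≤ b') : eventCount lab p s b ≤ eventCount lab p s b' := by
  classical
  exact Finset.card_le_card (Finset.filter_subset_filter _ (Finset.Ico_subset_Ico_right h))

end

/-! ## Consequences of a simulation -/

namespace SimulatedRun

variable {P Op Ret V St : Type*} {D : CASStructure P Op Ret V St} {Q : Set Op} {N : ℕ∞}
  {cfg : ℕ → Config P Op (VMem V) (VState V St)} {lab : ℕ → Label P Op Ret}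
  {Z : ℕ → P → Option (Op × Ret)} {cfg' : ℕ → Config P Op (ℕ → Option V) St}
  {lab' : ℕ → Label P Op Ret} {g : ℕ → ℕ}

theorem isSoloRun (hS : SimulatedRun D Q N cfg lab Z cfg' lab' g) (i : ℕ) :
    D.impl.IsSoloRun Q (g i) cfg' lab' :=
  ⟨⟨hS.init, fun k hk => (hS.step k i (by exact_mod_cast hk)).1⟩,
    fun k hk => (hS.step k i (by exact_mod_cast hk)).2⟩

theorem isSoloRun_top (hS : SimulatedRun D Q N cfg lab Z cfg' lab' g) (h : ∀ k, ∃ i, k < g i) :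
    D.impl.IsSoloRun Q ⊤ cfg' lab' :=
  ⟨⟨hS.init, fun k _ => (hS.step k _ (h k).choose_spec).1⟩,
    fun k _ => (hS.step k _ (h k).choose_spec).2⟩

theorem exists_of_lt (hS : SimulatedRun D Q N cfg lab Z cfg' lab' g) {k n : ℕ} (hk : k < g n) :
    ∃ i < n, (i : ℕ∞) < N ∧ g i ≤ k ∧ k < g (i + 1) := by
  induction n with
  | zero =>
    rw [hS.zero] at hk
    omega
  | succ n ih =>
    by_cases h : k < g n
    · obtain ⟨i, hi, h⟩ := ih h
      exact ⟨i, hi.trans (Nat.lt_succ_self n), h⟩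
    · refine ⟨n, Nat.lt_succ_self n, ?_, not_lt.1 h, hk⟩
      by_contra hn
      rw [hS.idle n hn] at hk
      exact h hk

theorem lt_of_lt (hS : SimulatedRun D Q N cfg lab Z cfg' lab' g) {i j : ℕ} (h : g i < g j) :
    i < j := by
  by_contra hcon
  exact absurd (hS.mono (not_lt.1 hcon)) (not_le.2 h)

theorem updateEvent (hS : SimulatedRun D Q N cfg lab Z cfg' lab' g) {i : ℕ} (hi : (i : ℕ∞) < N)
    (h : IsUpdateEvent Q (cfg i) (lab i)) : IsUpdateEvent Q (cfg' (g i)) (lab' (g i)) := by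
  rw [(hS.event i hi h).2]
  rcases h with h | ⟨p, r, op, l, h1, h2, h3⟩
  · exact .inl h
  · obtain ⟨e, h, hsim⟩ := hS.sim i hi.le
    obtain ⟨hl, h4, -⟩ := hsim.upd p op l h2 h3
    exact .inr ⟨p, r, op, hl, h1, h4, h3⟩

theorem of_updateEvent (hS : SimulatedRun D Q N cfg lab Z cfg' lab' g) {i : ℕ} (hi : (i : ℕ∞) < N)
    {k : ℕ} (hk : g i ≤ k) (hk' : k < g (i + 1)) (h : IsUpdateEvent Q (cfg' k) (lab' k)) :
    k = g i ∧ lab' k = lab i ∧ IsUpdateEvent Q (cfg i) (lab i) := by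
  rcases hS.entry i hi k hk hk' with h1 | ⟨p, op, l, h1, -⟩ | ⟨p, q, r, hz, h1⟩
  · exact h1
  · rw [h1] at h
    rcases h with ⟨_, _, h, -⟩ | ⟨_, _, _, _, h, -⟩ <;> cases h
  · exfalso
    have hq := (hS.query i hi p q r hz).1
    rcases h with ⟨p', op, h2, h3⟩ | ⟨p', r', op, l, h2, h3, h4⟩
    · rcases h1 with h1 | ⟨h1, l, h4⟩
      · rw [h2] at h1
        cases h1
        exact h3 hq
      · have hst := (hS.step k (i + 1) hk').1
        simp only at h1 h4
        rw [h2] at hst h1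
        obtain rfl : p' = p := h1
        rw [hst.inv_iff.1] at h4
        cases h4
    · rcases h1 with h1 | ⟨h1, l', h5⟩
      · rw [h2] at h1
        cases h1
      · simp only at h1 h5
        rw [h2] at h1
        obtain rfl : p' = p := h1
        rw [h3] at h5
        cases h5
        exact h4 hq

/-! ### Progress -/

variable (hrun : (D.versioned Q).IsRun ⊤ cfg lab)
  (hS : SimulatedRun D Q ⊤ cfg lab (fun _ _ => none) cfg' lab' g)

include hrun hS

/-- An instance that does not return does not return in the simulating run either, and takes
infinitely many steps if it does so in the simulated one. -/
theorem infinite_instance {i : ℕ} {p : P} {op : Op} (hinv : lab i = .inv p op) (hop : op ∉ Q)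
    (hres : ∀ k r, i < k → lab k ≠ .res p r) (hinf : {j | lab j = .step p}.Infinite) :
    (∀ k, ∃ i, k < g i) ∧ D.impl.IsSoloRun Q ⊤ cfg' lab' ∧ lab' (g i) = .inv p op ∧
      (∀ k r, g i < k → lab' k ≠ .res p r) ∧
      {k | lab' k = .step p ∧ ∃ l, (cfg' k).procs p = some (op, l)}.Infinite := by
  have hcnt : {j | i ≤ j ∧ (lab j).proc = p}.Infinite := by
    refine (hinf.sdiff (Set.finite_lt_nat i)).mono fun j hj => ⟨not_lt.1 hj.2, ?_⟩
    rw [hj.1]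
    rfl
  -- The bound by the factor 13 turns infinitely many steps into infinitely many events of the
  -- simulating run; in particular that run is infinite.
  have hunb : ∀ n, ∃ b, n ≤ eventCount lab' p (g i) (g b) := by
    intro n
    obtain ⟨b, hb, hn⟩ := eventCount_unbounded hcnt (13 * (n + 1))
    have hib : i < b := by
      rcases hb.lt_or_eq with h | rfl
      · exact h
      · simp at hn
    have := (hS.time p op i b hop hinv hib (by simp) fun k r h _ => hres k r h).2
    exact ⟨b, by omega⟩
  have htop : ∀ k, ∃ i, k < g i := by
    intro k
    obtain ⟨b, hb⟩ := hunb (k + 1)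
    refine ⟨b, ?_⟩
    have : eventCount lab' p (g i) (g b) ≤ g b - g i := by
      classical
      exact (Finset.card_filter_le _ _).trans (by simp)
    omega
  have hsolo := hS.isSoloRun_top htop
  have hstart := hS.event i (by simp) (.inl ⟨p, op, hinv, hop⟩)
  have hpend : ∀ j, i < j → ∃ l, (cfg j).procs p = some (op, l) := by
    intro j hj
    have hst := hrun.2 i (by simp)
    rw [hinv] at hst
    exact hrun.pending hj (by simp) hst.inv_iff.2.1 fun k r hk _ => hres k r hk
  -- Invocations and responses of updates are copied only from the original run, where this process
  -- has none after event `i`. No query blocks are executed here.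
  have hlater : ∀ k, g i < k → (∀ r, lab' k ≠ .res p r) ∧ ∀ op', lab' k ≠ .inv p op' := by
    intro k hk
    obtain ⟨b, hb⟩ := htop k
    obtain ⟨j, -, -, hj, hj'⟩ := hS.exists_of_lt hb
    rcases hS.entry j (by simp) k hj hj' with ⟨rfl, h1, h2⟩ | ⟨p', op', l, h1, -⟩ |
      ⟨_, _, _, h1, -⟩
    · have hij := hS.lt_of_lt hk
      rw [h1]
      refine ⟨fun r => hres j r hij, fun op' h3 => ?_⟩
      have hst := hrun.2 j (by simp)
      rw [h3] at hst
      obtain ⟨l, hl⟩ := hpend j hij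
      rw [hst.inv_iff.1] at hl
      cases hl
    · rw [h1]
      exact ⟨by simp, by simp⟩
    · cases h1
  refine ⟨htop, hsolo, hstart.2.trans hinv, fun k r hk => (hlater k hk).1 r, ?_⟩
  have hinf' : {k | g i ≤ k ∧ (lab' k).proc = p}.Infinite := by
    intro hfin
    obtain ⟨b, hb⟩ := hunb ({k | g i ≤ k ∧ (lab' k).proc = p}.ncard + 1)
    have := eventCount_le_ncard hfin (g b)
    omega
  refine (hinf'.sdiff (Set.finite_singleton (g i))).mono fun k hk => ?_
  have hk' : g i < k := lt_of_le_of_ne hk.1.1 (Ne.symm hk.2)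
  have hst := hsolo.1.2 (g i) (by simp)
  rw [hstart.2, hinv] at hst
  refine ⟨?_, hsolo.1.pending hk' (by simp) hst.inv_iff.2.1 fun j r hj _ => (hlater j hj).1 r⟩
  have hp := hk.1.2
  cases hl : lab' k with
  | inv p' op' =>
    rw [hl] at hp
    obtain rfl : p' = p := hp
    exact ((hlater k hk').2 _ hl).elim
  | step p' =>
    rw [hl] at hp
    obtain rfl : p' = p := hp
    rfl
  | res p' r =>
    rw [hl] at hp
    obtain rfl : p' = p := hp
    exact ((hlater k hk').1 _ hl).elim

/-- A process that has taken its last step takes finitely many steps in the simulating run. -/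
theorem finite_of_stopped {p : P} {op : Op} {l : VState V St} {j₀ : ℕ} (hop : op ∉ Q)
    (htop : ∀ k, ∃ i, k < g i) (hp : (cfg j₀).procs p = some (op, l))
    (hquiet : ∀ j, j₀ ≤ j → (lab j).proc ≠ p) :
    ∃ s, {k | s ≤ k ∧ (lab' k).proc = p}.Finite := by
  obtain ⟨a, ha, hinv, hbtw⟩ := hrun.exists_inv (by simp) hp
  refine ⟨g a, ?_⟩
  by_contra hinf
  obtain ⟨b, hb, hn⟩ := eventCount_unbounded hinf (eventCount lab p a j₀ + 1)
  -- A process without further events may still be served when a version is linearized. Its events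
  -- in the simulating run never outnumber those in the simulated run, which are now constant.
  have hfrozen : ∀ j, j₀ ≤ j → eventCount lab p a j = eventCount lab p a j₀ := by
    intro j hj
    induction j, hj using Nat.le_induction with
    | base => rfl
    | succ j hj ih => rw [eventCount_succ _ _ (by omega), ih, if_neg (hquiet j hj), add_zero]
  have hres : ∀ k r, a < k → lab k ≠ .res p r := by
    intro k r hk h
    rcases lt_or_ge k j₀ with h1 | h1
    · exact (hbtw k hk h1).1 r h
    · exact hquiet k h1 (by rw [h]; rfl)
  have hbound : ∀ j, j₀ ≤ j → eventCount lab' p (g a) (g j) ≤ eventCount lab p a j₀ := by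
    intro j hj
    rw [← hfrozen j hj]
    exact (hS.time p op a j hop hinv (by omega) (by simp) fun k r hk _ => hres k r hk).1
  obtain ⟨j, hj⟩ := htop b
  have h1 := hbound (max j j₀) (le_max_right _ _)
  have h2 : eventCount lab' p (g a) b ≤ eventCount lab' p (g a) (g (max j j₀)) :=
    eventCount_mono (hj.le.trans (hS.mono (le_max_left _ _)))
  omega

end SimulatedRun

namespace CASStructure

variable {P Op Ret V St : Type*} [Finite P] {D : CASStructure P Op Ret V St} {Q F : Set Op}

/-- Progress concerns only updates, so no queries are executed; this also avoids any hypothesis on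
the queries. -/
theorem exists_simulatedRun_top {cfg : ℕ → Config P Op (VMem V) (VState V St)}
    {lab : ℕ → Label P Op Ret} (hrun : (D.versioned Q).IsRun ⊤ cfg lab) :
    ∃ cfg' lab' g, SimulatedRun D Q ⊤ cfg lab (fun _ _ => none) cfg' lab' g :=
  exists_simulatedRun hrun (by simp)

theorem versioned_waitFree (hF : F ⊆ Qᶜ) (h : D.impl.WaitFree Q F) :
    (D.versioned Q).WaitFree ∅ F := by
  intro cfg lab hrun i p op hinv hop hinf
  by_contra hcon
  push Not at hcon
  obtain ⟨cfg', lab', g, hS⟩ := D.exists_simulatedRun_top hrun.1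
  obtain ⟨htop, h1, h2, h3, h4⟩ := hS.infinite_instance hrun.1 hinv (hF hop) hcon hinf
  obtain ⟨k, r, hk, hr⟩ := h cfg' lab' h1 (g i) p op h2 hop (h4.mono fun k hk => hk.1)
  exact h3 k r hk hr

/-- When `p` runs alone, the simulating run may still contain instructions of other processes,
executed with the versions that `p` linearizes. There are finitely many of them for each process, so
`p` eventually runs alone there as well. -/
theorem versioned_obstructionFree (hF : F ⊆ Qᶜ) (h : D.impl.ObstructionFree Q F) :
    (D.versioned Q).ObstructionFree ∅ F := by
  rintro cfg lab hrun i p op hinv hop ⟨N₀, hN₀⟩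
  by_contra hcon
  push Not at hcon
  obtain ⟨cfg', lab', g, hS⟩ := D.exists_simulatedRun_top hrun.1
  have hstep : ∀ j, max N₀ (i + 1) ≤ j → lab j = .step p := by
    intro j hj
    have hp := hN₀ j (by omega)
    have hst := hrun.1.2 i (by simp)
    rw [hinv] at hst
    obtain ⟨l, hl⟩ := hrun.1.pending (j := j) (by omega : i + 1 ≤ j) (by simp) hst.inv_iff.2.1
      fun k r hk _ => hcon k r hk
    cases hl' : lab j with
    | inv p' op' =>
      rw [hl'] at hp
      obtain rfl : p' = p := hp
      have hst := hrun.1.2 j (by simp)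
      rw [hl'] at hst
      rw [hst.inv_iff.1] at hl
      cases hl
    | step p' =>
      rw [hl'] at hp
      obtain rfl : p' = p := hp
      rfl
    | res p' r =>
      rw [hl'] at hp
      obtain rfl : p' = p := hp
      exact (hcon j r (by omega) hl').elim
  have hinf : {j | lab j = .step p}.Infinite :=
    (Set.Ici_infinite (max N₀ (i + 1))).mono fun j hj => hstep j hj
  obtain ⟨htop, h1, h2, h3, h4⟩ := hS.infinite_instance hrun.1 hinv (hF hop) hcon hinf
  have hfrozen : ∀ j, max N₀ (i + 1) ≤ j → ∀ p', p' ≠ p →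
      (cfg j).procs p' = (cfg (max N₀ (i + 1))).procs p' := by
    intro j hj p' hp'
    induction j, hj using Nat.le_induction with
    | base => rfl
    | succ j hj ih =>
      rw [(hrun.1.2 j (by simp)).procs_of_ne (by rw [hstep j hj]; exact Ne.symm hp'), ih]
  -- A stopped process with a pending update has finitely many events left. One that is idle or has
  -- a query pending has none, since it is absent from the simulating run.
  have hfin : ∀ p' : P, ∃ s, ∀ k, s ≤ k → g (max N₀ (i + 1)) ≤ k → (lab' k).proc = p' → p' = p := by
    intro p'
    by_cases hp' : p' = p
    · exact ⟨0, fun _ _ _ _ => hp'⟩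
    by_cases hpend : ∃ op l, (cfg (max N₀ (i + 1))).procs p' = some (op, l) ∧ op ∉ Q
    · obtain ⟨op', l, h5, h6⟩ := hpend
      obtain ⟨s, hs⟩ := hS.finite_of_stopped hrun.1 h6 htop h5 fun j hj => by
        rw [hstep j hj]
        exact Ne.symm hp'
      obtain ⟨s', hs'⟩ := hs.bddAbove
      refine ⟨max s (s' + 1), fun k hk _ hk' => ?_⟩
      have := hs' ⟨(le_max_left _ _).trans hk, hk'⟩
      omega
    · refine ⟨0, fun k _ hk hk' => ?_⟩
      exfalso
      obtain ⟨b, hb⟩ := htop k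
      obtain ⟨j, -, -, hj, hj'⟩ := hS.exists_of_lt hb
      have hjN : max N₀ (i + 1) ≤ j := by
        by_contra hcon'
        have := hS.mono (show j + 1 ≤ max N₀ (i + 1) by omega)
        omega
      rcases hS.entry j (by simp) k hj hj' with ⟨-, h5, -⟩ | ⟨p₁, op₁, l₁, h5, h6, h7⟩ | ⟨_, _, _, h5, -⟩
      · rw [h5, hstep j hjN] at hk'
        exact hp' hk'.symm
      · rw [h5] at hk'
        obtain rfl : p₁ = p' := hk'
        rw [hfrozen j hjN _ hp'] at h6
        exact hpend ⟨_, _, h6, h7⟩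
      · cases h5
  choose s hs using hfin
  obtain ⟨B, hB⟩ := (Set.finite_range s).bddAbove
  obtain ⟨k, r, hk, hr⟩ := h cfg' lab' h1 (g i) p op h2 hop
    ⟨max B (g (max N₀ (i + 1))), fun k hk =>
      hs (lab' k).proc k ((hB ⟨_, rfl⟩).trans (by omega)) (by omega) rfl⟩
  exact h3 k r hk hr

/-- If only finitely many operations of `F` return, some process stays forever in one instance,
which also runs forever in the simulating run. Then infinitely many operations of `F` return there,
and each of these responses is a copy of one in the original run. -/
theorem versioned_lockFree (hF : F ⊆ Qᶜ) (h : D.impl.LockFree Q F) :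
    (D.versioned Q).LockFree ∅ F := by
  intro cfg lab hrun hinf hfin
  obtain ⟨cfg', lab', g, hS⟩ := D.exists_simulatedRun_top hrun.1
  -- a process that takes infinitely many steps of operations of `F`
  obtain ⟨p, hp⟩ : ∃ p, {j | Impl.EventOf F cfg lab j ∧ lab j = .step p}.Infinite := by
    by_contra hcon
    push Not at hcon
    refine hinf ((Set.finite_iUnion hcon).subset ?_)
    rintro j ⟨h1, p, h2⟩
    exact Set.mem_iUnion.2 ⟨p, h1, h2⟩
  obtain ⟨B, hB⟩ := hfin.bddAbove
  obtain ⟨j₀, ⟨h1, h2⟩, hj₀⟩ := hp.exists_gt B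
  rw [Impl.EventOf, h2] at h1
  obtain ⟨op, l, hl, hop⟩ := h1
  obtain ⟨i, hi, hinv, hbtw⟩ := hrun.1.exists_inv (by simp) hl
  have hres : ∀ k r, i < k → lab k ≠ .res p r := by
    intro k r hk
    rcases lt_or_ge k j₀ with hkj | hkj
    · exact (hbtw k hk hkj).1 r
    induction k using Nat.strong_induction_on generalizing r with
    | _ k ih =>
      intro hr
      obtain ⟨l', hl'⟩ := hrun.1.pending hkj (by simp) hl fun k' r' h1 h2 => ih k' h2 r' (by omega) h1
      have : k ≤ B := hB ⟨by rw [Impl.EventOf, hr]; exact ⟨op, l', hl', hop⟩, p, r, hr⟩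
      omega
  obtain ⟨htop, h3, h4, h5, h6⟩ := hS.infinite_instance hrun.1 hinv (hF hop) hres
    (hp.mono fun j hj => hj.2)
  refine h cfg' lab' h3 (h6.mono ?_) ?_
  · rintro k ⟨h7, l', h8⟩
    refine ⟨?_, p, h7⟩
    rw [Impl.EventOf, h7]
    exact ⟨op, l', h8, hop⟩
  -- Responses of updates in the simulating run sit at positions `g j`, where `j` is the same
  -- response in the original run.
  · refine (hfin.image g).subset ?_
    rintro k ⟨h7, p', r, h8⟩
    rw [Impl.EventOf, h8] at h7
    obtain ⟨op', l', h9, h10⟩ := h7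
    obtain ⟨b, hb⟩ := htop k
    obtain ⟨j, -, -, hj, hj'⟩ := hS.exists_of_lt hb
    obtain ⟨rfl, h11, h12⟩ := hS.of_updateEvent (by simp) hj hj'
      (.inr ⟨p', r, op', l', h8, h9, hF h10⟩)
    rw [h11] at h8
    rcases h12 with ⟨_, _, h12, -⟩ | ⟨p₁, r₁, op₁, l₁, h12, h13, h14⟩
    · rw [h8] at h12
      cases h12
    · rw [h8] at h12
      cases h12
      obtain ⟨e, h, hsim⟩ := hS.sim j (by simp)
      obtain ⟨hl, h15, -⟩ := hsim.upd _ _ _ h13 h14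
      rw [h9] at h15
      cases h15
      refine ⟨j, ⟨?_, p', r, h8⟩, rfl⟩
      rw [Impl.EventOf, h8]
      exact ⟨op', l₁, h13, h10⟩

end CASStructure

/-! ## Snapshots -/

namespace VMem

variable {V : Type*} {m : VMem V} {h n n' : ℕ} {v v' : V}

theorem VersionVal.iff_here {t : ℕ} (ht : m.tsOf n = some (some t)) (hle : t ≤ h) :
    m.VersionVal h n v ↔ m.valOf n = some v := by
  obtain ⟨nd, hnd, hts⟩ := Option.map_eq_some_iff.1 ht
  have hval : m.valOf n = some nd.val := by rw [valOf, hnd]; rfl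
  rw [hval]
  constructor
  · intro hv
    cases hv with
    | here _ t' nd' h1 h2 h3 =>
      rw [hnd] at h1
      cases h1
      rfl
    | next _ n' nd' _ h1 h2 h3 h4 =>
      rw [hnd] at h1
      cases h1
      exact (h2 ⟨t, hts, hle⟩).elim
  · intro hv
    cases hv
    exact .here n t nd hnd hts hle

/-- The hypothesis also covers undecided versions: the search passes over them just as over versions
with a larger timestamp. -/
theorem VersionVal.iff_next (ht : ∀ t, m.tsOf n = some (some t) → h < t) :
    m.VersionVal h n v ↔ ∃ n', m.nextOf n = some (some n') ∧ m.VersionVal h n' v := by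
  constructor
  · intro hv
    cases hv with
    | here _ t nd h1 h2 h3 =>
      have := ht t (by rw [tsOf, h1, ← h2]; rfl)
      omega
    | next _ n' nd _ h1 h2 h3 h4 => exact ⟨n', by rw [nextOf, h1, ← h3]; rfl, h4⟩
  · rintro ⟨n', hn, hv⟩
    obtain ⟨nd, hnd, hnx⟩ := Option.map_eq_some_iff.1 hn
    refine .next n n' nd v hnd ?_ hnx hv
    rintro ⟨t, h1, h2⟩
    have := ht t (by rw [tsOf, hnd, ← h1]; rfl)
    omega

theorem IsSnapshot.unique {C C' : ℕ → Option V} (hC : m.IsSnapshot h C) (hC' : m.IsSnapshot h C') :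
    C = C' := by
  funext x
  refine Option.ext fun v => ?_
  rw [hC x v, hC' x v]

/-- The version that is found has been a head of the same object. -/
theorem VersionVal.exists_ts {J : ℕ → ℕ → Prop} (hm : m.Inv J) {x : ℕ} (hx : J x n)
    (hv : m.VersionVal h n v) : ∃ n' t, J x n' ∧ t ≤ h ∧ m.tsOf n' = some (some t) := by
  induction hv with
  | here n t nd hn ht hle => exact ⟨n, t, hx, hle, by rw [tsOf, hn, ← ht]; rfl⟩
  | next n n' nd v hn ht hn' hv ih =>
    exact ih (hm.next hx (n' := n') (by rw [nextOf, hn, ← hn']; rfl)).1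

end VMem

section

variable {P Op Ret V St : Type*} {D : CASStructure P Op Ret V St} {Q : Set Op} {N : ℕ∞}
  {cfg : ℕ → Config P Op (VMem V) (VState V St)} {lab : ℕ → Label P Op Ret}

/-- How the heads change. -/
theorem VStep.vhead_eq {l l' : VState V St} {m m' : VMem V} (hs : VStep D l m l' m') {x n : ℕ}
    (hx : m.vhead x = some n) : m'.vhead x = some n ∨
      ∃ k n', l = .casAppend x k n n' ∧ m'.vhead x = some n' ∧ m'.node = m.node := by
  cases hs with
  | casAppendSucc y k n₁ n' m hy =>
    by_cases hxy : x = y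
    · subst hxy
      rw [hx] at hy
      cases hy
      exact .inr ⟨k, n', rfl, by simp, rfl⟩
    · exact .inl (by simpa [Function.update_of_ne hxy] using hx)
  | newHead n' k y m hy =>
    have hxy : x ≠ y := by
      rintro rfl
      rw [hx] at hy
      cases hy
    exact .inl (by simpa [Function.update_of_ne hxy] using hx)
  | _ => exact .inl hx

/-- Once the timestamp of the camera is larger than `h`, the version of an object that belongs to
the snapshot with handle `h` does not change. -/
theorem versionVal_head (hrun : (D.versioned Q).IsRun N cfg lab) {i j : ℕ} (hij : i ≤ j) {k : ℕ}
    (hjk : j ≤ k) (hk : (k : ℕ∞) ≤ N) {h x n : ℕ} (hlt : h < (cfg i).shared.timestamp)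
    (hx : (cfg i).shared.vhead x = some n) :
    ∃ n', (cfg j).shared.vhead x = some n' ∧
      ∀ v, (cfg k).shared.VersionVal h n' v ↔ (cfg k).shared.VersionVal h n v := by
  induction j, hij using Nat.le_induction with
  | base => exact ⟨n, hx, fun v => Iff.rfl⟩
  | succ j hij ih =>
    obtain ⟨n₁, h1, h2⟩ := ih (by omega)
    have hjN : (j : ℕ∞) < N := lt_of_lt_of_le (by exact_mod_cast (by omega : j < k)) hk
    have hjN' : ((j + 1 : ℕ) : ℕ∞) ≤ N := by exact_mod_cast Order.add_one_le_of_lt hjN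
    have hst := hrun.2 j hjN
    have hinv := D.configInv_run hrun hjN.le
    cases hlab : lab j with
    | inv p op =>
      rw [hlab] at hst
      rw [hst.inv_iff.2.2]
      exact ⟨n₁, h1, h2⟩
    | res p r =>
      rw [hlab] at hst
      obtain ⟨-, -, -, -, -, h3⟩ := hst.res_iff
      rw [h3]
      exact ⟨n₁, h1, h2⟩
    | step p =>
      rw [hlab] at hst
      obtain ⟨op, l, l', h3, h4, h5⟩ := hst.step_iff
      rcases (vstep_of_step h4).vhead_eq h1 with h6 | ⟨κ, n', rfl, h6, h7⟩
      · exact ⟨n₁, h6, h2⟩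
      · refine ⟨n', h6, fun v => ?_⟩
        rw [← h2 v]
        have hJ : HeadBy cfg (j + 1) x n' := ⟨j + 1, le_rfl, h6⟩
        have hnext : (cfg (j + 1)).shared.nextOf n' = some (some n₁) := by
          rw [VMem.nextOf, h7]
          exact (hinv.loc h3).2.2.1
        have hnext' := ((D.ext_run hrun hjk hk).next_eq hJ).trans hnext
        rw [VMem.VersionVal.iff_next]
        · constructor
          · rintro ⟨n₂, h8, h9⟩
            rw [hnext'] at h8
            cases h8
            exact h9
          · exact fun h8 => ⟨n₁, hnext', h8⟩
        · intro t ht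
          by_contra hcon
          -- If the timestamp of the new version were at most `h`, then by `ts_of_final` it would
          -- have been decided or held by a process in configuration `i`. Either way the version
          -- would have been a head by then, but it is still private when it is appended later.
          have hnew : ∀ y, ¬ HeadBy cfg i y n' := fun y hy =>
            hinv.priv h3 (n := n') rfl y (hy.mono hij)
          rcases ts_of_final hrun (by omega : i ≤ k) hk ht (by omega) with h8 | ⟨p', op', next, h8⟩
          · obtain ⟨⟨y, hy⟩, -⟩ :=
              (D.configInv_run hrun ((Nat.cast_le.2 (hij.trans (by omega : j ≤ k))).trans hk)).mem.J_of_ts h8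
            exact hnew y hy
          · obtain ⟨⟨⟨y, hy⟩, -⟩, -⟩ :=
              (D.configInv_run hrun ((Nat.cast_le.2 (hij.trans (by omega : j ≤ k))).trans hk)).loc h8
            exact hnew y hy

end

section

variable {P Op Ret V St : Type*} {D : CASStructure P Op Ret V St} {Q : Set Op} {n : ℕ}
  {cfg : ℕ → Config P Op (VMem V) (VState V St)} {lab : ℕ → Label P Op Ret}
  (hrun : (D.versioned Q).IsRun n cfg lab)

include hrun

/-- The snapshot as seen from a head. -/
theorem VMem.IsSnapshot.iff_head {h : ℕ} {C : ℕ → Option V} (hC : (cfg n).shared.IsSnapshot h C)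
    {i : ℕ} (hi : i ≤ n) (hlt : h < (cfg i).shared.timestamp) {x m : ℕ}
    (hx : (cfg i).shared.vhead x = some m) (v : V) :
    C x = some v ↔ (cfg n).shared.VersionVal h m v := by
  obtain ⟨m', h1, h2⟩ := versionVal_head hrun hi le_rfl le_rfl hlt hx
  rw [hC x v, ← h2 v]
  constructor
  · rintro ⟨m'', h3, h4⟩
    rw [h1] at h3
    cases h3
    exact h4
  · exact fun h3 => ⟨m', h1, h3⟩

/-- The versions that are linearized when the camera gets beyond `h`. -/
theorem linearized_iff {i h m : ℕ} (hi : i < n) (hclock : (cfg i).shared.timestamp = h)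
    (hclock' : (cfg (i + 1)).shared.timestamp = h + 1) :
    Linearized n cfg (i + 1) m ↔ ∃ t ≤ h, (cfg n).shared.tsOf m = some (some t) := by
  have hi' : ((i + 1 : ℕ) : ℕ∞) ≤ n := by exact_mod_cast hi
  have hfinal : ∀ {j t}, j ≤ n → (cfg j).shared.tsOf m = some (some t) →
      (cfg n).shared.tsOf m = some (some t) := by
    intro j t hj ht
    have hjn : (j : ℕ∞) ≤ n := by exact_mod_cast hj
    obtain ⟨⟨x, hx⟩, -⟩ := (D.configInv_run hrun hjn).mem.J_of_ts ht
    exact (D.ext_run hrun hj le_rfl).ts_eq hx ht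
  constructor
  · rintro ⟨hx, ⟨t, ht⟩ | ⟨t, ht, j, hj, h1⟩⟩
    · refine ⟨t, ?_, hfinal hi ht⟩
      have hst := hrun.2 i (by exact_mod_cast hi)
      have hold : (cfg i).shared.tsOf m = some (some t) := by
        cases hlab : lab i with
        | inv p op =>
          rw [hlab] at hst
          rwa [hst.inv_iff.2.2] at ht
        | res p r =>
          rw [hlab] at hst
          obtain ⟨-, -, -, -, -, h3⟩ := hst.res_iff
          rwa [h3] at ht
        | step p =>
          rw [hlab] at hst
          obtain ⟨op, l, l', -, h4, -⟩ := hst.step_iff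
          rcases (vstep_of_step h4).tsOf_eq ht with h5 | ⟨-, -, h5⟩
          · exact h5
          · omega
      have := ((D.configInv_run hrun (i := i) (by exact_mod_cast hi.le)).mem.J_of_ts hold).2
      omega
    · exact ⟨t, by omega, hfinal (by exact_mod_cast hj) h1⟩
  · rintro ⟨t, ht, h1⟩
    have hinv := D.configInv_run hrun hi'
    rcases ts_of_final hrun (i := i + 1) hi le_rfl h1 (by omega) with h2 | ⟨p, op, next, h2⟩
    · exact ⟨(hinv.mem.J_of_ts h2).1, .inl ⟨t, h2⟩⟩
    · exact ⟨(hinv.loc h2).1.1, .inr ⟨t, by omega, n, le_rfl, h1⟩⟩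

/-- When the camera gets from `h` to `h + 1`, the memory of the original data structure is the
snapshot with handle `h`. -/
theorem Sim.isSnapshot {i h : ℕ} (hi : i < n) (hclock : (cfg i).shared.timestamp = h)
    (hclock' : (cfg (i + 1)).shared.timestamp = h + 1) {hc : Config P Op (ℕ → Option V) St}
    {e e' : P → ℕ} (hs : Sim D Q (HeadBy cfg (i + 1)) (Linearized n cfg (i + 1)) (cfg (i + 1)) hc e e') :
    (cfg n).shared.IsSnapshot h hc.shared := by
  have hi' : ((i + 1 : ℕ) : ℕ∞) ≤ n := by exact_mod_cast hi
  have hext := D.ext_run hrun hi le_rfl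
  have hlin := fun m => linearized_iff hrun (m := m) hi hclock hclock'
  have hinvn := D.configInv_run hrun (i := n) le_rfl
  intro x v
  cases hx : (cfg (i + 1)).shared.vhead x with
  -- An object created after the step of the camera has no version with timestamp at most `h`,
  -- because such a version would already be linearized and hence a head.
  | none =>
    have hnone : ∀ m, ¬ HeadBy cfg (i + 1) x m := fun m hm => by
      obtain ⟨m', hm'⟩ := hs.inv.mem.head_of_J hm
      rw [hx] at hm'
      cases hm'
    constructor
    · intro hv
      obtain ⟨m, h1, -⟩ := (hs.shared x v).1 hv
      exact (hnone m h1).elim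
    · rintro ⟨m, h1, h2⟩
      obtain ⟨m', t, h3, h4, h5⟩ := h2.exists_ts hinvn.mem ⟨n, le_rfl, h1⟩
      obtain ⟨⟨y, hy⟩, -⟩ := (hlin m').2 ⟨t, h4, h5⟩
      rw [hinvn.mem.obj_unique h3 (hy.mono hi)] at hnone
      exact (hnone m' hy).elim
  | some m =>
    obtain ⟨m', h1, h2⟩ := versionVal_head hrun (i := i + 1) hi le_rfl le_rfl (h := h) (by omega) hx
    have hJ : HeadBy cfg (i + 1) x m := ⟨i + 1, le_rfl, hx⟩
    have hR : (∃ n₁, (cfg n).shared.vhead x = some n₁ ∧ (cfg n).shared.VersionVal h n₁ v) ↔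
        (cfg n).shared.VersionVal h m v := by
      rw [← h2 v]
      constructor
      · rintro ⟨m'', h3, h4⟩
        rw [h1] at h3
        cases h3
        exact h4
      · exact fun h3 => ⟨m', h1, h3⟩
    rw [hR]
    -- At most the head is too new. If it is linearized, both sides give its value; otherwise both
    -- give the value of the version below it, if there is one, and that version is decided and
    -- linearized.
    by_cases hm : Linearized n cfg (i + 1) m
    · obtain ⟨t, h3, h4⟩ := (hlin m).1 hm
      rw [(hs.shared_head hx hm).2, VMem.VersionVal.iff_here h4 h3, hext.val_eq hJ]
    · rw [VMem.VersionVal.iff_next fun t ht => not_le.1 fun hle => hm ((hlin m).2 ⟨t, hle, ht⟩),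
        hext.next_eq hJ]
      obtain ⟨nd, hnd⟩ := Option.ne_none_iff_exists'.1 (hs.inv.mem.exists_of_J hJ)
      cases hnx : nd.nextv with
      | none =>
        have hnx' : (cfg (i + 1)).shared.nextOf m = some none := by rw [VMem.nextOf, hnd, ← hnx]; rfl
        rw [hs.shared_none hJ hm hnx', hnx']
        simp
      | some m₁ =>
        have hnx' : (cfg (i + 1)).shared.nextOf m = some (some m₁) := by
          rw [VMem.nextOf, hnd, ← hnx]; rfl
        obtain ⟨h3, h4, -⟩ := hs.inv.mem.next hJ hnx'
        obtain ⟨t, h5, h6⟩ := (hlin m₁).1 (hs.lin_of_decided _ h4)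
        rw [hs.shared_next hJ hm hnx', hnx', ← hext.val_eq h3, ← VMem.VersionVal.iff_here h6 h5]
        simp

end

/-! ## Running queries -/

section

variable {P Op Ret V St : Type*} (D : CASStructure P Op Ret V St) (m : VMem V) (C : ℕ → Option V)
  (h : ℕ) (s₀ : St) (k : ℕ)

/-- The local states of a query with handle `h` that has executed `k` original instructions. The
last argument is the number of steps for the current instruction, without the traversal of the
version list. -/
inductive Running : VState V St → ℕ → Prop
  | query (s) (hr : D.ReadRun C s₀ k s) : Running (.query h s) 0
  | initTest (s x κ n v) (hr : D.ReadRun C s₀ k s) (hc : D.code s = .read x κ) (hx : C x = some v)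
      (hv : m.VersionVal h n v) : Running (.initTest n (.ssTest h κ n)) 1
  | initRead (s x κ n v) (hr : D.ReadRun C s₀ k s) (hc : D.code s = .read x κ) (hx : C x = some v)
      (hv : m.VersionVal h n v) : Running (.initRead n (.ssTest h κ n)) 2
  | initCas (s x κ n v t) (hr : D.ReadRun C s₀ k s) (hc : D.code s = .read x κ) (hx : C x = some v)
      (hv : m.VersionVal h n v) : Running (.initCas n t (.ssTest h κ n)) 3
  | ssTest (s x κ n v) (hr : D.ReadRun C s₀ k s) (hc : D.code s = .read x κ) (hx : C x = some v)
      (hv : m.VersionVal h n v) : Running (.ssTest h κ n) 4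
  | ssNext (s x κ n v) (hr : D.ReadRun C s₀ k s) (hc : D.code s = .read x κ) (hx : C x = some v)
      (hv : m.VersionVal h n v) : Running (.ssNext h κ n) 5
  | ssRet (s x κ n v) (hr : D.ReadRun C s₀ k s) (hc : D.code s = .read x κ) (hx : C x = some v)
      (hv : m.VersionVal h n v) : Running (.ssRet h κ n) 5

/-- The process is about to follow a pointer in a version list. -/
def VState.IsNext : VState V St → Prop
  | .ssNext _ _ _ => True
  | _ => False

variable {D m C h s₀ k}

-- The original query run on `C` serves as a guide. An original read costs 6 steps, counting reading
-- `VHead`, `initTS`, one test and the return of the value; each followed pointer adds 2, for itself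
-- and for the next test.
open Classical in
theorem Running.step {J J' : ℕ → ℕ → Prop} {l l' : VState V St} {m₁ m₁' : VMem V} {o : ℕ}
    (hr : Running D m C h s₀ k l o) (hst : VStep D l m₁ l' m₁') (hl : l.Inv J m₁)
    (hext : VMem.Ext J m₁ J' m)
    (hhead : ∀ x n v, h < m₁.timestamp → m₁.vhead x = some n → C x = some v →
      m.VersionVal h n v)
    (hok : ∀ k s x κ, D.ReadRun C s₀ k s → D.code s = .read x κ → ∃ v, C x = some v) :
    ∃ k' o', Running D m C h s₀ k' l' o' ∧
      6 * k + o + 1 ≤ 6 * k' + o' + 2 * (if l.IsNext then 1 else 0) := by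
  cases hr with
  | query s hr =>
    cases hst with
    | queryRead _ _ x κ n _ hc hx =>
      obtain ⟨v, hv⟩ := hok k s x κ hr hc
      exact ⟨k, 1, .initTest _ _ _ _ _ hr hc hv (hhead _ _ _ hl hx hv), by simp⟩
    | queryLoc _ _ s' _ hc => exact ⟨k + 1, 0, .query _ (hr.loc _ _ _ hc), by omega⟩
  | initTest s x κ n v hr hc hx hv =>
    cases hst with
    | initTestNone => exact ⟨k, 2, .initRead _ _ _ _ _ hr hc hx hv, by simp⟩
    | initTestSome => exact ⟨k, 4, .ssTest _ _ _ _ _ hr hc hx hv, by omega⟩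
  | initRead s x κ n v hr hc hx hv =>
    cases hst
    exact ⟨k, 3, .initCas _ _ _ _ _ _ hr hc hx hv, by simp⟩
  | initCas s x κ n v t hr hc hx hv =>
    cases hst <;> exact ⟨k, 4, .ssTest _ _ _ _ _ hr hc hx hv, by simp⟩
  | ssTest s x κ n v hr hc hx hv =>
    cases hst with
    | ssTestGt => exact ⟨k, 5, .ssNext _ _ _ _ _ hr hc hx hv, by simp⟩
    | ssTestLe => exact ⟨k, 5, .ssRet _ _ _ _ _ hr hc hx hv, by simp⟩
  | ssNext s x κ n v hr hc hx hv =>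
    obtain ⟨-, ⟨y, hy⟩, t, hlt, ht⟩ := hl
    -- The current version is too new for the handle, so the value is found below it; in particular
    -- the pointer is not null.
    rw [VMem.VersionVal.iff_next fun t' ht' => by
      rw [hext.ts_eq hy ht] at ht'
      cases ht'
      exact hlt, hext.next_eq hy] at hv
    obtain ⟨n₁, h1, hv⟩ := hv
    cases hst with
    | ssNextSome _ _ _ _ nd n' hn hn' =>
      rw [VMem.nextOf, hn, Option.map_some, hn'] at h1
      cases h1
      exact ⟨k, 4, .ssTest _ _ _ _ _ hr hc hx hv, by simp [VState.IsNext]⟩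
    | ssNextNone _ _ _ _ nd hn hn' =>
      rw [VMem.nextOf, hn, Option.map_some, hn'] at h1
      cases h1
  | ssRet s x κ n v hr hc hx hv =>
    obtain ⟨-, ⟨y, hy⟩, t, hle, ht⟩ := hl
    rw [VMem.VersionVal.iff_here (hext.ts_eq hy ht) hle, hext.val_eq hy] at hv
    cases hst with
    | ssRet _ _ _ _ nd hn =>
      rw [VMem.valOf, hn] at hv
      cases hv
      exact ⟨k + 1, 0, .query _ (hr.read _ _ _ _ _ hc hx), by omega⟩

end

/-! ## Reachable configurations -/

section

variable {P Op Ret S L : Type*} {M : Impl P Op Ret S L} {Q : Set Op}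

theorem Impl.IsSoloRun.exists_path {n : ℕ∞} {cfg : ℕ → Config P Op S L} {lab : ℕ → Label P Op Ret}
    (h : M.IsSoloRun Q n cfg lab) {k : ℕ} (hk : (k : ℕ∞) ≤ n) :
    ∃ es, SoloPath M Q ⟨M.init, fun _ => none⟩ es (cfg k) := by
  induction k with
  | zero =>
    rw [← h.1.1]
    exact ⟨[], .nil _⟩
  | succ k ih =>
    have hkn : (k : ℕ∞) < n := lt_of_lt_of_le (by exact_mod_cast Nat.lt_succ_self k) hk
    obtain ⟨es, hes⟩ := ih hkn.le
    exact ⟨_, hes.append (.single (h.1.2 k hkn) (h.2 k hkn))⟩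

/-- The hypotheses on `D` are stated for runs, while extensions are built as paths; this translates
back. -/
theorem SoloPath.exists_run {es : List (Config P Op S L × Label P Op Ret)} {c : Config P Op S L}
    (h : SoloPath M Q ⟨M.init, fun _ => none⟩ es c) (ℓ₀ : Label P Op Ret) :
    ∃ (k : ℕ) (cfg : ℕ → Config P Op S L) (lab : ℕ → Label P Op Ret),
      M.IsSoloRun Q k cfg lab ∧ cfg k = c := by
  obtain ⟨cfg, lab, h1, -, h3⟩ := exists_run_of_paths (M := M) (Q := Q)
    (hc := fun i => if i = 0 then ⟨M.init, fun _ => none⟩ else c)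
    (seg := fun i => if i = 0 then es else []) (fun i => by
      by_cases hi : i = 0
      · simpa [hi] using h
      · simpa [hi] using .nil c) ℓ₀
  refine ⟨_, cfg, lab, ⟨⟨h1 0, fun k hk => (h3 k 1 (by exact_mod_cast hk)).1⟩,
    fun k hk => (h3 k 1 (by exact_mod_cast hk)).2⟩, h1 1⟩

end

section

variable {P Op Ret V St : Type*} {D : CASStructure P Op Ret V St} {Q : Set Op}

/-- In a reachable configuration without pending queries, a query that is run solo only reads
existing objects. -/
theorem SoloPath.readRun_ok (hns : D.impl.NeverStuck Q) (hro : D.ReadOnly Q)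
    {es : List (Config P Op (ℕ → Option V) St × Label P Op Ret)} {c : Config P Op (ℕ → Option V) St}
    (h : SoloPath D.impl Q ⟨D.init, fun _ => none⟩ es c)
    (hnoq : ∀ p op l, c.procs p = some (op, l) → op ∉ Q) {p : P} {q : Op} (hq : q ∈ Q)
    (hp : c.procs p = none) {k : ℕ} {s : St} (hr : D.ReadRun c.shared (D.start p q) k s) :
    (∃ r, D.code s = .ret r) ∨ (∃ s', D.code s = .loc s') ∨
      ∃ x κ v, D.code s = .read x κ ∧ c.shared x = some v := by
  classical
  obtain ⟨mid, h1, -⟩ := SoloPath.readRun hp hnoq hr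
  obtain ⟨n, cfg, lab, h2, h3⟩ := (h.append h1).exists_run (.step p)
  have hpend : (cfg n).procs p = some (q, s) := by simp [h3]
  have h4 := hns n cfg lab h2 p q s hpend
  have h5 := hro n cfg lab h2 p q s hpend hq
  rw [h3] at h4
  cases hc : D.code s with
  | ret r => exact .inl ⟨r, rfl⟩
  | loc s' => exact .inr (.inl ⟨s', rfl⟩)
  | cas => simp [hc] at h5
  | new => simp [hc] at h5
  | read x κ =>
    rcases h4 with ⟨r, h4⟩ | ⟨l', s', h4⟩
    · rw [impl_result, hc] at h4
      cases h4
    · simp only [CASStructure.impl, hc] at h4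
      obtain ⟨v, hv, -⟩ := h4
      exact .inr (.inr ⟨x, κ, v, rfl, hv⟩)

/-- The number of instructions of a query is bounded by its solo running time. -/
theorem CASStructure.ReadRun.soloTime {C : ℕ → Option V} {s₀ s : St} {k t : ℕ}
    (hr : D.ReadRun C s₀ k s) (ht : D.impl.SoloTime s₀ C t) :
    ∃ t', D.impl.SoloTime s C t' ∧ t = t' + k := by
  induction hr with
  | refl => exact ⟨t, ht, rfl⟩
  | read k s x κ v h hc hx ih =>
    obtain ⟨t', h1, rfl⟩ := ih
    cases h1 with
    | ret _ _ r h =>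
      rw [impl_result, hc] at h
      cases h
    | step _ l' _ s' t h ht' =>
      simp only [CASStructure.impl, hc] at h
      obtain ⟨v', hv', rfl, rfl⟩ := h
      rw [hx] at hv'
      cases hv'
      exact ⟨t, ht', by omega⟩
  | loc k s s' h hc ih =>
    obtain ⟨t', h1, rfl⟩ := ih
    cases h1 with
    | ret _ _ r h =>
      rw [impl_result, hc] at h
      cases h
    | step _ l' _ s' t h ht' =>
      simp only [CASStructure.impl, hc] at h
      obtain ⟨rfl, rfl⟩ := h
      exact ⟨t, ht', by omega⟩

/-- Reads and local steps are deterministic, so every complete solo execution begins with these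
instructions; the additional `1` is for the return. If there is none, the solo time is `⊤`. -/
theorem CASStructure.ReadRun.lt_soloTime {C : ℕ → Option V} {p : P} {q : Op} {s : St} {k : ℕ}
    (hr : D.ReadRun C (D.start p q) k s) : ((k + 1 : ℕ) : ℕ∞) ≤ D.impl.soloTime p q C := by
  refine le_iInf₂ fun t ht => ?_
  obtain ⟨t', h1, rfl⟩ := hr.soloTime ht
  have : 1 ≤ t' := by cases h1 <;> omega
  exact_mod_cast (by omega : k + 1 ≤ t' + k)

end

/-! ## The states of a query -/

section

variable {P Op Ret V St : Type*}

/-- Between the events `a` and `i`, while the process `p` was about to increment the camera from `h`,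
the camera has been incremented from `h`. -/
def SnapAt (cfg : ℕ → Config P Op (VMem V) (VState V St)) (p : P) (q : Op) (s : St) (a i h j : ℕ) :
    Prop :=
  a < j ∧ j < i ∧ (cfg j).procs p = some (q, .snapInc s h) ∧ (cfg j).shared.timestamp = h ∧
    (cfg (j + 1)).shared.timestamp = h + 1

open Classical in
/-- The number of pointers in version lists that the process `p` follows. -/
noncomputable def nextCount (cfg : ℕ → Config P Op (VMem V) (VState V St))
    (lab : ℕ → Label P Op Ret) (p : P) (a b : ℕ) : ℕ :=
  ((Finset.Ico a b).filter fun j => lab j = .step p ∧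
    ∃ q l, (cfg j).procs p = some (q, l) ∧ l.IsNext).card

open Classical in
theorem nextCount_succ (cfg : ℕ → Config P Op (VMem V) (VState V St)) (lab : ℕ → Label P Op Ret)
    (p : P) {a b : ℕ} (hab : a ≤ b) : nextCount cfg lab p a (b + 1) = nextCount cfg lab p a b +
      if lab b = .step p ∧ ∃ q l, (cfg b).procs p = some (q, l) ∧ l.IsNext then 1 else 0 := by
  rw [nextCount, nextCount, ← Finset.insert_Ico_right_eq_Ico_add_one hab, Finset.filter_insert]
  split_ifs
  · rw [Finset.card_insert_of_notMem (by simp)]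
  · rfl

/-- The states of the query `q` invoked by the process `p` in event `a` of a run of length `n`, before
event `i`. -/
inductive QueryState (D : CASStructure P Op Ret V St) (n : ℕ)
    (cfg : ℕ → Config P Op (VMem V) (VState V St)) (lab : ℕ → Label P Op Ret) (p : P) (q : Op)
    (a i : ℕ) : VState V St → Prop
  | snapRead (hcnt : eventCount lab p a i ≤ 1) : QueryState D n cfg lab p q a i (.snapRead (D.start p q))
  | snapInc (h : ℕ) (hle : (cfg a).shared.timestamp ≤ h)
      (hs : (cfg i).shared.timestamp = h ∨ ∃ j, SnapAt cfg p q (D.start p q) a i h j)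
      (hcnt : eventCount lab p a i ≤ 2) : QueryState D n cfg lab p q a i (.snapInc (D.start p q) h)
  | running (h C k o l) (hle : (cfg a).shared.timestamp ≤ h)
      (hs : ∃ j, SnapAt cfg p q (D.start p q) a i h j) (hC : (cfg n).shared.IsSnapshot h C)
      (hr : Running D (cfg n).shared C h (D.start p q) k l o)
      (hcnt : eventCount lab p a i ≤ 3 + (6 * k + o) + 2 * nextCount cfg lab p a i) :
      QueryState D n cfg lab p q a i l

variable {D : CASStructure P Op Ret V St} {Q : Set Op} {n : ℕ}
  {cfg : ℕ → Config P Op (VMem V) (VState V St)} {lab : ℕ → Label P Op Ret}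

theorem VStep.snapRead_eq {s : St} {l' : VState V St} {m m' : VMem V}
    (hs : VStep D (.snapRead s) m l' m') : l' = .snapInc s m.timestamp ∧ m' = m := by
  cases hs
  exact ⟨rfl, rfl⟩

theorem VStep.snapInc_eq {s : St} {h : ℕ} {l' : VState V St} {m m' : VMem V}
    (hs : VStep D (.snapInc s h) m l' m') : l' = .query h s ∧
      (m.timestamp = h ∧ m'.timestamp = h + 1 ∨ m.timestamp ≠ h) := by
  cases hs with
  | snapIncSucc _ _ _ ht => exact ⟨rfl, .inl ⟨ht, rfl⟩⟩
  | snapIncFail _ _ _ ht => exact ⟨rfl, .inr ht⟩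

theorem SnapAt.mono {p : P} {q : Op} {s : St} {a i i' h j : ℕ} (hs : SnapAt cfg p q s a i h j)
    (hi : i ≤ i') : SnapAt cfg p q s a i' h j :=
  ⟨hs.1, hs.2.1.trans_le hi, hs.2.2⟩

variable [Finite P] (hrun : (D.versioned Q).IsRun n cfg lab)

include hrun in
/-- The snapshot with handle `h` is the memory of a reachable configuration of the original data
structure in which the process is idle. -/
theorem SnapAt.exists_config {p : P} {q : Op} {s : St} {a i h j : ℕ}
    (hs : SnapAt cfg p q s a i h j) (hq : q ∈ Q) (hi : i ≤ n) :
    ∃ es c, SoloPath D.impl Q ⟨D.init, fun _ => none⟩ es c ∧ c.procs p = none ∧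
      (∀ p op l, c.procs p = some (op, l) → op ∉ Q) ∧ (cfg n).shared.IsSnapshot h c.shared := by
  obtain ⟨-, h2, h3, h4, h5⟩ := hs
  have hj : ((j + 1 : ℕ) : ℕ∞) ≤ n := by exact_mod_cast h2.trans_le hi
  -- A simulation without query blocks is used, because facts about the execution of queries are
  -- derived from this lemma.
  obtain ⟨cfg', lab', g, hS⟩ := exists_simulatedRun (Z := fun _ _ => none) hrun (by simp)
  obtain ⟨e, e', hsim⟩ := hS.sim (j + 1) hj
  obtain ⟨es, hes⟩ := (hS.isSoloRun (j + 1)).exists_path le_rfl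
  have hpend : ∃ l, (cfg (j + 1)).procs p = some (q, l) := by
    refine hrun.pending (Nat.le_succ j) hj h3 fun k r hk hk' hres => ?_
    obtain rfl : k = j := by omega
    have hst := hrun.2 k (by exact_mod_cast h2.trans_le hi)
    rw [hres] at hst
    obtain ⟨_, _, -, -, -, h6⟩ := hst.res_iff
    rw [h6] at h5
    omega
  obtain ⟨l, hl⟩ := hpend
  exact ⟨es, _, hes, hsim.query _ _ _ hl hq, fun p op l hp => (hsim.not_query hp).1,
    hsim.isSnapshot hrun (h2.trans_le hi) h4 h5⟩

variable (hns : D.impl.NeverStuck Q) (hro : D.ReadOnly Q)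

-- The snapshot is the memory of a configuration that `D` can reach, so running the query from there
-- is a legitimate solo run, to which the hypotheses on `D` apply.
include hrun hns hro in
theorem SnapAt.readRun_ok {p : P} {q : Op} {s : St} {a i h j : ℕ}
    (hs : SnapAt cfg p q s a i h j) (hq : q ∈ Q) (hi : i ≤ n) {C : ℕ → Option V}
    (hC : (cfg n).shared.IsSnapshot h C) {k : ℕ} {s : St} (hr : D.ReadRun C (D.start p q) k s) :
    (∃ r, D.code s = .ret r) ∨ (∃ s', D.code s = .loc s') ∨
      ∃ x κ v, D.code s = .read x κ ∧ C x = some v := by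
  obtain ⟨es, c, h1, h2, h3, h4⟩ := hs.exists_config hrun hq hi
  obtain rfl := hC.unique h4
  exact h1.readRun_ok hns hro h3 hq h2 hr

-- The invariant of a query. Its constants are 3 events for the invocation and `takeSnapshot`, and
-- then the account of `Running.step`. The moment of the snapshot is remembered together with the
-- progress.
include hrun hns hro in
theorem queryState {p : P} {q : Op} (hq : q ∈ Q) {a : ℕ} (ha : lab a = .inv p q) {i : ℕ}
    (hai : a < i) (hi : i ≤ n) (hres : ∀ k r, a < k → k < i → lab k ≠ .res p r) :
    ∃ l, (cfg i).procs p = some (q, l) ∧ QueryState D n cfg lab p q a i l := by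
  have hlt : ∀ {j}, j < n → (j : ℕ∞) < n := fun hj => by exact_mod_cast hj
  induction i, hai using Nat.le_induction with
  | base =>
    have hst := hrun.2 a (hlt hi)
    rw [ha] at hst
    have hstart : (D.versioned Q).start p q = .snapRead (D.start p q) := if_pos hq
    refine ⟨_, hst.inv_iff.2.1, ?_⟩
    rw [hstart]
    refine .snapRead ?_
    rw [eventCount_succ _ _ le_rfl, eventCount_self]
    split_ifs <;> omega
  | succ i hai ih =>
    replace hai : a < i := hai
    obtain ⟨l, hl, hqs⟩ := ih (by omega) fun k r hk hk' => hres k r hk (by omega)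
    have hst := hrun.2 i (hlt hi)
    have hinv := D.configInv_run hrun (hlt hi).le
    have hclock : (cfg (i + 1)).shared.timestamp = (cfg i).shared.timestamp ∨
        (cfg (i + 1)).shared.timestamp = (cfg i).shared.timestamp + 1 := by
      cases hlab : lab i with
      | inv p op =>
        rw [hlab] at hst
        exact .inl (by rw [hst.inv_iff.2.2])
      | res p r =>
        rw [hlab] at hst
        obtain ⟨-, -, -, -, -, h⟩ := hst.res_iff
        exact .inl (by rw [h])
      | step p =>
        rw [hlab] at hst
        obtain ⟨op, l, l', -, h, -⟩ := hst.step_iff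
        rcases (vstep_of_step h).timestamp_eq with h | ⟨-, h⟩
        · exact .inl h
        · exact .inr (by rw [h])
    by_cases hp : (lab i).proc = p
    · cases hlab : lab i with
      | inv p' op =>
        rw [hlab] at hst hp
        obtain rfl : p' = p := hp
        rw [hst.inv_iff.1] at hl
        cases hl
      | res p' r =>
        rw [hlab] at hp
        obtain rfl : p' = p := hp
        exact (hres i r hai (Nat.lt_succ_self i) hlab).elim
      | step p' =>
        rw [hlab] at hst hp
        obtain rfl : p' = p := hp
        obtain ⟨op, l₁, l', h1, h2, h3⟩ := hst.step_iff
        rw [hl] at h1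
        cases h1
        have hv := vstep_of_step h2
        refine ⟨l', h3, ?_⟩
        have hcnt : eventCount lab p' a (i + 1) = eventCount lab p' a i + 1 := by
          rw [eventCount_succ _ _ hai.le, hlab]
          simp [Label.proc]
        cases hqs with
        | snapRead h4 =>
          obtain ⟨rfl, h5⟩ := hv.snapRead_eq
          exact .snapInc _ (timestamp_mono hrun hai.le (hlt (by omega)).le) (.inl (by rw [h5]))
            (by omega)
        | snapInc h hle hs h4 =>
          obtain ⟨rfl, h5⟩ := hv.snapInc_eq
          -- If the CAS succeeds, the query takes its snapshot itself. If it fails, another process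
          -- has incremented the camera from `h` since the query read it, and that increment serves
          -- for both.
          have hs' : ∃ j, SnapAt cfg p' q (D.start p' q) a (i + 1) h j := by
            rcases h5 with ⟨h5, h6⟩ | h5
            · exact ⟨i, hai, Nat.lt_succ_self i, hl, h5, h6⟩
            · obtain ⟨j, hs⟩ := hs.resolve_left h5
              exact ⟨j, hs.mono (Nat.le_succ i)⟩
          obtain ⟨_, C, -, -, -, hC⟩ := hs'.choose_spec.exists_config hrun hq hi
          refine .running h C.shared 0 0 _ hle hs' hC (.query _ .refl) ?_
          omega
        | running h C k o _ hle hs hC hr h4 =>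
          obtain ⟨j, hs⟩ := hs
          obtain ⟨k', o', h5, h6⟩ := hr.step hv (hinv.loc hl) (D.ext_run hrun (by omega) le_rfl)
            (fun x m v hlt' hx hv' => (hC.iff_head hrun (by omega) hlt' hx v).1 hv')
            (fun k s x κ hr' hc => by
              rcases hs.readRun_ok hrun hns hro hq (by omega) hC hr' with ⟨r, h⟩ | ⟨s', h⟩ |
                ⟨x', κ', v, h, hv'⟩
              · rw [hc] at h; cases h
              · rw [hc] at h; cases h
              · rw [hc] at h; cases h; exact ⟨v, hv'⟩)
          refine .running h C k' o' l' hle ⟨j, hs.mono (Nat.le_succ i)⟩ hC h5 ?_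
          rw [hcnt, nextCount_succ _ _ _ hai.le]
          by_cases hn : l.IsNext
          · rw [if_pos ⟨hlab, q, l, hl, hn⟩]
            rw [if_pos hn] at h6
            omega
          · rw [if_neg hn] at h6
            split_ifs <;> omega
    · have hcnt : eventCount lab p a (i + 1) = eventCount lab p a i := by
        rw [eventCount_succ _ _ hai.le, if_neg hp, add_zero]
      refine ⟨l, by rw [hst.procs_of_ne hp, hl], ?_⟩
      cases hqs with
      | snapRead h4 => exact .snapRead (hcnt ▸ h4)
      | snapInc h hle hs h4 =>
        refine .snapInc h hle ?_ (hcnt ▸ h4)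
        rcases hs with hs | ⟨j, hs⟩
        · rcases hclock with h5 | h5
          · exact .inl (h5.trans hs)
          -- Another process advances the camera while this one is about to do so.
          · exact .inr ⟨i, hai, Nat.lt_succ_self i, hl, hs, by omega⟩
        · exact .inr ⟨j, hs.mono (Nat.le_succ i)⟩
      | running h C k o _ hle hs hC hr h4 =>
        refine .running h C k o l hle ⟨_, hs.choose_spec.mono (Nat.le_succ i)⟩ hC hr ?_
        rw [hcnt, nextCount_succ _ _ _ hai.le]
        omega

end

/-! ## Every instruction can be executed -/

section

variable {P Op Ret V St : Type*} {D : CASStructure P Op Ret V St} {Q : Set Op}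

/-- Memory invariants guarantee the nodes and heads used inside the operations on objects, so only
the crash state and the first access of an original instruction can be stuck; these are left to the
hypotheses. -/
theorem VState.Inv.exists_step {J : ℕ → ℕ → Prop} {m : VMem V} {l : VState V St} (hm : m.Inv J)
    (hl : l.Inv J m) (hcrash : l ≠ .crash)
    (hcode : ∀ s, (l = .upd s ∨ ∃ h, l = .query h s) →
      match D.code s with
      | .read x _ => ∃ n, m.vhead x = some n
      | .cas x _ _ _ => l = .upd s ∧ ∃ n, m.vhead x = some n
      | .new _ _ => l = .upd s
      | _ => True) :
    (∃ r, (D.versioned Q).result l = some r) ∨ ∃ l' m', (D.versioned Q).step l m l' m' := by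
  have hnode : ∀ {n}, (∃ x, J x n) → ∃ nd, m.node n = some nd := fun ⟨x, hx⟩ =>
    Option.ne_none_iff_exists'.1 (hm.exists_of_J hx)
  change (∃ r, (D.versioned Q).result l = some r) ∨ ∃ l' m', (D.vcode l).Exec m l' m'
  cases l with
  | upd s =>
    have h := hcode s (.inl rfl)
    simp only [CASStructure.vcode]
    cases hc : D.code s with
    | read x k =>
      simp only [hc] at h
      obtain ⟨n, hn⟩ := h
      exact .inr ⟨_, _, n, hn, rfl, rfl⟩
    | cas x old new k =>
      simp only [hc] at h
      obtain ⟨-, n, hn⟩ := h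
      exact .inr ⟨_, _, n, hn, rfl, rfl⟩
    | new v k =>
      obtain ⟨n, hn⟩ := hm.fresh_node.nonempty
      exact .inr ⟨_, _, n, hn, rfl, rfl⟩
    | loc s' => exact .inr ⟨_, _, rfl, rfl⟩
    | ret r => exact .inl ⟨r, versioned_result.2 (.inl ⟨s, rfl, hc⟩)⟩
  | query h s =>
    have h := hcode s (.inr ⟨_, rfl⟩)
    simp only [CASStructure.vcode]
    cases hc : D.code s with
    | read x k =>
      simp only [hc] at h
      obtain ⟨n, hn⟩ := h
      exact .inr ⟨_, _, n, hn, rfl, rfl⟩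
    | cas x old new k =>
      simp only [hc] at h
      cases h.1
    | new v k =>
      simp only [hc] at h
      cases h
    | loc s' => exact .inr ⟨_, _, rfl, rfl⟩
    | ret r => exact .inl ⟨r, versioned_result.2 (.inr ⟨_, s, rfl, hc⟩)⟩
  | crash => exact (hcrash rfl).elim
  | initTest n next =>
    obtain ⟨nd, hn⟩ := hnode hl.1
    exact .inr ⟨_, _, nd, hn, rfl, rfl⟩
  | initRead n next => exact .inr ⟨_, _, rfl, rfl⟩
  | initCas n t next =>
    obtain ⟨nd, hn⟩ := hnode hl.1.1
    by_cases ht : nd.ts = none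
    · exact .inr ⟨_, _, nd, hn, by rw [if_pos ht]; exact ⟨rfl, rfl⟩⟩
    · exact .inr ⟨_, _, nd, hn, by rw [if_neg ht]; exact ⟨rfl, rfl⟩⟩
  | readRet n k =>
    obtain ⟨nd, hn⟩ := hnode hl.1
    exact .inr ⟨_, _, nd, hn, rfl, rfl⟩
  | casTest x old new k n =>
    obtain ⟨nd, hn⟩ := hnode ⟨x, hl.1⟩
    exact .inr ⟨_, _, nd, hn, rfl, rfl⟩
  | casNew x new k n =>
    obtain ⟨n', hn⟩ := hm.fresh_node.nonempty
    exact .inr ⟨_, _, n', hn, rfl, rfl⟩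
  | casAppend x k n n' =>
    obtain ⟨n₁, hn⟩ := hm.head_of_J hl.1
    by_cases h : n₁ = n
    · exact .inr ⟨_, _, n₁, hn, by rw [if_pos h]; exact ⟨rfl, rfl⟩⟩
    · exact .inr ⟨_, _, n₁, hn, by rw [if_neg h]; exact ⟨rfl, rfl⟩⟩
  | casDelete x k n => exact .inr ⟨_, _, rfl, rfl⟩
  | casHelp x k =>
    obtain ⟨n, hn⟩ := hl
    obtain ⟨n', hn'⟩ := hm.head_of_J hn
    exact .inr ⟨_, _, n', hn', rfl, rfl⟩
  | casRet x k b => exact .inr ⟨_, _, rfl, rfl⟩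
  | newHead n k =>
    obtain ⟨x, hx⟩ := hm.fresh_obj.nonempty
    exact .inr ⟨_, _, x, hx, rfl, rfl⟩
  | snapRead s => exact .inr ⟨_, _, rfl, rfl⟩
  | snapInc s h =>
    by_cases ht : m.timestamp = h
    · exact .inr ⟨_, _, by simp only [CASStructure.vcode, VInstr.Exec]; rw [if_pos ht]; exact ⟨rfl, rfl⟩⟩
    · exact .inr ⟨_, _, by simp only [CASStructure.vcode, VInstr.Exec]; rw [if_neg ht]; exact ⟨rfl, rfl⟩⟩
  | ssTest h k n =>
    obtain ⟨nd, hn⟩ := hnode hl.2.1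
    exact .inr ⟨_, _, nd, hn, rfl, rfl⟩
  | ssNext h k n =>
    obtain ⟨nd, hn⟩ := hnode hl.2.1
    exact .inr ⟨_, _, nd, hn, rfl, rfl⟩
  | ssRet h k n =>
    obtain ⟨nd, hn⟩ := hnode hl.2.1
    exact .inr ⟨_, _, nd, hn, rfl, rfl⟩

/-- Both kinds of operations borrow the property from `D`: an update from the corresponding
configuration of the simulating run, a query from the configuration at its snapshot. An object that
exists there has a head here. -/
theorem CASStructure.versioned_neverStuck [Finite P] (hns : D.impl.NeverStuck Q)
    (hro : D.ReadOnly Q) : (D.versioned Q).NeverStuck ∅ := by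
  rintro n cfg lab ⟨hrun, -⟩ p op l hp
  have hinv := D.configInv_run hrun (i := n) le_rfl
  by_cases hop : op ∈ Q
  · obtain ⟨a, ha, hinva, hbtw⟩ := hrun.exists_inv le_rfl hp
    obtain ⟨l', hl', hqs⟩ := queryState hrun hns hro hop hinva ha le_rfl
      fun k r hk hk' => (hbtw k hk hk').1 r
    rw [hp] at hl'
    cases hl'
    refine (hinv.loc hp).exists_step hinv.mem ?_ ?_
    · rintro rfl
      cases hqs with
      | running h C k o _ hle hs hC hr => cases hr
    · rintro s (rfl | ⟨h, rfl⟩)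
      · exact ((hinv.query_iff hp).1 hop).elim
      · cases hqs with
        | running h C k o _ hle hs hC hr =>
          obtain ⟨j, hs⟩ := hs
          cases hr with
          | query _ hr =>
            rcases hs.readRun_ok hrun hns hro hop le_rfl hC hr with ⟨r, h1⟩ | ⟨s', h1⟩ |
              ⟨x, κ, v, h1, h2⟩
            · simp [h1]
            · simp [h1]
            · obtain ⟨m, hm, -⟩ := (hC x v).1 h2
              simp only [h1]
              exact ⟨m, hm⟩
  · refine (hinv.loc hp).exists_step hinv.mem ?_ ?_
    · rintro rfl
      exact hop ((hinv.query_iff hp).2 trivial)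
    · rintro s (rfl | ⟨h, rfl⟩)
      -- Between two original instructions the local state of the simulating run is `s` itself.
      · obtain ⟨cfg', lab', g, hS⟩ := exists_simulatedRun (Z := fun _ _ => none) hrun (by simp)
        obtain ⟨e, e', hsim⟩ := hS.sim n le_rfl
        obtain ⟨hl, h1, d, h2, -⟩ := hsim.upd p op _ hp hop
        cases h2
        have h3 := hns _ cfg' lab' (hS.isSoloRun n) p op s h1
        have hhead : ∀ x v, (cfg' (g n)).shared x = some v →
            ∃ m, (cfg n).shared.vhead x = some m := fun x v hv => by
          obtain ⟨m, h4, -⟩ := (hsim.shared x v).1 hv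
          exact hinv.mem.head_of_J h4
        cases hc : D.code s with
        | read x k =>
          simp only [hc, reduceCtorEq, exists_false, false_or, CASStructure.impl] at h3
          obtain ⟨_, _, v, hv, -⟩ := h3
          exact hhead x v hv
        | cas x old new k =>
          simp only [hc, reduceCtorEq, exists_false, false_or, CASStructure.impl] at h3
          obtain ⟨_, _, v, hv, -⟩ := h3
          exact ⟨rfl, hhead x v hv⟩
        | new v k => rfl
        | loc s' => trivial
        | ret r => trivial
      · exact (hop ((hinv.query_iff hp).2 trivial)).elim

end

/-! ## The queries that are executed in the simulating run -/

/-- A query that has taken its snapshot. -/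
def VState.Snapped {V St : Type*} : VState V St → Prop
  | .query _ _ => True
  | .ssTest _ _ _ => True
  | .ssNext _ _ _ => True
  | .ssRet _ _ _ => True
  | .crash => True
  | .initTest _ next => next.Snapped
  | .initRead _ next => next.Snapped
  | .initCas _ _ next => next.Snapped
  | _ => False

section

variable {P Op Ret V St : Type*} {D : CASStructure P Op Ret V St} {Q : Set Op} {n : ℕ}
  {cfg : ℕ → Config P Op (VMem V) (VState V St)} {lab : ℕ → Label P Op Ret}

theorem VStep.snapped {l l' : VState V St} {m m' : VMem V} (hs : VStep D l m l' m')
    (hl : l.Snapped) : l'.Snapped := by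
  cases hs <;> trivial

/-- A property of local states that is preserved by all steps. -/
theorem Impl.IsRun.pending_of {S L : Type*} {M : Impl P Op Ret S L} {N : ℕ∞}
    {cfg : ℕ → Config P Op S L} {lab : ℕ → Label P Op Ret}
    (hrun : M.IsRun N cfg lab) {R : L → Prop}
    (hR : ∀ l s l' s', R l → M.step l s l' s' → R l') {p : P} {q : Op} {l : L} {i j : ℕ} (hij : i ≤ j)
    (hj : (j : ℕ∞) ≤ N) (hi : (cfg i).procs p = some (q, l)) (hl : R l)
    (hres : ∀ k r, i ≤ k → k < j → lab k ≠ .res p r) :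
    ∃ l', (cfg j).procs p = some (q, l') ∧ R l' := by
  induction j, hij using Nat.le_induction with
  | base => exact ⟨l, hi, hl⟩
  | succ j hij ih =>
    have hjn : (j : ℕ∞) < N := lt_of_lt_of_le (by exact_mod_cast Nat.lt_succ_self j) hj
    obtain ⟨l', h1, h2⟩ := ih hjn.le fun k r hk hk' => hres k r hk (by omega)
    have hst := hrun.2 j hjn
    by_cases hp : (lab j).proc = p
    · cases hlab : lab j with
      | inv p' op =>
        rw [hlab] at hst hp
        obtain rfl : p' = p := hp
        rw [hst.inv_iff.1] at h1
        cases h1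
      | step p' =>
        rw [hlab] at hst hp
        obtain rfl : p' = p := hp
        obtain ⟨op, l₁, l₂, h3, h4, h5⟩ := hst.step_iff
        rw [h1] at h3
        cases h3
        exact ⟨l₂, h5, hR _ _ _ _ h2 h4⟩
      | res p' r =>
        rw [hlab] at hp
        obtain rfl : p' = p := hp
        exact (hres j r hij (Nat.lt_succ_self j) hlab).elim
    · exact ⟨l', by rw [hst.procs_of_ne hp, h1], h2⟩

variable (hrun : (D.versioned Q).IsRun n cfg lab)

include hrun

/-- After `snapInc`, a query has the same handle. -/
theorem snapped_of_snapInc {p : P} {q : Op} {s : St} {h i j : ℕ} (hij : i ≤ j) (hj : j ≤ n)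
    (hi : (cfg i).procs p = some (q, .snapInc s h))
    (hres : ∀ k r, i ≤ k → k < j → lab k ≠ .res p r) :
    ∃ l, (cfg j).procs p = some (q, l) ∧ (l = .snapInc s h ∨ l.Snapped) := by
  refine hrun.pending_of (R := fun l => l = .snapInc s h ∨ l.Snapped) ?_ hij (by exact_mod_cast hj)
    hi (.inl rfl) hres
  rintro l m l' m' (rfl | hl) hst
  · rw [(vstep_of_step hst).snapInc_eq.1]
    exact .inr trivial
  · exact .inr ((vstep_of_step hst).snapped hl)

/-- A query about to increment the camera keeps its handle until it performs the CAS, and afterwards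
never returns to that state; meanwhile the camera leaves the value `h` only once. -/
theorem SnapAt.unique {p : P} {q : Op} {s : St} {a i h h' j j' : ℕ} (hi : i ≤ n)
    (hs : SnapAt cfg p q s a i h j) (hs' : SnapAt cfg p q s a i h' j')
    (hres : ∀ k r, a < k → k < i → lab k ≠ .res p r) : j = j' ∧ h = h' := by
  have key : ∀ {h h' j j' : ℕ}, SnapAt cfg p q s a i h j → SnapAt cfg p q s a i h' j' → ¬ j < j' := by
    rintro h h' j j' ⟨h1, h2, h3, h4, h5⟩ ⟨h1', h2', h3', h4', h5'⟩ hlt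
    obtain ⟨l, h6, h7⟩ := snapped_of_snapInc hrun hlt.le (by omega) h3
      fun k r hk hk' => hres k r (by omega) (by omega)
    rw [h3'] at h6
    cases h6
    rcases h7 with h7 | h7
    · cases h7
      have := timestamp_mono hrun (show j + 1 ≤ j' from hlt) (by exact_mod_cast (by omega : j' ≤ n))
      omega
    · exact h7
  have hj : j = j' := le_antisymm (not_lt.1 (key hs' hs)) (not_lt.1 (key hs hs'))
  subst hj
  exact ⟨rfl, hs.2.2.2.1.symm.trans hs'.2.2.2.1⟩

omit hrun

/-- The process `p` returns `r` from the query `q`, whose snapshot is taken by the event `i`. -/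
def QueryAt (D : CASStructure P Op Ret V St) (Q : Set Op) (n : ℕ)
    (cfg : ℕ → Config P Op (VMem V) (VState V St)) (lab : ℕ → Label P Op Ret) (i : ℕ) (p : P)
    (q : Op) (r : Ret) (a k : ℕ) : Prop :=
  q ∈ Q ∧ lab a = .inv p q ∧ RespondsAt lab n a k r ∧ ∃ h, SnapAt cfg p q (D.start p q) a k h i

open Classical in
/-- The queries that are executed when the event `i` happens. -/
noncomputable def executedQueries (D : CASStructure P Op Ret V St) (Q : Set Op) (n : ℕ)
    (cfg : ℕ → Config P Op (VMem V) (VState V St)) (lab : ℕ → Label P Op Ret) (i : ℕ) (p : P) :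
    Option (Op × Ret) :=
  if h : ∃ x : Op × Ret, ∃ a k, QueryAt D Q n cfg lab i p x.1 x.2 a k then some h.choose else none

theorem RespondsAt.no_res {p : P} {q : Op} {a k : ℕ} {r : Ret} (h : RespondsAt lab n a k r)
    (ha : lab a = .inv p q) : lab k = .res p r ∧ ∀ j r', a < j → j < k → lab j ≠ .res p r' := by
  obtain ⟨-, -, p', op, h1, h2, h3⟩ := h
  rw [ha] at h1
  cases h1
  exact ⟨h2, fun j r' hj hj' => h3 j hj hj' r'⟩

theorem RespondsAt.unique {a k k' : ℕ} {r r' : Ret} (h : RespondsAt lab n a k r)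
    (h' : RespondsAt lab n a k' r') : k = k' ∧ r = r' := by
  have key : ∀ {k k' r r'}, RespondsAt lab n a k r → RespondsAt lab n a k' r' → ¬ k < k' := by
    rintro k k' r r' ⟨h1, h2, p, op, h3, h4, h5⟩ ⟨h1', h2', p', op', h3', h4', h5'⟩ hlt
    rw [h3] at h3'
    cases h3'
    exact h5' k h1 hlt r h4
  obtain rfl : k = k' := le_antisymm (not_lt.1 (key h' h)) (not_lt.1 (key h h'))
  obtain ⟨-, -, p, op, h3, h4, -⟩ := h
  obtain ⟨-, -, p', op', -, h4', -⟩ := h'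
  rw [h4] at h4'
  cases h4'
  exact ⟨rfl, rfl⟩

include hrun

/-- The invocation of a pending instance is unique. -/
theorem invocation_unique {p : P} {q q' : Op} {a a' i : ℕ} (hi : i ≤ n) (ha : lab a = .inv p q)
    (ha' : lab a' = .inv p q') (hai : a < i) (hai' : a' < i)
    (hres : ∀ k r, a < k → k < i → lab k ≠ .res p r)
    (hres' : ∀ k r, a' < k → k < i → lab k ≠ .res p r) : a = a' := by
  have key : ∀ {q q' a a'}, lab a = .inv p q → lab a' = .inv p q' → a' < i →
      (∀ k r, a < k → k < i → lab k ≠ .res p r) → ¬ a < a' := by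
    intro q q' a a' ha ha' hai' hres hlt
    have hst := hrun.2 a (by exact_mod_cast (by omega : a < n))
    have hst' := hrun.2 a' (by exact_mod_cast (by omega : a' < n))
    rw [ha] at hst
    rw [ha'] at hst'
    obtain ⟨l, hl⟩ := hrun.pending (show a + 1 ≤ a' from hlt) (by exact_mod_cast (by omega : a' ≤ n))
      hst.inv_iff.2.1 fun k r hk hk' => hres k r (by omega) (by omega)
    rw [hst'.inv_iff.1] at hl
    cases hl
  exact le_antisymm (not_lt.1 (key ha' ha hai hres')) (not_lt.1 (key ha ha' hai' hres))

theorem QueryAt.unique {i : ℕ} {p : P} {q q' : Op} {r r' : Ret} {a a' k k' : ℕ}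
    (h : QueryAt D Q n cfg lab i p q r a k) (h' : QueryAt D Q n cfg lab i p q' r' a' k') :
    q = q' ∧ r = r' ∧ a = a' := by
  obtain ⟨-, h1, h2, t, h3⟩ := h
  obtain ⟨-, h1', h2', t', h3'⟩ := h'
  have h4 := h3.2.1
  have h4' := h3'.2.1
  have hk := h2.2.1
  obtain rfl : a = a' := invocation_unique hrun (i := i) (by omega) h1 h1' h3.1 h3'.1
    (fun j r hj hj' => (h2.no_res h1).2 j r hj (by omega))
    (fun j r hj hj' => (h2'.no_res h1').2 j r hj (by omega))
  rw [h1] at h1'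
  cases h1'
  exact ⟨rfl, (h2.unique h2').2, rfl⟩

theorem executedQueries_eq {i : ℕ} {p : P} {q : Op} {r : Ret} :
    executedQueries D Q n cfg lab i p = some (q, r) ↔ ∃ a k, QueryAt D Q n cfg lab i p q r a k := by
  classical
  constructor
  · intro h
    rw [executedQueries] at h
    split_ifs at h with hex
    have := hex.choose_spec
    rw [Option.some.inj h] at this
    exact this
  · rintro ⟨a, k, h⟩
    have hex : ∃ x : Op × Ret, ∃ a k, QueryAt D Q n cfg lab i p x.1 x.2 a k := ⟨(q, r), a, k, h⟩
    rw [executedQueries, dif_pos hex]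
    obtain ⟨a', k', h'⟩ := hex.choose_spec
    obtain ⟨h1, h2, -⟩ := h.unique hrun h'
    exact congrArg some (Prod.ext h1.symm h2.symm)

/-- A returned query has executed its code on the snapshot, and the snapshot is the memory of the
simulating run right after the corresponding step of the camera. So a solo execution there gives the
same response. -/
theorem exists_simulatedRun_queries [Finite P] (hns : D.impl.NeverStuck Q) (hro : D.ReadOnly Q) :
    ∃ cfg' lab' g, SimulatedRun D Q n cfg lab (executedQueries D Q n cfg lab) cfg' lab' g := by
  refine exists_simulatedRun hrun fun i hi p q r hz => ?_
  obtain ⟨a, k, hq, ha, hresp, h, hs⟩ := (executedQueries_eq hrun).1 hz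
  refine ⟨hq, ⟨_, hs.2.2.1⟩, ?_, fun hc e e' hsim => ?_⟩
  · rw [hs.2.2.2.1, hs.2.2.2.2]
    exact Nat.lt_succ_self h
  · obtain ⟨hk, hno⟩ := hresp.no_res ha
    have hkn := hresp.2.1
    obtain ⟨l, hl, hqs⟩ := queryState hrun hns hro hq ha hresp.1 hkn.le fun j r hj hj' => hno j r hj hj'
    have hst := hrun.2 k (by exact_mod_cast hkn)
    rw [hk] at hst
    obtain ⟨op, l', h1, h2, -, -⟩ := hst.res_iff
    rw [hl] at h1
    cases h1
    have hC' := hsim.isSnapshot hrun (by exact_mod_cast hi) hs.2.2.2.1 hs.2.2.2.2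
    rcases versioned_result.1 h2 with ⟨s, rfl, h3⟩ | ⟨h', s, rfl, h3⟩
    · exact (((D.configInv_run hrun (i := k) (by exact_mod_cast hkn.le)).query_iff hl).1 hq).elim
    · cases hqs with
      | running h'' C κ o _ hle hs' hC hr =>
        obtain ⟨j, hs'⟩ := hs'
        -- The handle with which the query has run belongs to the very event `i` at which its block
        -- is scheduled.
        obtain ⟨-, rfl⟩ := hs.unique hrun hkn.le hs' hno
        obtain rfl := hC.unique hC'
        cases hr with
        | query _ hr => exact ⟨κ, s, hr, h3⟩

end

/-! ## Histories of the simulating run -/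

section

variable {P Op Ret S L : Type*} {Q : Set Op} {cfg : ℕ → Config P Op S L} {lab : ℕ → Label P Op Ret}

theorem highLevelEventOf_iff {i : ℕ} :
    HighLevelEventOf Qᶜ cfg lab i ↔ IsUpdateEvent Q (cfg i) (lab i) := by
  unfold HighLevelEventOf Impl.EventOf IsUpdateEvent
  cases lab i with
  | inv p op => simp
  | step p => simp
  | res p r => simp

end

section

variable {P Op Ret V St : Type*} {D : CASStructure P Op Ret V St} {Q : Set Op} {n : ℕ}
  {cfg : ℕ → Config P Op (VMem V) (VState V St)} {lab : ℕ → Label P Op Ret}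
  {cfg' : ℕ → Config P Op (ℕ → Option V) St} {lab' : ℕ → Label P Op Ret} {g : ℕ → ℕ}
  {Z : ℕ → P → Option (Op × Ret)} (hrun : (D.versioned Q).IsRun n cfg lab)

namespace SimulatedRun

theorem lt_of_event (hS : SimulatedRun D Q n cfg lab Z cfg' lab' g) {i j : ℕ} (hij : i < j)
    (hj : j ≤ n) (h : IsUpdateEvent Q (cfg i) (lab i)) : g i < g j := by
  have h1 := (hS.event i (by exact_mod_cast hij.trans_le hj) h).1
  have := hS.mono (show i + 1 ≤ j from hij)
  omega

theorem sameHistory (hS : SimulatedRun D Q n cfg lab Z cfg' lab' g) :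
    SameHistory Qᶜ n cfg lab (g n) cfg' lab' g where
  map i hi h := by
    rw [highLevelEventOf_iff] at h
    refine ⟨hS.lt_of_event hi le_rfl h, (hS.event i (by exact_mod_cast hi) h).2, ?_⟩
    rw [highLevelEventOf_iff]
    exact hS.updateEvent (by exact_mod_cast hi) h
  mono i j hij hj h _ := hS.lt_of_event hij hj.le (highLevelEventOf_iff.1 h)
  surj k hk h := by
    obtain ⟨i, hi, hin, h1, h2⟩ := hS.exists_of_lt hk
    obtain ⟨h3, -, h4⟩ := hS.of_updateEvent hin h1 h2 (highLevelEventOf_iff.1 h)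
    exact ⟨i, hi, highLevelEventOf_iff.2 h4, h3.symm⟩

include hrun

/-- The response of an operation that is not a query corresponds to its response in the simulating
run. -/
theorem res_iff (hS : SimulatedRun D Q n cfg lab Z cfg' lab' g) {p : P} {op : Op} (hop : op ∉ Q)
    {a i k : ℕ} (ha : lab a = .inv p op) (hai : a < i) (hi : i < n)
    (hres : ∀ j r, a < j → j < i → lab j ≠ .res p r) (hk : g i ≤ k) (hk' : k < g (i + 1)) {r : Ret} :
    lab' k = .res p r ↔ lab i = .res p r ∧ k = g i := by
  have hin : (i : ℕ∞) < n := by exact_mod_cast hi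
  have hst := hrun.2 a (by exact_mod_cast hai.trans hi)
  rw [ha] at hst
  obtain ⟨l, hl⟩ := hrun.pending (show a + 1 ≤ i from hai) hin.le hst.inv_iff.2.1
    fun k r hk hk' => hres k r (by omega) hk'
  constructor
  · intro h
    rcases hS.entry i hin k hk hk' with ⟨h1, h2, -⟩ | ⟨p', op', l', h1, -⟩ | ⟨p', q, r', h1, h2⟩
    · exact ⟨h2 ▸ h, h1⟩
    · rw [h] at h1
      cases h1
    · have h3 : p = p' := by
        have := h2.proc
        rw [h] at this
        exact this
      subst h3
      obtain ⟨hq, l', hl'⟩ := hS.query i hin _ _ _ h1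
      rw [hl] at hl'
      cases hl'
      exact (hop hq).elim
  · rintro ⟨h1, rfl⟩
    rw [(hS.event i hin (.inr ⟨p, r, op, l, h1, hl, hop⟩)).2, h1]

theorem isInstance (hS : SimulatedRun D Q n cfg lab Z cfg' lab' g) {p : P} {op : Op} (hop : op ∉ Q)
    {a b : ℕ} (hb : b ≤ n) (h : IsInstance lab p op a b) : IsInstance lab' p op (g a) (g b) := by
  obtain ⟨hab, ha, hres⟩ := h
  have hu : IsUpdateEvent Q (cfg a) (lab a) := .inl ⟨p, op, ha, hop⟩
  refine ⟨hS.lt_of_event hab hb hu, ?_, ?_⟩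
  · rw [(hS.event a (by exact_mod_cast hab.trans_le hb) hu).2, ha]
  · intro k r hk hk' hr
    obtain ⟨i, hib, -, h1, h2⟩ := hS.exists_of_lt (show k < g b by omega)
    have hai : a < i := by
      rcases lt_trichotomy a i with h | h | h
      · exact h
      · subst h
        have := (hS.event a (by exact_mod_cast hab.trans_le hb) hu).1
        omega
      · have := hS.mono (show i + 1 ≤ a from h)
        omega
    have hres' : ∀ j r, a < j → j < i → lab j ≠ .res p r :=
      fun j r hj hj' => hres j r hj (by omega)
    obtain ⟨h3, rfl⟩ := (hS.res_iff hrun hop ha hai (by omega) hres' h1 h2).1 hr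
    refine hres i r hai ?_ h3
    have hst := hrun.2 i (by exact_mod_cast (by omega : i < n))
    rw [h3] at hst
    obtain ⟨op', l, h4, -⟩ := hst.res_iff
    have hst' := hrun.2 a (by exact_mod_cast hab.trans_le hb)
    rw [ha] at hst'
    obtain ⟨l', hl'⟩ := hrun.pending (show a + 1 ≤ i from hai)
      (by exact_mod_cast (by omega : i ≤ n)) hst'.inv_iff.2.1
      fun k r hk hk' => hres' k r (by omega) hk'
    rw [h4] at hl'
    cases hl'
    have h5 := (hS.event i (by exact_mod_cast (by omega : i < n)) (.inr ⟨p, r, op, l, h3, h4, hop⟩)).1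
    exact hS.lt_of_lt (by omega)

/-- Operations that are not queries are slower by a constant factor. -/
theorem instance_time (hS : SimulatedRun D Q n cfg lab Z cfg' lab' g) {p : P} {op : Op}
    (hop : op ∉ Q) {a b : ℕ} (hb : b ≤ n) (h : IsInstance lab p op a b) :
    procTime lab' p (g a) (g b) ≤ procTime lab p a b ∧
      procTime lab p a b ≤ 13 * procTime lab' p (g a) (g b) := by
  obtain ⟨hab, ha, hres⟩ := h
  rw [procTime_eq, procTime_eq]
  suffices h : eventCount lab' p (g a) (g b) ≤ eventCount lab p a b ∧
      eventCount lab p a b ≤ 13 * eventCount lab' p (g a) (g b) from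
    ⟨by exact_mod_cast h.1, by exact_mod_cast h.2⟩
  obtain ⟨b, rfl⟩ : ∃ b', b = b' + 1 := ⟨b - 1, by omega⟩
  -- The simulation bounds the time only before the response; the response is one event in both runs
  -- and is added separately.
  by_cases hlast : ∃ r, lab b = .res p r
  · obtain ⟨r, hr⟩ := hlast
    have hab' : a < b := by
      rcases (show a ≤ b by omega).lt_or_eq with h | rfl
      · exact h
      · rw [ha] at hr
        cases hr
    have hbn : (b : ℕ∞) < n := by exact_mod_cast hb
    have hst := hrun.2 a (by exact_mod_cast (by omega : a < n))
    rw [ha] at hst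
    obtain ⟨l, hl⟩ := hrun.pending (show a + 1 ≤ b from hab') hbn.le hst.inv_iff.2.1
      fun k r hk hk' => hres k r (by omega) (by omega)
    have h1 := hS.time p op a b hop ha hab' hbn.le fun k r hk hk' => hres k r hk (by omega)
    obtain ⟨h2, h3⟩ := hS.event b hbn (.inr ⟨p, r, op, l, hr, hl, hop⟩)
    rw [h2, eventCount_succ _ _ hab'.le, eventCount_succ _ _ (hS.mono hab'.le), h3, hr]
    simp only [Label.proc, if_true]
    omega
  · refine hS.time p op a (b + 1) hop ha hab (by exact_mod_cast hb) fun k r hk hk' hr => ?_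
    rcases (show k ≤ b by omega).lt_or_eq with h | rfl
    · exact hres k r hk (by omega) hr
    · exact hlast ⟨r, hr⟩

end SimulatedRun

end

/-! ## Linearizability -/

section

variable {P Op Ret V St : Type*} {D : CASStructure P Op Ret V St} {Q : Set Op} {n : ℕ}
  {cfg : ℕ → Config P Op (VMem V) (VState V St)} {lab : ℕ → Label P Op Ret}
  {cfg' : ℕ → Config P Op (ℕ → Option V) St} {lab' : ℕ → Label P Op Ret} {g : ℕ → ℕ}

/-- The invocation `k` in the simulating run corresponds to the invocation `a`. -/
def InvCorr (D : CASStructure P Op Ret V St) (Q : Set Op) (n : ℕ)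
    (cfg : ℕ → Config P Op (VMem V) (VState V St)) (lab lab' : ℕ → Label P Op Ret) (g : ℕ → ℕ)
    (a k : ℕ) : Prop :=
  a < n ∧ g a ≤ k ∧ lab' k = lab a ∧ ((k = g a ∧ ∃ p op, lab a = .inv p op ∧ op ∉ Q) ∨
    ∃ i p q r κ, g i ≤ k ∧ k < g (i + 1) ∧ lab' k = .inv p q ∧ QueryAt D Q n cfg lab i p q r a κ)

variable (hrun : (D.versioned Q).IsRun n cfg lab)
  (hS : SimulatedRun D Q n cfg lab (executedQueries D Q n cfg lab) cfg' lab' g)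

include hrun hS

/-- Invocations in the simulating run are copies of invocations of updates, or begin blocks of
returned queries, so the linearization to be carried back has no foreign entries. -/
theorem exists_invCorr {k : ℕ} (hk : k < g n) {p : P} {op : Op} (h : lab' k = .inv p op) :
    ∃ a, InvCorr D Q n cfg lab lab' g a k := by
  obtain ⟨i, hi, hin, h1, h2⟩ := hS.exists_of_lt hk
  by_cases hop : op ∈ Q
  · rcases hS.entry i hin k h1 h2 with ⟨h3, h4, ⟨p', op', h5, h6⟩ | ⟨_, _, _, _, h5, -⟩⟩ |
      ⟨_, _, _, h3, -⟩ | ⟨p', q, r, h3, h4⟩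
    · rw [h4, h5] at h
      cases h
      exact (h6 hop).elim
    · rw [h4, h5] at h
      cases h
    · rw [h] at h3
      cases h3
    · rcases h4 with h4 | ⟨h4, l, h5⟩
      · obtain ⟨a, κ, h6⟩ := (executedQueries_eq hrun).1 h3
        have h4' : lab' k = .inv p' q := h4
        have hai : a < i := h6.2.2.2.choose_spec.1
        exact ⟨a, by omega, (hS.mono hai.le).trans h1, h4'.trans h6.2.1.symm,
          .inr ⟨i, p', q, r, κ, h1, h2, h4', h6⟩⟩
      · have hst := (hS.step k _ hk).1
        simp only at h4 h5
        rw [h] at hst h4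
        obtain rfl : p = p' := h4
        rw [hst.inv_iff.1] at h5
        cases h5
  · obtain ⟨rfl, h3, -⟩ := hS.of_updateEvent hin h1 h2 (.inl ⟨p, op, h, hop⟩)
    exact ⟨i, hi, le_rfl, h3, .inl ⟨rfl, p, op, h3 ▸ h, hop⟩⟩

/-- An update has only the position `g a`. A query has one snapshot, hence one segment, and a
process invokes at most one query in a segment. -/
theorem InvCorr.unique {a k k' : ℕ} (h : InvCorr D Q n cfg lab lab' g a k)
    (h' : InvCorr D Q n cfg lab lab' g a k') : k = k' := by
  obtain ⟨han, -, -, h⟩ := h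
  obtain ⟨-, -, -, h'⟩ := h'
  rcases h with ⟨h1, p, op, h2, h3⟩ | ⟨i, p, q, r, κ, h1, h2, h3, h4⟩
  · rcases h' with ⟨h1', -⟩ | ⟨i', p', q', r', κ', h1', h2', h3', h4'⟩
    · rw [h1, h1']
    · have := h4'.2.1
      rw [h2] at this
      cases this
      exact (h3 h4'.1).elim
  · rcases h' with ⟨h1', p', op', h2', h3'⟩ | ⟨i', p', q', r', κ', h1', h2', h3', h4'⟩
    · have := h4.2.1
      rw [h2'] at this
      cases this
      exact (h3' h4.1).elim
    · have h5 := h4.2.1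
      rw [h4'.2.1] at h5
      cases h5
      obtain ⟨rfl, rfl⟩ := h4.2.2.1.unique h4'.2.2.1
      obtain ⟨hq, ha, hresp, t, hs⟩ := h4
      obtain ⟨-, -, -, t', hs'⟩ := h4'
      obtain ⟨rfl, -⟩ := hs.unique hrun hresp.2.1.le hs' fun j r hj hj' => (hresp.no_res ha).2 j r hj hj'
      have hin : (i : ℕ∞) < n := by exact_mod_cast hs.2.1.trans hresp.2.1
      obtain ⟨k₁, k₂, -, -, -, -, -, -, huniq⟩ := hS.block i hin p q r
        ((executedQueries_eq hrun).2 ⟨a, κ, hq, ha, hresp, t, hs⟩)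
      rw [huniq k h1 h2 q h3, huniq k' h1' h2' q h3']

theorem InvCorr.unique_left {a a' k : ℕ} (h : InvCorr D Q n cfg lab lab' g a k)
    (h' : InvCorr D Q n cfg lab lab' g a' k) : a = a' := by
  have hseg : ∀ {i i'}, g i ≤ k → k < g (i + 1) → g i' ≤ k → k < g (i' + 1) → i = i' := by
    intro i i' h1 h2 h3 h4
    have h5 := hS.lt_of_lt (h1.trans_lt h4)
    have h6 := hS.lt_of_lt (h3.trans_lt h2)
    omega
  obtain ⟨han, h0, hl, h⟩ := h
  obtain ⟨han', h0', hl', h'⟩ := h'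
  have hlt : ∀ {a p op}, a < n → lab a = .inv p op → op ∉ Q → g a < g (a + 1) :=
    fun han hl hop => hS.lt_of_event (Nat.lt_succ_self _) han (.inl ⟨_, _, hl, hop⟩)
  rcases h with ⟨h1, p, op, h2, h3⟩ | ⟨i, p, q, r, κ, h1, h2, h3, h4⟩
  · rcases h' with ⟨h1', p', op', h2', h3'⟩ | ⟨i', p', q', r', κ', h1', h2', h3', h4'⟩
    · have h4 := hlt han h2 h3
      have h4' := hlt han' h2' h3'
      exact hseg (by omega) (by omega) (by omega) (by omega)
    · rw [hl, h2] at h3'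
      cases h3'
      exact (h3 h4'.1).elim
  · rcases h' with ⟨h1', p', op', h2', h3'⟩ | ⟨i', p', q', r', κ', h1', h2', h3', h4'⟩
    · rw [hl', h2'] at h3
      cases h3
      exact (h3' h4.1).elim
    · obtain rfl := hseg h1 h2 h1' h2'
      rw [h3] at h3'
      cases h3'
      exact (h4.unique hrun h4').2.2

variable [Finite P] (hns : D.impl.NeverStuck Q) (hro : D.ReadOnly Q)

include hns hro in
/-- A completed instance corresponds to one in the simulating run, which returns not later. -/
theorem exists_respondsAt {a κ : ℕ} {r : Ret} (h : RespondsAt lab n a κ r) :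
    ∃ k k', InvCorr D Q n cfg lab lab' g a k ∧ RespondsAt lab' (g n) k k' r ∧ k' < g (κ + 1) := by
  have h' := h
  obtain ⟨haκ, hκn, p, op, ha, hκ, hno⟩ := h
  have hκN : (κ : ℕ∞) < n := by exact_mod_cast hκn
  have hst := hrun.2 a (by exact_mod_cast haκ.trans hκn)
  rw [ha] at hst
  obtain ⟨l, hl⟩ := hrun.pending (show a + 1 ≤ κ from haκ) hκN.le hst.inv_iff.2.1
    fun k r hk hk' => hno k (by omega) hk' r
  by_cases hop : op ∈ Q
  · have hst' := hrun.2 κ hκN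
    rw [hκ] at hst'
    obtain ⟨op', l', h1, h2, -, -⟩ := hst'.res_iff
    rw [hl] at h1
    cases h1
    obtain ⟨l', hl', hqs⟩ := queryState hrun hns hro hop ha haκ hκn.le
      fun j r hj hj' => hno j hj hj' r
    rw [hl] at hl'
    cases hl'
    have hsnap : ∃ h i, SnapAt cfg p op (D.start p op) a κ h i := by
      cases hqs with
      | snapRead => rcases versioned_result.1 h2 with ⟨_, h, -⟩ | ⟨_, _, h, -⟩ <;> cases h
      | snapInc => rcases versioned_result.1 h2 with ⟨_, h, -⟩ | ⟨_, _, h, -⟩ <;> cases h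
      | running h C k o _ hle hs hC hr => exact ⟨h, hs⟩
    obtain ⟨t, i, hs⟩ := hsnap
    have hqa : QueryAt D Q n cfg lab i p op r a κ := ⟨hop, ha, h', t, hs⟩
    have hin : i < n := hs.2.1.trans hκn
    obtain ⟨k₁, k₂, h3, h4, h5, h6, h7, h8, -⟩ := hS.block i (by exact_mod_cast hin) p op r
      ((executedQueries_eq hrun).2 ⟨a, κ, hqa⟩)
    have h9 : g (i + 1) ≤ g n := hS.mono hin
    have h10 : g (i + 1) ≤ g (κ + 1) := hS.mono (by have := hs.2.1; omega)
    have h11 : g a ≤ g i := hS.mono hs.1.le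
    refine ⟨k₁, k₂, ⟨by omega, by omega, by rw [h6, ha], .inr ⟨i, p, op, r, κ, h3, by omega, h6, hqa⟩⟩,
      ⟨h4, by omega, p, op, h6, h7, fun j hj hj' r' => ?_⟩, by omega⟩
    rw [h8 j hj hj']
    simp
  · obtain ⟨h1, h2⟩ := hS.event κ hκN (.inr ⟨p, r, op, l, hκ, hl, hop⟩)
    have hinst := hS.isInstance hrun hop (show κ + 1 ≤ n from hκn)
      ⟨by omega, ha, fun j r hj hj' => hno j hj (by omega) r⟩
    have h3 : g (κ + 1) ≤ g n := hS.mono hκn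
    have hu : IsUpdateEvent Q (cfg a) (lab a) := .inl ⟨p, op, ha, hop⟩
    have h4 := hS.lt_of_event haκ hκn.le hu
    refine ⟨g a, g κ, ⟨by omega, le_rfl, by rw [hinst.2.1, ha], .inl ⟨rfl, p, op, ha, hop⟩⟩,
      ⟨h4, by omega, p, op, hinst.2.1, by rw [h2, hκ], fun j hj hj' r' => ?_⟩, by omega⟩
    exact hinst.2.2 j r' hj (by omega)

-- A linearization of the simulating run is kept and only its positions are renamed. Invocations do
-- not occur earlier there and responses not later, so every precedence between instances persists
-- and the order of the linearization remains admissible.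
include hns hro in
theorem exists_linearization {S : Type*} {A : ADT Op Ret S}
    (hlin : D.impl.LinearizableWithSolo Q A) : ∃ xs, IsLinearization A lab n xs := by
  classical
  obtain ⟨xs, hxs⟩ := hlin (g n) cfg' lab' (hS.isSoloRun n)
  have hex : ∀ x ∈ xs, ∃ a, InvCorr D Q n cfg lab lab' g a x.1 := fun x hx => by
    obtain ⟨h1, p, h2⟩ := hxs.isInv x hx
    exact exists_invCorr hrun hS h1 h2
  -- The default `0` is never used on entries of `xs`.
  set φ : ℕ → ℕ := fun k => if h : ∃ a, InvCorr D Q n cfg lab lab' g a k then h.choose else 0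
    with hφ_def
  have hφ : ∀ {a k}, InvCorr D Q n cfg lab lab' g a k → φ k = a := by
    intro a k h
    have hex : ∃ a, InvCorr D Q n cfg lab lab' g a k := ⟨a, h⟩
    simp only [hφ_def, dif_pos hex]
    exact hex.choose_spec.unique_left hrun hS h
  have hφ' : ∀ x ∈ xs, InvCorr D Q n cfg lab lab' g (φ x.1) x.1 := fun x hx => by
    obtain ⟨a, ha⟩ := hex x hx
    rwa [hφ ha]
  refine ⟨xs.map fun x => (φ x.1, x.2), ?_, ?_, ?_, ?_, ?_⟩
  · rw [List.map_map]
    have : (Prod.fst ∘ fun x : ℕ × Op × Ret => (φ x.1, x.2)) = φ ∘ Prod.fst := rfl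
    rw [this, ← List.map_map]
    refine hxs.nodup.map_on fun k hk k' hk' h => ?_
    obtain ⟨x, hx, rfl⟩ := List.mem_map.1 hk
    obtain ⟨x', hx', rfl⟩ := List.mem_map.1 hk'
    have h1 := hφ' x hx
    rw [h] at h1
    exact h1.unique hrun hS (hφ' x' hx')
  · intro y hy
    obtain ⟨x, hx, rfl⟩ := List.mem_map.1 hy
    obtain ⟨h1, -, h2, -⟩ := hφ' x hx
    obtain ⟨-, p, h3⟩ := hxs.isInv x hx
    exact ⟨h1, p, h2.symm.trans h3⟩
  · intro a κ r h
    obtain ⟨k, k', h1, h2, -⟩ := exists_respondsAt hrun hS hns hro h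
    obtain ⟨op, hop⟩ := hxs.complete k k' r h2
    exact ⟨op, List.mem_map.2 ⟨_, hop, by simp only [hφ h1]⟩⟩
  · rw [List.pairwise_map]
    refine hxs.order.imp_of_mem ?_
    rintro x y hx hy h ⟨κ, r, h1, h2⟩
    -- If `y` returns before `x` is invoked, its copy returns before `g (κ + 1)`, and the copy of
    -- `x` is not invoked before that position.
    obtain ⟨k, k', h3, h4, h5⟩ := exists_respondsAt hrun hS hns hro h1
    obtain rfl := h3.unique hrun hS (hφ' y hy)
    refine h ⟨k', r, h4, ?_⟩
    have h6 : g (κ + 1) ≤ g (φ x.1) := hS.mono h2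
    have h7 := (hφ' x hx).2.1
    omega
  · rw [List.map_map]
    exact hxs.legal

end

theorem CASStructure.versioned_linearizable {P Op Ret V St S : Type*} [Finite P]
    {D : CASStructure P Op Ret V St} {Q : Set Op} {A : ADT Op Ret S} (hns : D.impl.NeverStuck Q)
    (hro : D.ReadOnly Q) (hlin : D.impl.LinearizableWithSolo Q A) :
    (D.versioned Q).Linearizable A := by
  rintro n cfg lab ⟨hrun, -⟩
  obtain ⟨cfg', lab', g, hS⟩ := exists_simulatedRun_queries hrun hns hro
  exact exists_linearization hrun hS hns hro hlin

/-! ## The versions that a query visits -/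

/-- A property of local states that holds now has been established by a step of the process. -/
theorem Impl.IsRun.exists_begin {P Op Ret S L : Type*} {M : Impl P Op Ret S L} {N : ℕ∞}
    {cfg : ℕ → Config P Op S L} {lab : ℕ → Label P Op Ret} (hrun : M.IsRun N cfg lab)
    {R : L → Prop} (hstart : ∀ p op, ¬ R (M.start p op)) {p : P} {q : Op} {l : L} {i : ℕ}
    (hi : (i : ℕ∞) ≤ N) (hp : (cfg i).procs p = some (q, l)) (hl : R l) :
    ∃ u < i, lab u = .step p ∧ (∃ l₀ l₁, (cfg u).procs p = some (q, l₀) ∧ ¬ R l₀ ∧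
      M.step l₀ (cfg u).shared l₁ (cfg (u + 1)).shared ∧ (cfg (u + 1)).procs p = some (q, l₁) ∧
      R l₁) ∧ ∀ j, u < j → j ≤ i → ∃ l', (cfg j).procs p = some (q, l') ∧ R l' := by
  induction i generalizing l with
  | zero => simp [hrun.1] at hp
  | succ i ih =>
    have hiN : (i : ℕ∞) < N := lt_of_lt_of_le (by exact_mod_cast Nat.lt_succ_self i) hi
    have hst := hrun.2 i hiN
    have hext : ∀ l', (cfg i).procs p = some (q, l') → R l' → ∃ u < i + 1, lab u = .step p ∧
        (∃ l₀ l₁, (cfg u).procs p = some (q, l₀) ∧ ¬ R l₀ ∧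
          M.step l₀ (cfg u).shared l₁ (cfg (u + 1)).shared ∧ (cfg (u + 1)).procs p = some (q, l₁) ∧
          R l₁) ∧ ∀ j, u < j → j ≤ i + 1 → ∃ l', (cfg j).procs p = some (q, l') ∧ R l' := by
      intro l' h1 h2
      obtain ⟨u, hu, h3, h4, h5⟩ := ih hiN.le h1 h2
      refine ⟨u, by omega, h3, h4, fun j hj hj' => ?_⟩
      rcases Nat.le_succ_iff.1 hj' with hj' | rfl
      · exact h5 j hj hj'
      · exact ⟨l, hp, hl⟩
    by_cases hq : (lab i).proc = p
    · cases hlab : lab i with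
      | inv p' op =>
        rw [hlab] at hst hq
        obtain rfl : p' = p := hq
        have h1 := hst.inv_iff.2.1
        rw [hp] at h1
        cases h1
        exact (hstart _ _ hl).elim
      | res p' r =>
        rw [hlab] at hst hq
        obtain rfl : p' = p := hq
        obtain ⟨-, -, -, -, h1, -⟩ := hst.res_iff
        rw [hp] at h1
        cases h1
      | step p' =>
        rw [hlab] at hst hq
        obtain rfl : p' = p := hq
        obtain ⟨op, l₀, l₁, h1, h2, h3⟩ := hst.step_iff
        rw [hp] at h3
        cases h3
        by_cases h4 : R l₀
        · exact hext l₀ h1 h4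
        · refine ⟨i, Nat.lt_succ_self i, hlab, ⟨l₀, l, h1, h4, h2, hp, hl⟩, fun j hj hj' => ?_⟩
          obtain rfl : j = i + 1 := by omega
          exact ⟨l, hp, hl⟩
    · rw [hst.procs_of_ne hq] at hp
      exact hext l hp hl

namespace VState

variable {V St : Type*}

/-- The version on which a `readSnapshot` is currently working. -/
def accessNode : VState V St → Option ℕ
  | .ssTest _ _ n => some n
  | .ssNext _ _ n => some n
  | .ssRet _ _ n => some n
  | .initTest _ next => next.accessNode
  | .initRead _ next => next.accessNode
  | .initCas _ _ next => next.accessNode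
  | _ => none

/-- A `vCAS` on `x` has appended the version `n`, and is about to initialize its timestamp. -/
def Installing (x n : ℕ) : VState V St → Prop
  | .initTest m next => m = n ∧ ∃ k, next = .casRet x k true
  | .initRead m next => m = n ∧ ∃ k, next = .casRet x k true
  | .initCas m _ next => m = n ∧ ∃ k, next = .casRet x k true
  | _ => False

/-- A `vCAS` will not append a version any more. -/
def AfterAppend : VState V St → Prop
  | .casRet _ _ _ => True
  | .initTest _ next => next.AfterAppend
  | .initRead _ next => next.AfterAppend
  | .initCas _ _ next => next.AfterAppend
  | _ => False

theorem Installing.vcasOn {x n : ℕ} {l : VState V St} (h : l.Installing x n) :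
    l.vcasOn = some x := by
  cases l <;> simp only [Installing] at h
  all_goals
    obtain ⟨-, k, rfl⟩ := h
    rfl

end VState

section

variable {P Op Ret V St : Type*} {D : CASStructure P Op Ret V St} {l l' : VState V St}
  {m m' : VMem V}

theorem VStep.begins_vcas (hs : VStep D l m l' m') {x : ℕ} (h' : l'.vcasOn = some x)
    (h : l.vcasOn ≠ some x) : ∃ s old new k, l = .upd s ∧ D.code s = .cas x old new k := by
  cases hs with
  | updCas s y old new k n _ hc hx =>
    cases h'
    exact ⟨s, old, new, k, rfl, hc⟩
  | _ => first | exact (h h').elim | cases h'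

theorem VStep.accessNode_eq (hs : VStep D l m l' m') {n : ℕ} (h : l'.accessNode = some n) :
    (∃ h s x k, l = .query h s ∧ D.code s = .read x k ∧ m.vhead x = some n) ∨
      l.accessNode = some n ∧ ¬ l.IsNext ∨
      ∃ n₀, l.accessNode = some n₀ ∧ m.nextOf n₀ = some (some n) := by
  cases hs with
  | queryRead h s x k n _ hc hx =>
    cases h
    exact .inl ⟨_, _, _, _, rfl, hc, hx⟩
  | ssNextSome h k n₀ _ nd n' hn hn' =>
    cases h
    exact .inr (.inr ⟨n₀, rfl, by simp [VMem.nextOf, hn, hn']⟩)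
  | _ => first | exact .inr (.inl ⟨h, id⟩) | cases h

theorem VStep.installing (hs : VStep D l m l' m') {x n : ℕ} (h : l.Installing x n) :
    l'.Installing x n ∨ m'.Decided n := by
  cases hs with
  | initTestNone => exact .inl h
  | initTestSome _ _ _ nd t hn ht =>
    obtain ⟨rfl, -⟩ := h
    exact .inr ⟨t, by simp [VMem.tsOf, hn, ht]⟩
  | initRead => exact .inl h
  | initCasSucc _ t _ _ nd hn ht =>
    obtain ⟨rfl, -⟩ := h
    exact .inr ⟨t, by simp [VMem.tsOf]⟩
  | initCasFail _ _ _ _ nd t hn ht =>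
    obtain ⟨rfl, -⟩ := h
    exact .inr ⟨t, by simp [VMem.tsOf, hn, ht]⟩
  | _ => exact h.elim

theorem VStep.afterAppend (hs : VStep D l m l' m') (h : l.AfterAppend) :
    l'.AfterAppend ∨ l'.vcasOn = none := by
  cases hs with
  | casRet => exact .inr rfl
  | initTestNone => exact .inl h
  | initTestSome => exact .inl h
  | initRead => exact .inl h
  | initCasSucc => exact .inl h
  | initCasFail => exact .inl h
  | _ => exact h.elim

theorem VStep.vhead_new (hs : VStep D l m l' m') {x n : ℕ} (h : m'.vhead x = some n) :
    m.vhead x = some n ∨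
      (∃ k n₀, l = .casAppend x k n₀ n ∧ l' = .initTest n (.casRet x k true)) ∨
      ∃ k, l = .newHead n k ∧ m'.node = m.node := by
  cases hs with
  | casAppendSucc y k n₀ n' m hy =>
    by_cases hxy : x = y
    · subst hxy
      simp only [Function.update_self, Option.some.injEq] at h
      subst h
      exact .inr (.inl ⟨k, n₀, rfl, rfl⟩)
    · exact .inl (by simpa [Function.update_of_ne hxy] using h)
  | newHead n' k y m hy =>
    by_cases hxy : x = y
    · subst hxy
      simp only [Function.update_self, Option.some.injEq] at h
      subst h
      exact .inr (.inr ⟨k, rfl, rfl⟩)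
    · exact .inl (by simpa [Function.update_of_ne hxy] using h)
  | _ => exact .inl h

end

/-- The first configuration in which `n` is a head. -/
noncomputable def firstHead {P Op V L : Type*} (cfg : ℕ → Config P Op (VMem V) L) (n : ℕ) : ℕ :=
  sInf {j | ∃ x, (cfg j).shared.vhead x = some n}

section

variable {P Op Ret V St : Type*} {D : CASStructure P Op Ret V St} {Q : Set Op} {n : ℕ}
  {cfg : ℕ → Config P Op (VMem V) (VState V St)} {lab : ℕ → Label P Op Ret}

/-- The process `p` performs a `vCAS` on `x` in configuration `i`. -/
def InVCAS (cfg : ℕ → Config P Op (VMem V) (VState V St)) (p : P) (x i : ℕ) : Prop :=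
  ∃ op l, (cfg i).procs p = some (op, l) ∧ l.vcasOn = some x

/-- In event `e`, the process `p` appends the version `nd` to the list of `x`. -/
def AppendsAt (cfg : ℕ → Config P Op (VMem V) (VState V St)) (lab : ℕ → Label P Op Ret) (p : P)
    (x nd e : ℕ) : Prop :=
  lab e = .step p ∧ ∃ op k n₀, (cfg e).procs p = some (op, .casAppend x k n₀ nd) ∧
    (cfg (e + 1)).procs p = some (op, .initTest nd (.casRet x k true)) ∧
    (cfg (e + 1)).shared.vhead x = some nd

/-- The `vCAS` on `x` that the process `p` performs in configuration `i` appends the version `nd`. -/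
def AppendedBy (n : ℕ) (cfg : ℕ → Config P Op (VMem V) (VState V St)) (lab : ℕ → Label P Op Ret)
    (p : P) (x nd i : ℕ) : Prop :=
  ∃ e < n, AppendsAt cfg lab p x nd e ∧
    ∀ j, (i ≤ j ∧ j ≤ e ∨ e ≤ j ∧ j ≤ i) → InVCAS cfg p x j

theorem AppendedBy.inVCAS {p : P} {x nd i : ℕ} (h : AppendedBy n cfg lab p x nd i) :
    InVCAS cfg p x i := by
  obtain ⟨e, -, -, h⟩ := h
  exact h i ((le_total i e).imp (fun h => ⟨le_rfl, h⟩) fun h => ⟨h, le_rfl⟩)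

variable (hrun : (D.versioned Q).IsRun n cfg lab)

include hrun

/-- When a version becomes head for the first time, its successor has already been a head of the
same object. The first occurrence as a head thus orders each version list strictly. -/
theorem firstHead_lt {i x nd nd' : ℕ} (hi : i ≤ n) (h : HeadBy cfg i x nd)
    (hn : (cfg i).shared.nextOf nd = some (some nd')) : firstHead cfg nd' < firstHead cfg nd := by
  obtain ⟨k, hk, h⟩ := h
  obtain ⟨y, hy⟩ : ∃ y, (cfg (firstHead cfg nd)).shared.vhead y = some nd :=
    Nat.sInf_mem (s := {j | ∃ x, (cfg j).shared.vhead x = some nd}) ⟨k, x, h⟩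
  have hle : firstHead cfg nd ≤ k := Nat.sInf_le ⟨x, h⟩
  have hJ : HeadBy cfg (firstHead cfg nd) y nd := ⟨_, le_rfl, hy⟩
  have hin : (i : ℕ∞) ≤ n := by exact_mod_cast hi
  rw [(D.ext_run hrun (hle.trans hk) hin).next_eq hJ] at hn
  have hfn : (firstHead cfg nd : ℕ∞) ≤ n := by exact_mod_cast (hle.trans hk).trans hi
  obtain ⟨⟨j, hj, h1⟩, -, h2⟩ := (D.configInv_run hrun hfn).mem.next hJ hn
  have h3 : firstHead cfg nd' ≤ j := Nat.sInf_le ⟨y, h1⟩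
  -- Equality would make both the head of one object in the same configuration, but their values
  -- differ.
  refine lt_of_le_of_ne (h3.trans hj) fun he => h2 ?_
  obtain rfl : j = firstHead cfg nd := by omega
  rw [h1] at hy
  cases hy
  rfl

/-- A `readSnapshot` visits newer versions first. -/
theorem exists_beginsReadSnapshot {p : P} {q : Op} {l : VState V St} {i nd : ℕ} (hi : i ≤ n)
    (hp : (cfg i).procs p = some (q, l)) (hl : l.accessNode = some nd) :
    ∃ u x, u < i ∧ D.BeginsReadSnapshot cfg lab p u x ∧ HeadBy cfg i x nd ∧
      (∀ j, u < j → j ≤ i → (cfg j).procs p ≠ none) ∧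
      ∀ j, u < j → j < i → ∀ q' l' nd', lab j = .step p → (cfg j).procs p = some (q', l') →
        l'.IsNext → l'.accessNode = some nd' → firstHead cfg nd < firstHead cfg nd' := by
  have hcast : ∀ {j}, j ≤ n → (j : ℕ∞) ≤ n := fun h => by exact_mod_cast h
  obtain ⟨u, hu, h1, ⟨l₀, l₁, h2, h3, h4, h5, h6⟩, h7⟩ := hrun.exists_begin
    (R := fun l => ∃ n, l.accessNode = some n) (fun p op => by
      by_cases h : op ∈ Q <;> simp [CASStructure.versioned, h, VState.accessNode]) (hcast hi) hp ⟨nd, hl⟩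
  obtain ⟨nd₁, h8⟩ := h6
  obtain ⟨h, s, x, k, rfl, hc, hx⟩ : ∃ h s x k, l₀ = .query h s ∧ D.code s = .read x k ∧
      (cfg u).shared.vhead x = some nd₁ := by
    rcases (vstep_of_step h4).accessNode_eq h8 with h | h | ⟨n₀, h, -⟩
    · exact h
    · exact (h3 ⟨_, h.1⟩).elim
    · exact (h3 ⟨_, h⟩).elim
  refine ⟨u, x, hu, ⟨q, h, s, k, h1, h2, hc⟩, ?_⟩
  -- Invariant since the start of the `readSnapshot`: the current version belongs to `x` and is
  -- older than every version left through a followed pointer.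
  suffices hmain : ∀ j, u + 1 ≤ j → j ≤ i → ∀ l nd, (cfg j).procs p = some (q, l) →
      l.accessNode = some nd → HeadBy cfg j x nd ∧ ∀ j', u < j' → j' < j → ∀ q' l' nd',
        lab j' = .step p → (cfg j').procs p = some (q', l') → l'.IsNext →
        l'.accessNode = some nd' → firstHead cfg nd < firstHead cfg nd' by
    obtain ⟨h9, h10⟩ := hmain i hu le_rfl l nd hp hl
    refine ⟨h9, fun j hj hj' h => ?_, h10⟩
    obtain ⟨_, h11, -⟩ := h7 j hj hj'
    rw [h] at h11
    cases h11
  intro j hj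
  induction j, hj using Nat.le_induction with
  | base =>
    intro _ l nd hp hl
    rw [h5] at hp
    cases hp
    rw [h8] at hl
    cases hl
    exact ⟨⟨u, Nat.le_succ u, hx⟩, fun j' h9 h10 => by omega⟩
  | succ j hj ih =>
    intro hji l nd hp hl
    obtain ⟨lj, hlj, ndj, hndj⟩ := h7 j hj (by omega)
    obtain ⟨h9, h10⟩ := ih (by omega) lj ndj hlj hndj
    have hjn : (j : ℕ∞) < n := by exact_mod_cast (by omega : j < n)
    have hst := hrun.2 j hjn
    have hinv := D.configInv_run hrun hjn.le
    by_cases hpj : (lab j).proc = p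
    · cases hlab : lab j with
      | inv p' op =>
        rw [hlab] at hst hpj
        obtain rfl : p' = p := hpj
        rw [hst.inv_iff.1] at hlj
        cases hlj
      | res p' r =>
        rw [hlab] at hst hpj
        obtain rfl : p' = p := hpj
        obtain ⟨-, -, -, -, h11, -⟩ := hst.res_iff
        rw [hp] at h11
        cases h11
      | step p' =>
        rw [hlab] at hst hpj
        obtain rfl : p' = p := hpj
        obtain ⟨op, l', l'', h11, h12, h13⟩ := hst.step_iff
        rw [hlj] at h11
        cases h11
        rw [hp] at h13
        cases h13
        rcases (vstep_of_step h12).accessNode_eq hl with ⟨_, _, _, _, rfl, -⟩ | ⟨h14, h15⟩ |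
          ⟨n₀, h14, h15⟩
        · cases hndj
        · rw [hndj] at h14
          cases h14
          refine ⟨h9.mono (Nat.le_succ j), fun j' hj' hj'' q' l' nd' h16 h17 h18 h19 => ?_⟩
          rcases Nat.lt_succ_iff_lt_or_eq.1 hj'' with hj'' | rfl
          · exact h10 j' hj' hj'' q' l' nd' h16 h17 h18 h19
          · rw [hlj] at h17
            cases h17
            exact (h15 h18).elim
        · rw [hndj] at h14
          cases h14
          have hlt := firstHead_lt hrun (by omega) h9 h15
          refine ⟨(hinv.mem.next h9 h15).1.mono (Nat.le_succ j),
            fun j' hj' hj'' q' l' nd' h16 h17 h18 h19 => ?_⟩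
          rcases Nat.lt_succ_iff_lt_or_eq.1 hj'' with hj'' | rfl
          · exact hlt.trans (h10 j' hj' hj'' q' l' nd' h16 h17 h18 h19)
          · rw [hlj] at h17
            cases h17
            rw [hndj] at h19
            cases h19
            exact hlt
    · rw [hst.procs_of_ne hpj, hlj] at hp
      cases hp
      rw [hndj] at hl
      cases hl
      refine ⟨h9.mono (Nat.le_succ j), fun j' hj' hj'' q' l' nd' h16 h17 h18 h19 => ?_⟩
      rcases Nat.lt_succ_iff_lt_or_eq.1 hj'' with hj'' | rfl
      · exact h10 j' hj' hj'' q' l' nd' h16 h17 h18 h19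
      · rw [h16] at hpj
        exact (hpj rfl).elim

/-- A version with a predecessor has been appended by a `vCAS`. -/
theorem exists_appendsAt {i x nd nd' : ℕ} (hi : i ≤ n) (h : HeadBy cfg i x nd)
    (hn : (cfg i).shared.nextOf nd = some (some nd')) : ∃ e < i, ∃ p, AppendsAt cfg lab p x nd e := by
  induction i with
  -- Initial versions have no successor. The same fact excludes the versions made by constructors
  -- below.
  | zero =>
    obtain ⟨k, hk, h⟩ := h
    obtain rfl : k = 0 := by omega
    rw [hrun.1] at h hn
    simp only [CASStructure.versioned, VMem.nextOf, Option.map_map, Option.map_eq_some_iff] at h hn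
    obtain ⟨v, -, h2⟩ := hn
    cases h2
  | succ i ih =>
    have hin : (i : ℕ∞) < n := by exact_mod_cast hi
    have hext : HeadBy cfg i x nd → ∃ e < i + 1, ∃ p, AppendsAt cfg lab p x nd e := fun h1 => by
      rw [(D.ext_run hrun (Nat.le_succ i) (by exact_mod_cast hi)).next_eq h1] at hn
      obtain ⟨e, he, h2⟩ := ih (by omega) h1 hn
      exact ⟨e, by omega, h2⟩
    rw [headBy_succ] at h
    rcases h with h | h
    · exact hext h
    have hst := hrun.2 i hin
    cases hlab : lab i with
    | inv p op =>
      rw [hlab] at hst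
      rw [hst.inv_iff.2.2] at h
      exact hext ⟨i, le_rfl, h⟩
    | res p r =>
      rw [hlab] at hst
      obtain ⟨-, -, -, -, -, h1⟩ := hst.res_iff
      rw [h1] at h
      exact hext ⟨i, le_rfl, h⟩
    | step p =>
      rw [hlab] at hst
      obtain ⟨op, l, l', h1, h2, h3⟩ := hst.step_iff
      rcases (vstep_of_step h2).vhead_new h with h4 | ⟨k, n₀, rfl, rfl⟩ | ⟨k, rfl, h4⟩
      · exact hext ⟨i, le_rfl, h4⟩
      · exact ⟨i, Nat.lt_succ_self i, p, hlab, op, k, n₀, h1, h3, h⟩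
      · have h5 := ((D.configInv_run hrun hin.le).loc h1).1
        rw [VMem.nextOf, ← h4, ← VMem.nextOf, hn] at h5
        cases h5

theorem exists_beginsVCAS {p : P} {i x : ℕ} (hi : i ≤ n) (h : InVCAS cfg p x i) :
    ∃ u < i, lab u = .step p ∧ D.BeginsVCAS cfg lab u x ∧ ∀ j, u < j → j ≤ i → InVCAS cfg p x j := by
  obtain ⟨op, l, hp, hl⟩ := h
  obtain ⟨u, hu, h1, ⟨l₀, l₁, h2, h3, h4, h5, h6⟩, h7⟩ := hrun.exists_begin
    (R := fun l => l.vcasOn = some x) (fun p op => by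
      by_cases h : op ∈ Q <;> simp [CASStructure.versioned, h, VState.vcasOn]) (by exact_mod_cast hi) hp hl
  obtain ⟨s, old, new, k, rfl, hc⟩ := (vstep_of_step h4).begins_vcas h6 h3
  exact ⟨u, hu, h1, ⟨p, op, s, old, new, k, h1, h2, hc⟩, fun j hj hj' => ⟨op, h7 j hj hj'⟩⟩

/-- A `vCAS` initializes the timestamp of the version that it has appended. -/
theorem AppendsAt.installing {p : P} {x nd e : ℕ} (h : AppendsAt cfg lab p x nd e) {i : ℕ}
    (hei : e < i) (hi : i ≤ n) :
    (cfg i).shared.Decided nd ∨ ∃ op l, (cfg i).procs p = some (op, l) ∧ l.Installing x nd := by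
  obtain ⟨-, op, k, n₀, -, h1, h2⟩ := h
  induction i, hei using Nat.le_induction with
  | base => exact .inr ⟨op, _, h1, rfl, k, rfl⟩
  | succ i hei ih =>
    have hin : (i : ℕ∞) < n := by exact_mod_cast hi
    have hJ : HeadBy cfg i x nd := ⟨e + 1, hei, h2⟩
    have hst := hrun.2 i hin
    rcases ih (by omega) with h3 | ⟨op', l, h3, h4⟩
    · exact .inl ((D.ext_run hrun (Nat.le_succ i) (by exact_mod_cast hi)).decided hJ h3)
    · by_cases hp : (lab i).proc = p
      · cases hlab : lab i with
        | inv p' op =>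
          rw [hlab] at hst hp
          obtain rfl : p' = p := hp
          rw [hst.inv_iff.1] at h3
          cases h3
        | res p' r =>
          rw [hlab] at hst hp
          obtain rfl : p' = p := hp
          obtain ⟨op, l', h5, h6, -⟩ := hst.res_iff
          rw [h3] at h5
          cases h5
          rcases versioned_result.1 h6 with ⟨_, rfl, -⟩ | ⟨_, _, rfl, -⟩ <;> exact h4.elim
        | step p' =>
          rw [hlab] at hst hp
          obtain rfl : p' = p := hp
          obtain ⟨op, l', l'', h5, h6, h7⟩ := hst.step_iff
          rw [h3] at h5
          cases h5
          exact ((vstep_of_step h6).installing h4).symm.imp id fun h8 => ⟨_, _, h7, h8⟩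
      · exact .inr ⟨op', l, by rw [hst.procs_of_ne hp, h3], h4⟩

/-- A `vCAS` appends at most one version. -/
theorem AppendsAt.not_lt {p : P} {x x' nd nd' e e' : ℕ} (h : AppendsAt cfg lab p x nd e)
    (h' : AppendsAt cfg lab p x' nd' e') (hn : e' < n)
    (hin : ∀ j, e < j → j ≤ e' → ∃ y, InVCAS cfg p y j) : ¬ e < e' := by
  intro hlt
  obtain ⟨-, op, k, n₀, -, h1, -⟩ := h
  obtain ⟨-, op', k', n₀', h2, -⟩ := h'
  suffices hmain : ∀ j, e + 1 ≤ j → j ≤ e' →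
      ∃ op l, (cfg j).procs p = some (op, l) ∧ l.AfterAppend by
    obtain ⟨op, l, h3, h4⟩ := hmain e' hlt le_rfl
    rw [h2] at h3
    cases h3
    exact h4
  intro j hj
  induction j, hj using Nat.le_induction with
  | base => exact fun _ => ⟨op, _, h1, trivial⟩
  | succ j hj ih =>
    intro hje
    obtain ⟨op₁, l, h3, h4⟩ := ih (by omega)
    obtain ⟨y, op₂, l', h5, h6⟩ := hin (j + 1) (by omega) hje
    have hst := hrun.2 j (by exact_mod_cast (by omega : j < n))
    by_cases hp : (lab j).proc = p
    · cases hlab : lab j with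
      | inv p' op =>
        rw [hlab] at hst hp
        obtain rfl : p' = p := hp
        rw [hst.inv_iff.1] at h3
        cases h3
      | res p' r =>
        rw [hlab] at hst hp
        obtain rfl : p' = p := hp
        obtain ⟨-, -, -, -, h7, -⟩ := hst.res_iff
        rw [h5] at h7
        cases h7
      | step p' =>
        rw [hlab] at hst hp
        obtain rfl : p' = p := hp
        obtain ⟨op₃, l₃, l₄, h7, h8, h9⟩ := hst.step_iff
        rw [h3] at h7
        cases h7
        rw [h5] at h9
        cases h9
        refine ⟨_, _, h5, ((vstep_of_step h8).afterAppend h4).resolve_right fun h => ?_⟩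
        rw [h] at h6
        cases h6
    · exact ⟨op₁, l, by rw [hst.procs_of_ne hp, h3], h4⟩

/-- Both appends are joined to configuration `i` by an interval inside a `vCAS`, so the process does
not leave its `vCAS` between them; and one `vCAS` appends only once. -/
theorem AppendedBy.unique {p : P} {x x' nd nd' i : ℕ} (h : AppendedBy n cfg lab p x nd i)
    (h' : AppendedBy n cfg lab p x' nd' i) : nd = nd' := by
  obtain ⟨e, he, h1, h2⟩ := h
  obtain ⟨e', he', h1', h2'⟩ := h'
  have h3 := h1.not_lt hrun h1' he' fun j hj hj' => by
    rcases le_total i j with h | h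
    · exact ⟨_, h2' j (.inl ⟨h, hj'⟩)⟩
    · exact ⟨_, h2 j (.inr ⟨hj.le, h⟩)⟩
  have h4 := h1'.not_lt hrun h1 he fun j hj hj' => by
    rcases le_total i j with h | h
    · exact ⟨_, h2 j (.inl ⟨h, hj'⟩)⟩
    · exact ⟨_, h2' j (.inr ⟨hj.le, h⟩)⟩
  obtain rfl : e = e' := by omega
  obtain ⟨-, _, _, _, h5, -⟩ := h1
  obtain ⟨-, _, _, _, h6, -⟩ := h1'
  rw [h5] at h6
  cases h6
  rfl

/-- A version whose timestamp exceeds the value of the camera in configuration `a` has been appended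
by a `vCAS` that is in progress then or begins later. -/
theorem exists_appendedBy {a i x nd nd' t : ℕ} (hai : a ≤ i) (hi : i ≤ n) (h : HeadBy cfg i x nd)
    (hn : (cfg i).shared.nextOf nd = some (some nd'))
    (ht : (cfg i).shared.tsOf nd = some (some t)) (hlt : (cfg a).shared.timestamp < t) :
    (∃ p, AppendedBy n cfg lab p x nd a) ∨
      ∃ u, a ≤ u ∧ u < i ∧ D.BeginsVCAS cfg lab u x ∧
        ∃ p, lab u = .step p ∧ AppendedBy n cfg lab p x nd (u + 1) := by
  have hin : (i : ℕ∞) ≤ n := by exact_mod_cast hi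
  obtain ⟨e, he, p, happ⟩ := exists_appendsAt hrun hi h hn
  obtain ⟨-, op, k, n₀, h1, -, h2⟩ := id happ
  have hine : InVCAS cfg p x e := ⟨op, _, h1, rfl⟩
  by_cases hea : e < a
  -- A version appended before `a` is still undecided in `a`, since otherwise its timestamp would be
  -- at most the camera there. So its creator is still inside the `vCAS`.
  · have hext : ∀ j, e < j → j ≤ a → InVCAS cfg p x j := fun j hj hja => by
      rcases happ.installing hrun hj (hja.trans (hai.trans hi)) with ⟨t', h3⟩ | ⟨op', l, h3, h4⟩
      · have hj' : (j : ℕ∞) ≤ n := by exact_mod_cast hja.trans (hai.trans hi)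
        have h4 := ((D.configInv_run hrun hj').mem.J_of_ts h3).2
        rw [(D.ext_run hrun (hja.trans hai) hin).ts_eq ⟨e + 1, hj, h2⟩ h3] at ht
        cases ht
        have := timestamp_mono hrun hja (by exact_mod_cast hai.trans hi)
        omega
      · exact ⟨op', l, h3, h4.vcasOn⟩
    refine .inl ⟨p, e, by omega, happ, fun j hj => ?_⟩
    rcases hj with hj | ⟨hj, hj'⟩
    · omega
    · rcases hj.eq_or_lt with rfl | hj
      · exact hine
      · exact hext j hj hj'
  · obtain ⟨u, hu, h3, h4, h5⟩ := exists_beginsVCAS hrun (he.le.trans hi) hine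
    by_cases hua : u < a
    · refine .inl ⟨p, e, by omega, happ, fun j hj => h5 j (by omega) (by omega)⟩
    · refine .inr ⟨u, by omega, by omega, h4, p, h3, e, by omega, happ,
        fun j hj => h5 j (by omega) (by omega)⟩

end

/-! ## The running time of queries -/

section

variable {P Op Ret V St : Type*} {D : CASStructure P Op Ret V St} {Q : Set Op} {n : ℕ}
  {cfg : ℕ → Config P Op (VMem V) (VState V St)} {lab : ℕ → Label P Op Ret}

/-- A crude bound, needed only to know that the maximum number of accesses is finite. -/
theorem CASStructure.accesses_le (p : P) (a b x : ℕ) :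
    D.accesses cfg lab p a b x ≤ ((b - a : ℕ) : ℕ∞) := by
  rw [← Nat.card_Ico, ← Set.encard_coe_eq_coe_finsetCard]
  exact Set.encard_le_encard fun i hi => by simpa using ⟨hi.1, hi.2.1⟩

variable [Finite P] (hrun : (D.versioned Q).IsRun n cfg lab) (hns : D.impl.NeverStuck Q)
  (hro : D.ReadOnly Q)

include hrun hns hro in
/-- The visited versions whose successors are visited as well. -/
theorem exists_visit {p : P} {q : Op} (hq : q ∈ Q) {a : ℕ} (ha : lab a = .inv p q) {i : ℕ}
    (hai : a < i) (hi : i ≤ n) (hres : ∀ k r, a < k → k < i → lab k ≠ .res p r) {q' : Op}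
    {l : VState V St} (hp : (cfg i).procs p = some (q', l)) (hl : l.IsNext) :
    ∃ nd nd' t, l.accessNode = some nd ∧ (cfg i).shared.nextOf nd = some (some nd') ∧
      (cfg i).shared.tsOf nd = some (some t) ∧ (cfg a).shared.timestamp < t := by
  obtain ⟨l', h1, h2⟩ := queryState hrun hns hro hq ha hai hi hres
  rw [hp] at h1
  cases h1
  have hin : (i : ℕ∞) ≤ n := by exact_mod_cast hi
  have hinv := (D.configInv_run hrun hin).loc hp
  cases h2 with
  | snapRead => exact hl.elim
  | snapInc => exact hl.elim
  | running h C k o _ hle hs hC hr =>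
    cases hr with
    | ssNext s x κ nd v hr hc hx hv =>
      obtain ⟨-, ⟨y, hy⟩, t, hlt, ht⟩ := hinv
      have hext := D.ext_run hrun hi le_rfl
      rw [VMem.VersionVal.iff_next fun t' ht' => by
        rw [hext.ts_eq hy ht] at ht'
        cases ht'
        exact hlt] at hv
      obtain ⟨nd', h3, -⟩ := hv
      exact ⟨nd, nd', t, rfl, by rw [← hext.next_eq hy, h3], ht, hle.trans_lt hlt⟩
    | _ => exact hl.elim

-- Each followed pointer is charged to the `vCAS` that appended the version it leaves. A `vCAS` is
-- charged at most once per `readSnapshot` on its object, hence at most `A` times, and the charged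
-- `vCAS` operations are among those counted by `W`.
open Classical in
include hrun hns hro in
theorem nextCount_le {p : P} {q : Op} (hq : q ∈ Q) {a b : ℕ} (hb : b ≤ n)
    (hinst : IsInstance lab p q a b) :
    (nextCount cfg lab p a b : ℕ∞) ≤
      D.concurrentVCAS cfg lab p a b * D.maxAccesses cfg lab p a b := by
  obtain ⟨hab, ha, hres⟩ := hinst
  set E := (Finset.Ico a b).filter fun j => lab j = .step p ∧
    ∃ q l, (cfg j).procs p = some (q, l) ∧ l.IsNext with hE
  -- For a followed pointer `e`: the version left, its object, the start of the `readSnapshot`, and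
  -- the charged `vCAS`. The latter is named by its process if it is in progress at `a`, and by its
  -- first event otherwise.
  have hdata : ∀ e, ∃ nd x u, ∃ w : P ⊕ ℕ, e ∈ E → (∃ q l, (cfg e).procs p = some (q, l) ∧ l.IsNext ∧
      l.accessNode = some nd) ∧ a ≤ u ∧ u < e ∧ D.BeginsReadSnapshot cfg lab p u x ∧
      HeadBy cfg n x nd ∧
      (∀ j, u < j → j < e → ∀ q' l' nd', lab j = .step p → (cfg j).procs p = some (q', l') →
        l'.IsNext → l'.accessNode = some nd' → firstHead cfg nd < firstHead cfg nd') ∧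
      ((∃ p', w = .inl p' ∧ AppendedBy n cfg lab p' x nd a) ∨
        ∃ u', w = .inr u' ∧ a ≤ u' ∧ u' < b ∧ D.BeginsVCAS cfg lab u' x ∧
          ∃ p', lab u' = .step p' ∧ AppendedBy n cfg lab p' x nd (u' + 1)) := by
    intro e
    by_cases he : e ∈ E
    · simp only [hE, Finset.mem_filter, Finset.mem_Ico] at he
      obtain ⟨⟨hae, heb⟩, hlab, q', l, hp, hl⟩ := id he
      have hae : a < e := by
        refine lt_of_le_of_ne hae ?_
        rintro rfl
        rw [ha] at hlab
        cases hlab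
      obtain ⟨nd, nd', t, h1, h2, h3, h4⟩ := exists_visit hrun hns hro hq ha hae (by omega)
        (fun k r hk hk' => hres k r hk (by omega)) hp hl
      obtain ⟨u, x, h5, h6, h7, h8, h9⟩ := exists_beginsReadSnapshot hrun (by omega) hp h1
      have hidle : (cfg a).procs p = none := by
        have hst := hrun.2 a (by exact_mod_cast (by omega : a < n))
        rw [ha] at hst
        exact hst.inv_iff.1
      have hau : a ≤ u := by
        by_contra hcon
        exact h8 a (by omega) hae.le hidle
      rcases exists_appendedBy hrun hae.le (by omega) h7 h2 h3 h4 with ⟨p', h10⟩ |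
        ⟨u', h10, h11, h12, p', h13, h14⟩
      · exact ⟨nd, x, u, .inl p', fun _ => ⟨⟨q', l, hp, hl, h1⟩, hau, h5, h6, h7.mono (by omega), h9,
          .inl ⟨p', rfl, h10⟩⟩⟩
      · exact ⟨nd, x, u, .inr u', fun _ => ⟨⟨q', l, hp, hl, h1⟩, hau, h5, h6, h7.mono (by omega), h9,
          .inr ⟨u', rfl, h10, by omega, h12, p', h13, h14⟩⟩⟩
    · exact ⟨0, 0, 0, .inr 0, fun h => (he h).elim⟩
  choose nd x u w hdata using hdata
  have hmem : ∀ {e}, e ∈ E → e < b ∧ lab e = .step p := fun he => by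
    simp only [hE, Finset.mem_filter, Finset.mem_Ico] at he
    exact ⟨he.1.2, he.2.1⟩
  -- Within one `readSnapshot` the visited versions get strictly older, so none is left twice.
  have hlt : ∀ {e e'}, e ∈ E → e' ∈ E → nd e = nd e' → u e = u e' → ¬ e < e' := by
    intro e e' he he' hn hu hlt
    obtain ⟨⟨q', l, hp, hl, hnd⟩, -, h1, -⟩ := hdata e he
    obtain ⟨-, -, -, -, -, h2, -⟩ := hdata e' he'
    have := h2 e (by omega) hlt q' l (nd e) (hmem he).2 hp hl hnd
    rw [hn] at this
    exact lt_irrefl _ this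
  have hacc : ∀ {e}, e ∈ E → D.accesses cfg lab p a b (x e) ≠ 0 := by
    intro e he
    obtain ⟨-, h1, h2, h3, -⟩ := hdata e he
    exact Set.encard_ne_zero.2 ⟨u e, h1, by have := (hmem he).1; omega, h3⟩
  have hw : ∀ {e e'}, e ∈ E → e' ∈ E → w e = w e' → nd e = nd e' := by
    intro e e' he he' hww
    obtain ⟨-, -, -, -, -, -, h1⟩ := hdata e he
    obtain ⟨-, -, -, -, -, -, h2⟩ := hdata e' he'
    rcases h1 with ⟨p₁, h1, h3⟩ | ⟨u₁, h1, -, -, -, p₁, h4, h3⟩ <;>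
      rcases h2 with ⟨p₂, h2, h5⟩ | ⟨u₂, h2, -, -, -, p₂, h6, h5⟩ <;>
      rw [h1, h2] at hww <;> cases hww
    · exact h3.unique hrun h5
    · rw [h4] at h6
      cases h6
      exact h3.unique hrun h5
  have hinvn := D.configInv_run hrun (i := n) le_rfl
  have hmax : D.maxAccesses cfg lab p a b ≠ ⊤ :=
    ne_top_of_le_ne_top (ENat.natCast_ne_top (b - a)) (iSup_le fun y => D.accesses_le p a b y)
  obtain ⟨A, hA⟩ := ENat.ne_top_iff_exists.1 hmax
  -- Charges to the same `vCAS` concern the same version, so they come from different `readSnapshot`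
  -- operations, all on the same object.
  have hfib : ∀ y ∈ E.image w, (E.filter fun e => w e = y).card ≤ A := by
    intro y hy
    obtain ⟨e₀, he₀, rfl⟩ := Finset.mem_image.1 hy
    rw [← ENat.natCast_le_natCast, hA, ← Set.encard_coe_eq_coe_finsetCard]
    refine le_trans ?_ (le_iSup _ (x e₀))
    have hinj : Set.InjOn u (E.filter fun e => w e = w e₀ : Finset ℕ) := by
      intro e he e' he' huu
      simp only [Finset.coe_filter, Set.mem_ofPred_eq] at he he'
      have hn := hw he.1 he'.1 (he.2.trans he'.2.symm)
      have h1 := hlt he.1 he'.1 hn huu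
      have h2 := hlt he'.1 he.1 hn.symm huu.symm
      omega
    rw [← hinj.encard_image]
    refine Set.encard_le_encard ?_
    rintro _ ⟨e, he, rfl⟩
    simp only [Finset.coe_filter, Set.mem_ofPred_eq] at he
    obtain ⟨-, h1, h2, h3, h4, -⟩ := hdata e he.1
    obtain ⟨-, -, -, -, h5, -⟩ := hdata e₀ he₀
    rw [hw he.1 he₀ he.2] at h4
    rw [hinvn.mem.obj_unique h4 h5] at h3
    exact ⟨h1, by have := (hmem he.1).1; omega, h3⟩
  have himg : ((E.image w).card : ℕ∞) ≤ D.concurrentVCAS cfg lab p a b := by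
    rw [← Set.encard_coe_eq_coe_finsetCard]
    refine le_trans (Set.encard_le_encard (t := Sum.inl '' {p' | ∃ op l x, (cfg a).procs p' = some (op, l) ∧
      l.vcasOn = some x ∧ D.accesses cfg lab p a b x ≠ 0} ∪ Sum.inr '' {i | a ≤ i ∧ i < b ∧
      ∃ x, D.BeginsVCAS cfg lab i x ∧ D.accesses cfg lab p a b x ≠ 0}) ?_)
      ((Set.encard_union_le _ _).trans (le_of_eq ?_))
    · intro y hy
      obtain ⟨e, he, rfl⟩ := Finset.mem_image.1 hy
      obtain ⟨-, -, -, -, -, -, h1⟩ := hdata e he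
      rcases h1 with ⟨p', h1, h2⟩ | ⟨u', h1, h2, h3, h4, -⟩
      · obtain ⟨op, l, h3, h4⟩ := h2.inVCAS
        exact .inl ⟨p', ⟨op, l, _, h3, h4, hacc he⟩, h1.symm⟩
      · exact .inr ⟨u', ⟨h2, h3, _, h4, hacc he⟩, h1.symm⟩
    · rw [Sum.inl_injective.encard_image, Sum.inr_injective.encard_image]
      rfl
  calc (nextCount cfg lab p a b : ℕ∞) = (E.card : ℕ∞) := rfl
    _ ≤ ((A * (E.image w).card : ℕ) : ℕ∞) :=
      ENat.natCast_le_natCast.2 (Finset.card_le_mul_card_image E A hfib)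
    _ = (E.image w).card * A := by rw [Nat.cast_mul, mul_comm]
    _ ≤ _ := by
      rw [← hA]
      gcongr

end

section

variable {P Op Ret V St : Type*} [Finite P] {D : CASStructure P Op Ret V St} {Q : Set Op} {n : ℕ}
  {cfg : ℕ → Config P Op (VMem V) (VState V St)} {lab : ℕ → Label P Op Ret}
  (hrun : (D.versioned Q).IsRun n cfg lab) (hns : D.impl.NeverStuck Q) (hro : D.ReadOnly Q)

include hrun hns hro

/-- The handle of a query determines when it took its snapshot. -/
theorem exists_snapAt {p : P} {q : Op} (hq : q ∈ Q) {a b s t h : ℕ} (hb : b ≤ n)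
    (hinst : IsInstance lab p q a b) (hts : TakesSnapshot cfg lab p a b s t h) :
    ∃ j, s < j ∧ j ≤ t ∧ SnapAt cfg p q (D.start p q) a (t + 1) h j := by
  obtain ⟨-, ha, hres⟩ := hinst
  obtain ⟨has, hst, htb, -, hlab, ⟨q₁, s₁, hps⟩, q₂, s₂, hpt⟩ := hts
  have hres' : ∀ k r, a < k → k < t + 1 → lab k ≠ .res p r := fun k r hk hk' => by
    rcases Nat.lt_succ_iff_lt_or_eq.1 hk' with hk' | rfl
    · exact hres k r hk (by omega)
    · rw [hlab]
      simp
  have hstep := hrun.2 t (by exact_mod_cast htb.trans_le hb)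
  rw [hlab] at hstep
  obtain ⟨op, l, l', h1, h2, h3⟩ := hstep.step_iff
  rw [hpt] at h1
  cases h1
  rw [(vstep_of_step h2).snapInc_eq.1] at h3
  obtain ⟨l, h4, h5⟩ := queryState hrun hns hro hq ha (show a < t + 1 by omega) (by omega) hres'
  rw [h3] at h4
  cases h4
  cases h5 with
  | running h C k o _ hle hs hC hr =>
    cases hr
    obtain ⟨j, hs⟩ := hs
    refine ⟨j, ?_, Nat.lt_succ_iff.1 hs.2.1, hs⟩
    by_contra hcon
    obtain ⟨l, h6, h7⟩ := snapped_of_snapInc hrun (not_lt.1 hcon) (by omega) hs.2.2.1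
      fun k r hk hk' => hres' k r (by have := hs.1; omega) (by omega)
    rw [hps] at h6
    cases h6
    rcases h7 with h7 | h7
    · cases h7
    · exact h7

/-- The running time of a query. -/
theorem query_time {p : P} {q : Op} (hq : q ∈ Q) {a b s t h : ℕ} (hb : b ≤ n)
    (hinst : IsInstance lab p q a b) (hts : TakesSnapshot cfg lab p a b s t h)
    {C : ℕ → Option V} (hC : (cfg n).shared.IsSnapshot h C) :
    procTime lab p a b ≤ 13 * (D.impl.soloTime p q C +
      D.concurrentVCAS cfg lab p a b * D.maxAccesses cfg lab p a b) := by
  obtain ⟨j, -, -, hj⟩ := exists_snapAt hrun hns hro hq hb hinst hts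
  have hnext := nextCount_le hrun hns hro hq hb hinst
  obtain ⟨-, ha, hres⟩ := hinst
  obtain ⟨has, hst, htb, -, hlab, -⟩ := hts
  -- The invariant of the query holds only while it is pending, so a final response is cut off; it
  -- costs one event.
  obtain ⟨c, hac, htc, hcb, hresc, hcnt, hnx⟩ : ∃ c, a < c ∧ t + 1 ≤ c ∧ c ≤ b ∧
      (∀ k r, a < k → k < c → lab k ≠ .res p r) ∧
      eventCount lab p a b ≤ eventCount lab p a c + 1 ∧
      nextCount cfg lab p a c ≤ nextCount cfg lab p a b := by
    obtain ⟨b, rfl⟩ : ∃ b', b = b' + 1 := ⟨b - 1, by omega⟩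
    by_cases hr : ∃ r, lab b = .res p r
    · obtain ⟨r, hr⟩ := hr
      have htb' : t ≠ b := by
        rintro rfl
        rw [hlab] at hr
        cases hr
      refine ⟨b, by omega, by omega, by omega, fun k r hk hk' => hres k r hk (by omega), ?_, ?_⟩
      · rw [eventCount_succ _ _ (by omega)]
        split_ifs <;> omega
      · rw [nextCount_succ _ _ _ (by omega)]
        omega
    · refine ⟨b + 1, by omega, by omega, le_rfl, fun k r hk hk' => ?_, by omega, le_rfl⟩
      rcases Nat.lt_succ_iff_lt_or_eq.1 hk' with hk' | rfl
      · exact hres k r hk (by omega)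
      · exact fun h => hr ⟨r, h⟩
  -- At most `3 + (6 * k + 5)` events and 2 for each pointer before the response, and one for the
  -- response. The solo time is at least `k + 1`, with the return.
  have hbound : ∃ k, ((k + 1 : ℕ) : ℕ∞) ≤ D.impl.soloTime p q C ∧
      eventCount lab p a b ≤ 13 * (k + 1) + 2 * nextCount cfg lab p a b := by
    obtain ⟨l, -, hqs⟩ := queryState hrun hns hro hq ha hac (hcb.trans hb) hresc
    have hone : ((0 + 1 : ℕ) : ℕ∞) ≤ D.impl.soloTime p q C :=
      CASStructure.ReadRun.lt_soloTime .refl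
    cases hqs with
    | snapRead hle => exact ⟨0, hone, by omega⟩
    | snapInc _ _ _ hle => exact ⟨0, hone, by omega⟩
    | running h' C' k o _ _ hs' hC' hr hle =>
      obtain ⟨j', hs'⟩ := hs'
      obtain ⟨-, rfl⟩ := (hj.mono htc).unique hrun (hcb.trans hb) hs' hresc
      obtain rfl := hC.unique hC'
      have ho : o ≤ 5 := by cases hr <;> omega
      cases hr <;> exact ⟨k, CASStructure.ReadRun.lt_soloTime ‹_›, by omega⟩
  obtain ⟨k, hk, hk'⟩ := hbound
  rw [procTime_eq]
  calc (eventCount lab p a b : ℕ∞)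
      ≤ ((13 * ((k + 1) + nextCount cfg lab p a b) : ℕ) : ℕ∞) :=
        ENat.natCast_le_natCast.2 (by omega)
    _ = 13 * (((k + 1 : ℕ) : ℕ∞) + (nextCount cfg lab p a b : ℕ∞)) := by push_cast; ring
    _ ≤ _ := by gcongr

end

/-! ### The main theorem. -/

theorem theorem2 :
    ∃ c : ℕ, ∀ (P Op Ret V St S : Type*) [Finite P] (D : CASStructure P Op Ret V St) (Q : Set Op)
      (A : ADT Op Ret S),
      D.impl.NeverStuck Q → D.ReadOnly Q → D.impl.LinearizableWithSolo Q A →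
      -- the transformed data structure is linearizable and well-defined
      (D.versioned Q).Linearizable A ∧
      (D.versioned Q).NeverStuck ∅ ∧
      -- progress of the operations outside `Q`
      (∀ F ⊆ Qᶜ, D.impl.WaitFree Q F → (D.versioned Q).WaitFree ∅ F) ∧
      (∀ F ⊆ Qᶜ, D.impl.LockFree Q F → (D.versioned Q).LockFree ∅ F) ∧
      (∀ F ⊆ Qᶜ, D.impl.ObstructionFree Q F → (D.versioned Q).ObstructionFree ∅ F) ∧
      -- running times: every finite run has a corresponding run of the original data structure
      ∀ (n : ℕ) (cfg : ℕ → Config P Op (VMem V) (VState V St)) (lab : ℕ → Label P Op Ret),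
        (D.versioned Q).IsRun n cfg lab →
        ∃ (n' : ℕ) (cfg' : ℕ → Config P Op (ℕ → Option V) St) (lab' : ℕ → Label P Op Ret)
          (f : ℕ → ℕ),
          D.impl.IsSoloRun Q n' cfg' lab' ∧
          SameHistory Qᶜ n cfg lab n' cfg' lab' f ∧
          -- operations outside `Q` are slower by a constant factor
          (∀ p, ∀ op ∉ Q, ∀ a b, b ≤ n → IsInstance lab p op a b →
            ∃ b', b' ≤ n' ∧ IsInstance lab' p op (f a) b' ∧
              procTime lab' p (f a) b' ≤ procTime lab p a b ∧
              procTime lab p a b ≤ c * procTime lab' p (f a) b') ∧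
          -- queries: configuration `j` of the original is the state at their `takeSnapshot`
          (∀ p, ∀ q ∈ Q, ∀ a b s t h, b ≤ n → IsInstance lab p q a b →
            TakesSnapshot cfg lab p a b s t h →
            ∃ j, j ≤ n' ∧ (cfg n).shared.IsSnapshot h (cfg' j).shared ∧
              (∀ i, i < s → HighLevelEventOf Qᶜ cfg lab i → f i < j) ∧
              (∀ i, t < i → i < n → HighLevelEventOf Qᶜ cfg lab i → j ≤ f i) ∧
              procTime lab p a b ≤ c * (D.impl.soloTime p q (cfg' j).shared +
                D.concurrentVCAS cfg lab p a b * D.maxAccesses cfg lab p a b)) := by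
  -- The constant is the number of steps of the longest `vCAS`; for queries it is generous.
  refine ⟨13, fun P Op Ret V St S _ D Q A hns hro hlin => ⟨D.versioned_linearizable hns hro hlin,
    D.versioned_neverStuck hns hro, fun F hF h => D.versioned_waitFree hF h,
    fun F hF h => D.versioned_lockFree hF h, fun F hF h => D.versioned_obstructionFree hF h,
    fun n cfg lab hrun => ?_⟩⟩
  obtain ⟨cfg', lab', g, hS⟩ := exists_simulatedRun_queries hrun hns hro
  refine ⟨g n, cfg', lab', g, hS.isSoloRun n, hS.sameHistory,
    fun p op hop a b hb hinst => ⟨g b, hS.mono hb, hS.isInstance hrun hop hb hinst,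
      hS.instance_time hrun hop hb hinst⟩, fun p q hq a b s t h hb hinst hts => ?_⟩
  obtain ⟨j, hsj, hjt, hj⟩ := exists_snapAt hrun hns hro hq hb hinst hts
  have hjn : j < n := by have := hts.2.2.1; omega
  obtain ⟨e, e', hsim⟩ := hS.sim (j + 1) (by exact_mod_cast hjn)
  have hC := hsim.isSnapshot hrun hjn hj.2.2.2.1 hj.2.2.2.2
  -- The state is taken at the end of the segment of the event that advances the camera; the query
  -- blocks in this segment leave the memory unchanged.
  refine ⟨g (j + 1), hS.mono hjn, hC, fun i hi he => ?_, fun i hi hin he => ?_,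
    query_time hrun hns hro hq hb hinst hts hC⟩
  · exact hS.lt_of_event (by omega) hjn (highLevelEventOf_iff.1 he)
  · exact hS.mono (by omega)
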